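/- Let $C\subset\mathbb R^2$ be a tropical curve, i.e. the corner locus of a tropical Laurent polynomial $\max_{a}(c_a+\langle a,p\rangle)$, whose edges are weighted by the integer lengths of the dual edges in the dual subdivision of the Newton polygon $\Delta$, where $\Delta$ has dimension $2$. Suppose that $C$ is simple (all $2$-cells of the dual subdivision are triangles or parallelograms). Its normalization $\tilde C$ is the $3$-valent graph obtained from $C$ by separating the two branches at each node (a point dual to a parallelogram); the vertices of $\tilde C$ are the points of $C$ dual to triangles. Suppose that $C$ is irreducible, i.e. $\tilde C$ is connected. Let $L\subset(\mathbb C^*)^2$ be the phase-tropical line, the limit for $t\to\infty$ of the images of $\{z+w+1=0\}$ under the map that raises the moduli of the coordinates to the power $1/\log t$ and keeps their arguments. A simple phase-tropical curve $V$ with amoeba $C$ consists of a general phase-tropical line $\Gamma_v=A_v(L)$ for each vertex $v$ of $\tilde C$, where $A_v(z,w)=(b_1z^{a_{11}}w^{a_{12}},b_2z^{a_{21}}w^{a_{22}})$ with $a_{ij}\in\mathbb Z$, $b_i\in\mathbb C^*$, such that the amoeba of $\Gamma_v$ agrees near $v$, with weights, with $C$, and such that $\Gamma_v$ and $\Gamma_{v'}$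 coincide over each bounded edge $vv'$ of $\tilde C$. (Both $A_v$ and $A_{v'}$ cover the annulus over the edge with degree equal to its weight, and $V$ includes an isomorphism between these two coverings; for an edge of weight $1$ it is unique.) The normalization $\tilde V$ of $V$ is the surface glued from the parts of the lines $\Gamma_v$, parametrized by $L$, over the tripods formed by $v$ and its three adjacent open edges and leaves, along the annuli over the bounded edges. Suppose that $V$ is real, i.e. invariant under complex conjugation. Then $\tilde V$ carries a real structure, whose fixed locus $\mathbb R\tilde V$ parametrizes the real part $\mathbb RV$, and the map $\mathcal A(z,w)=(\log|z|,\log|w|)$ makes $\mathbb R\tilde V$ piecewise linear. The curve $V$ is a phase-tropical Harnack curve if moreover $\mathbb RV$ has no inflection pattern, i.e. any three consecutive edges or leaves of $\mathbb RV$ (the middle one over a bounded edge of $\tilde C$) form a convex piecewise linear path under $\mathcal A$. For such $V$, the real part $\mathbb R\tilde V$ divides $\tilde V$ into two conjugate halves. Orient $\mathbb R\tilde V$ as the boundary of one of them. Let $\iota_\varepsilon$ be any sufficiently small smooth deformation of $\mathcal A|_{\mathbb R\tilde V}$ as an immersed curve in $\mathbb R^2$ (whose velocity is close to convex combinations of the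 nearby velocities of the piecewise linear curve, and which has the same asymptotic velocities at infinity). Its logarithmic Gauss map $\gamma_\varepsilon=[-dy:dx]$ to $\mathbb{RP}^1$, extended to the points at infinity that close up $\mathbb R\tilde V$, has a degree, which does not depend on the deformation. The logarithmic curvature of $\mathbb RV$ is this degree, for the choice of the half that makes it non-negative. **Proposition.** For every phase-tropical Harnack curve $V$ with amoeba $C$, the logarithmic curvature of $\mathbb RV$ is equal to $-\chi(\tilde V)$, where $\chi$ is the Euler characteristic, and $-\chi(\tilde V)$ is equal to the number of vertices of $\tilde C$. -/

import Mathlib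

open Set Filter Topology
open scoped ContDiff

noncomputable section

namespace PhaseTropical

/-! ### Plane tropical curves -/

/-- The determinant of two plane vectors. -/
def cross {R : Type*} [CommRing R] (a b : R × R) : R := a.1 * b.2 - a.2 * b.1

/-- An integer vector as a real vector. -/
def toReal (a : ℤ × ℤ) : ℝ × ℝ := ((a.1 : ℝ), (a.2 : ℝ))

/-- A tropical Laurent polynomial `max_{a ∈ supp} (coeff a + ⟨a, p⟩)` in two variables. -/
structure TropicalPolynomial where
  supp : Finset (ℤ × ℤ)
  coeff : ℤ × ℤ → ℝ

namespace TropicalPolynomial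

/-- The value of the tropical monomial with exponent `a` at `p`. -/
def monomial (C : TropicalPolynomial) (a : ℤ × ℤ) (p : ℝ × ℝ) : ℝ :=
  C.coeff a + (a.1 * p.1 + a.2 * p.2)

/-- The exponents of the monomials that attain the maximum at `p`. -/
def active (C : TropicalPolynomial) (p : ℝ × ℝ) : Set (ℤ × ℤ) :=
  {a | a ∈ C.supp ∧ ∀ b ∈ C.supp, C.monomial b p ≤ C.monomial a p}

/-- The tropical zero set: at least two monomials attain the maximum. -/
def curve (C : TropicalPolynomial) : Set (ℝ × ℝ) := {p | (C.active p).Nontrivial}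

/-- The cell dual to `p`. The dual subdivision of the Newton polygon consists of the sets
`C.cell p`, for `p` in the plane. -/
def cell (C : TropicalPolynomial) (p : ℝ × ℝ) : Set (ℝ × ℝ) :=
  convexHull ℝ (toReal '' C.active p)

/-- The integer length of the cell dual to `p`; this is the weight of the leaf or edge through
`p`, whenever this cell is a segment. -/
def weight (C : TropicalPolynomial) (p : ℝ × ℝ) : ℕ :=
  {a : ℤ × ℤ | toReal a ∈ C.cell p}.ncard - 1

/-- The cell dual to `p` is a (nondegenerate) triangle. For a simple tropical curve, these `p` are
the 3-valent vertices, in bijection with the vertices of the normalization. -/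
def IsVertex (C : TropicalPolynomial) (p : ℝ × ℝ) : Prop :=
  ∃ a b c : ℤ × ℤ, cross (b - a) (c - a) ≠ 0 ∧
    C.cell p = convexHull ℝ {toReal a, toReal b, toReal c}

/-- The cell dual to `p` is a (nondegenerate) parallelogram. -/
def IsNode (C : TropicalPolynomial) (p : ℝ × ℝ) : Prop :=
  ∃ a b c : ℤ × ℤ, cross (b - a) (c - a) ≠ 0 ∧
    C.cell p = convexHull ℝ {toReal a, toReal b, toReal c, toReal (b + c - a)}

/-- A tropical curve is simple if all 2-dimensional cells of its dual subdivision are triangles and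
parallelograms. -/
def IsSimple (C : TropicalPolynomial) : Prop :=
  ∀ p, Collinear ℝ (C.cell p) ∨ C.IsVertex p ∨ C.IsNode p

/-- The set of vertices of the (normalization of the) tropical curve. -/
def Vertex (C : TropicalPolynomial) : Type := {p : ℝ × ℝ // C.IsVertex p}

/-- The tripod of `v`: the union of `v` and of the three open leaves and edges of the
normalization adjacent to `v`. Such a leaf or edge runs straight through the nodes, and ends at
the next vertex. -/
def tripod (C : TropicalPolynomial) (v : C.Vertex) : Set (ℝ × ℝ) :=
  {x | segment ℝ v.1 x ⊆ C.curve ∧ ∀ y ∈ segment ℝ v.1 x, C.IsVertex y → y = v.1}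

/-- Two distinct vertices are adjacent if they are the ends of an edge of the normalization,
i.e. the segment between them lies in the curve and has no vertex in its interior. -/
def normalizationGraph (C : TropicalPolynomial) : SimpleGraph C.Vertex where
  Adj v v' := v ≠ v' ∧ segment ℝ v.1 v'.1 ⊆ C.curve ∧
    ∀ y ∈ openSegment ℝ v.1 v'.1, ¬ C.IsVertex y
  symm := ⟨fun v v' h => ⟨h.1.symm, by rw [segment_symm]; exact h.2.1,
    by rw [openSegment_symm]; exact h.2.2⟩⟩
  loopless := ⟨fun v h => h.1 rfl⟩

/-- The normalization is connected: no component of it is a line without vertices (every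
point of the curve lies on some tripod), and its vertices and edges form a connected graph. -/
def IsIrreducible (C : TropicalPolynomial) : Prop :=
  C.curve ⊆ ⋃ v, C.tripod v ∧ C.normalizationGraph.Connected

end TropicalPolynomial

/-! ### Phase-tropical lines -/

/-- The complex torus `(ℂ^*)²`; complex conjugation on it is `star`. -/
abbrev Torus : Type := ℂˣ × ℂˣ

/-- The amoeba map `(z, w) ↦ (log |z|, log |w|)`. -/
def amoeba (p : Torus) : ℝ × ℝ := (Real.log ‖(p.1 : ℂ)‖, Real.log ‖(p.2 : ℂ)‖)

/-- Those of the three terms `1`, `z`, `w` that have the largest modulus. -/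
def dominantTerms (p : Torus) : Set ℂ :=
  {x | x ∈ ({1, (p.1 : ℂ), (p.2 : ℂ)} : Set ℂ) ∧
    ∀ y ∈ ({1, (p.1 : ℂ), (p.2 : ℂ)} : Set ℂ), ‖y‖ ≤ ‖x‖}

/-- The phase-tropical line `L`, the limit of `H_t {z + w + 1 = 0}` for `t → ∞`, where `H_t`
raises the moduli to the power `1 / log t` and keeps the arguments. In the limit, the terms of
`z + w + 1 = 0` that are not of largest modulus are negligible, and the ones of largest modulus
can have any relative size. So `L` consists of the closure of the coamoeba
of `{z + w + 1 = 0}` over the origin, and of the three holomorphic annuli `w = -1`, `z = -1`,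
`z = -w` over the three rays of the tropical line. -/
def phaseTropicalLine : Set Torus := {p | (0 : ℂ) ∈ convexHull ℝ (dominantTerms p)}

/-- The primitive vectors on the three rays of the tropical line `amoeba '' phaseTropicalLine`. -/
def ray : Fin 3 → ℤ × ℤ := ![(-1, 0), (0, -1), (1, 1)]

/-- The toric morphism `(z, w) ↦ (b₁ z^a₁₁ w^a₁₂, b₂ z^a₂₁ w^a₂₂)`. -/
structure ToricMorphism where
  a₁₁ : ℤ
  a₁₂ : ℤ
  a₂₁ : ℤ
  a₂₂ : ℤ
  b : Torus

namespace ToricMorphism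

/-- The toric morphism as a map. -/
def toFun (A : ToricMorphism) (p : Torus) : Torus :=
  (A.b.1 * (p.1 ^ A.a₁₁ * p.2 ^ A.a₁₂), A.b.2 * (p.1 ^ A.a₂₁ * p.2 ^ A.a₂₂))

/-- The linear part on integer vectors. -/
def linInt (A : ToricMorphism) (u : ℤ × ℤ) : ℤ × ℤ :=
  (A.a₁₁ * u.1 + A.a₁₂ * u.2, A.a₂₁ * u.1 + A.a₂₂ * u.2)

/-- The linear part on real vectors. -/
def linReal (A : ToricMorphism) (u : ℝ × ℝ) : ℝ × ℝ :=
  (A.a₁₁ * u.1 + A.a₁₂ * u.2, A.a₂₁ * u.1 + A.a₂₂ * u.2)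

/-- The part of the phase-tropical line `L` that the toric morphism `A` sends over the set `T` of
the plane. -/
def partOver (A : ToricMorphism) (T : Set (ℝ × ℝ)) : Set Torus :=
  {p | p ∈ phaseTropicalLine ∧ amoeba (A.toFun p) ∈ T}

end ToricMorphism

/-! ### Simple phase-tropical curves, with their normalization -/

/-- A simple phase-tropical curve with underlying simple tropical curve `C`: for every vertex `v`
of `C`, a general phase-tropical line `Γ_v`, parametrized by a toric morphism `chart v` from `L`,
whose amoeba is, with weights, the tripod of `C` at `v` prolonged to infinity; and for every edge,
an identification of the two holomorphic annuli over this edge that come from the phase-tropical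
lines at its ends. In particular, these two phase-tropical lines coincide over the edge. If the
edge has weight `1`, the identification is determined by this coincidence; in general it is an
isomorphism between two coverings of the same annulus whose degree is the weight of the edge. -/
structure SimplePhaseTropicalCurve (C : TropicalPolynomial) where
  chart : C.Vertex → ToricMorphism
  /-- The amoeba of `Γ_v` has its vertex at `v`. -/
  chart_origin : ∀ v, amoeba (chart v).b = v.1
  /-- Each ray of the amoeba of `Γ_v` starts along `C` at `v`, with the same weight. -/
  chart_ray : ∀ v i, ∃ (m : ℕ) (u : ℤ × ℤ), IsCoprime u.1 u.2 ∧
    (chart v).linInt (ray i) = (m : ℤ) • u ∧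
    ∀ᶠ t in 𝓝[>] (0 : ℝ), v.1 + t • toReal u ∈ C.curve ∧ C.weight (v.1 + t • toReal u) = m
  glue : C.Vertex → C.Vertex → Torus → Torus
  glue_mapsTo : ∀ v v', C.normalizationGraph.Adj v v' →
    MapsTo (glue v v') ((chart v).partOver (openSegment ℝ v.1 v'.1))
      ((chart v').partOver (openSegment ℝ v'.1 v.1))
  glue_continuousOn : ∀ v v', C.normalizationGraph.Adj v v' →
    ContinuousOn (glue v v') ((chart v).partOver (openSegment ℝ v.1 v'.1))
  glue_glue : ∀ v v', C.normalizationGraph.Adj v v' →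
    ∀ p ∈ (chart v).partOver (openSegment ℝ v.1 v'.1), glue v' v (glue v v' p) = p
  chart_glue : ∀ v v', C.normalizationGraph.Adj v v' →
    ∀ p ∈ (chart v).partOver (openSegment ℝ v.1 v'.1),
      (chart v').toFun (glue v v' p) = (chart v).toFun p

namespace SimplePhaseTropicalCurve

/-- The part of the phase-tropical line `Γ_v` over the tripod of `v`. -/
abbrev Piece {C : TropicalPolynomial} (V : SimplePhaseTropicalCurve C) (v : C.Vertex) : Type :=
  {p : Torus // p ∈ (V.chart v).partOver (C.tripod v)}

/-- The points over an edge are identified by means of `V.glue`. -/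
def GlueRel {C : TropicalPolynomial} (V : SimplePhaseTropicalCurve C)
    (x y : Σ v : C.Vertex, V.Piece v) : Prop :=
  C.normalizationGraph.Adj x.1 y.1 ∧
    x.2.1 ∈ (V.chart x.1).partOver (openSegment ℝ x.1.1 y.1.1) ∧ y.2.1 = V.glue x.1 y.1 x.2.1

/-- The normalization of a simple phase-tropical curve: the topological surface
that is glued from the pieces over the tripods along the annuli over the edges. -/
def Normalization {C : TropicalPolynomial} (V : SimplePhaseTropicalCurve C) : Type :=
  Quot V.GlueRel

instance {C : TropicalPolynomial} (V : SimplePhaseTropicalCurve C) :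
    TopologicalSpace V.Normalization :=
  inferInstanceAs (TopologicalSpace (Quot V.GlueRel))

/-- The point of the normalization given by a point of a piece. -/
def point {C : TropicalPolynomial} (V : SimplePhaseTropicalCurve C) (v : C.Vertex)
    (p : V.Piece v) : V.Normalization := Quot.mk _ ⟨v, p⟩

/-- The map from the normalization to `(ℂ^*)²`. -/
def toTorus {C : TropicalPolynomial} (V : SimplePhaseTropicalCurve C) :
    V.Normalization → Torus :=
  Quot.lift (fun x => (V.chart x.1).toFun x.2.1) (by
    rintro ⟨v, p⟩ ⟨v', q⟩ ⟨hadj, hp, hq⟩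
    dsimp only at hadj hp hq ⊢
    rw [hq, V.chart_glue v v' hadj p.1 hp])

/-- The simple phase-tropical curve as a subset of `(ℂ^*)²`. -/
def carrier {C : TropicalPolynomial} (V : SimplePhaseTropicalCurve C) : Set Torus :=
  range V.toTorus

/-- The amoeba map on the normalization. -/
def amoebaMap {C : TropicalPolynomial} (V : SimplePhaseTropicalCurve C)
    (x : V.Normalization) : ℝ × ℝ := amoeba (V.toTorus x)

end SimplePhaseTropicalCurve

/-! ### Real structure -/

theorem amoeba_star (p : Torus) : amoeba (star p) = amoeba p := by
  simp [amoeba]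

theorem dominantTerms_star (p : Torus) :
    dominantTerms (star p) = Complex.conjLIE '' dominantTerms p := by
  ext x
  simp only [dominantTerms, mem_ofPred_eq, mem_image, mem_insert_iff, mem_singleton_iff,
    Prod.fst_star, Prod.snd_star, Units.coe_star, forall_eq_or_imp, forall_eq]
  constructor
  · rintro ⟨hx, hn⟩
    refine ⟨star x, ⟨?_, ?_⟩, by simp⟩
    · rcases hx with rfl | rfl | rfl <;> simp
    · simpa using hn
  · rintro ⟨y, ⟨hy, hn⟩, rfl⟩
    refine ⟨?_, by simpa using hn⟩
    rcases hy with rfl | rfl | rfl <;> simp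

theorem star_mem_phaseTropicalLine {p : Torus} (hp : p ∈ phaseTropicalLine) :
    star p ∈ phaseTropicalLine := by
  change (0 : ℂ) ∈ convexHull ℝ (dominantTerms (star p))
  rw [dominantTerms_star]
  have h : (0 : ℂ) ∈ Complex.conjLIE.toLinearEquiv.toLinearMap ''
      convexHull ℝ (dominantTerms p) := ⟨0, hp, by simp⟩
  rw [LinearMap.image_convexHull] at h
  exact h

/-- A simple real-tropical curve: a simple phase-tropical curve that is invariant under complex
conjugation. Conjugation preserves the amoeba map, hence acts on each of the pieces. -/
structure SimpleRealTropicalCurve (C : TropicalPolynomial) extends SimplePhaseTropicalCurve C where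
  chart_star : ∀ v p, (chart v).toFun (star p) = star ((chart v).toFun p)
  glue_star : ∀ v v', C.normalizationGraph.Adj v v' →
    ∀ p ∈ (chart v).partOver (openSegment ℝ v.1 v'.1), glue v v' (star p) = star (glue v v' p)

namespace SimpleRealTropicalCurve

theorem star_mem_partOver {C : TropicalPolynomial} (V : SimpleRealTropicalCurve C) {v : C.Vertex}
    {T : Set (ℝ × ℝ)} {p : Torus} (hp : p ∈ (V.chart v).partOver T) :
    star p ∈ (V.chart v).partOver T :=
  ⟨star_mem_phaseTropicalLine hp.1, by rw [V.chart_star, amoeba_star]; exact hp.2⟩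

/-- The real structure on the normalization. -/
def conj {C : TropicalPolynomial} (V : SimpleRealTropicalCurve C) :
    V.Normalization → V.Normalization :=
  Quot.map (fun x => ⟨x.1, ⟨star x.2.1, V.star_mem_partOver x.2.2⟩⟩) (by
    rintro ⟨v, p⟩ ⟨v', q⟩ ⟨hadj, hp, hq⟩
    dsimp only at hadj hp hq
    refine ⟨hadj, V.star_mem_partOver hp, ?_⟩
    dsimp only
    rw [hq, V.glue_star v v' hadj p.1 hp])

/-- The real part of the normalization, which parametrizes the real part of the curve. -/
def realPart {C : TropicalPolynomial} (V : SimpleRealTropicalCurve C) : Set V.Normalization :=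
  {x | V.conj x = x}

/-- Two real points lie in the same quadrant of `(ℝ^*)²`. -/
def SameQuadrant (p q : Torus) : Prop :=
  0 < (p.1 : ℂ).re * (q.1 : ℂ).re ∧ 0 < (p.2 : ℂ).re * (q.2 : ℂ).re

/-- The real part has an inflection pattern over the edge from `v` to `v'`. There are three
consecutive edges or leaves of the real part, the middle one over this edge (through `p₂` in the
piece of `v`, which is the point `p₃` in the piece of `v'`), the outer ones through `p₁` and `p₄`.
Real leaves-edges of `L` are consecutive if they are in the same quadrant. The three pieces are not
convex, i.e. the outer ones are on different sides of the middle one. -/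
def InflectionPattern {C : TropicalPolynomial} (V : SimpleRealTropicalCurve C)
    (v v' : C.Vertex) : Prop :=
  C.normalizationGraph.Adj v v' ∧ ∃ (p₁ p₂ : V.Piece v) (p₃ p₄ : V.Piece v'),
    star p₁.1 = p₁.1 ∧ star p₂.1 = p₂.1 ∧ star p₃.1 = p₃.1 ∧ star p₄.1 = p₄.1 ∧
    V.amoebaMap (V.point v p₂) ∈ openSegment ℝ v.1 v'.1 ∧
    V.point v p₂ = V.point v' p₃ ∧ SameQuadrant p₁.1 p₂.1 ∧ SameQuadrant p₃.1 p₄.1 ∧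
    cross (v'.1 - v.1) (V.amoebaMap (V.point v p₁) - v.1) *
      cross (v'.1 - v.1) (V.amoebaMap (V.point v' p₄) - v.1) < 0

/-- A phase-tropical Harnack curve. -/
structure IsHarnack {C : TropicalPolynomial} (V : SimpleRealTropicalCurve C) : Prop where
  simple : C.IsSimple
  irreducible : C.IsIrreducible
  no_inflection : ∀ v v', ¬ V.InflectionPattern v v'

/-! ### The logarithmic curvature -/

/-- A half of the normalization: an open set `S` such that the complement of the real part is the
disjoint union of `S` and its conjugate. -/
structure IsHalf {C : TropicalPolynomial} (V : SimpleRealTropicalCurve C)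
    (S : Set V.Normalization) : Prop where
  isOpen : IsOpen S
  disjoint : Disjoint S (V.conj ⁻¹' S)
  union : S ∪ V.conj ⁻¹' S = V.realPartᶜ

/-- A parametrization of the real part: the components are the images of the paths
`path k : ℝ → V.Normalization`. If `period k = 0`, the component is a line, and `path k` is
injective. If `period k > 0`, the component is a circle, and `period k` is the least period. The
amoeba map turns these paths into piecewise linear paths with unit speed. -/
structure RealParametrization {C : TropicalPolynomial} (V : SimpleRealTropicalCurve C) where
  n : ℕ
  path : Fin n → ℝ → V.Normalization
  period : Fin n → ℝ
  period_nonneg : ∀ k, 0 ≤ period k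
  continuous : ∀ k, Continuous (path k)
  range_eq : ⋃ k, range (path k) = V.realPart
  path_eq_iff : ∀ k l s t, path k s = path l t ↔ k = l ∧ ∃ m : ℤ, t = s + m * period k
  unit_speed : ∀ k s, ∃ δ > 0, ∃ d₁ d₂ : ℝ × ℝ,
    d₁.1 ^ 2 + d₁.2 ^ 2 = 1 ∧ d₂.1 ^ 2 + d₂.2 ^ 2 = 1 ∧ ∀ h ∈ Icc (0 : ℝ) δ,
      V.amoebaMap (path k (s - h)) = V.amoebaMap (path k s) - h • d₁ ∧
      V.amoebaMap (path k (s + h)) = V.amoebaMap (path k s) + h • d₂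

/-- The rotation of the arguments by the angles `τ • d`: the translation by `τ • (i d)` in
logarithmic coordinates. -/
def rotate (τ : ℝ) (d : ℝ × ℝ) (p : Torus) : Torus :=
  (Circle.toUnits (Circle.exp (τ * d.1)) * p.1, Circle.toUnits (Circle.exp (τ * d.2)) * p.2)

namespace RealParametrization

/-- The path in the plane that parametrizes the amoeba of a component. -/
def planePath {C : TropicalPolynomial} {V : SimpleRealTropicalCurve C} (P : V.RealParametrization)
    (k : Fin P.n) (s : ℝ) : ℝ × ℝ := V.amoebaMap (P.path k s)

/-- The real part is oriented as the boundary of the half `S`: where a path has velocity `d` in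
logarithmic coordinates of its piece, the direction `i d` points into `S`. -/
def IsOrientedBy {C : TropicalPolynomial} {V : SimpleRealTropicalCurve C}
    (P : V.RealParametrization) (S : Set V.Normalization) : Prop :=
  ∀ (k : Fin P.n) (s : ℝ) (v : C.Vertex) (p : V.Piece v) (d : ℝ × ℝ), P.path k s = V.point v p →
    HasDerivAt (P.planePath k) ((V.chart v).linReal d) s →
    ∀ᶠ τ in 𝓝[>] (0 : ℝ), ∃ q : V.Piece v, q.1 = rotate τ d p.1 ∧ V.point v q ∈ S

/-- An `ε`-small smooth deformation of the amoeba of the real part: smooth paths `g k` that are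
`ε`-close to the given piecewise linear paths, whose velocity at `s` is `ε`-close
to the convex hull of the velocities of the given path near `s`, and which have, on the
unbounded components, the same asymptotic velocities as the given path. -/
structure IsSmoothing {C : TropicalPolynomial} {V : SimpleRealTropicalCurve C}
    (P : V.RealParametrization) (ε : ℝ) (g : Fin P.n → ℝ → ℝ × ℝ) : Prop where
  smooth : ∀ k, ContDiff ℝ ∞ (g k)
  periodic : ∀ k s, g k (s + P.period k) = g k s
  close : ∀ k s, dist (g k s) (P.planePath k s) < ε
  deriv_close : ∀ k s, ∃ y ∈ convexHull ℝ
    (deriv (P.planePath k) '' {t | |t - s| < ε ∧ DifferentiableAt ℝ (P.planePath k) t}),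
      dist (deriv (g k) s) y < ε
  tendsto_atTop : ∀ k, P.period k = 0 →
    Tendsto (fun s => deriv (g k) s - deriv (P.planePath k) s) atTop (𝓝 0)
  tendsto_atBot : ∀ k, P.period k = 0 →
    Tendsto (fun s => deriv (g k) s - deriv (P.planePath k) s) atBot (𝓝 0)

end RealParametrization

/-- The logarithmic Gauss map `s ↦ [-y'(s) : x'(s)]` of a plane curve `g = (x, y)` (in logarithmic
coordinates) turns by the total angle `α` along `g`: it has a continuous lift `θ` through
`ℝ → ℝP¹, θ ↦ [cos θ : sin θ]`, which grows by `α`, over one period if the period is positive,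
and from `-∞` to `∞` otherwise. -/
def GaussMapTurnsBy (g : ℝ → ℝ × ℝ) (period α : ℝ) : Prop :=
  ∃ θ : ℝ → ℝ, Continuous θ ∧
    (∀ s, ∃ r : ℝ, r ≠ 0 ∧
      (-(deriv g s).2, (deriv g s).1) = r • (Real.cos (θ s), Real.sin (θ s))) ∧
    ((0 < period ∧ α = θ period - θ 0) ∨
      (period = 0 ∧ ∃ a b, Tendsto θ atBot (𝓝 a) ∧ Tendsto θ atTop (𝓝 b) ∧ α = b - a))

/-- The logarithmic Gauss map of the deformation `g` of the real part has degree `κ`. It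
is a map to `ℝP¹`, a circle of length `π`, from the real part closed up by the points at infinity,
where the two ends over the same leaf meet. -/
def RealParametrization.GaussMapHasDegree {C : TropicalPolynomial} {V : SimpleRealTropicalCurve C}
    (P : V.RealParametrization) (g : Fin P.n → ℝ → ℝ × ℝ) (κ : ℤ) : Prop :=
  ∃ α : Fin P.n → ℝ, (∀ k, GaussMapTurnsBy (g k) (P.period k) (α k)) ∧
    ∑ k, α k = κ * Real.pi

/-- `κ` is the logarithmic curvature of the real part of `V`: for the orientation of the real part
as the boundary of one of the halves of the normalization, `κ ≥ 0` is the degree of the logarithmic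
Gauss map of all sufficiently small smooth deformations (and there are such deformations). -/
def IsLogCurvature {C : TropicalPolynomial} (V : SimpleRealTropicalCurve C) (κ : ℤ) : Prop :=
  0 ≤ κ ∧ ∃ S, V.IsHalf S ∧ ∃ P : V.RealParametrization, P.IsOrientedBy S ∧
    (∀ ε > 0, ∃ g, P.IsSmoothing ε g) ∧
    ∃ ε > 0, ∀ g, P.IsSmoothing ε g → P.GaussMapHasDegree g κ

end SimpleRealTropicalCurve

/-! ### The Euler characteristic -/

/-- The Euler characteristic of `X` is `χ`: the space `X` has the homotopy type of a finite
CW complex `Y` for which the alternating sum of the numbers of cells is `χ`. -/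
def HasEulerCharacteristic (X : Type) [TopologicalSpace X] (χ : ℤ) : Prop :=
  ∃ (Y : Type) (_ : TopologicalSpace Y) (_ : T2Space Y) (_ : Topology.CWComplex (univ : Set Y)),
    Topology.RelCWComplex.Finite (univ : Set Y) ∧
    Nonempty (ContinuousMap.HomotopyEquiv X Y) ∧
    χ = ∑ᶠ n : ℕ, (-1) ^ n * (Nat.card (Topology.RelCWComplex.cell (univ : Set Y) n) : ℤ)

end PhaseTropical

end

open PhaseTropical

/-!
# The logarithmic curvature of phase-tropical Harnack curves

Both sides of the equality are computed on a combinatorial model of the surface `Ṽ`.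

*The model.* At a point dual to a triangle, the tropical curve leaves in three balanced directions,
there are finitely many such points (`TropicalPolynomial.finite_setOf_isVertex`), and an edge passes
straight through the points dual to parallelograms. After exchanging the two coordinates of `L`
where the chart at a vertex reverses the orientation, each `Γ_v` is parametrized by `L` with its
three rays in positive cyclic order. The line `L` consists of the three annuli `arm i`, with the
logarithmic coordinates `u`, `0 ≤ u.re`, and two triangles over the vertex. Over an edge of length
`T` the gluing intertwines two power maps, so it is a continuous branch of a power function; as this
goes in both directions, the exponents agree (`Opposite.exists_coord_turnedGlue`) and the gluing is
`ζ ↦ c / ζ` with `‖c‖ = e^T`. As it commutes with conjugation, `c` is real. If `c` were positive,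
the real part would turn to different sides at the two ends of the edge, an inflection pattern; so
`c = -e^T` (`IsHarnack.turnedGlue_arm`). Hence `Ṽ` is homeomorphic to the surface `Ribbon.Surface`
that is glued in this way from copies of `L` along the underlying 3-valent graph
(`IsHarnack.homeomorph`).

*The Euler characteristic.* The annuli over the leaves retract to their boundary circles. What is
left has a cell decomposition with three real points and two triangles at each vertex, and with
rectangles that cut the annuli over the edges. Counting cells gives minus the number of vertices of
the graph (`Ribbon.hasEulerCharacteristic`).

*The curvature.* The sign of `Im z - Im w` on `L` is compatible with the gluing and distinguishes
the two halves of the surface (`IsHarnack.isHalf`). The real part consists of one arc for each pair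
of consecutive rays at a vertex, which comes in along one ray, has a corner at the vertex and goes
out along the other. The arcs fit together to a flow of unit speed (`ArcAtlas.flow`), whose orbits
parametrize the components of the real part, oriented as the boundary of a half. At each corner the
real part turns left, by an angle between `0` and `π`, and the three angles at a vertex add up to
`π` (`PlaneRibbon.sum_cornerAngle`). The velocity of a small smoothing is close to convex
combinations of the two velocities at a corner, which stay away from zero, so its argument has to
follow the smoothed direction of the flow, and its Gauss map turns along each component by the sum
of the angles at the corners (`PlaneAtlas.gaussMapTurnsBy`). In total it turns by `π` for each
vertex, and a half turn is one turn around the projective line, so the degree is the number of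
vertices.
-/

noncomputable section

namespace PhaseTropical

/-! ### The phase-tropical line -/

/-- A point of `L` is a solution of `a + b z + c w = 0` with nonnegative coefficients, of which only
those of the dominant terms are nonzero. -/
theorem exists_coeff_of_mem_phaseTropicalLine {p : Torus} (hp : p ∈ phaseTropicalLine) :
    ∃ a b c : ℝ, 0 ≤ a ∧ 0 ≤ b ∧ 0 ≤ c ∧ a + b + c = 1 ∧ (a : ℂ) + b * p.1 + c * p.2 = 0 ∧
      (a ≠ 0 → ‖(p.1 : ℂ)‖ ≤ 1 ∧ ‖(p.2 : ℂ)‖ ≤ 1) ∧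
      (b ≠ 0 → 1 ≤ ‖(p.1 : ℂ)‖ ∧ ‖(p.2 : ℂ)‖ ≤ ‖(p.1 : ℂ)‖) ∧
      (c ≠ 0 → 1 ≤ ‖(p.2 : ℂ)‖ ∧ ‖(p.1 : ℂ)‖ ≤ ‖(p.2 : ℂ)‖) := by
  let T : Set ℂ := {x | ∃ a b c : ℝ, 0 ≤ a ∧ 0 ≤ b ∧ 0 ≤ c ∧ a + b + c = 1 ∧
      (a : ℂ) + b * p.1 + c * p.2 = x ∧
      (a ≠ 0 → ‖(p.1 : ℂ)‖ ≤ 1 ∧ ‖(p.2 : ℂ)‖ ≤ 1) ∧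
      (b ≠ 0 → 1 ≤ ‖(p.1 : ℂ)‖ ∧ ‖(p.2 : ℂ)‖ ≤ ‖(p.1 : ℂ)‖) ∧
      (c ≠ 0 → 1 ≤ ‖(p.2 : ℂ)‖ ∧ ‖(p.1 : ℂ)‖ ≤ ‖(p.2 : ℂ)‖)}
  have hT : Convex ℝ T := by
    rintro x ⟨a, b, c, ha, hb, hc, h1, hx, hA, hB, hC⟩ y 
      ⟨a', b', c', ha', hb', hc', h1', hy, hA', hB', hC'⟩ s t hs ht hst
    refine ⟨s * a + t * a', s * b + t * b', s * c + t * c', by positivity, by positivity,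
      by positivity, ?_, ?_, ?_, ?_, ?_⟩
    · linear_combination s * h1 + t * h1' + hst
    · rw [← hx, ← hy]; simp only [Complex.real_smul]; push_cast; ring
    · intro h
      by_cases h0 : a = 0
      · exact hA' (by rintro rfl; simp [h0] at h)
      · exact hA h0
    · intro h
      by_cases h0 : b = 0
      · exact hB' (by rintro rfl; simp [h0] at h)
      · exact hB h0
    · intro h
      by_cases h0 : c = 0
      · exact hC' (by rintro rfl; simp [h0] at h)
      · exact hC h0
  have hsub : dominantTerms p ⊆ T := by
    rintro x ⟨hx, hd⟩
    simp only [mem_insert_iff, mem_singleton_iff, forall_eq_or_imp, forall_eq, norm_one] at hx hd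
    rcases hx with rfl | rfl | rfl
    · exact ⟨1, 0, 0, by simp, by simp, by simp, by simp, by simp, fun _ => by simpa using hd.2,
        by simp, by simp⟩
    · exact ⟨0, 1, 0, by simp, by simp, by simp, by simp, by simp, by simp,
        fun _ => ⟨hd.1, hd.2.2⟩, by simp⟩
    · exact ⟨0, 0, 1, by simp, by simp, by simp, by simp, by simp, by simp, by simp,
        fun _ => ⟨hd.1, hd.2.1⟩⟩
  exact convexHull_min hsub hT hp

theorem continuous_units_neg : Continuous fun ζ : ℂˣ => -ζ := by
  rw [Units.continuous_iff]
  refine ⟨Units.continuous_val.neg, ?_⟩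
  have h : (fun ζ : ℂˣ => ((-ζ)⁻¹ : ℂˣ)) = fun ζ => -ζ⁻¹ := funext fun ζ => inv_neg
  have h' : Continuous fun ζ : ℂˣ => -((ζ⁻¹ : ℂˣ) : ℂ) :=
    (Units.continuous_val.comp continuous_inv).neg
  simpa using h'

/-- The outward parametrization of the annulus of `L` over the line spanned by the `i`-th ray. Real
points go to real points, and the symmetry of order three that permutes `1`, `z`, `w`
cyclically permutes these parametrizations. -/
def annulus (i : Fin 3) (ζ : ℂˣ) : Torus := ![(ζ⁻¹, -1), (-1, -ζ⁻¹), (-ζ, ζ)] i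

/-- The coordinate on the torus that inverts `annulus i`. -/
def coord (i : Fin 3) (p : Torus) : ℂˣ := ![p.1⁻¹, -p.2⁻¹, p.2] i

@[simp] theorem coord_annulus (i : Fin 3) (ζ : ℂˣ) : coord i (annulus i ζ) = ζ := by
  fin_cases i <;> simp [coord, annulus, inv_neg]

theorem continuous_annulus (i : Fin 3) : Continuous (annulus i) := by
  fin_cases i
  · change Continuous fun ζ : ℂˣ => ((ζ⁻¹, -1) : Torus); fun_prop
  · change Continuous fun ζ : ℂˣ => ((-1, -ζ⁻¹) : Torus)
    exact continuous_const.prodMk (continuous_units_neg.comp continuous_inv)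
  · change Continuous fun ζ : ℂˣ => ((-ζ, ζ) : Torus)
    exact continuous_units_neg.prodMk continuous_id

theorem continuous_coord (i : Fin 3) : Continuous (coord i) := by
  fin_cases i
  · change Continuous fun p : Torus => p.1⁻¹; fun_prop
  · change Continuous fun p : Torus => -p.2⁻¹
    exact continuous_units_neg.comp continuous_snd.inv
  · change Continuous fun p : Torus => p.2; fun_prop

/-- The exponential function as a map to the group of units. -/
def cexpUnit (u : ℂ) : ℂˣ := Units.mk0 (Complex.exp u) (Complex.exp_ne_zero u)

@[simp] theorem coe_cexpUnit (u : ℂ) : (cexpUnit u : ℂ) = Complex.exp u := rfl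

theorem cexpUnit_add (u v : ℂ) : cexpUnit (u + v) = cexpUnit u * cexpUnit v :=
  Units.ext (Complex.exp_add u v)

theorem cexpUnit_neg (u : ℂ) : cexpUnit (-u) = (cexpUnit u)⁻¹ :=
  Units.ext (by simp [Complex.exp_neg])

theorem cexpUnit_eq_iff {u v : ℂ} : cexpUnit u = cexpUnit v ↔ Complex.exp u = Complex.exp v :=
  Units.ext_iff

theorem exists_cexpUnit (ζ : ℂˣ) : ∃ u, cexpUnit u = ζ :=
  ⟨Complex.log ζ, Units.ext (Complex.exp_log ζ.ne_zero)⟩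

theorem continuous_cexpUnit : Continuous cexpUnit := by
  rw [Units.continuous_iff]
  refine ⟨by simpa [Function.comp_def] using Complex.continuous_exp, ?_⟩
  simp only [← cexpUnit_neg, coe_cexpUnit]
  fun_prop

theorem norm_cexpUnit (u : ℂ) : ‖(cexpUnit u : ℂ)‖ = Real.exp u.re := Complex.norm_exp u

theorem star_cexpUnit (u : ℂ) : star (cexpUnit u) = cexpUnit (star u) := by
  ext; simp [← Complex.exp_conj]

/-- The annulus of `L` over a ray in logarithmic coordinates. -/
def arm (i : Fin 3) (u : ℂ) : Torus := annulus i (cexpUnit u)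

theorem continuous_arm (i : Fin 3) : Continuous (arm i) :=
  (continuous_annulus i).comp continuous_cexpUnit

theorem arm_eq_iff {i : Fin 3} {u v : ℂ} : arm i u = arm i v ↔ Complex.exp u = Complex.exp v := by
  rw [← cexpUnit_eq_iff]
  exact ⟨fun h => by simpa [arm] using congrArg (coord i) h, fun h => by rw [arm, h, arm]⟩

theorem star_arm (i : Fin 3) (u : ℂ) : star (arm i u) = arm i (star u) := by
  rw [arm, arm, ← star_cexpUnit]
  ext <;> fin_cases i <;> simp [annulus]

theorem amoeba_arm (i : Fin 3) (u : ℂ) : amoeba (arm i u) = u.re • toReal (ray i) := by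
  fin_cases i <;> simp [amoeba, arm, annulus, toReal, ray, Complex.norm_exp]

/-- The heights of a point of the torus along the three rays: on `L`, at most one of them is
nonzero, and it tells how far the amoeba is from the vertex. -/
def height (i : Fin 3) (p : Torus) : ℝ :=
  let m := max (max (amoeba p).1 (amoeba p).2) 0
  ![m - (amoeba p).1, m - (amoeba p).2, m] i

theorem continuous_amoeba : Continuous amoeba := by
  unfold amoeba
  refine Continuous.prodMk ?_ ?_ <;> refine Continuous.log (by fun_prop) fun p => ?_ <;> simp

theorem continuous_height (i : Fin 3) : Continuous (height i) := by
  have h1 := continuous_amoeba.fst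
  have h2 := continuous_amoeba.snd
  fin_cases i
  · change Continuous fun p => max (max (amoeba p).1 (amoeba p).2) 0 - (amoeba p).1; fun_prop
  · change Continuous fun p => max (max (amoeba p).1 (amoeba p).2) 0 - (amoeba p).2; fun_prop
  · change Continuous fun p => max (max (amoeba p).1 (amoeba p).2) 0; fun_prop

theorem height_nonneg (i : Fin 3) (p : Torus) : 0 ≤ height i p := by
  fin_cases i <;> simp [height]

theorem amoeba_eq_sum (p : Torus) : amoeba p = ∑ i, height i p • toReal (ray i) := by
  ext <;> simp [Fin.sum_univ_three, height, toReal, ray]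

theorem height_star (i : Fin 3) (p : Torus) : height i (star p) = height i p := by
  simp [height, amoeba_star]

theorem height_arm (i j : Fin 3) {u : ℂ} (hu : 0 ≤ u.re) :
    height j (arm i u) = if i = j then u.re else 0 := by
  rw [height, amoeba_arm]
  fin_cases i <;> fin_cases j <;> simp [toReal, ray, hu]

@[simp] theorem height_arm_self (i : Fin 3) {u : ℂ} (hu : 0 ≤ u.re) :
    height i (arm i u) = u.re := by
  simp [height_arm i i hu]

/-- Away from the fibre over the vertex, `L` consists of the three annuli. -/
theorem eq_arm_of_height_pos {p : Torus} (hp : p ∈ phaseTropicalLine) {i : Fin 3}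
    (hi : 0 < height i p) : ∃ u : ℂ, p = arm i u ∧ u.re = height i p := by
  suffices h : ∃ ζ : ℂˣ, p = annulus i ζ by
    obtain ⟨ζ, rfl⟩ := h
    obtain ⟨u, rfl⟩ := exists_cexpUnit ζ
    refine ⟨u, rfl, ?_⟩
    rw [← arm] at hi ⊢
    by_cases hu : 0 ≤ u.re
    · rw [height_arm_self i hu]
    · exfalso
      have := hi
      rw [height, amoeba_arm] at this
      push Not at hu
      fin_cases i <;> simp [toReal, ray, hu.le] at this
  obtain ⟨a, b, c, ha, hb, hc, h1, h0, hA, hB, hC⟩ := exists_coeff_of_mem_phaseTropicalLine hp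
  have hz : 0 < ‖(p.1 : ℂ)‖ := by simp
  have hw : 0 < ‖(p.2 : ℂ)‖ := by simp
  -- the coefficient of a term that is not dominant vanishes, so that the other two terms cancel
  fin_cases i
  · have hb0 : b = 0 := by
      by_contra hb0
      obtain ⟨h2, h3⟩ := hB hb0
      have e2 := Real.log_nonneg h2
      have e3 := Real.log_le_log hw h3
      simp [height, amoeba] at hi
      rcases hi with hi | hi <;> linarith
    subst hb0
    simp only [Complex.ofReal_zero, zero_mul, add_zero] at h0
    have ha0 : a ≠ 0 := by
      rintro rfl
      have hc1 : c = 1 := by linarith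
      simp [hc1] at h0
    have hc0 : c ≠ 0 := by
      rintro rfl
      have hc1 : a = 1 := by linarith
      simp [hc1] at h0
    have hn : ‖(p.2 : ℂ)‖ = 1 := le_antisymm (hA ha0).2 (hC hc0).1
    have hac : a = c := by
      have : (a : ℂ) = - (c * p.2) := by linear_combination h0
      have := congrArg norm this
      simpa [hn, abs_of_nonneg ha, abs_of_nonneg hc] using this
    refine ⟨p.1⁻¹, ?_⟩
    have hw1 : (p.2 : ℂ) = -1 := by
      subst hac
      have : (a : ℂ) ≠ 0 := by exact_mod_cast ha0
      refine mul_left_cancel₀ this ?_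
      linear_combination h0
    exact Prod.ext (by simp [annulus]) (Units.ext (by simp [annulus, hw1]))
  · have hc0 : c = 0 := by
      by_contra hc0
      obtain ⟨h2, h3⟩ := hC hc0
      have e2 := Real.log_nonneg h2
      have e3 := Real.log_le_log hz h3
      simp [height, amoeba] at hi
      rcases hi with hi | hi <;> linarith
    subst hc0
    simp only [Complex.ofReal_zero, zero_mul, add_zero] at h0
    have ha0 : a ≠ 0 := by
      rintro rfl
      have hc1 : b = 1 := by linarith
      simp [hc1] at h0
    have hb0 : b ≠ 0 := by
      rintro rfl
      have hc1 : a = 1 := by linarith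
      simp [hc1] at h0
    have hn : ‖(p.1 : ℂ)‖ = 1 := le_antisymm (hA ha0).1 (hB hb0).1
    have hab : a = b := by
      have : (a : ℂ) = - (b * p.1) := by linear_combination h0
      have := congrArg norm this
      simpa [hn, abs_of_nonneg ha, abs_of_nonneg hb] using this
    refine ⟨-p.2⁻¹, ?_⟩
    have hw1 : (p.1 : ℂ) = -1 := by
      subst hab
      have : (a : ℂ) ≠ 0 := by exact_mod_cast ha0
      refine mul_left_cancel₀ this ?_
      linear_combination h0
    exact Prod.ext (Units.ext (by simp [annulus, hw1])) (by simp [annulus, inv_neg])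
  · have ha0 : a = 0 := by
      by_contra ha0
      obtain ⟨h2, h3⟩ := hA ha0
      have e2 := Real.log_nonpos hz.le h2
      have e3 := Real.log_nonpos hw.le h3
      simp [height, amoeba] at hi
      linarith [hi e2]
    subst ha0
    simp only [Complex.ofReal_zero, zero_add] at h0
    have hc0 : c ≠ 0 := by
      rintro rfl
      have hc1 : b = 1 := by linarith
      simp [hc1] at h0
    have hb0 : b ≠ 0 := by
      rintro rfl
      have hc1 : c = 1 := by linarith
      simp [hc1] at h0
    have hn : ‖(p.1 : ℂ)‖ = ‖(p.2 : ℂ)‖ := le_antisymm (hC hc0).2 (hB hb0).2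
    have hbc : b = c := by
      have : (b : ℂ) * p.1 = - (c * p.2) := by linear_combination h0
      have := congrArg norm this
      rw [norm_neg, norm_mul, norm_mul, hn] at this
      simpa [abs_of_nonneg hb, abs_of_nonneg hc] using this
    refine ⟨p.2, ?_⟩
    have hw1 : (p.1 : ℂ) = -p.2 := by
      subst hbc
      have : (b : ℂ) ≠ 0 := by exact_mod_cast hb0
      refine mul_left_cancel₀ this ?_
      linear_combination h0
    exact Prod.ext (Units.ext (by simp [annulus, hw1])) (by simp [annulus])

/-- Over the vertex all three terms are dominant, so that membership in `L` only needs some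
nonnegative relation between them. -/
theorem mem_phaseTropicalLine_of_norm_eq_one {p : Torus} (h1 : ‖(p.1 : ℂ)‖ = 1)
    (h2 : ‖(p.2 : ℂ)‖ = 1) {a b c : ℝ} (ha : 0 ≤ a) (hb : 0 ≤ b) (hc : 0 ≤ c) (h : 0 < a + b + c)
    (h0 : (a : ℂ) + b * p.1 + c * p.2 = 0) : p ∈ phaseTropicalLine := by
  have hd : dominantTerms p = {1, (p.1 : ℂ), (p.2 : ℂ)} := by
    ext x
    simp only [dominantTerms, mem_insert_iff, mem_singleton_iff, forall_eq_or_imp, forall_eq,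
      norm_one, mem_ofPred_eq, h1, h2, and_self, and_iff_left_iff_imp]
    rintro (rfl | rfl | rfl) <;> simp [h1, h2]
  change (0 : ℂ) ∈ convexHull ℝ (dominantTerms p)
  rw [hd]
  have := (convex_convexHull ℝ ({1, (p.1 : ℂ), (p.2 : ℂ)} : Set ℂ)).sum_mem
    (t := Finset.univ) (w := ![a / (a + b + c), b / (a + b + c), c / (a + b + c)])
    (z := ![1, (p.1 : ℂ), (p.2 : ℂ)])
    (by intro i _; fin_cases i <;> simp <;> positivity)
    (by simp [Fin.sum_univ_three]; field_simp)
    (by intro i _; apply subset_convexHull; fin_cases i <;> simp)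
  convert this using 1
  have hne : ((a : ℂ) + b + c) ≠ 0 := by exact_mod_cast h.ne'
  simp [Fin.sum_univ_three]
  field_simp
  linear_combination -h0

theorem arm_mem_phaseTropicalLine (i : Fin 3) {u : ℂ} (hu : 0 ≤ u.re) :
    arm i u ∈ phaseTropicalLine := by
  have key : ∀ x ∈ dominantTerms (arm i u), -x ∈ dominantTerms (arm i u) →
      arm i u ∈ phaseTropicalLine := by
    intro x hx hx'
    have := (convex_convexHull ℝ (dominantTerms (arm i u))) (subset_convexHull ℝ _ hx)
      (subset_convexHull ℝ _ hx') (a := 1/2) (b := 1/2) (by norm_num) (by norm_num) (by norm_num)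
    rw [smul_neg, add_neg_cancel] at this
    exact this
  have hu' : (Real.exp u.re)⁻¹ ≤ 1 := inv_le_one_of_one_le₀ (Real.one_le_exp hu)
  fin_cases i
  · refine key 1 ?_ ?_ <;> simp [dominantTerms, arm, annulus, Complex.norm_exp, hu']
  · refine key 1 ?_ ?_ <;> simp [dominantTerms, arm, annulus, Complex.norm_exp, hu']
  · refine key (arm 2 u).2 ?_ ?_ <;> simp [dominantTerms, arm, annulus, Complex.norm_exp, hu]

/-- The difference of the imaginary parts of the coordinates. Its sign distinguishes the two halves
of the phase-tropical line, and it vanishes on the real part only. -/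
def imDiff (p : Torus) : ℝ := (p.1 : ℂ).im - (p.2 : ℂ).im

theorem continuous_imDiff : Continuous imDiff := by unfold imDiff; fun_prop

theorem imDiff_star (p : Torus) : imDiff (star p) = -imDiff p := by
  simp [imDiff]; ring

theorem star_eq_self_iff_im {p : Torus} : star p = p ↔ (p.1 : ℂ).im = 0 ∧ (p.2 : ℂ).im = 0 := by
  rw [Prod.ext_iff, Units.ext_iff, Units.ext_iff]
  simp [Complex.conj_eq_iff_im]

/-- If `0` is a convex combination of `1`, `z` and `w`, then `z` and `w` are not in the same open
half plane bounded by the real line. -/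
theorem im_mul_im_nonpos {p : Torus} (hp : p ∈ phaseTropicalLine) :
    (p.1 : ℂ).im * (p.2 : ℂ).im ≤ 0 := by
  obtain ⟨a, b, c, ha, hb, hc, h1, h0, -⟩ := exists_coeff_of_mem_phaseTropicalLine hp
  have him := congrArg Complex.im h0
  have hre := congrArg Complex.re h0
  simp at him hre
  rcases hb.eq_or_lt with rfl | hb
  · rcases hc.eq_or_lt with rfl | hc
    · exfalso; simp at hre; linarith
    · simp [hc.ne'] at him; simp [him]
  · have : (p.1 : ℂ).im * (p.2 : ℂ).im = - (c / b) * (p.2 : ℂ).im ^ 2 := by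
      field_simp; linear_combination (p.2 : ℂ).im * him
    rw [this]
    have : 0 ≤ c / b * (p.2 : ℂ).im ^ 2 := by positivity
    linarith

theorem imDiff_eq_zero_iff {p : Torus} (hp : p ∈ phaseTropicalLine) :
    imDiff p = 0 ↔ star p = p := by
  rw [star_eq_self_iff_im]
  have := im_mul_im_nonpos hp
  unfold imDiff
  constructor
  · intro h
    have h' : (p.1 : ℂ).im = (p.2 : ℂ).im := by linarith
    rw [h'] at this ⊢
    have : (p.2 : ℂ).im = 0 := by nlinarith
    exact ⟨this, this⟩
  · rintro ⟨h, h'⟩; rw [h, h', sub_zero]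

/-- On the annuli, `imDiff` has the sign opposite to the imaginary part of the coordinate. -/
theorem imDiff_arm (i : Fin 3) (u : ℂ) :
    ∃ r : ℝ, 0 < r ∧ imDiff (arm i u) = -r * Real.sin u.im := by
  fin_cases i
  · refine ⟨Real.exp (-u.re), Real.exp_pos _, ?_⟩
    simp [imDiff, arm, annulus, ← Complex.exp_neg, Complex.exp_im]
  · refine ⟨Real.exp (-u.re), Real.exp_pos _, ?_⟩
    simp [imDiff, arm, annulus, ← Complex.exp_neg, Complex.exp_im]
  · refine ⟨2 * Real.exp (u.re), by positivity, ?_⟩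
    simp [imDiff, arm, annulus, Complex.exp_im]; ring

theorem cexp_eq_of_sin_eq_zero {u : ℂ} (h : Real.sin u.im = 0) :
    Complex.exp u = Complex.exp u.re ∨
      Complex.exp u = Complex.exp (u.re + Real.pi * Complex.I) := by
  have h2 : Real.cos u.im = 1 ∨ Real.cos u.im = -1 := Real.sin_eq_zero_iff_cos_eq.mp h
  rcases h2 with h2 | h2
  · left; apply Complex.ext <;> simp [Complex.exp_re, Complex.exp_im, h, h2]
  · right; apply Complex.ext <;> simp [Complex.exp_re, Complex.exp_im, h, h2]

/-- The three real points of `L` over the vertex: at each of them, the negative half of one real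
line meets the positive half of the next one. -/
theorem arm_corner (i : Fin 3) : arm i (Real.pi * Complex.I) = arm (i + 1) 0 := by
  ext <;> fin_cases i <;> simp [arm, annulus]

/-- The points of `L` over the vertex form the closed coamoeba of a line: two triangles with common
corners. They are parametrized by this map on `[0, π] × [0, 1]` and on `[-π, 0] × [0, 1]`, which
collapses the side `x = 0` of either rectangle to a corner. -/
def triangle (x y : ℝ) : Torus :=
  (cexpUnit (x * Complex.I), -cexpUnit (x * y * Complex.I))

theorem continuous_triangle : Continuous fun q : ℝ × ℝ => triangle q.1 q.2 := by
  have h1 : Continuous fun q : ℝ × ℝ => cexpUnit (q.1 * Complex.I) :=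
    continuous_cexpUnit.comp (by fun_prop)
  have h2 : Continuous fun q : ℝ × ℝ => cexpUnit (q.1 * q.2 * Complex.I) :=
    continuous_cexpUnit.comp (by fun_prop)
  exact h1.prodMk (continuous_units_neg.comp h2)

theorem height_triangle (i : Fin 3) (x y : ℝ) : height i (triangle x y) = 0 := by
  have h : amoeba (triangle x y) = 0 := by
    have h1 := norm_cexpUnit (x * Complex.I)
    have h2 := norm_cexpUnit (x * y * Complex.I)
    simp at h1 h2
    simp [amoeba, triangle, h2]
  rw [height, h]
  fin_cases i <;> simp

theorem star_triangle (x y : ℝ) : star (triangle x y) = triangle (-x) y := by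
  simp only [triangle]
  refine Prod.ext ?_ ?_
  · simp only [Prod.fst_star, star_cexpUnit]; congr 1; simp
  · have h : ∀ ζ : ℂˣ, star (-ζ) = -star ζ := fun ζ => Units.ext (by simp)
    simp only [Prod.snd_star, h, star_cexpUnit]; congr 2; simp

theorem triangle_mem_phaseTropicalLine {x y : ℝ} (hx : x ∈ Icc (-Real.pi) Real.pi)
    (hy : y ∈ Icc (0 : ℝ) 1) : triangle x y ∈ phaseTropicalLine := by
  wlog h0 : 0 ≤ x generalizing x
  · have := this (x := -x) ⟨by linarith [hx.2], by linarith [hx.1]⟩ (by linarith)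
    simpa [star_triangle] using star_mem_phaseTropicalLine this
  have h1 := norm_cexpUnit (x * Complex.I)
  have h2 := norm_cexpUnit (x * y * Complex.I)
  simp at h1 h2
  obtain ⟨hx0, hx1⟩ := hx
  obtain ⟨hy0, hy1⟩ := hy
  have hxy : x * y ≤ x := mul_le_of_le_one_right h0 hy1
  have hxy0 : 0 ≤ x * y := by positivity
  rcases hx1.eq_or_lt with rfl | hx1
  · refine mem_phaseTropicalLine_of_norm_eq_one (a := 1) (b := 1) (c := 0) (by simp [triangle])
      (by simpa [triangle]) (by simp) (by simp) (by simp) (by simp) ?_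
    simp [triangle]
  rcases h0.eq_or_lt with rfl | hx2
  · refine mem_phaseTropicalLine_of_norm_eq_one (a := 1) (b := 0) (c := 1) (by simp [triangle])
      (by simp [triangle]) (by simp) (by simp) (by simp) (by simp) ?_
    simp [triangle]
  -- the coefficients are the lengths of the sides of a triangle with sides of directions `1`, `z`
  -- and `w`, by the law of sines
  have hs : 0 < Real.sin x := Real.sin_pos_of_pos_of_lt_pi hx2 hx1
  refine mem_phaseTropicalLine_of_norm_eq_one (a := Real.sin (x - x * y)) (b := Real.sin (x * y))
    (c := Real.sin x) (by simp [triangle]) (by simpa [triangle])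
    (Real.sin_nonneg_of_nonneg_of_le_pi (by linarith) (by linarith))
    (Real.sin_nonneg_of_nonneg_of_le_pi hxy0 (by linarith)) hs.le ?_ ?_
  · have := Real.sin_nonneg_of_nonneg_of_le_pi (x := x - x * y) (by linarith) (by linarith)
    have := Real.sin_nonneg_of_nonneg_of_le_pi hxy0 (by linarith)
    linarith
  · have e : ((x : ℂ) * y * Complex.I) = ((x * y : ℝ) : ℂ) * Complex.I := by push_cast; ring
    simp only [triangle, Units.val_neg, coe_cexpUnit, e]
    apply Complex.ext
    · simp [-Complex.ofReal_mul, -Complex.ofReal_sin, -Complex.ofReal_sub, Complex.exp_ofReal_mul_I_re,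
        Complex.exp_ofReal_mul_I_im, Real.sin_sub]
      ring
    · simp [-Complex.ofReal_mul, -Complex.ofReal_sin, -Complex.ofReal_sub, 
        Complex.exp_ofReal_mul_I_re, Complex.exp_ofReal_mul_I_im]
      ring

theorem imDiff_triangle (x y : ℝ) : imDiff (triangle x y) = Real.sin x + Real.sin (x * y) := by
  have e : ((x : ℂ) * y * Complex.I) = ((x * y : ℝ) : ℂ) * Complex.I := by push_cast; ring
  simp only [triangle, imDiff, Units.val_neg, coe_cexpUnit, e]
  simp [-Complex.ofReal_mul, -Complex.ofReal_sin, -Complex.ofReal_sub, Complex.exp_ofReal_mul_I_im]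

theorem exists_triangle_eq {p : Torus} (hp : p ∈ phaseTropicalLine) (h : ∀ i, height i p = 0) :
    ∃ x ∈ Icc (-Real.pi) Real.pi, ∃ y ∈ Icc (0 : ℝ) 1, p = triangle x y := by
  -- conjugation exchanges the two triangles
  wlog him : 0 ≤ imDiff p generalizing p
  · obtain ⟨x, hx, y, hy, e⟩ := this (star_mem_phaseTropicalLine hp)
      (fun i => by rw [height_star, h]) (by rw [imDiff_star]; linarith)
    refine ⟨-x, ⟨by linarith [hx.2], by linarith [hx.1]⟩, y, hy, ?_⟩
    rw [← star_triangle, ← e, star_star]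
  have ham : amoeba p = 0 := by rw [amoeba_eq_sum]; simp [h]
  simp only [amoeba, Prod.mk_eq_zero] at ham
  have n1 : ‖(p.1 : ℂ)‖ = 1 := Real.eq_one_of_pos_of_log_eq_zero (by simp) ham.1
  have n2 : ‖(p.2 : ℂ)‖ = 1 := Real.eq_one_of_pos_of_log_eq_zero (by simp) ham.2
  obtain ⟨a, b, c, ha, hb, hc, h1, h0, -⟩ := exists_coeff_of_mem_phaseTropicalLine hp
  have hneg := im_mul_im_nonpos hp
  unfold imDiff at him
  have i1 : 0 ≤ (p.1 : ℂ).im := by nlinarith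
  have i2 : (p.2 : ℂ).im ≤ 0 := by nlinarith
  -- with `z = e^{iα}` and `w = -e^{iβ}`, the condition on the point is `0 ≤ β ≤ α ≤ π`
  set α := Complex.arg p.1 with hα
  set β := Complex.arg (-p.2) with hβ
  have hα0 : 0 ≤ α := Complex.arg_nonneg_iff.mpr i1
  have hβ0 : 0 ≤ β := Complex.arg_nonneg_iff.mpr (by simpa using i2)
  have hα1 : α ≤ Real.pi := Complex.arg_le_pi _
  have hβ1 : β ≤ Real.pi := Complex.arg_le_pi _
  have ez : (p.1 : ℂ) = Complex.exp (α * Complex.I) := by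
    have := Complex.norm_mul_exp_arg_mul_I (p.1 : ℂ)
    rw [n1] at this; simpa using this.symm
  have ew : (p.2 : ℂ) = -Complex.exp (β * Complex.I) := by
    have := Complex.norm_mul_exp_arg_mul_I (-p.2 : ℂ)
    rw [norm_neg, n2] at this
    rw [hβ, eq_neg_iff_add_eq_zero, ← eq_neg_iff_add_eq_zero, neg_eq_iff_eq_neg.symm]
    simpa using this.symm
  have him := congrArg Complex.im h0
  have hre := congrArg Complex.re h0
  rw [ez, ew] at him hre
  simp [Complex.exp_ofReal_mul_I_re, Complex.exp_ofReal_mul_I_im] at him hre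
  have sa := Real.sin_nonneg_of_nonneg_of_le_pi hα0 hα1
  have hsin : 0 ≤ c * Real.sin (α - β) := by
    rw [Real.sin_sub]
    have e : c * (Real.sin α * Real.cos β - Real.cos α * Real.sin β) = a * Real.sin α := by
      linear_combination -Real.sin α * hre + Real.cos α * him
    rw [e]
    positivity
  have hle : β ≤ α := by
    by_contra hlt
    push Not at hlt
    rcases eq_or_ne (β - α) Real.pi with e | e
    · have hα' : α = 0 := by linarith
      have hβ' : β = Real.pi := by linarith
      rw [hα', hβ'] at hre
      simp at hre
      linarith
    · have : Real.sin (α - β) < 0 := Real.sin_neg_of_neg_of_neg_pi_lt (by linarith)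
        (by rcases lt_or_gt_of_ne e with h | h <;> linarith)
      have hc0 : c = 0 := by
        by_contra hc0
        have : 0 < c := lt_of_le_of_ne hc (Ne.symm hc0)
        nlinarith
      subst hc0
      simp at him hre
      rcases him with rfl | him
      · simp at hre; linarith
      · rcases Real.sin_eq_zero_iff_cos_eq.mp him with h' | h'
        · rw [h'] at hre; linarith
        · have : α = Real.pi := by
            have h3 := Real.arccos_cos hα0 hα1
            rw [h', Real.arccos_neg_one] at h3; exact h3.symm
          linarith
  rcases hα0.eq_or_lt with e | hpos
  · refine ⟨0, ⟨by linarith [Real.pi_pos], Real.pi_pos.le⟩, 0, by simp, ?_⟩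
    have : β = 0 := by linarith
    refine Prod.ext (Units.ext ?_) (Units.ext ?_)
    · rw [ez, ← e]; simp [triangle]
    · rw [ew, this]; simp [triangle]
  · refine ⟨α, ⟨by linarith, hα1⟩, β / α, ⟨by positivity, by rw [div_le_one hpos]; exact hle⟩, ?_⟩
    refine Prod.ext (Units.ext ?_) (Units.ext ?_)
    · rw [ez]; simp [triangle]
    · rw [ew]
      have : (α : ℂ) ≠ 0 := by exact_mod_cast hpos.ne'
      simp [triangle, mul_div_cancel₀ _ this]

/-! ### Local structure of plane tropical curves -/

/-- The pairing of an exponent with a vector of the plane. -/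
def pairing (a : ℤ × ℤ) (y : ℝ × ℝ) : ℝ := a.1 * y.1 + a.2 * y.2

theorem pairing_smul (a : ℤ × ℤ) (y : ℝ × ℝ) (t : ℝ) : pairing a (t • y) = t * pairing a y := by
  simp [pairing]; ring

theorem toReal_injective : Function.Injective toReal := by
  intro a b h
  simpa [toReal, Prod.ext_iff] using h

/-- The exponents in `S` on the face of the convex hull of `S` with outward normal `y`. -/
def face (S : Set (ℤ × ℤ)) (y : ℝ × ℝ) : Set (ℤ × ℤ) :=
  {a | a ∈ S ∧ ∀ b ∈ S, pairing b y ≤ pairing a y}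

theorem face_smul (S : Set (ℤ × ℤ)) (y : ℝ × ℝ) {r : ℝ} (hr : 0 < r) :
    face S (r • y) = face S y := by
  simp only [face, pairing_smul, mul_le_mul_iff_right₀ hr]

/-- A linear functional attains its maximum over a convex hull on the generating set. -/
theorem exists_pairing_le_of_mem_convexHull {S : Set (ℤ × ℤ)} {e : ℤ × ℤ} (y : ℝ × ℝ)
    (he : toReal e ∈ convexHull ℝ (toReal '' S)) : ∃ a ∈ S, pairing e y ≤ pairing a y := by
  let f : ℝ × ℝ →ₗ[ℝ] ℝ := y.1 • LinearMap.fst ℝ ℝ ℝ + y.2 • LinearMap.snd ℝ ℝ ℝ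
  have hf : ∀ a, f (toReal a) = pairing a y := fun a => by simp [f, toReal, pairing]; ring
  obtain ⟨_, ⟨a, ha, rfl⟩, h⟩ :=
    (f.convexOn (convex_convexHull ℝ (toReal '' S))).exists_ge_of_mem_convexHull
      (subset_convexHull ℝ _) he
  exact ⟨a, ha, by rw [← hf, ← hf]; exact h⟩

/-- Affine coordinates of a point of a triangle, tested against all linear functionals. -/
theorem exists_coeff_of_mem_triangle {a b c x : ℤ × ℤ}
    (hx : toReal x ∈ convexHull ℝ {toReal a, toReal b, toReal c}) :
    ∃ s t : ℝ, 0 ≤ s ∧ 0 ≤ t ∧ s + t ≤ 1 ∧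
      ∀ y, pairing x y = pairing a y + s * (pairing b y - pairing a y)
        + t * (pairing c y - pairing a y) := by
  let T : Set (ℝ × ℝ) := {x | ∃ s t : ℝ, 0 ≤ s ∧ 0 ≤ t ∧ s + t ≤ 1 ∧
    x = toReal a + s • (toReal b - toReal a) + t • (toReal c - toReal a)}
  have hT : Convex ℝ T := by
    rintro _ ⟨s, t, hs, ht, hst, rfl⟩ _ ⟨s', t', hs', ht', hst', rfl⟩ k l hk hl hkl
    refine ⟨k * s + l * s', k * t + l * t', by positivity, by positivity, ?_, ?_⟩
    · nlinarith
    · obtain rfl : l = 1 - k := by linarith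
      module
  have hsub : {toReal a, toReal b, toReal c} ⊆ T := by
    rintro _ (rfl | rfl | rfl)
    · exact ⟨0, 0, by simp, by simp, by simp, by simp⟩
    · exact ⟨1, 0, by simp, by simp, by simp, by simp⟩
    · exact ⟨0, 1, by simp, by simp, by simp, by simp⟩
  obtain ⟨s, t, hs, ht, hst, e⟩ := convexHull_min hsub hT hx
  refine ⟨s, t, hs, ht, hst, fun y => ?_⟩
  simp only [toReal, Prod.ext_iff, Prod.fst_add, Prod.snd_add, Prod.smul_fst, Prod.smul_snd,
    Prod.fst_sub, Prod.snd_sub, smul_eq_mul] at e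
  simp only [pairing, e.1, e.2]; ring

/-- Affine coordinates of a point of a parallelogram, tested against all linear functionals. -/
theorem exists_coeff_of_mem_parallelogram {a b c x : ℤ × ℤ}
    (hx : toReal x ∈ convexHull ℝ {toReal a, toReal b, toReal c, toReal (b + c - a)}) :
    ∃ s t : ℝ, 0 ≤ s ∧ s ≤ 1 ∧ 0 ≤ t ∧ t ≤ 1 ∧
      ∀ y, pairing x y = pairing a y + s * (pairing b y - pairing a y)
        + t * (pairing c y - pairing a y) := by
  let T : Set (ℝ × ℝ) := {x | ∃ s t : ℝ, 0 ≤ s ∧ s ≤ 1 ∧ 0 ≤ t ∧ t ≤ 1 ∧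
    x = toReal a + s • (toReal b - toReal a) + t • (toReal c - toReal a)}
  have hT : Convex ℝ T := by
    rintro _ ⟨s, t, hs, hs1, ht, ht1, rfl⟩ _ ⟨s', t', hs', hs1', ht', ht1', rfl⟩ k l hk hl hkl
    refine ⟨k * s + l * s', k * t + l * t', by positivity, ?_, by positivity, ?_, ?_⟩
    · nlinarith
    · nlinarith
    · obtain rfl : l = 1 - k := by linarith
      module
  have hsub : {toReal a, toReal b, toReal c, toReal (b + c - a)} ⊆ T := by
    rintro _ (rfl | rfl | rfl | rfl)
    · exact ⟨0, 0, by simp, by simp, by simp, by simp, by simp⟩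
    · exact ⟨1, 0, by simp, by simp, by simp, by simp, by simp⟩
    · exact ⟨0, 1, by simp, by simp, by simp, by simp, by simp⟩
    · refine ⟨1, 1, by simp, by simp, by simp, by simp, ?_⟩
      ext <;> simp [toReal] <;> ring
  obtain ⟨s, t, hs, hs1, ht, ht1, e⟩ := convexHull_min hsub hT hx
  refine ⟨s, t, hs, hs1, ht, ht1, fun y => ?_⟩
  simp only [toReal, Prod.ext_iff, Prod.fst_add, Prod.snd_add, Prod.smul_fst, Prod.smul_snd,
    Prod.fst_sub, Prod.snd_sub, smul_eq_mul] at e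
  simp only [pairing, e.1, e.2]; ring

theorem pairing_injective {a b : ℤ × ℤ} (h : ∀ y, pairing a y = pairing b y) : a = b := by
  have h1 := h (1, 0)
  have h2 := h (0, 1)
  simp [pairing] at h1 h2
  exact Prod.ext h1 h2

/-- For a nondegenerate triple there is a linear functional with a strict maximum at the first
point. -/
theorem exists_pairing_lt {a b c : ℤ × ℤ} (h : cross (b - a) (c - a) ≠ 0) :
    ∃ y, pairing b y < pairing a y ∧ pairing c y < pairing a y := by
  have h' : (((b.1 - a.1) * (c.2 - a.2) - (b.2 - a.2) * (c.1 - a.1) : ℤ) : ℝ) ≠ 0 := by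
    exact_mod_cast h
  push_cast at h'
  set D : ℝ := ((b.1 : ℝ) - a.1) * (c.2 - a.2) - (b.2 - a.2) * (c.1 - a.1)
  have hD : 0 < D ^ 2 := by positivity
  -- a normal vector of the opposite side, on which the functional takes a constant value
  refine ⟨(-D * (c.2 - b.2), -D * (b.1 - c.1)), ?_, ?_⟩
  · have : pairing a (-D * (c.2 - b.2), -D * (b.1 - c.1)) -
      pairing b (-D * (c.2 - b.2), -D * (b.1 - c.1)) = D ^ 2 := by
      simp only [pairing, D]; ring
    linarith
  · have : pairing a (-D * (c.2 - b.2), -D * (b.1 - c.1)) -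
      pairing c (-D * (c.2 - b.2), -D * (b.1 - c.1)) = D ^ 2 := by
      simp only [pairing, D]; ring
    linarith

theorem eq_zero_of_pairing_eq {a b c : ℤ × ℤ} (h : cross (b - a) (c - a) ≠ 0) {y : ℝ × ℝ}
    (hb : pairing b y = pairing a y) (hc : pairing c y = pairing a y) : y = 0 := by
  have h' : (((b.1 - a.1) * (c.2 - a.2) - (b.2 - a.2) * (c.1 - a.1) : ℤ) : ℝ) ≠ 0 := by
    exact_mod_cast h
  push_cast at h'
  simp only [pairing] at hb hc
  refine Prod.ext (mul_left_cancel₀ h' ?_) (mul_left_cancel₀ h' ?_)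
  · rw [Prod.fst_zero, mul_zero]
    linear_combination (c.2 - a.2 : ℝ) * hb - (b.2 - a.2 : ℝ) * hc
  · rw [Prod.snd_zero, mul_zero]
    linear_combination (b.1 - a.1 : ℝ) * hc - (c.1 - a.1 : ℝ) * hb

/-- The vertices of a triangle are recovered from any set with this convex hull. -/
theorem triangle_vertex_mem {S : Set (ℤ × ℤ)} {a b c : ℤ × ℤ} (h : cross (b - a) (c - a) ≠ 0)
    (hS : convexHull ℝ (toReal '' S) = convexHull ℝ {toReal a, toReal b, toReal c}) : a ∈ S := by
  obtain ⟨y, hb, hc⟩ := exists_pairing_lt h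
  obtain ⟨x, hxS, hx⟩ := exists_pairing_le_of_mem_convexHull (S := S) (e := a) y
    (by rw [hS]; exact subset_convexHull ℝ _ (by simp))
  obtain ⟨s, t, hs, ht, hst, e⟩ := exists_coeff_of_mem_triangle (a := a) (b := b) (c := c) (x := x)
    (by rw [← hS]; exact subset_convexHull ℝ _ (mem_image_of_mem _ hxS))
  have ey := e y
  obtain rfl : s = 0 := by
    by_contra h0
    have : 0 < s := lt_of_le_of_ne hs (Ne.symm h0)
    nlinarith
  obtain rfl : t = 0 := by
    by_contra h0
    have : 0 < t := lt_of_le_of_ne ht (Ne.symm h0)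
    nlinarith
  have : x = a := pairing_injective fun y => by rw [e y]; ring
  exact this ▸ hxS

theorem parallelogram_vertex_mem {S : Set (ℤ × ℤ)} {a b c : ℤ × ℤ}
    (h : cross (b - a) (c - a) ≠ 0)
    (hS : convexHull ℝ (toReal '' S) =
      convexHull ℝ {toReal a, toReal b, toReal c, toReal (b + c - a)}) : a ∈ S := by
  obtain ⟨y, hb, hc⟩ := exists_pairing_lt h
  obtain ⟨x, hxS, hx⟩ := exists_pairing_le_of_mem_convexHull (S := S) (e := a) y
    (by rw [hS]; exact subset_convexHull ℝ _ (by simp))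
  obtain ⟨s, t, hs, hs1, ht, ht1, e⟩ := exists_coeff_of_mem_parallelogram (a := a) (b := b)
    (c := c) (x := x) (by rw [← hS]; exact subset_convexHull ℝ _ (mem_image_of_mem _ hxS))
  have ey := e y
  obtain rfl : s = 0 := by
    by_contra h0
    have : 0 < s := lt_of_le_of_ne hs (Ne.symm h0)
    nlinarith
  obtain rfl : t = 0 := by
    by_contra h0
    have : 0 < t := lt_of_le_of_ne ht (Ne.symm h0)
    nlinarith
  have : x = a := pairing_injective fun y => by rw [e y]; ring
  exact this ▸ hxS

theorem cross_rotate {a b c : ℤ × ℤ} (h : cross (b - a) (c - a) ≠ 0) :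
    cross (c - b) (a - b) ≠ 0 := by
  contrapose! h
  simp only [cross, Prod.fst_sub, Prod.snd_sub] at h ⊢
  linear_combination h

/-- If the convex hull of `S` is a triangle and if its face with outward normal `y` is not a
vertex, then two of the vertices of the triangle are on this face. -/
theorem tie_of_face_nontrivial {S : Set (ℤ × ℤ)} {a b c : ℤ × ℤ} (h : cross (b - a) (c - a) ≠ 0)
    (hS : convexHull ℝ (toReal '' S) = convexHull ℝ {toReal a, toReal b, toReal c})
    {y : ℝ × ℝ} (hy : (face S y).Nontrivial) :
    (pairing a y = pairing b y ∧ pairing c y ≤ pairing a y) ∨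
    (pairing b y = pairing c y ∧ pairing a y ≤ pairing b y) ∨
    (pairing c y = pairing a y ∧ pairing b y ≤ pairing c y) := by
  have key : ∀ {a b c : ℤ × ℤ}, cross (b - a) (c - a) ≠ 0 →
      convexHull ℝ (toReal '' S) = convexHull ℝ {toReal a, toReal b, toReal c} →
      ¬ (pairing b y < pairing a y ∧ pairing c y < pairing a y) := by
    rintro a b c h hS ⟨hb, hc⟩
    have ha := triangle_vertex_mem h hS
    have hx : ∀ x ∈ face S y, x = a := by
      rintro x ⟨hxS, hx⟩
      obtain ⟨s, t, hs, ht, hst, e⟩ := exists_coeff_of_mem_triangle (a := a) (b := b) (c := c)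
        (x := x) (by rw [← hS]; exact subset_convexHull ℝ _ (mem_image_of_mem _ hxS))
      have ey := e y
      have hxa := hx a ha
      obtain rfl : s = 0 := by
        by_contra h0
        have : 0 < s := lt_of_le_of_ne hs (Ne.symm h0)
        nlinarith
      obtain rfl : t = 0 := by
        by_contra h0
        have : 0 < t := lt_of_le_of_ne ht (Ne.symm h0)
        nlinarith
      exact pairing_injective fun y => by rw [e y]; ring
    obtain ⟨x, hx', z, hz', hne⟩ := hy
    exact hne ((hx x hx').trans (hx z hz').symm)
  have h1 := key h hS
  have h2 := key (cross_rotate h) (by rw [hS]; congr 1; ext; simp; tauto)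
  have h3 := key (cross_rotate (cross_rotate h)) (by rw [hS]; congr 1; ext; simp; tauto)
  grind

/-- The linear expression `s β + t γ` on the unit square is minimal at the corner that is determined
by the signs of the coefficients, and only there. -/
theorem coeff_eq_ite_of_le {β γ s t : ℝ} (hβ : β ≠ 0) (hs : 0 ≤ s) (hs1 : s ≤ 1) (ht : 0 ≤ t)
    (ht1 : t ≤ 1) (h1 : s * β + t * γ ≤ 0) (h2 : s * β + t * γ ≤ β) (h3 : s * β + t * γ ≤ γ)
    (h4 : s * β + t * γ ≤ β + γ) : s = if β < 0 then 1 else 0 := by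
  split_ifs with h
  · refine le_antisymm hs1 ?_
    rcases le_total 0 γ with hγ | hγ
    · nlinarith [mul_nonneg ht hγ]
    · nlinarith [mul_nonneg (sub_nonneg.mpr ht1) (neg_nonneg.mpr hγ)]
  · have hβ' : 0 < β := lt_of_le_of_ne (not_lt.mp h) (Ne.symm hβ)
    refine le_antisymm ?_ hs
    rcases le_total 0 γ with hγ | hγ
    · nlinarith [mul_nonneg ht hγ]
    · nlinarith [mul_nonneg (sub_nonneg.mpr ht1) (neg_nonneg.mpr hγ)]

namespace TropicalPolynomial

variable (C : TropicalPolynomial)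

/-- Near `p`, in the direction `y`, the active monomials are those on a face of the cell of `p`. -/
theorem eventually_active_eq (p y : ℝ × ℝ) :
    ∀ᶠ t in 𝓝[>] (0 : ℝ), C.active (p + t • y) = face (C.active p) y := by
  have hmon : ∀ a (t : ℝ), C.monomial a (p + t • y) = C.monomial a p + t * pairing a y := by
    intro a t; simp [monomial, pairing]; ring
  have h1 : ∀ᶠ t in 𝓝[>] (0 : ℝ), ∀ a ∈ C.supp, ∀ b ∈ C.supp,
      C.monomial b p < C.monomial a p → C.monomial b (p + t • y) < C.monomial a (p + t • y) := by
    simp only [Filter.eventually_all_finset]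
    intro a _ b _
    by_cases hab : C.monomial b p < C.monomial a p
    · simp only [hab, forall_const, hmon]
      have hc : ∀ c, Tendsto (fun t : ℝ => C.monomial c p + t * pairing c y) (𝓝[>] 0)
          (𝓝 (C.monomial c p)) := by
        intro c
        have : Continuous fun t : ℝ => C.monomial c p + t * pairing c y := by fun_prop
        simpa using (this.tendsto 0).mono_left nhdsWithin_le_nhds
      exact (hc b).eventually_lt (hc a) hab
    · simp [hab]
  filter_upwards [h1, self_mem_nhdsWithin] with t h1 (ht : 0 < t)
  ext a
  constructor
  · rintro ⟨ha, hmax⟩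
    have hap : a ∈ C.active p := by
      refine ⟨ha, fun b hb => ?_⟩
      by_contra hlt
      exact absurd (h1 b hb a ha (not_le.mp hlt)) (not_lt.mpr (hmax b hb))
    refine ⟨hap, fun b hb => ?_⟩
    have e := hmax b hb.1
    have e' := hb.2 a ha
    have e'' := hap.2 b hb.1
    rw [hmon, hmon] at e
    have : t * pairing b y ≤ t * pairing a y := by linarith
    exact le_of_mul_le_mul_left this ht
  · rintro ⟨hap, hmax⟩
    refine ⟨hap.1, fun b hb => ?_⟩
    by_cases hbp : b ∈ C.active p
    · rw [hmon, hmon]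
      have := mul_le_mul_of_nonneg_left (hmax b hbp) ht.le
      linarith [hap.2 b hb]
    · have : C.monomial b p < C.monomial a p := by
        by_contra hlt
        exact hbp ⟨hb, fun c hc => (hap.2 c hc).trans (not_lt.mp hlt)⟩
      exact (h1 a hap.1 b hb this).le

/-- The curve leaves `p` in the direction `y` if `y` is normal to a side of the cell of `p`. -/
theorem eventually_mem_curve_iff (p y : ℝ × ℝ) :
    (∀ᶠ t in 𝓝[>] (0 : ℝ), p + t • y ∈ C.curve) ↔ (face (C.active p) y).Nontrivial := by
  have h := C.eventually_active_eq p y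
  constructor
  · intro h'
    obtain ⟨t, ht, ht'⟩ := (h.and h').exists
    rw [← ht]; exact ht'
  · intro h'
    filter_upwards [h] with t ht
    change (C.active (p + t • y)).Nontrivial
    rwa [ht]

theorem isClosed_curve : IsClosed C.curve := by
  have hmon : ∀ a, Continuous (C.monomial a) := fun a => by unfold monomial; fun_prop
  have e : C.curve = ⋃ a ∈ C.supp, ⋃ b ∈ C.supp, {p | a ≠ b ∧ ∀ c ∈ C.supp,
      C.monomial c p ≤ C.monomial a p ∧ C.monomial c p ≤ C.monomial b p} := by
    ext p
    simp only [curve, Set.Nontrivial, active, mem_ofPred_eq, mem_iUnion, exists_prop]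
    constructor
    · rintro ⟨a, ⟨ha, ha'⟩, b, ⟨hb, hb'⟩, hab⟩
      exact ⟨a, ha, b, hb, hab, fun c hc => ⟨ha' c hc, hb' c hc⟩⟩
    · rintro ⟨a, ha, b, hb, hab, h⟩
      exact ⟨a, ⟨ha, fun c hc => (h c hc).1⟩, b, ⟨hb, fun c hc => (h c hc).2⟩, hab⟩
  rw [e]
  refine isClosed_biUnion_finset fun a _ => isClosed_biUnion_finset fun b _ => ?_
  by_cases hab : a = b
  · simp [hab]
  · simp only [ne_eq, hab, not_false_eq_true, true_and, ofPred_forall]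
    exact isClosed_biInter fun c _ => (isClosed_le (hmon c) (hmon a)).inter
      (isClosed_le (hmon c) (hmon b))

/-- A vertex is determined by the set of monomials that are maximal there, since these are not on
a line. -/
theorem finite_setOf_isVertex : {p | C.IsVertex p}.Finite := by
  refine Set.Finite.of_finite_image (f := C.active) (C.supp.finite_toSet.powerset.subset ?_) ?_
  · rintro _ ⟨p, -, rfl⟩ a ha
    exact ha.1
  · rintro p ⟨a, b, c, h, hp⟩ q - e
    have hS : convexHull ℝ (toReal '' C.active p) = _ := hp
    have ha := triangle_vertex_mem h hS
    have hb := triangle_vertex_mem (cross_rotate h) (by rw [hS]; congr 1; ext; simp; tauto)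
    have hc := triangle_vertex_mem (cross_rotate (cross_rotate h))
      (by rw [hS]; congr 1; ext; simp; tauto)
    have heq : ∀ x ∈ C.active p, ∀ y ∈ C.active p, pairing x (p - q) = pairing y (p - q) := by
      intro x hx y hy
      have h1 := le_antisymm (hy.2 x hx.1) (hx.2 y hy.1)
      change C.active p = C.active q at e
      rw [e] at hx hy
      have h2 := le_antisymm (hy.2 x hx.1) (hx.2 y hy.1)
      simp only [monomial, pairing, Prod.fst_sub, Prod.snd_sub] at *
      linear_combination h1 - h2
    exact sub_eq_zero.mp (eq_zero_of_pairing_eq h (heq b hb a ha) (heq c hc a ha))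

instance : Finite C.Vertex := C.finite_setOf_isVertex.to_subtype

/-- Away from the vertices, a simple tropical curve is locally a union of lines, since segments
and parallelograms are centrally symmetric. -/
theorem IsSimple.face_nontrivial {C : TropicalPolynomial} (hC : C.IsSimple) {q y : ℝ × ℝ}
    (hq : ¬ C.IsVertex q) (h : (face (C.active q) (-y)).Nontrivial) :
    (face (C.active q) y).Nontrivial := by
  obtain ⟨x, ⟨hx, hxm⟩, z, ⟨hz, hzm⟩, hne⟩ := h
  have hneg : ∀ a, pairing a (-y) = -pairing a y := fun a => by simp [pairing]; ring
  simp only [hneg, neg_le_neg_iff] at hxm hzm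
  have hxz : pairing x y = pairing z y := le_antisymm (hxm z hz) (hzm x hx)
  rcases hC q with hcol | hv | ⟨a, b, c, hD, hS⟩
  · have hcol' : Collinear ℝ (toReal '' C.active q) := hcol.subset (subset_convexHull ℝ _)
    rw [collinear_iff_of_mem (mem_image_of_mem _ hx)] at hcol'
    obtain ⟨d, hd⟩ := hcol'
    have hall : ∀ a ∈ C.active q, pairing a y = pairing x y := by
      have hp : ∀ a ∈ C.active q, ∃ r : ℝ, pairing a y = pairing x y + r * (d.1 * y.1 + d.2 * y.2)
          ∧ toReal a = r • d +ᵥ toReal x := by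
        intro a ha
        obtain ⟨r, hr⟩ := hd _ (mem_image_of_mem _ ha)
        refine ⟨r, ?_, hr⟩
        simp only [toReal, vadd_eq_add, Prod.ext_iff, Prod.fst_add, Prod.snd_add, Prod.smul_fst,
          Prod.smul_snd, smul_eq_mul] at hr
        simp only [pairing, hr.1, hr.2]; ring
      obtain ⟨r, hr, hr'⟩ := hp z hz
      have hr0 : r ≠ 0 := by
        rintro rfl
        exact hne (toReal_injective (by simpa using hr'.symm))
      have hd0 : d.1 * y.1 + d.2 * y.2 = 0 := by
        have : r * (d.1 * y.1 + d.2 * y.2) = 0 := by linarith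
        exact (mul_eq_zero.mp this).resolve_left hr0
      intro a ha
      obtain ⟨s, hs, -⟩ := hp a ha
      rw [hs, hd0]; ring
    exact ⟨x, ⟨hx, fun a ha => (hall a ha).le⟩, z, ⟨hz, fun a ha => by
      rw [← hxz]; exact (hall a ha).le⟩, hne⟩
  · exact absurd hv hq
  · have hS' : convexHull ℝ (toReal '' C.active q) = _ := hS
    set d := b + c - a with hd
    have ha : a ∈ C.active q := parallelogram_vertex_mem hD hS'
    have hb : b ∈ C.active q := by
      refine parallelogram_vertex_mem (a := b) (b := a) (c := d) ?_ ?_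
      · contrapose! hD
        simp only [cross, hd, Prod.fst_sub, Prod.snd_sub, Prod.fst_add, Prod.snd_add] at hD ⊢
        linear_combination -hD
      · rw [hS', show a + d - b = c by rw [hd]; abel]; congr 1; ext; simp; tauto
    have hc : c ∈ C.active q := by
      refine parallelogram_vertex_mem (a := c) (b := d) (c := a) ?_ ?_
      · contrapose! hD
        simp only [cross, hd, Prod.fst_sub, Prod.snd_sub, Prod.fst_add, Prod.snd_add] at hD ⊢
        linear_combination -hD
      · rw [hS', show d + a - c = b by rw [hd]; abel]; congr 1; ext; simp; tauto
    have hd' : d ∈ C.active q := by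
      refine parallelogram_vertex_mem (a := d) (b := b) (c := c) ?_ ?_
      · contrapose! hD
        simp only [cross, hd, Prod.fst_sub, Prod.snd_sub, Prod.fst_add, Prod.snd_add] at hD ⊢
        linear_combination -hD
      · rw [hS', show b + c - d = a by rw [hd]; abel]; congr 1; ext; simp; tauto
    have hpd : pairing d y = pairing b y + pairing c y - pairing a y := by
      simp [pairing, hd]; ring
    have hab : a ≠ b := by rintro rfl; simp [cross] at hD
    have hac : a ≠ c := by rintro rfl; simp [cross] at hD
    have hcd : c ≠ d := by
      intro h; apply hab; rw [hd] at h
      have := sub_eq_zero.mpr h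
      rw [← sub_eq_zero]; rw [← this]; abel
    have hbd : b ≠ d := by
      intro h; apply hac; rw [hd] at h
      have := sub_eq_zero.mpr h
      rw [← sub_eq_zero]; rw [← this]; abel
    have hle : ∀ {M : ℝ}, pairing a y ≤ M → pairing b y ≤ M → pairing c y ≤ M → pairing d y ≤ M →
        ∀ x ∈ C.active q, pairing x y ≤ M := by
      intro M h1 h2 h3 h4 x hx
      obtain ⟨s, t, hs, hs1, ht, ht1, e⟩ := exists_coeff_of_mem_parallelogram (a := a) (b := b)
        (c := c) (x := x) (by rw [← hd, ← hS']; exact subset_convexHull ℝ _ (mem_image_of_mem _ hx))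
      rw [e y]
      rw [hpd] at h4
      nlinarith [mul_nonneg hs ht, mul_nonneg hs (sub_nonneg.mpr ht1),
        mul_nonneg (sub_nonneg.mpr hs1) ht, mul_nonneg (sub_nonneg.mpr hs1) (sub_nonneg.mpr ht1)]
    by_cases hβ : pairing b y = pairing a y
    · rcases le_total (pairing c y) (pairing a y) with h | h
      · exact ⟨a, ⟨ha, hle le_rfl hβ.le h (by linarith)⟩, b,
          ⟨hb, hle hβ.ge le_rfl (by linarith) (by linarith)⟩, hab⟩
      · exact ⟨c, ⟨hc, hle h (by linarith) le_rfl (by linarith)⟩, d,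
          ⟨hd', hle (by linarith) (by linarith) (by linarith) le_rfl⟩, hcd⟩
    by_cases hγ : pairing c y = pairing a y
    · rcases le_total (pairing b y) (pairing a y) with h | h
      · exact ⟨a, ⟨ha, hle le_rfl h hγ.le (by linarith)⟩, c,
          ⟨hc, hle hγ.ge (by linarith) le_rfl (by linarith)⟩, hac⟩
      · exact ⟨b, ⟨hb, hle h le_rfl (by linarith) (by linarith)⟩, d,
          ⟨hd', hle (by linarith) (by linarith) (by linarith) le_rfl⟩, hbd⟩
    -- otherwise the minimum is attained at one vertex of the parallelogram only
    exfalso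
    apply hne
    have hm : ∀ {x}, x ∈ C.active q → (∀ b ∈ C.active q, pairing x y ≤ pairing b y) →
        ∀ y', pairing x y' = pairing a y'
          + (if pairing b y < pairing a y then 1 else 0) * (pairing b y' - pairing a y')
          + (if pairing c y < pairing a y then 1 else 0) * (pairing c y' - pairing a y') := by
      intro x hx hxm
      obtain ⟨s, t, hs, hs1, ht, ht1, e⟩ := exists_coeff_of_mem_parallelogram (a := a) (b := b)
        (c := c) (x := x) (by rw [← hd, ← hS']; exact subset_convexHull ℝ _ (mem_image_of_mem _ hx))
      have ey := e y
      have e1 := hxm a ha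
      have e2 := hxm b hb
      have e3 := hxm c hc
      have e4 := hxm d hd'
      rw [hpd] at e4
      have hs' := coeff_eq_ite_of_le (β := pairing b y - pairing a y)
        (γ := pairing c y - pairing a y) (s := s) (t := t) (sub_ne_zero.mpr hβ) hs hs1 ht ht1
        (by linarith) (by linarith) (by linarith) (by linarith)
      have ht' := coeff_eq_ite_of_le (β := pairing c y - pairing a y)
        (γ := pairing b y - pairing a y) (s := t) (t := s) (sub_ne_zero.mpr hγ) ht ht1 hs hs1
        (by linarith) (by linarith) (by linarith) (by linarith)
      simp only [sub_neg] at hs' ht'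
      rw [← hs', ← ht']
      exact e
    exact pairing_injective fun y' => by rw [hm hx hxm, hm hz hzm]

end TropicalPolynomial

/-- The outward normal of the side from `a` to `b` of a triangle, up to a positive factor. -/
def sideNormal (a b c : ℤ × ℤ) : ℝ × ℝ :=
  ((cross (b - a) (c - a) : ℤ) : ℝ) • ((b.2 - a.2 : ℝ), -(b.1 - a.1 : ℝ))

/-- A functional that is constant on a side of a triangle, and maximal there, is a positive multiple
of the outward normal. -/
theorem exists_smul_sideNormal {a b c : ℤ × ℤ} (h : cross (b - a) (c - a) ≠ 0) {y : ℝ × ℝ}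
    (hy : y ≠ 0) (hab : pairing a y = pairing b y) (hc : pairing c y ≤ pairing a y) :
    ∃ r : ℝ, 0 < r ∧ y = r • sideNormal a b c := by
  have hD : ((cross (b - a) (c - a) : ℤ) : ℝ) ≠ 0 := by exact_mod_cast h
  have hDe : ((cross (b - a) (c - a) : ℤ) : ℝ) =
    (b.1 - a.1) * (c.2 - a.2) - (b.2 - a.2) * (c.1 - a.1) := by simp [cross]
  unfold sideNormal
  set D : ℝ := ((cross (b - a) (c - a) : ℤ) : ℝ)
  have hn : 0 < (b.1 - a.1 : ℝ) ^ 2 + (b.2 - a.2 : ℝ) ^ 2 := by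
    by_contra hle
    have h1 : (b.1 - a.1 : ℝ) = 0 := by
      nlinarith [sq_nonneg (b.1 - a.1 : ℝ), sq_nonneg (b.2 - a.2 : ℝ)]
    have h2 : (b.2 - a.2 : ℝ) = 0 := by
      nlinarith [sq_nonneg (b.1 - a.1 : ℝ), sq_nonneg (b.2 - a.2 : ℝ)]
    rw [h1, h2] at hDe
    apply hD; rw [hDe]; ring
  simp only [pairing] at hab hc
  set n : ℝ := (b.1 - a.1 : ℝ) ^ 2 + (b.2 - a.2 : ℝ) ^ 2
  set κ : ℝ := (y.1 * (b.2 - a.2) - y.2 * (b.1 - a.1)) / n with hκ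
  have e1 : y.1 = κ * (b.2 - a.2) := by
    rw [hκ]; field_simp; simp only [n]; linear_combination -(b.1 - a.1 : ℝ) * hab
  have e2 : y.2 = -κ * (b.1 - a.1) := by
    rw [hκ]; field_simp; simp only [n]; linear_combination -(b.2 - a.2 : ℝ) * hab
  have hκD : 0 ≤ κ * D := by rw [hDe]; rw [e1, e2] at hc; linarith
  have hκ0 : κ ≠ 0 := by
    intro h0; rw [h0] at e1 e2
    exact hy (Prod.ext (by simpa using e1) (by simpa using e2))
  refine ⟨κ / D, ?_, ?_⟩
  · have : κ / D = κ * D / D ^ 2 := by field_simp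
    rw [this]
    exact div_pos (lt_of_le_of_ne hκD (mul_ne_zero hκ0 hD).symm) (by positivity)
  · rw [smul_smul, div_mul_cancel₀ _ hD]
    exact Prod.ext (by simpa using e1) (by simp [e2]; ring)

namespace TropicalPolynomial

variable {C : TropicalPolynomial}

/-- The sides of a triangle have no opposite outward normals, so no line runs through a vertex. -/
theorem IsVertex.not_opposite {p y : ℝ × ℝ} (hp : C.IsVertex p) (hy : y ≠ 0)
    (h : (face (C.active p) y).Nontrivial) (h' : (face (C.active p) (-y)).Nontrivial) : False := by
  obtain ⟨a, b, c, hD, hS⟩ := hp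
  have hneg : ∀ a, pairing a (-y) = -pairing a y := fun a => by simp [pairing]; ring
  have h1 := tie_of_face_nontrivial hD hS h
  have h2 := tie_of_face_nontrivial hD hS h'
  simp only [hneg] at h2
  refine hy (eq_zero_of_pairing_eq hD (y := y) ?_ ?_)
  · rcases h1 with h1 | h1 | h1 <;> rcases h2 with h2 | h2 | h2 <;> linarith
  · rcases h1 with h1 | h1 | h1 <;> rcases h2 with h2 | h2 | h2 <;> linarith

/-- The curve leaves a vertex in at most three directions. -/
theorem IsVertex.exists_normals {p : ℝ × ℝ} (hp : C.IsVertex p) :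
    ∃ N : Fin 3 → ℝ × ℝ, ∀ y ≠ 0, (face (C.active p) y).Nontrivial →
      ∃ k, ∃ r : ℝ, 0 < r ∧ y = r • N k := by
  obtain ⟨a, b, c, hD, hS⟩ := hp
  refine ⟨![sideNormal a b c, sideNormal b c a, sideNormal c a b], fun y hy h => ?_⟩
  rcases tie_of_face_nontrivial hD hS h with h | h | h
  · exact ⟨0, exists_smul_sideNormal hD hy h.1 h.2⟩
  · exact ⟨1, exists_smul_sideNormal (cross_rotate hD) hy h.1 h.2⟩
  · exact ⟨2, exists_smul_sideNormal (cross_rotate (cross_rotate hD)) hy h.1 h.2⟩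

/-- Three balanced directions in which the curve leaves a vertex are all such directions. -/
theorem IsVertex.directions {p : ℝ × ℝ} (hp : C.IsVertex p) {w : Fin 3 → ℝ × ℝ}
    (hw : ∀ i, w i ≠ 0) (hsum : ∑ i, w i = 0) (hg : ∀ i, (face (C.active p) (w i)).Nontrivial) :
    cross (w 0) (w 1) ≠ 0 ∧ ∀ y ≠ 0, (face (C.active p) y).Nontrivial →
      ∃ i, ∃ r : ℝ, 0 < r ∧ y = r • w i := by
  rw [Fin.sum_univ_three] at hsum
  have h2 : w 2 = -(w 0 + w 1) := by rw [eq_neg_iff_add_eq_zero, ← hsum]; abel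
  -- parallel directions would sum to zero only if two of them were opposite
  have hcr : cross (w 0) (w 1) ≠ 0 := by
    intro h0
    obtain ⟨μ, hμ⟩ : ∃ μ : ℝ, w 1 = μ • w 0 := by
      by_cases hx : (w 0).1 = 0
      · have hy : (w 0).2 ≠ 0 := fun hy => hw 0 (Prod.ext hx hy)
        refine ⟨(w 1).2 / (w 0).2, Prod.ext ?_ ?_⟩
        · simp only [cross, hx] at h0
          have : (w 1).1 = 0 := by
            have : (w 0).2 * (w 1).1 = 0 := by linarith
            exact (mul_eq_zero.mp this).resolve_left hy
          simp [hx, this]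
        · simp [hy]
      · refine ⟨(w 1).1 / (w 0).1, Prod.ext (by simp [hx]) ?_⟩
        simp only [Prod.smul_snd, smul_eq_mul]
        field_simp
        simp only [cross] at h0
        linarith
    have hscale : ∀ {r : ℝ} {i : Fin 3}, 0 < r → w i = -(r • w 0) → False := by
      intro r i hr h
      refine hp.not_opposite (hw 0) (hg 0) ?_
      have := hg i
      rwa [h, ← smul_neg, face_smul _ _ hr] at this
    rcases lt_trichotomy μ 0 with h | rfl | h
    · exact hscale (r := -μ) (i := 1) (by linarith) (by rw [hμ]; simp)
    · exact hw 1 (by simpa using hμ)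
    · exact hscale (r := 1 + μ) (i := 2) (by linarith) (by rw [h2, hμ, add_smul, one_smul])
  have hcr' : ∀ i j, i ≠ j → cross (w i) (w j) ≠ 0 := by
    intro i j hij h0
    apply hcr
    fin_cases i <;> fin_cases j <;> simp [h2] at hij h0 <;>
      simp only [cross, Prod.fst_neg, Prod.snd_neg, Prod.fst_add, Prod.snd_add] at h0 ⊢ <;> linarith
  refine ⟨hcr, fun y hy hyg => ?_⟩
  obtain ⟨N, hN⟩ := hp.exists_normals
  choose σ r hr hσ using fun i => hN (w i) (hw i) (hg i)
  have hinj : Function.Injective σ := by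
    intro i j hij
    by_contra hne
    apply hcr' i j hne
    rw [hσ i, hσ j, hij]
    simp [cross]; ring
  obtain ⟨k, s, hs, hk⟩ := hN y hy hyg
  obtain ⟨i, rfl⟩ := Finite.surjective_of_injective hinj k
  refine ⟨i, s / r i, div_pos hs (hr i), ?_⟩
  rw [hk]
  conv_rhs => rw [hσ i]
  rw [smul_smul, div_mul_cancel₀ _ (hr i).ne']

/-- A ray that leaves `v` along a simple tropical curve stays in it up to the next vertex. -/
theorem IsSimple.segment_subset_curve (hC : C.IsSimple) {v w : ℝ × ℝ}
    (hg : (face (C.active v) w).Nontrivial) {T : ℝ}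
    (hno : ∀ t ∈ Ioo 0 T, ¬ C.IsVertex (v + t • w)) :
    ∀ t ∈ Icc 0 T, v + t • w ∈ C.curve := by
  have hg' := (C.eventually_mem_curve_iff v w).mpr hg
  have hcont : Continuous fun t : ℝ => v + t • w := by fun_prop
  have hv : v ∈ C.curve := by
    have : Tendsto (fun t : ℝ => v + t • w) (𝓝[>] 0) (𝓝 v) := by
      simpa using (hcont.tendsto 0).mono_left nhdsWithin_le_nhds
    exact C.isClosed_curve.mem_of_tendsto this hg'
  let s : Set ℝ := {x | ∀ t ∈ Icc 0 x, v + t • w ∈ C.curve}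
  have hcl : IsClosed (s ∩ Icc 0 T) := by
    rw [← isSeqClosed_iff_isClosed]
    intro u x hu hx
    refine ⟨fun t ht => ?_, isClosed_Icc.isSeqClosed (fun n => (hu n).2) hx⟩
    rcases ht.2.eq_or_lt with rfl | hlt
    · exact C.isClosed_curve.mem_of_tendsto ((hcont.tendsto t).comp hx)
        (Eventually.of_forall fun n => (hu n).1 _ ⟨(hu n).2.1, le_rfl⟩)
    · obtain ⟨n, hn⟩ := (hx.eventually (lt_mem_nhds hlt)).exists
      exact (hu n).1 t ⟨ht.1, hn.le⟩
  have hsub : Icc 0 T ⊆ s := by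
    refine hcl.Icc_subset_of_forall_exists_gt ?_ ?_
    · intro t ht
      obtain rfl : t = 0 := le_antisymm ht.2 ht.1
      simpa using hv
    · rintro x ⟨hx, hx0, hxT⟩ y (hy : x < y)
      have hgx : ∀ᶠ h in 𝓝[>] (0 : ℝ), v + x • w + h • w ∈ C.curve := by
        rcases hx0.eq_or_lt with rfl | hx0
        · simpa using hg'
        · rw [eventually_mem_curve_iff]
          refine hC.face_nontrivial (hno x ⟨hx0, hxT⟩) ?_
          rw [← eventually_mem_curve_iff]
          filter_upwards [Ioo_mem_nhdsGT hx0] with h hh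
          have := hx (x - h) ⟨by linarith [hh.2], by linarith [hh.1]⟩
          rwa [sub_smul, ← add_sub_assoc, sub_eq_add_neg, ← smul_neg] at this
      obtain ⟨δ, hδ, hsubδ⟩ := mem_nhdsGT_iff_exists_Ioo_subset.mp hgx
      have hδ' : (0 : ℝ) < δ := hδ
      have hm : 0 < min (δ / 2) ((y - x) / 2) := lt_min (by linarith) (by linarith)
      refine ⟨x + min (δ / 2) ((y - x) / 2), fun t ht => ?_, by linarith, ?_⟩
      · rcases le_or_gt t x with htx | htx
        · exact hx t ⟨ht.1, htx⟩
        · have hle : t - x ≤ δ / 2 := by linarith [ht.2, min_le_left (δ / 2) ((y - x) / 2)]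
          have := hsubδ (show t - x ∈ Ioo 0 δ from ⟨by linarith, by linarith⟩)
          change v + x • w + (t - x) • w ∈ C.curve at this
          rwa [add_assoc, ← add_smul, add_sub_cancel] at this
      · linarith [min_le_right (δ / 2) ((y - x) / 2)]
  intro t ht
  exact hsub ht t ⟨ht.1, le_rfl⟩

/-- On a ray, either there is no vertex, or there is a first one. -/
theorem first_vertex (C : TropicalPolynomial) (v : ℝ × ℝ) {w : ℝ × ℝ} (hw : w ≠ 0) :
    (∀ t > (0 : ℝ), ¬ C.IsVertex (v + t • w)) ∨
    ∃ T > (0 : ℝ), C.IsVertex (v + T • w) ∧ ∀ t ∈ Ioo 0 T, ¬ C.IsVertex (v + t • w) := by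
  by_cases h : ∃ t > (0 : ℝ), C.IsVertex (v + t • w)
  · right
    have hfin : {t : ℝ | 0 < t ∧ C.IsVertex (v + t • w)}.Finite := by
      refine Set.Finite.of_finite_image (f := fun t : ℝ => v + t • w)
        (C.finite_setOf_isVertex.subset ?_) ?_
      · rintro _ ⟨t, ht, rfl⟩; exact ht.2
      · intro s _ t _ e
        exact smul_left_injective ℝ hw (add_left_cancel e)
    obtain ⟨T, ⟨hT0, hT⟩, hmin⟩ := hfin.exists_minimalFor id _ h
    refine ⟨T, hT0, hT, fun t ht hv => ?_⟩
    have := hmin ⟨ht.1, hv⟩ ht.2.le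
    simp at this
    linarith [ht.2]
  · left
    push Not at h
    exact h

end TropicalPolynomial

/-! ### Surfaces glued from phase-tropical lines -/

/-- The combinatorial model of the normalization of a real phase-tropical curve without inflection
patterns: a 3-valent graph with vertex set `W`, whose half-edges and leaves are the pairs in
`W × Fin 3`, cyclically ordered at each vertex, with a length for each edge. Half-edges that are
not leaves satisfy `IsEdge`, and `opp` is the other half of such an edge. -/
structure Ribbon (W : Type) where
  IsEdge : W × Fin 3 → Prop
  opp : W × Fin 3 → W × Fin 3
  len : W × Fin 3 → ℝ
  len_pos : ∀ h, IsEdge h → 0 < len h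
  isEdge_opp : ∀ h, IsEdge h → IsEdge (opp h)
  opp_opp : ∀ h, IsEdge h → opp (opp h) = h
  len_opp : ∀ h, IsEdge h → len (opp h) = len h
  opp_fst_ne : ∀ h, IsEdge h → (opp h).1 ≠ h.1

namespace Ribbon

variable {W : Type} (M : Ribbon W)

/-- The part of the phase-tropical line in which the ray `i` is cut off at the length of the edge
`(v, i)`. -/
def pieceSet (v : W) : Set Torus :=
  {p | p ∈ phaseTropicalLine ∧ ∀ i, M.IsEdge (v, i) → height i p < M.len (v, i)}

/-- The copy at the vertex `v` of the phase-tropical line with shortened rays. -/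
abbrev Piece (v : W) : Type := {p : Torus // p ∈ M.pieceSet v}

/-- The gluing over the edge `h`, in logarithmic coordinates of the annuli at its two ends. The
imaginary shift glues the real line on the left of the edge at one end to the one that is on the
left of it, as seen from the same end, at the other end. -/
def flip (h : W × Fin 3) (u : ℂ) : ℂ := M.len h + Real.pi * Complex.I - u

/-- Points over the edges are identified by `flip`. -/
def Rel (x y : Σ v, M.Piece v) : Prop :=
  ∃ i j u, M.IsEdge (x.1, i) ∧ M.opp (x.1, i) = (y.1, j) ∧ 0 < u.re ∧ u.re < M.len (x.1, i) ∧
    x.2.1 = arm i u ∧ y.2.1 = arm j (M.flip (x.1, i) u)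

/-- The surface glued from the pieces. -/
def Surface : Type := Quot M.Rel

instance : TopologicalSpace M.Surface := inferInstanceAs (TopologicalSpace (Quot M.Rel))

/-- The point of the surface given by a point of a piece. -/
def pt (v : W) (p : M.Piece v) : M.Surface := Quot.mk _ ⟨v, p⟩

variable {M}

theorem exists_pt (x : M.Surface) : ∃ v p, x = M.pt v p := by
  obtain ⟨⟨v, p⟩, rfl⟩ := Quot.exists_rep x
  exact ⟨v, p, rfl⟩

theorem flip_flip {h h' : W × Fin 3} (hl : M.len h = M.len h') (u : ℂ) :
    M.flip h (M.flip h' u) = u := by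
  simp [flip, hl]

@[simp] theorem flip_re (h : W × Fin 3) (u : ℂ) : (M.flip h u).re = M.len h - u.re := by
  simp [flip]

@[simp] theorem flip_im (h : W × Fin 3) (u : ℂ) : (M.flip h u).im = Real.pi - u.im := by
  simp [flip]

theorem arm_flip_eq (h : W × Fin 3) (j : Fin 3) {u u' : ℂ} (e : Complex.exp u = Complex.exp u') :
    arm j (M.flip h u) = arm j (M.flip h u') := by
  rw [arm_eq_iff, flip, flip, Complex.exp_sub, Complex.exp_sub, e]

theorem arm_mem_pieceSet {v : W} {i : Fin 3} {u : ℂ} (h0 : 0 ≤ u.re)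
    (h1 : M.IsEdge (v, i) → u.re < M.len (v, i)) : arm i u ∈ M.pieceSet v := by
  refine ⟨arm_mem_phaseTropicalLine i h0, fun j hj => ?_⟩
  rw [height_arm _ _ h0]
  split_ifs with hij
  · subst hij; exact h1 hj
  · exact M.len_pos _ hj

theorem eq_of_arm_eq {i j : Fin 3} {u u' : ℂ} (hu : 0 < u.re) (hu' : 0 ≤ u'.re)
    (h : arm i u = arm j u') : i = j ∧ Complex.exp u = Complex.exp u' := by
  have hij : i = j := by
    by_contra hij
    have h1 := height_arm_self i hu.le
    rw [h, height_arm _ _ hu', if_neg (Ne.symm hij)] at h1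
    exact hu.ne h1
  subst hij
  exact ⟨rfl, arm_eq_iff.mp h⟩

theorem Rel.symm {x y : Σ v, M.Piece v} (h : M.Rel x y) : M.Rel y x := by
  obtain ⟨i, j, u, hE, ho, h0, h1, hx, hy⟩ := h
  have hl := M.len_opp _ hE
  have hE' := M.isEdge_opp _ hE
  have ho' := M.opp_opp _ hE
  rw [ho] at hl hE' ho'
  refine ⟨j, i, M.flip (x.1, i) u, hE', ho', by rw [flip_re]; linarith, by
    rw [flip_re]; linarith, hy, ?_⟩
  rw [flip_flip hl, hx]

/-- No three pieces overlap. -/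
theorem Rel.trans {x y z : Σ v, M.Piece v} (h : M.Rel x y) (h' : M.Rel y z) : x = z := by
  obtain ⟨i, j, u, hE, ho, h0, h1, hx, hy⟩ := h
  obtain ⟨j', k, u', hE', ho', h0', h1', hy', hz⟩ := h'
  have hl := M.len_opp _ hE
  have ho2 := M.opp_opp _ hE
  rw [ho] at hl ho2
  obtain ⟨rfl, he⟩ := eq_of_arm_eq h0' (by rw [flip_re]; linarith) (hy'.symm.trans hy)
  rw [ho2] at ho'
  obtain ⟨z1, z2⟩ := z
  obtain ⟨x1, x2⟩ := x
  simp only [Prod.mk.injEq] at ho'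
  obtain ⟨rfl, rfl⟩ := ho'
  simp only [Sigma.mk.injEq, heq_eq_eq, true_and]
  apply Subtype.ext
  rw [hx, hz, arm_flip_eq _ _ he, flip_flip hl]

/-- Since no three pieces overlap, `Rel` generates no further identifications. -/
theorem pt_eq_iff_rel {v v' : W} {p : M.Piece v} {p' : M.Piece v'} :
    M.pt v p = M.pt v' p' ↔
      (⟨v, p⟩ : Σ v, M.Piece v) = ⟨v', p'⟩ ∨ M.Rel ⟨v, p⟩ ⟨v', p'⟩ := by
  constructor
  · intro h
    have h' := Quot.eqvGen_exact h
    generalize (⟨v, p⟩ : Σ v, M.Piece v) = x at h'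
    generalize (⟨v', p'⟩ : Σ v, M.Piece v) = y at h'
    clear h
    induction h' with
    | rel x y h => exact Or.inr h
    | refl x => exact Or.inl rfl
    | symm x y h ih =>
      rcases ih with ih | ih
      · exact Or.inl ih.symm
      · exact Or.inr ih.symm
    | trans x y z h1 h2 ih1 ih2 =>
      rcases ih1 with ih1 | ih1
      · rcases ih2 with ih2 | ih2
        · exact Or.inl (ih1.trans ih2)
        · exact Or.inr (ih1 ▸ ih2)
      · rcases ih2 with ih2 | ih2
        · exact Or.inr (ih2 ▸ ih1)
        · exact Or.inl (ih1.trans ih2)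
  · rintro (h | h)
    · exact congrArg (Quot.mk M.Rel) h
    · exact Quot.sound h

theorem Rel.fst_ne {x y : Σ v, M.Piece v} (h : M.Rel x y) : x.1 ≠ y.1 := by
  obtain ⟨i, j, u, hE, ho, -⟩ := h
  have := M.opp_fst_ne _ hE
  rw [ho] at this
  exact this.symm

theorem pt_injective (v : W) : Function.Injective (M.pt v) := by
  intro p q h
  rcases pt_eq_iff_rel.mp h with h | h
  · simpa using h
  · exact absurd rfl h.fst_ne

theorem pt_arm {v v' : W} {i j : Fin 3} (hE : M.IsEdge (v, i)) (ho : M.opp (v, i) = (v', j))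
    {u : ℂ} (h0 : 0 < u.re) (h1 : u.re < M.len (v, i)) :
    M.pt v ⟨arm i u, arm_mem_pieceSet h0.le fun _ => h1⟩ =
      M.pt v' ⟨arm j (M.flip (v, i) u), arm_mem_pieceSet (by rw [flip_re]; linarith) fun _ => by
        have := M.len_opp _ hE
        rw [ho] at this
        rw [flip_re, this]; linarith⟩ :=
  pt_eq_iff_rel.mpr (Or.inr ⟨i, j, u, hE, ho, h0, h1, rfl, rfl⟩)

/-- The identification over an edge, described by conditions that are closed in the product of two
pieces; this is what makes the surface Hausdorff. -/
theorem rel_iff {x y : Σ v, M.Piece v} : M.Rel x y ↔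
    ∃ i j, M.IsEdge (x.1, i) ∧ M.opp (x.1, i) = (y.1, j) ∧
      annulus j (cexpUnit (M.len (x.1, i) + Real.pi * Complex.I) * (coord i x.2.1)⁻¹) = y.2.1 ∧
      height i x.2.1 + height j y.2.1 = M.len (x.1, i) := by
  have key : ∀ h i j u, arm j (M.flip h u) =
      annulus j (cexpUnit (M.len h + Real.pi * Complex.I) * (coord i (arm i u))⁻¹) := by
    intro h i j u
    rw [arm, arm, coord_annulus, flip, sub_eq_add_neg, cexpUnit_add, cexpUnit_neg]
  constructor
  · rintro ⟨i, j, u, hE, ho, h0, h1, hx, hy⟩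
    refine ⟨i, j, hE, ho, ?_, ?_⟩
    · rw [hy, key _ i, hx]
    · rw [hx, hy, height_arm_self i h0.le, height_arm_self j (by rw [flip_re]; linarith), flip_re]
      ring
  · rintro ⟨i, j, hE, ho, he, hh⟩
    have hj : height j y.2.1 < M.len (x.1, i) := by
      rw [← M.len_opp _ hE, ho]
      refine y.2.2.2 j ?_
      rw [← ho]; exact M.isEdge_opp _ hE
    have hi := x.2.2.2 i hE
    obtain ⟨u, hu, hu'⟩ := eq_arm_of_height_pos x.2.2.1 (i := i) (by linarith)
    refine ⟨i, j, u, hE, ho, by linarith, by linarith, hu, ?_⟩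
    rw [← he, key _ i, hu]

theorem continuous_pt (v : W) : Continuous (M.pt v) :=
  continuous_quot_mk.comp continuous_sigmaMk

/-- The points of another piece that lie in the image of an open set form the preimage of this set
under a gluing map, which is defined on an open set. -/
theorem isOpenMap_pt (v : W) : IsOpenMap (M.pt v) := by
  intro U hU
  obtain ⟨O, hO, rfl⟩ := isOpen_induced_iff.mp hU
  change IsOpen (Quot.mk M.Rel ⁻¹' _)
  rw [isOpen_sigma_iff]
  intro v'
  have e : (Sigma.mk v' ⁻¹' (Quot.mk M.Rel ⁻¹' (M.pt v '' (Subtype.val ⁻¹' O)))) =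
      {p : M.Piece v' | v' = v ∧ p.1 ∈ O} ∪ ⋃ i : Fin 3, ⋃ j : Fin 3,
        {p : M.Piece v' | (M.IsEdge (v', i) ∧ M.opp (v', i) = (v, j)) ∧ 0 < height i p.1 ∧
          annulus j (cexpUnit (M.len (v', i) + Real.pi * Complex.I) * (coord i p.1)⁻¹) ∈ O} := by
    ext p
    simp only [mem_preimage, mem_union, mem_iUnion, mem_ofPred_eq]
    constructor
    · rintro ⟨q, hq, e⟩
      rcases pt_eq_iff_rel.mp e.symm with h | h
      · left
        obtain rfl : v' = v := congrArg Sigma.fst h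
        simp only [Sigma.mk.injEq, heq_eq_eq, true_and] at h
        exact ⟨rfl, h ▸ hq⟩
      · right
        have h' := h
        obtain ⟨i, j, u, -, ho2, h0, -, hx, -⟩ := h'
        obtain ⟨i', j', hE, ho, he, hh⟩ := rel_iff.mp h
        refine ⟨i', j', ⟨hE, ho⟩, ?_, by rw [he]; exact hq⟩
        have := q.2.2 j' (by rw [← ho]; exact M.isEdge_opp _ hE)
        rw [← ho, M.len_opp _ hE] at this
        simp only at hh
        linarith
    · rintro (⟨rfl, h⟩ | ⟨i, j, ⟨hE, ho⟩, h0, h⟩)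
      · exact ⟨p, h, rfl⟩
      · obtain ⟨u, hu, hu'⟩ := eq_arm_of_height_pos p.2.1 h0
        have h1 : u.re < M.len (v', i) := hu' ▸ p.2.2 i hE
        have hpt := pt_arm hE ho (hu' ▸ h0) h1
        refine ⟨_, ?_, hpt.symm.trans ?_⟩
        · rw [hu] at h
          rw [arm, coord_annulus, ← cexpUnit_neg, ← cexpUnit_add, ← sub_eq_add_neg] at h
          exact h
        · exact congrArg (M.pt v') (Subtype.ext hu.symm)
  refine e ▸ IsOpen.union ?_ (isOpen_iUnion fun i => isOpen_iUnion fun j => ?_)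
  · by_cases hv : v' = v
    · simp only [hv, true_and]; exact hO.preimage continuous_subtype_val
    · simp [hv]
  · by_cases hc : M.IsEdge (v', i) ∧ M.opp (v', i) = (v, j)
    · simp only [hc, and_self, true_and]
      refine (isOpen_lt continuous_const ((continuous_height i).comp continuous_subtype_val)).inter
        (hO.preimage ((continuous_annulus j).comp ?_))
      exact continuous_const.mul ((continuous_coord i).comp continuous_subtype_val).inv
    · simp [hc]

theorem isOpenEmbedding_pt (v : W) : IsOpenEmbedding (M.pt v) :=
  .of_continuous_injective_isOpenMap (continuous_pt v) (pt_injective v) (isOpenMap_pt v)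

theorem continuous_prod_iff {Z Z' : Type*} [TopologicalSpace Z] [TopologicalSpace Z']
    {f : Z' × M.Surface → Z} :
    Continuous f ↔ ∀ v, Continuous fun q : Z' × M.Piece v => f (q.1, M.pt v q.2) := by
  refine ⟨fun h v => h.comp (continuous_id.prodMap (continuous_pt v)), fun h => ?_⟩
  rw [continuous_iff_continuousAt]
  rintro ⟨z, x⟩
  obtain ⟨v, p, rfl⟩ := exists_pt x
  exact ((IsOpenEmbedding.id (X := Z')).prodMap (isOpenEmbedding_pt v)).continuousAt_iff
    (x := (z, p)) |>.mp (h v).continuousAt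

instance : T2Space M.Surface := by
  refine ⟨fun x y hxy => ?_⟩
  obtain ⟨v, p, rfl⟩ := exists_pt x
  obtain ⟨v', p', rfl⟩ := exists_pt y
  have hcl : IsClosed {q : M.Piece v × M.Piece v' | M.pt v q.1 = M.pt v' q.2} := by
    by_cases hv : v = v'
    · subst hv
      have : {q : M.Piece v × M.Piece v | M.pt v q.1 = M.pt v q.2} = diagonal _ := by
        ext q; simp [(pt_injective v).eq_iff]
      rw [this]; exact isClosed_diagonal
    · have : {q : M.Piece v × M.Piece v' | M.pt v q.1 = M.pt v' q.2} =
          ⋃ i : Fin 3, ⋃ j : Fin 3, {q | (M.IsEdge (v, i) ∧ M.opp (v, i) = (v', j)) ∧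
            annulus j (cexpUnit (M.len (v, i) + Real.pi * Complex.I) * (coord i q.1.1)⁻¹) = q.2.1 ∧
            height i q.1.1 + height j q.2.1 = M.len (v, i)} := by
        ext q
        simp only [mem_ofPred_eq, mem_iUnion, pt_eq_iff_rel, rel_iff, Sigma.mk.injEq, hv, false_and,
          false_or, and_assoc]
      rw [this]
      refine isClosed_iUnion_of_finite fun i => isClosed_iUnion_of_finite fun j => ?_
      by_cases hc : M.IsEdge (v, i) ∧ M.opp (v, i) = (v', j)
      · simp only [hc, and_self, true_and]
        have c1 : Continuous fun q : M.Piece v × M.Piece v' => q.1.1 :=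
          continuous_subtype_val.comp continuous_fst
        have c2 : Continuous fun q : M.Piece v × M.Piece v' => q.2.1 :=
          continuous_subtype_val.comp continuous_snd
        refine (isClosed_eq ((continuous_annulus j).comp ?_) c2).inter (isClosed_eq
          (((continuous_height i).comp c1).add ((continuous_height j).comp c2)) continuous_const)
        exact continuous_const.mul ((continuous_coord i).comp c1).inv
      · simp [hc]
  have hmem : {q : M.Piece v × M.Piece v' | M.pt v q.1 = M.pt v' q.2}ᶜ ∈ 𝓝 (p, p') :=
    hcl.isOpen_compl.mem_nhds hxy
  obtain ⟨U, U', hU, hpU, hU', hpU', hsub⟩ := mem_nhds_prod_iff'.mp hmem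
  refine ⟨_, _, isOpenMap_pt v U hU, isOpenMap_pt v' U' hU', mem_image_of_mem _ hpU,
    mem_image_of_mem _ hpU', ?_⟩
  rw [Set.disjoint_left]
  rintro _ ⟨q, hq, rfl⟩ ⟨q', hq', e⟩
  exact hsub (mk_mem_prod hq hq') e.symm

end Ribbon

/-! ### Cell structures of dimension two -/

/-- The inverse of a characteristic map is continuous on the open cell, by compactness of the
closed ball. -/
theorem continuousOn_symm_of_isCompact {X Y : Type*} [TopologicalSpace X] [TopologicalSpace Y]
    [T2Space Y] (e : PartialEquiv X Y) {K : Set X} (hK : IsCompact K)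
    (hc : ContinuousOn e K) (hsub : e.source ⊆ K)
    (hdisj : ∀ x ∈ K, e x ∈ e.target → x ∈ e.source) : ContinuousOn e.symm e.target := by
  rw [continuousOn_iff_isClosed]
  intro t ht
  refine ⟨e '' (K ∩ t), ((hK.inter_right ht).image_of_continuousOn
    (hc.mono inter_subset_left)).isClosed, ?_⟩
  ext y
  constructor
  · rintro ⟨h1, h2⟩
    exact ⟨⟨e.symm y, ⟨hsub (e.map_target h2), h1⟩, e.right_inv h2⟩, h2⟩
  · rintro ⟨⟨x, ⟨hxK, hxt⟩, rfl⟩, h2⟩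
    refine ⟨?_, h2⟩
    rw [mem_preimage, e.left_inv (hdisj x hxK h2)]
    exact hxt

/-- Index types for the cells of a complex of dimension two. -/
def CellIndex (A₀ A₁ A₂ : Type) : ℕ → Type
  | 0 => A₀
  | 1 => A₁
  | 2 => A₂
  | _ => Empty

/-- Characteristic maps on cubes of side length `2`, from maps on cubes of side length `1`. -/
def cellMap {Y A₀ A₁ A₂ : Type} (p₀ : A₀ → Y) (p₁ : A₁ → ℝ → Y) (p₂ : A₂ → ℝ × ℝ → Y) :
    (n : ℕ) → CellIndex A₀ A₁ A₂ n → (Fin n → ℝ) → Y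
  | 0, a, _ => p₀ a
  | 1, a, x => p₁ a ((x 0 + 1) / 2)
  | 2, a, x => p₂ a ((x 0 + 1) / 2, (x 1 + 1) / 2)
  | _ + 3, a, _ => Empty.elim a

theorem mem_ball_zero_one_iff {n : ℕ} {x : Fin n → ℝ} :
    x ∈ Metric.ball (0 : Fin n → ℝ) 1 ↔ ∀ i, (x i + 1) / 2 ∈ Ioo (0 : ℝ) 1 := by
  rw [mem_ball_zero_iff, pi_norm_lt_iff one_pos]
  refine forall_congr' fun i => ?_
  rw [Real.norm_eq_abs, abs_lt, mem_Ioo]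
  constructor <;> rintro ⟨h1, h2⟩ <;> constructor <;> linarith

theorem mem_closedBall_zero_one_iff {n : ℕ} {x : Fin n → ℝ} :
    x ∈ Metric.closedBall (0 : Fin n → ℝ) 1 ↔ ∀ i, (x i + 1) / 2 ∈ Icc (0 : ℝ) 1 := by
  rw [mem_closedBall_zero_iff, pi_norm_le_iff_of_nonneg zero_le_one]
  refine forall_congr' fun i => ?_
  rw [Real.norm_eq_abs, abs_le, mem_Icc]
  constructor <;> rintro ⟨h1, h2⟩ <;> constructor <;> linarith

/-- The cells of dimension at most two of a compact Hausdorff space: the open cells partition the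
space, and the boundary of each cell is covered by closed cells of lower dimension. The cells of
dimension one and two are parametrized by `[0, 1]` and `[0, 1] × [0, 1]`; the values of these maps
outside are irrelevant. -/
structure CellDecomposition (Y A₀ A₁ A₂ : Type) [TopologicalSpace Y] where
  p₀ : A₀ → Y
  p₁ : A₁ → ℝ → Y
  p₂ : A₂ → ℝ × ℝ → Y
  continuousOn₁ : ∀ a, ContinuousOn (p₁ a) (Icc 0 1)
  continuousOn₂ : ∀ a, ContinuousOn (p₂ a) (Icc 0 1 ×ˢ Icc 0 1)
  inj₀₀ : ∀ a b, p₀ a = p₀ b → a = b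
  inj₁₁ : ∀ a b, ∀ x ∈ Ioo (0 : ℝ) 1, ∀ y ∈ Ioo (0 : ℝ) 1, p₁ a x = p₁ b y → a = b ∧ x = y
  inj₂₂ : ∀ a b, ∀ x ∈ Ioo (0 : ℝ) 1 ×ˢ Ioo (0 : ℝ) 1, ∀ y ∈ Ioo (0 : ℝ) 1 ×ˢ Ioo (0 : ℝ) 1,
    p₂ a x = p₂ b y → a = b ∧ x = y
  ne₀₁ : ∀ a b, ∀ x ∈ Ioo (0 : ℝ) 1, p₀ a ≠ p₁ b x
  ne₀₂ : ∀ a b, ∀ x ∈ Ioo (0 : ℝ) 1 ×ˢ Ioo (0 : ℝ) 1, p₀ a ≠ p₂ b x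
  ne₁₂ : ∀ a b, ∀ x ∈ Ioo (0 : ℝ) 1, ∀ y ∈ Ioo (0 : ℝ) 1 ×ˢ Ioo (0 : ℝ) 1, p₁ a x ≠ p₂ b y
  boundary₁ : ∀ a, ∀ x ∈ Icc (0 : ℝ) 1, x ∉ Ioo (0 : ℝ) 1 → ∃ b, p₁ a x = p₀ b
  boundary₂ : ∀ a, ∀ x ∈ Icc (0 : ℝ) 1 ×ˢ Icc (0 : ℝ) 1, x ∉ Ioo (0 : ℝ) 1 ×ˢ Ioo (0 : ℝ) 1 →
    ∃ b, ∃ y ∈ Icc (0 : ℝ) 1, p₂ a x = p₁ b y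
  cover : ∀ y, (∃ a, y = p₀ a) ∨ (∃ a, ∃ x ∈ Icc (0 : ℝ) 1, y = p₁ a x) ∨
    ∃ a, ∃ x ∈ Icc (0 : ℝ) 1 ×ˢ Icc (0 : ℝ) 1, y = p₂ a x

namespace CellDecomposition

variable {Y A₀ A₁ A₂ : Type} [TopologicalSpace Y] (D : CellDecomposition Y A₀ A₁ A₂)

/-- The open cells are disjoint, and the characteristic maps are injective on them. -/
theorem cellMap_eq {m n : ℕ} (a : CellIndex A₀ A₁ A₂ m) (b : CellIndex A₀ A₁ A₂ n)
    {x : Fin m → ℝ} {y : Fin n → ℝ} (hx : x ∈ Metric.ball 0 1) (hy : y ∈ Metric.ball 0 1)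
    (h : cellMap D.p₀ D.p₁ D.p₂ m a x = cellMap D.p₀ D.p₁ D.p₂ n b y) :
    (⟨m, a, x⟩ : Σ n, CellIndex A₀ A₁ A₂ n × (Fin n → ℝ)) = ⟨n, b, y⟩ := by
  rw [mem_ball_zero_one_iff] at hx hy
  match m, n with
  | 0, 0 =>
    obtain rfl := D.inj₀₀ a b h
    rw [Subsingleton.elim x y]
  | 0, 1 => exact absurd h (D.ne₀₁ a b _ (hy 0))
  | 0, 2 => exact absurd h (D.ne₀₂ a b _ ⟨hy 0, hy 1⟩)
  | 1, 0 => exact absurd h.symm (D.ne₀₁ b a _ (hx 0))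
  | 1, 1 =>
    obtain ⟨rfl, h⟩ := D.inj₁₁ a b _ (hx 0) _ (hy 0) h
    have : x = y := by ext i; fin_cases i; simp; linarith
    rw [this]
  | 1, 2 => exact absurd h (D.ne₁₂ a b _ (hx 0) _ ⟨hy 0, hy 1⟩)
  | 2, 0 => exact absurd h.symm (D.ne₀₂ b a _ ⟨hx 0, hx 1⟩)
  | 2, 1 => exact absurd h.symm (D.ne₁₂ b a _ (hy 0) _ ⟨hx 0, hx 1⟩)
  | 2, 2 =>
    obtain ⟨rfl, h'⟩ := D.inj₂₂ a b _ ⟨hx 0, hx 1⟩ _ ⟨hy 0, hy 1⟩ h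
    rw [Prod.mk.injEq] at h'
    have : x = y := by ext i; fin_cases i <;> simp <;> linarith
    rw [this]
  | _ + 3, _ => exact Empty.elim a
  | _, _ + 3 => exact Empty.elim b

theorem continuousOn_cellMap (n : ℕ) (a : CellIndex A₀ A₁ A₂ n) :
    ContinuousOn (cellMap D.p₀ D.p₁ D.p₂ n a) (Metric.closedBall 0 1) := by
  match n with
  | 0 => exact continuousOn_const
  | 1 =>
    refine (D.continuousOn₁ a).comp (f := fun x : Fin 1 → ℝ => (x 0 + 1) / 2)
      (by fun_prop) fun x hx => ?_
    rw [mem_closedBall_zero_one_iff] at hx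
    exact hx 0
  | 2 =>
    refine (D.continuousOn₂ a).comp (f := fun x : Fin 2 → ℝ => ((x 0 + 1) / 2, (x 1 + 1) / 2))
      (by fun_prop) fun x hx => ?_
    rw [mem_closedBall_zero_one_iff] at hx
    exact ⟨hx 0, hx 1⟩
  | _ + 3 => exact Empty.elim a

theorem exists_cellMap₀ (a : A₀) : ∃ x ∈ Metric.closedBall (0 : Fin 0 → ℝ) 1,
    cellMap D.p₀ D.p₁ D.p₂ 0 a x = D.p₀ a := ⟨0, by simp, rfl⟩

theorem exists_cellMap₁ (a : A₁) {y : ℝ} (hy : y ∈ Icc (0 : ℝ) 1) :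
    ∃ x ∈ Metric.closedBall (0 : Fin 1 → ℝ) 1, cellMap D.p₀ D.p₁ D.p₂ 1 a x = D.p₁ a y := by
  refine ⟨fun _ => 2 * y - 1, ?_, ?_⟩
  · rw [mem_closedBall_zero_one_iff]
    intro i; convert hy using 1; ring
  · simp [cellMap]

theorem exists_cellMap₂ (a : A₂) {y : ℝ × ℝ} (hy : y ∈ Icc (0 : ℝ) 1 ×ˢ Icc (0 : ℝ) 1) :
    ∃ x ∈ Metric.closedBall (0 : Fin 2 → ℝ) 1, cellMap D.p₀ D.p₁ D.p₂ 2 a x = D.p₂ a y := by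
  refine ⟨![2 * y.1 - 1, 2 * y.2 - 1], ?_, ?_⟩
  · rw [mem_closedBall_zero_one_iff]
    intro i
    fin_cases i
    · convert hy.1 using 1; simp
    · convert hy.2 using 1; simp
  · simp [cellMap]

/-- The boundary of a cell is covered by closed cells of lower dimension. -/
theorem exists_lower (n : ℕ) (a : CellIndex A₀ A₁ A₂ n) {x : Fin n → ℝ}
    (hx : x ∈ Metric.sphere 0 1) : ∃ m < n, ∃ b : CellIndex A₀ A₁ A₂ m,
      ∃ y ∈ Metric.closedBall (0 : Fin m → ℝ) 1,
        cellMap D.p₀ D.p₁ D.p₂ m b y = cellMap D.p₀ D.p₁ D.p₂ n a x := by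
  have h1 := Metric.sphere_subset_closedBall hx
  have h2 : x ∉ Metric.ball (0 : Fin n → ℝ) 1 := fun h =>
    (Metric.sphere_disjoint_ball (x := (0 : Fin n → ℝ)) (ε := 1)).le_bot ⟨hx, h⟩
  rw [mem_closedBall_zero_one_iff] at h1
  rw [mem_ball_zero_one_iff] at h2
  match n with
  | 0 => exact absurd (fun i : Fin 0 => i.elim0) h2
  | 1 =>
    obtain ⟨b, hb⟩ := D.boundary₁ a _ (h1 0) fun h => h2 fun i => by
      rw [Subsingleton.elim i 0]; exact h
    obtain ⟨y, hy, e⟩ := D.exists_cellMap₀ b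
    exact ⟨0, one_pos, b, y, hy, e.trans hb.symm⟩
  | 2 =>
    obtain ⟨b, y, hy, hb⟩ := D.boundary₂ a ((x 0 + 1) / 2, (x 1 + 1) / 2) ⟨h1 0, h1 1⟩
      fun h => h2 fun i => by
        fin_cases i
        · exact h.1
        · exact h.2
    obtain ⟨z, hz, e⟩ := D.exists_cellMap₁ b hy
    exact ⟨1, one_lt_two, b, z, hz, e.trans hb.symm⟩
  | _ + 3 => exact Empty.elim a

/-- A space with a finite cell decomposition of dimension two is a finite CW complex, so its Euler
characteristic is the alternating sum of the numbers of cells. -/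
theorem hasEulerCharacteristic (D : CellDecomposition Y A₀ A₁ A₂) [T2Space Y]
    [Finite A₀] [Finite A₁] [Finite A₂] {X : Type}
    [TopologicalSpace X] (e : ContinuousMap.HomotopyEquiv X Y) :
    HasEulerCharacteristic X (Nat.card A₀ - Nat.card A₁ + Nat.card A₂) := by
  let F := cellMap D.p₀ D.p₁ D.p₂
  have hinj : ∀ n a, InjOn (F n a) (Metric.ball 0 1) := by
    intro n a x hx y hy h
    have := D.cellMap_eq a a hx hy h
    simpa using this
  let map : (n : ℕ) → (a : CellIndex A₀ A₁ A₂ n) → PartialEquiv (Fin n → ℝ) Y := fun n a =>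
    (hinj n a).toPartialEquiv (F n a) (Metric.ball 0 1)
  have hF : ∀ n a, (map n a : (Fin n → ℝ) → Y) = F n a := fun n a => rfl
  have hfin : ∀ n, Finite (CellIndex A₀ A₁ A₂ n) := fun n => match n with
    | 0 => ‹Finite A₀›
    | 1 => ‹Finite A₁›
    | 2 => ‹Finite A₂›
    | _ + 3 => inferInstanceAs (Finite Empty)
  have hev : ∀ᶠ n in Filter.atTop, IsEmpty (CellIndex A₀ A₁ A₂ n) := by
    filter_upwards [eventually_ge_atTop 3] with n hn
    obtain ⟨k, rfl⟩ := Nat.exists_eq_add_of_le' hn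
    exact inferInstanceAs (IsEmpty Empty)
  have hcont : ∀ n a, ContinuousOn (map n a) (Metric.closedBall 0 1) := D.continuousOn_cellMap
  have hlow : ∀ n a, MapsTo (map n a) (Metric.sphere 0 1)
      (⋃ (m < n) (j : CellIndex A₀ A₁ A₂ m), map m j '' Metric.closedBall 0 1) := by
    intro n a x hx
    obtain ⟨m, hm, b, y, hy, e⟩ := D.exists_lower n a hx
    simp only [mem_iUnion]
    exact ⟨m, hm, b, y, hy, e⟩
  -- every point of a closed cell is in an open cell of the same or of a smaller dimension
  have hopen : ∀ n, ∀ (a : CellIndex A₀ A₁ A₂ n), ∀ x ∈ Metric.closedBall (0 : Fin n → ℝ) 1,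
      x ∉ Metric.ball (0 : Fin n → ℝ) 1 → ∃ m < n, ∃ b : CellIndex A₀ A₁ A₂ m,
        ∃ y ∈ Metric.ball (0 : Fin m → ℝ) 1, F m b y = F n a x := by
    intro n
    induction n using Nat.strong_induction_on with
    | _ n ih =>
      intro a x hx hx'
      have hs : x ∈ Metric.sphere (0 : Fin n → ℝ) 1 := by
        rw [← Metric.closedBall_sdiff_ball]; exact ⟨hx, hx'⟩
      obtain ⟨m, hm, b, y, hy, e⟩ := D.exists_lower n a hs
      by_cases hy' : y ∈ Metric.ball (0 : Fin m → ℝ) 1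
      · exact ⟨m, hm, b, y, hy', e⟩
      · obtain ⟨k, hk, c, z, hz, e'⟩ := ih m hm b y hy hy'
        exact ⟨k, hk.trans hm, c, z, hz, e'.trans e⟩
  -- so the boundary does not meet the open cell
  have hsymm : ∀ n a, ContinuousOn (map n a).symm (map n a).target := by
    intro n a
    refine continuousOn_symm_of_isCompact _ (isCompact_closedBall 0 1) (hcont n a)
      Metric.ball_subset_closedBall ?_
    rintro x hx ⟨y, hy, h⟩
    by_contra hx'
    obtain ⟨m, hm, b, z, hz, e⟩ := hopen n a x hx hx'
    have := D.cellMap_eq b a hz hy (e.trans h.symm)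
    exact hm.ne (congrArg Sigma.fst this)
  have hdisj : (univ : Set (Σ n, CellIndex A₀ A₁ A₂ n)).PairwiseDisjoint
      (fun ni => map ni.1 ni.2 '' Metric.ball 0 1) := by
    rintro ⟨m, a⟩ - ⟨n, b⟩ - hne
    rw [Function.onFun, Set.disjoint_left]
    rintro _ ⟨x, hx, rfl⟩ ⟨y, hy, h⟩
    apply hne
    have := D.cellMap_eq b a hy hx h
    obtain ⟨rfl, h'⟩ := Sigma.mk.inj_iff.mp this
    have h'' := eq_of_heq h'
    rw [Prod.mk.injEq] at h''
    rw [h''.1]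
  have hcover : ⋃ (n : ℕ) (j : CellIndex A₀ A₁ A₂ n), map n j '' Metric.closedBall 0 1 = univ := by
    rw [eq_univ_iff_forall]
    intro y
    simp only [mem_iUnion]
    rcases D.cover y with ⟨a, rfl⟩ | ⟨a, x, hx, rfl⟩ | ⟨a, x, hx, rfl⟩
    · exact ⟨0, a, D.exists_cellMap₀ a⟩
    · exact ⟨1, a, D.exists_cellMap₁ a hx⟩
    · exact ⟨2, a, D.exists_cellMap₂ a hx⟩
  refine ⟨Y, inferInstance, inferInstance, Topology.CWComplex.mkFinite univ (CellIndex A₀ A₁ A₂) map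
    hev hfin (fun n a => rfl) hcont hsymm hdisj hlow hcover,
    Topology.CWComplex.finite_mkFinite _ _ _ _ _ _ _ _ _ _ _, ⟨e⟩, ?_⟩
  change _ = ∑ᶠ n : ℕ, (-1) ^ n * (Nat.card (CellIndex A₀ A₁ A₂ n) : ℤ)
  rw [finsum_eq_sum_of_support_subset (s := {0, 1, 2})]
  · simp [CellIndex]; ring
  · intro n hn
    match n with
    | 0 => simp
    | 1 => simp
    | 2 => simp
    | k + 3 => simp [CellIndex] at hn

end CellDecomposition

/-! ### The core of a glued surface -/

/-- Logarithms in the principal strip are determined by the exponential. -/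
theorem eq_of_exp_eq {u v : ℂ} (hu : u.im ∈ Ioc (-Real.pi) Real.pi)
    (hv : v.im ∈ Ioc (-Real.pi) Real.pi) (h : Complex.exp u = Complex.exp v) : u = v := by
  rw [← Complex.log_exp hu.1 hu.2, ← Complex.log_exp hv.1 hv.2, h]

theorem sin_im_eq_of_exp_eq {u v : ℂ} (h : Complex.exp u = Complex.exp v) :
    u.re = v.re ∧ Real.sin u.im = Real.sin v.im := by
  have h1 : u.re = v.re := by simpa [Complex.norm_exp] using congrArg norm h
  refine ⟨h1, ?_⟩
  have h2 := congrArg Complex.im h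
  rw [Complex.exp_im, Complex.exp_im, h1] at h2
  exact mul_left_cancel₀ (Real.exp_ne_zero _) h2

theorem exists_im_mem_Ioc (u : ℂ) : ∃ u' : ℂ, Complex.exp u' = Complex.exp u ∧ u'.re = u.re ∧
    u'.im ∈ Ioc (-Real.pi) Real.pi := by
  refine ⟨Complex.log (Complex.exp u), Complex.exp_log (Complex.exp_ne_zero u), ?_,
    Complex.neg_pi_lt_log_im _, Complex.log_im_le_pi _⟩
  rw [Complex.log_re, Complex.norm_exp, Real.log_exp]

namespace Ribbon

variable {W : Type} (M : Ribbon W)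

/-- The point of the surface given by a point of a piece; it is a junk value outside of the
piece. -/
def ptOf (v : W) (p : Torus) : M.Surface :=
  open Classical in
  if h : p ∈ M.pieceSet v then M.pt v ⟨p, h⟩
  else M.pt v ⟨arm 0 0, arm_mem_pieceSet le_rfl (M.len_pos _)⟩

variable {M}

theorem ptOf_eq {v : W} {p : Torus} (h : p ∈ M.pieceSet v) : M.ptOf v p = M.pt v ⟨p, h⟩ :=
  dif_pos h

theorem continuousOn_ptOf (v : W) : ContinuousOn (M.ptOf v) (M.pieceSet v) := by
  rw [continuousOn_iff_continuous_domRestrict]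
  convert continuous_pt (M := M) v using 1
  ext p
  exact ptOf_eq p.2

theorem arm_mem_pieceSet' {v : W} {i : Fin 3} {u : ℂ} (h0 : u.re = 0) :
    arm i u ∈ M.pieceSet v :=
  arm_mem_pieceSet h0.ge fun h => by rw [h0]; exact M.len_pos _ h

theorem triangle_mem_pieceSet {v : W} {x y : ℝ} (hx : x ∈ Icc (-Real.pi) Real.pi)
    (hy : y ∈ Icc (0 : ℝ) 1) : triangle x y ∈ M.pieceSet v :=
  ⟨triangle_mem_phaseTropicalLine hx hy, fun i hi => by
    rw [height_triangle]; exact M.len_pos _ hi⟩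

/-- A point over a vertex has only one representative. -/
theorem eq_of_ptOf_eq {v v' : W} {p p' : Torus} (hp : p ∈ M.pieceSet v) (hp' : p' ∈ M.pieceSet v')
    (h0 : ∀ i, height i p = 0) (h : M.ptOf v p = M.ptOf v' p') : v = v' ∧ p = p' := by
  rw [ptOf_eq hp, ptOf_eq hp', pt_eq_iff_rel] at h
  rcases h with h | ⟨i, j, u, hE, ho, hu0, hu1, hx, hy⟩
  · rw [Sigma.mk.injEq] at h
    obtain ⟨rfl, h⟩ := h
    exact ⟨rfl, congrArg Subtype.val (eq_of_heq h)⟩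
  · have := h0 i
    simp only at hx
    rw [hx, height_arm_self i hu0.le] at this
    exact absurd this hu0.ne'

variable (M) in
/-- The closed annulus over an edge, in logarithmic coordinates of the half-edge `h`. Its far end
belongs to the piece of the other vertex. -/
def edgePt (h : W × Fin 3) (u : ℂ) : M.Surface :=
  if u.re < M.len h then M.ptOf h.1 (arm h.2 u)
  else M.ptOf (M.opp h).1 (arm (M.opp h).2 (M.flip h u))

theorem edgePt_of_lt {h : W × Fin 3} {u : ℂ} (hu : u.re < M.len h) :
    M.edgePt h u = M.ptOf h.1 (arm h.2 u) := if_pos hu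

theorem edgePt_of_pos {h : W × Fin 3} (hE : M.IsEdge h) {u : ℂ} (h0 : 0 < u.re)
    (h1 : u.re ≤ M.len h) : M.edgePt h u = M.ptOf (M.opp h).1 (arm (M.opp h).2 (M.flip h u)) := by
  by_cases hlt : u.re < M.len h
  · rw [edgePt_of_lt hlt, ptOf_eq (arm_mem_pieceSet h0.le fun _ => hlt),
      ptOf_eq (arm_mem_pieceSet (by simpa using h1) fun _ => by
        rw [Prod.mk.eta, M.len_opp h hE, flip_re]; linarith)]
    exact pt_arm (v := h.1) (i := h.2) hE rfl h0 hlt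
  · exact if_neg hlt

/-- The closed annulus over an edge, seen from its other end. -/
theorem edgePt_opp {h : W × Fin 3} (hE : M.IsEdge h) {u : ℂ} (h0 : 0 ≤ u.re)
    (h1 : u.re ≤ M.len h) : M.edgePt (M.opp h) (M.flip h u) = M.edgePt h u := by
  rcases h0.eq_or_lt with h0 | h0
  · rw [edgePt_of_pos (M.isEdge_opp h hE) (by rw [flip_re, ← h0, sub_zero]; exact M.len_pos h hE)
      (by rw [M.len_opp h hE, flip_re]; linarith), M.opp_opp h hE, flip_flip (M.len_opp h hE),
      edgePt_of_lt (by rw [← h0]; exact M.len_pos h hE)]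
  · rw [edgePt_of_pos hE h0 h1, edgePt_of_lt (by rw [M.len_opp h hE, flip_re]; linarith)]

theorem edgePt_congr {h : W × Fin 3} {u u' : ℂ} (e : Complex.exp u = Complex.exp u') :
    M.edgePt h u = M.edgePt h u' := by
  rw [edgePt, edgePt, arm_flip_eq h _ e, arm_eq_iff.mpr e, (sin_im_eq_of_exp_eq e).1]

theorem continuousOn_edgePt {h : W × Fin 3} (hE : M.IsEdge h) :
    ContinuousOn (M.edgePt h) {u | 0 ≤ u.re ∧ u.re ≤ M.len h} := by
  have c1 : ContinuousOn (fun u => M.ptOf h.1 (arm h.2 u)) {u | 0 ≤ u.re ∧ u.re < M.len h} :=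
    (continuousOn_ptOf h.1).comp (continuous_arm h.2).continuousOn fun u hu =>
      arm_mem_pieceSet hu.1 fun _ => hu.2
  have c2 : ContinuousOn (fun u => M.ptOf (M.opp h).1 (arm (M.opp h).2 (M.flip h u)))
      {u | 0 < u.re ∧ u.re ≤ M.len h} := by
    have cf : Continuous (M.flip h) := by unfold flip; fun_prop
    refine (continuousOn_ptOf _).comp ((continuous_arm _).comp cf).continuousOn fun u hu =>
      arm_mem_pieceSet (by rw [flip_re]; linarith [hu.2]) fun _ => by
        rw [Prod.mk.eta, M.len_opp h hE, flip_re]; linarith [hu.1]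
  intro u hu
  rcases hu.2.lt_or_eq with hlt | heq
  · have ho : {u : ℂ | u.re < M.len h} ∈ 𝓝 u :=
      (isOpen_lt Complex.continuous_re continuous_const).mem_nhds hlt
    refine ContinuousWithinAt.congr_of_eventuallyEq (f := fun u => M.ptOf h.1 (arm h.2 u)) ?_ ?_ ?_
    · refine (c1 u ⟨hu.1, hlt⟩).mono_of_mem_nhdsWithin ?_
      filter_upwards [self_mem_nhdsWithin, mem_nhdsWithin_of_mem_nhds ho] with x hx hx'
      exact ⟨hx.1, hx'⟩
    · filter_upwards [mem_nhdsWithin_of_mem_nhds ho] with x hx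
      exact edgePt_of_lt hx
    · exact edgePt_of_lt hlt
  · have hpos : 0 < u.re := heq ▸ M.len_pos h hE
    have ho : {u : ℂ | 0 < u.re} ∈ 𝓝 u :=
      (isOpen_lt continuous_const Complex.continuous_re).mem_nhds hpos
    refine ContinuousWithinAt.congr_of_eventuallyEq
      (f := fun u => M.ptOf (M.opp h).1 (arm (M.opp h).2 (M.flip h u))) ?_ ?_ ?_
    · refine (c2 u ⟨hpos, hu.2⟩).mono_of_mem_nhdsWithin ?_
      filter_upwards [self_mem_nhdsWithin, mem_nhdsWithin_of_mem_nhds ho] with x hx hx'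
      exact ⟨hx', hx.2⟩
    · filter_upwards [self_mem_nhdsWithin, mem_nhdsWithin_of_mem_nhds ho] with x hx hx'
      exact edgePt_of_pos hE hx' hx.2
    · exact edgePt_of_pos hE hpos hu.2

theorem eq_of_edgePt_eq {h h' : W × Fin 3} {u u' : ℂ}
    (hu : u.re ∈ Ioo 0 (M.len h)) (hu' : u'.re ∈ Ioo 0 (M.len h'))
    (e : M.edgePt h u = M.edgePt h' u') : (h = h' ∧ Complex.exp u = Complex.exp u') ∨
      (h' = M.opp h ∧ Complex.exp u' = Complex.exp (M.flip h u)) := by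
  rw [edgePt_of_lt hu.2, edgePt_of_lt hu'.2, ptOf_eq (arm_mem_pieceSet hu.1.le fun _ => hu.2),
    ptOf_eq (arm_mem_pieceSet hu'.1.le fun _ => hu'.2), pt_eq_iff_rel] at e
  obtain ⟨v, i⟩ := h
  obtain ⟨v', i'⟩ := h'
  rcases e with e | ⟨i₁, j, w, hE₁, ho, h0, h1, hx, hy⟩
  · left
    rw [Sigma.mk.injEq] at e
    obtain ⟨rfl, e⟩ := e
    obtain ⟨h1, h2⟩ := eq_of_arm_eq hu.1 hu'.1.le (congrArg Subtype.val (eq_of_heq e))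
    exact ⟨by rw [h1], h2⟩
  · right
    simp only at hx hy hE₁ ho h1
    obtain ⟨rfl, e1⟩ := eq_of_arm_eq hu.1 h0.le hx
    have h3 : 0 ≤ (M.flip (v, i) w).re := by rw [flip_re]; linarith
    obtain ⟨rfl, e2⟩ := eq_of_arm_eq hu'.1 h3 hy
    refine ⟨ho.symm, ?_⟩
    rw [e2, flip, flip, Complex.exp_sub, Complex.exp_sub, e1]

/-- Points over an edge are not over a vertex. -/
theorem ptOf_ne_edgePt {v : W} {p : Torus} {h : W × Fin 3} {u : ℂ} (hp : p ∈ M.pieceSet v)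
    (h0 : ∀ i, height i p = 0) (hu : u.re ∈ Ioo 0 (M.len h)) : M.ptOf v p ≠ M.edgePt h u := by
  intro e
  rw [edgePt_of_lt hu.2] at e
  obtain ⟨-, rfl⟩ := eq_of_ptOf_eq hp (arm_mem_pieceSet hu.1.le fun _ => hu.2) h0 e
  have := h0 h.2
  rw [height_arm_self _ hu.1.le] at this
  exact hu.1.ne' this

variable (M) in
/-- The core of the surface: the complement of the leaves. -/
def core : Set M.Surface :=
  {x | ∃ v p, x = M.pt v p ∧ ∀ i, ¬ M.IsEdge (v, i) → height i p.1 = 0}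

theorem ptOf_mem_core {v : W} {p : Torus} (hp : p ∈ M.pieceSet v) (h0 : ∀ i, height i p = 0) :
    M.ptOf v p ∈ M.core := ⟨v, ⟨p, hp⟩, ptOf_eq hp, fun i _ => h0 i⟩

theorem edgePt_mem_core {h : W × Fin 3} (hE : M.IsEdge h) {u : ℂ} (h0 : 0 ≤ u.re)
    (h1 : u.re ≤ M.len h) : M.edgePt h u ∈ M.core := by
  have key : ∀ h, M.IsEdge h → ∀ u : ℂ, 0 ≤ u.re → u.re < M.len h →
      M.ptOf h.1 (arm h.2 u) ∈ M.core := by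
    intro h hE u h0 h1
    refine ⟨h.1, _, ptOf_eq (arm_mem_pieceSet h0 fun _ => h1), fun i hi => ?_⟩
    rw [height_arm _ _ h0, if_neg]
    rintro rfl
    exact hi hE
  rcases h1.lt_or_eq with h1 | h1
  · rw [edgePt_of_lt h1]; exact key h hE u h0 h1
  · rw [edgePt_of_pos hE (h1 ▸ M.len_pos h hE) h1.le]
    refine key _ (M.isEdge_opp h hE) _ (by rw [flip_re]; linarith) ?_
    rw [flip_re, M.len_opp h hE, h1]
    linarith [M.len_pos h hE]

variable (M) in
/-- The sum of the heights over the leaves at `v`, as a vector. -/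
def leafVector (v : W) (p : Torus) : ℝ × ℝ :=
  open Classical in
  ∑ i, if M.IsEdge (v, i) then 0 else height i p • toReal (ray i)

theorem continuous_leafVector (v : W) : Continuous (M.leafVector v) := by
  unfold leafVector
  refine continuous_finsetSum _ fun i _ => ?_
  split_ifs
  · exact continuous_const
  · exact (continuous_height i).smul continuous_const

variable (M) in
/-- Multiplication by the positive vector that shortens the leaves at `v` by the factor `1 - t`. -/
def shrinkTorus (v : W) (t : ℝ) (p : Torus) : Torus :=
  (cexpUnit (-(t * (M.leafVector v p).1 : ℝ)) * p.1,
    cexpUnit (-(t * (M.leafVector v p).2 : ℝ)) * p.2)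

theorem shrinkTorus_of_height_eq_zero {v : W} {t : ℝ} {p : Torus}
    (h : ∀ i, ¬ M.IsEdge (v, i) → height i p = 0) : M.shrinkTorus v t p = p := by
  have h0 : M.leafVector v p = 0 := by
    unfold leafVector
    refine Finset.sum_eq_zero fun i _ => ?_
    split_ifs with hE
    · rfl
    · rw [h i hE, zero_smul]
  refine Prod.ext ?_ ?_ <;> ext <;> simp [shrinkTorus, h0]

theorem shrinkTorus_arm {v : W} {t : ℝ} {i : Fin 3} {u : ℂ} (hE : ¬ M.IsEdge (v, i))
    (hu : 0 ≤ u.re) : M.shrinkTorus v t (arm i u) = arm i (u - t * u.re) := by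
  have h0 : M.leafVector v (arm i u) = u.re • toReal (ray i) := by
    unfold leafVector
    rw [Finset.sum_eq_single i]
    · rw [if_neg hE, height_arm_self i hu]
    · intro j _ hj
      rw [height_arm _ _ hu, if_neg hj.symm]; simp
    · simp
  ext <;> rw [shrinkTorus, h0] <;> fin_cases i <;>
    simp [arm, annulus, ray, toReal, Complex.exp_sub, Complex.exp_neg, div_eq_mul_inv] <;> ring

theorem shrinkTorus_mem {v : W} {t : ℝ} (ht : t ∈ Icc (0 : ℝ) 1) {p : Torus}
    (hp : p ∈ M.pieceSet v) : M.shrinkTorus v t p ∈ M.pieceSet v := by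
  by_cases h : ∃ i, ¬ M.IsEdge (v, i) ∧ 0 < height i p
  · obtain ⟨i, hE, hi⟩ := h
    obtain ⟨u, rfl, hu⟩ := eq_arm_of_height_pos hp.1 hi
    rw [shrinkTorus_arm hE (hu ▸ hi.le)]
    refine arm_mem_pieceSet ?_ fun h => absurd h hE
    simp
    rw [hu]
    nlinarith [ht.2]
  · push Not at h
    rw [shrinkTorus_of_height_eq_zero fun i hE => le_antisymm (h i hE) (height_nonneg i p)]
    exact hp

variable (M) in
/-- The deformation that shortens the leaves by the factor `1 - t`. It does not move the points over
the edges, so it is compatible with the gluing. -/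
def shrink (t : unitInterval) : M.Surface → M.Surface :=
  Quot.lift (fun x => M.pt x.1 ⟨M.shrinkTorus x.1 t x.2.1, shrinkTorus_mem t.2 x.2.2⟩) (by
    -- the points over edges do not move
    have key : ∀ x y, M.Rel x y → M.shrinkTorus x.1 t x.2.1 = x.2.1 := by
      rintro x y ⟨i, j, u, hE, ho, h0, h1, hx, hy⟩
      refine shrinkTorus_of_height_eq_zero fun k hk => ?_
      rw [hx, height_arm _ _ h0.le, if_neg]
      rintro rfl
      exact hk hE
    intro x y h
    simp only [key x y h, key y x h.symm]
    exact Quot.sound h)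

theorem shrink_pt (t : unitInterval) (v : W) (p : M.Piece v) : M.shrink t (M.pt v p) =
    M.pt v ⟨M.shrinkTorus v t p.1, shrinkTorus_mem t.2 p.2⟩ := rfl

theorem continuous_shrink : Continuous fun q : unitInterval × M.Surface => M.shrink q.1 q.2 := by
  rw [continuous_prod_iff]
  intro v
  simp only [shrink_pt]
  refine (continuous_pt v).comp (Continuous.subtype_mk ?_ _)
  have c0 : Continuous fun q : unitInterval × M.Piece v => (q.1 : ℝ) :=
    continuous_subtype_val.comp continuous_fst
  have c1 : Continuous fun q : unitInterval × M.Piece v => q.2.1 :=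
    continuous_subtype_val.comp continuous_snd
  have c2 := (continuous_leafVector (M := M) v).comp c1
  have e1 : Continuous fun q : unitInterval × M.Piece v =>
      cexpUnit (-(q.1 * (M.leafVector v q.2.1).1 : ℝ)) :=
    continuous_cexpUnit.comp (Complex.continuous_ofReal.comp (c0.mul c2.fst)).neg
  have e2 : Continuous fun q : unitInterval × M.Piece v =>
      cexpUnit (-(q.1 * (M.leafVector v q.2.1).2 : ℝ)) :=
    continuous_cexpUnit.comp (Complex.continuous_ofReal.comp (c0.mul c2.snd)).neg
  exact (e1.mul c1.fst).prodMk (e2.mul c1.snd)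

theorem shrink_zero (x : M.Surface) : M.shrink 0 x = x := by
  obtain ⟨v, p, rfl⟩ := exists_pt x
  rw [shrink_pt]
  congr 1
  apply Subtype.ext
  refine Prod.ext ?_ ?_ <;> ext <;> simp [shrinkTorus]

theorem shrink_one_mem_core (x : M.Surface) : M.shrink 1 x ∈ M.core := by
  obtain ⟨v, p, rfl⟩ := exists_pt x
  refine ⟨v, _, shrink_pt 1 v p, fun i hE => ?_⟩
  by_cases h : ∃ i, ¬ M.IsEdge (v, i) ∧ 0 < height i p.1
  · obtain ⟨k, hE', hk⟩ := h
    obtain ⟨u, hu, hu'⟩ := eq_arm_of_height_pos p.2.1 hk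
    have hu0 : 0 ≤ u.re := hu' ▸ hk.le
    have : (0 : ℝ) ≤ (u - ((1 : unitInterval) : ℝ) * u.re : ℂ).re := by simp
    change height i (M.shrinkTorus v (1 : unitInterval) p.1) = 0
    rw [hu, shrinkTorus_arm hE' hu0, height_arm _ _ this]
    simp
  · push Not at h
    have h' : ∀ i, ¬ M.IsEdge (v, i) → height i p.1 = 0 := fun i hE =>
      le_antisymm (h i hE) (height_nonneg i p.1)
    change height i (M.shrinkTorus v (1 : unitInterval) p.1) = 0
    rw [shrinkTorus_of_height_eq_zero h', h' i hE]

theorem shrink_of_mem_core {x : M.Surface} (hx : x ∈ M.core) (t : unitInterval) :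
    M.shrink t x = x := by
  obtain ⟨v, p, rfl, hp⟩ := hx
  rw [shrink_pt]
  congr 1
  exact Subtype.ext (shrinkTorus_of_height_eq_zero hp)

variable (M) in
/-- The core is a deformation retract. -/
def coreHomotopyEquiv : ContinuousMap.HomotopyEquiv M.Surface M.core where
  toFun := ⟨fun x => ⟨M.shrink 1 x, shrink_one_mem_core x⟩,
    (continuous_shrink.comp (continuous_const.prodMk continuous_id)).subtype_mk _⟩
  invFun := ⟨Subtype.val, continuous_subtype_val⟩
  left_inv := by
    refine ContinuousMap.Homotopic.symm ⟨⟨⟨fun q => M.shrink q.1 q.2, continuous_shrink⟩, ?_, ?_⟩⟩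
    · intro x; exact shrink_zero x
    · intro x; rfl
  right_inv := by
    have : (⟨fun x => ⟨M.shrink 1 x, shrink_one_mem_core x⟩,
      (continuous_shrink.comp (continuous_const.prodMk continuous_id)).subtype_mk _⟩ :
        C(M.Surface, M.core)).comp ⟨Subtype.val, continuous_subtype_val⟩ =
        ContinuousMap.id M.core := by
      ext x
      exact shrink_of_mem_core x.2 1
    rw [this]

end Ribbon

/-! ### Cells of the core -/

/-- The sign given by a boolean. -/
def boolSign (s : Bool) : ℝ := if s then 1 else -1

theorem boolSign_sq (s : Bool) : boolSign s * boolSign s = 1 := by cases s <;> simp [boolSign]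

@[simp] theorem boolSign_not (s : Bool) : boolSign (!s) = -boolSign s := by
  cases s <;> simp [boolSign]

theorem boolSign_mul_mem_Icc (s : Bool) {x : ℝ} (hx : x ∈ Icc (0 : ℝ) 1) :
    boolSign s * Real.pi * x ∈ Icc (-Real.pi) Real.pi := by
  have h1 : 0 ≤ Real.pi * x := mul_nonneg Real.pi_pos.le hx.1
  have h2 : Real.pi * x ≤ Real.pi := mul_le_of_le_one_right Real.pi_pos.le hx.2
  cases s <;> simp only [boolSign] <;> constructor <;> simp <;> linarith

theorem boolSign_mul_mem_Ioc (s : Bool) {x : ℝ} (hx : x ∈ Ioo (0 : ℝ) 1) :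
    boolSign s * Real.pi * x ∈ Ioc (-Real.pi) Real.pi := by
  have h1 : 0 < Real.pi * x := mul_pos Real.pi_pos hx.1
  have h2 : Real.pi * x < Real.pi := mul_lt_of_lt_one_right Real.pi_pos hx.2
  cases s <;> simp only [boolSign] <;> constructor <;> simp <;> linarith

theorem boolSign_mul_sin_pos (s : Bool) {x : ℝ} (hx : x ∈ Ioo (0 : ℝ) 1) :
    0 < boolSign s * Real.sin (boolSign s * Real.pi * x) := by
  have h1 : 0 < Real.pi * x := mul_pos Real.pi_pos hx.1
  have h2 : Real.pi * x < Real.pi := mul_lt_of_lt_one_right Real.pi_pos hx.2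
  have := Real.sin_pos_of_pos_of_lt_pi h1 h2
  cases s <;> simpa [boolSign] using this

theorem sin_boolSign_mul_ne_zero (s : Bool) {x : ℝ} (hx : x ∈ Ioo (0 : ℝ) 1) :
    Real.sin (boolSign s * Real.pi * x) ≠ 0 := fun h => by
  have := boolSign_mul_sin_pos s hx
  rw [h, mul_zero] at this
  exact this.false

theorem boolSign_mul_inj {s t : Bool} {x y : ℝ} (hx : 0 < x) (hy : 0 < y)
    (h : boolSign s * Real.pi * x = boolSign t * Real.pi * y) : s = t ∧ x = y := by
  have h' : boolSign s * x = boolSign t * y := by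
    refine mul_left_cancel₀ Real.pi_ne_zero ?_
    linear_combination h
  cases s <;> cases t <;> simp [boolSign] at h' ⊢ <;> linarith

/-- The sides of the two triangles of `L` over the vertex lie over the three sets described here. -/
def OnSide (i : Fin 3) (p : Torus) : Prop :=
  ![(p.2 : ℂ).im = 0, (p.1 : ℂ).im = 0, (p.1 : ℂ) = -p.2] i

theorem onSide_arm (i : Fin 3) (u : ℂ) : OnSide i (arm i u) := by
  fin_cases i <;> simp [OnSide, arm, annulus]

/-- Two sides of a triangle meet in real points only. -/
theorem OnSide.imDiff_eq_zero {i j : Fin 3} {p : Torus} (hi : OnSide i p) (hj : OnSide j p)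
    (hij : i ≠ j) : imDiff p = 0 := by
  fin_cases i <;> fin_cases j <;> simp [OnSide] at hij hi hj <;> simp_all [imDiff]

theorem imDiff_arm_mul_I {i : Fin 3} {φ : ℝ} (h : Real.sin φ ≠ 0) :
    imDiff (arm i (φ * Complex.I)) ≠ 0 := by
  obtain ⟨r, hr, e⟩ := imDiff_arm i (φ * Complex.I)
  rw [e]
  simpa [hr.ne'] using h

theorem imDiff_corner (i : Fin 3) : imDiff (arm i (Real.pi * Complex.I)) = 0 := by
  obtain ⟨r, hr, e⟩ := imDiff_arm i (Real.pi * Complex.I)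
  rw [e]
  simp

theorem corner_injective {i j : Fin 3} (h : arm i (Real.pi * Complex.I) =
    arm j (Real.pi * Complex.I)) : i = j := by
  have h1 := congrArg (fun p : Torus => (p.1 : ℂ).re) h
  have h2 := congrArg (fun p : Torus => (p.2 : ℂ).re) h
  fin_cases i <;> fin_cases j <;> simp [arm, annulus] at h1 h2 ⊢ <;> linarith

theorem mul_mem_Ioo_zero_one {x y : ℝ} (hx : x ∈ Ioo (0 : ℝ) 1) (hy : y ∈ Ioo (0 : ℝ) 1) :
    x * y ∈ Ioo (0 : ℝ) 1 :=
  ⟨mul_pos hx.1 hy.1, by nlinarith [hx.1, hx.2, hy.1, hy.2]⟩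

theorem triangle_fst_im (x y : ℝ) : ((triangle x y).1 : ℂ).im = Real.sin x := by
  simp [triangle, Complex.exp_ofReal_mul_I_im]

theorem triangle_snd_im (x y : ℝ) : ((triangle x y).2 : ℂ).im = -Real.sin (x * y) := by
  have e : ((x : ℂ) * y * Complex.I) = ((x * y : ℝ) : ℂ) * Complex.I := by push_cast; ring
  simp only [triangle, Units.val_neg, coe_cexpUnit, e, Complex.neg_im, Complex.exp_ofReal_mul_I_im]

theorem triangle_inj {s t : Bool} {x y : ℝ × ℝ} (hx : x ∈ Ioo (0 : ℝ) 1 ×ˢ Ioo (0 : ℝ) 1)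
    (hy : y ∈ Ioo (0 : ℝ) 1 ×ˢ Ioo (0 : ℝ) 1)
    (h : triangle (boolSign s * Real.pi * x.1) x.2 = triangle (boolSign t * Real.pi * y.1) y.2) :
    s = t ∧ x = y := by
  have h1 := congrArg (fun p : Torus => (p.1 : ℂ)) h
  have h2 := congrArg (fun p : Torus => (p.2 : ℂ)) h
  simp only [triangle, coe_cexpUnit, Units.val_neg, neg_inj] at h1 h2
  have e1 := eq_of_exp_eq (by simpa using boolSign_mul_mem_Ioc s hx.1)
    (by simpa using boolSign_mul_mem_Ioc t hy.1) h1
  have e1' := congrArg Complex.im e1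
  simp at e1'
  obtain ⟨rfl, e⟩ := boolSign_mul_inj hx.1.1 hy.1.1 e1'
  have e2 := eq_of_exp_eq
    (by simpa [mul_assoc] using boolSign_mul_mem_Ioc s (mul_mem_Ioo_zero_one hx.1 hx.2))
    (by simpa [mul_assoc] using boolSign_mul_mem_Ioc s (mul_mem_Ioo_zero_one hy.1 hy.2)) h2
  have e2' := congrArg Complex.im e2
  simp [e1'] at e2'
  refine ⟨rfl, Prod.ext e ?_⟩
  rcases e2' with h | h
  · exact h
  · exfalso
    rcases h with h | h
    · cases s <;> simp [boolSign] at h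
    · exact hy.1.1.ne' h

theorem not_onSide_triangle {s : Bool} {x : ℝ × ℝ} (hx : x ∈ Ioo (0 : ℝ) 1 ×ˢ Ioo (0 : ℝ) 1)
    (i : Fin 3) : ¬ OnSide i (triangle (boolSign s * Real.pi * x.1) x.2) := by
  have h2 := sin_boolSign_mul_ne_zero s (mul_mem_Ioo_zero_one hx.1 hx.2)
  rw [← mul_assoc] at h2
  fin_cases i
  · change ¬ ((triangle _ _).2 : ℂ).im = 0
    rw [triangle_snd_im]
    simpa using h2
  · change ¬ ((triangle _ _).1 : ℂ).im = 0
    rw [triangle_fst_im]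
    exact sin_boolSign_mul_ne_zero s hx.1
  · change ¬ ((triangle _ _).1 : ℂ) = -((triangle _ _).2 : ℂ)
    intro h
    simp only [triangle, coe_cexpUnit, Units.val_neg, neg_neg] at h
    have e := eq_of_exp_eq (by simpa using boolSign_mul_mem_Ioc s hx.1)
      (by simpa [mul_assoc] using boolSign_mul_mem_Ioc s (mul_mem_Ioo_zero_one hx.1 hx.2)) h
    have e' := congrArg Complex.im e
    simp at e'
    have : boolSign s * Real.pi * x.1 ≠ 0 := fun h0 => by
      apply sin_boolSign_mul_ne_zero s hx.1; rw [h0, Real.sin_zero]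
    have h3 : x.2 = 1 := mul_left_cancel₀ this (by linear_combination -e')
    exact hx.2.2.ne h3

theorem imDiff_triangle_ne_zero {s : Bool} {x : ℝ × ℝ}
    (hx : x ∈ Ioo (0 : ℝ) 1 ×ˢ Ioo (0 : ℝ) 1) :
    imDiff (triangle (boolSign s * Real.pi * x.1) x.2) ≠ 0 := by
  rw [imDiff_triangle]
  have h1 := boolSign_mul_sin_pos s hx.1
  have h2 := boolSign_mul_sin_pos s (mul_mem_Ioo_zero_one hx.1 hx.2)
  rw [← mul_assoc] at h2
  intro h
  have : boolSign s * (Real.sin (boolSign s * Real.pi * x.1) +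
    Real.sin (boolSign s * Real.pi * x.1 * x.2)) = 0 := by rw [h, mul_zero]
  linarith

namespace Ribbon

variable {W : Type} (M : Ribbon W)

/-- A choice of a sign for each half-edge, such that the two halves of an edge have opposite
signs. -/
theorem exists_sign : ∃ σ : W × Fin 3 → Bool, ∀ h, M.IsEdge h → σ (M.opp h) = !σ h := by
  classical
  -- the half-edge at the smaller vertex, for some linear order of the vertices
  refine ⟨fun h => decide (WellOrderingRel h.1 (M.opp h).1), fun h hE => ?_⟩
  simp only [M.opp_opp h hE]
  have hne := M.opp_fst_ne h hE
  rcases trichotomous_of WellOrderingRel h.1 (M.opp h).1 with h' | h' | h'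
  · simp [h', asymm_of WellOrderingRel h']
  · exact absurd h'.symm hne
  · simp [h', asymm_of WellOrderingRel h']

/-- The edges of the cell decomposition: for each ray at a vertex, the two halves of the unit circle
of its annulus, and for each half-edge, the segment over it on which its coordinate is positive. By
the sign of the gluing map, the segments of the two halves of an edge are the two real segments
over this edge. -/
def cell₁ : (W × Fin 3) × Bool ⊕ {h // M.IsEdge h} → ℝ → M.Surface
  | .inl a, x => M.ptOf a.1.1 (arm a.1.2 ((boolSign a.2 * Real.pi * x : ℝ) * Complex.I))
  | .inr h, x => M.edgePt h.1 ((M.len h.1 * x : ℝ) : ℂ)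

/-- The faces of the cell decomposition: triangles over the vertices, and strips over the
edges. There are two strips over each edge; the choice `σ` of signs associates them to its
halves. -/
def cell₂ (σ : W × Fin 3 → Bool) : W × Bool ⊕ {h // M.IsEdge h} → ℝ × ℝ → M.Surface
  | .inl a, x => M.ptOf a.1 (triangle (boolSign a.2 * Real.pi * x.1) x.2)
  | .inr h, x => M.edgePt h.1
      ((M.len h.1 * x.1 : ℝ) + (boolSign (σ h.1) * Real.pi * x.2 : ℝ) * Complex.I)

variable {M}

theorem len_mul_mem_Icc {h : W × Fin 3} (hE : M.IsEdge h) {x : ℝ} (hx : x ∈ Icc (0 : ℝ) 1) :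
    M.len h * x ∈ Icc 0 (M.len h) :=
  ⟨mul_nonneg (M.len_pos h hE).le hx.1, mul_le_of_le_one_right (M.len_pos h hE).le hx.2⟩

theorem len_mul_mem_Ioo {h : W × Fin 3} (hE : M.IsEdge h) {x : ℝ} (hx : x ∈ Ioo (0 : ℝ) 1) :
    M.len h * x ∈ Ioo 0 (M.len h) :=
  ⟨mul_pos (M.len_pos h hE) hx.1, mul_lt_of_lt_one_right (M.len_pos h hE) hx.2⟩

theorem height_arm_of_re_eq_zero {i : Fin 3} {u : ℂ} (h : u.re = 0) (j : Fin 3) :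
    height j (arm i u) = 0 := by rw [height_arm _ _ h.ge, h]; simp

theorem cell₁_mem_core (a : (W × Fin 3) × Bool ⊕ {h // M.IsEdge h}) {x : ℝ}
    (hx : x ∈ Icc (0 : ℝ) 1) : M.cell₁ a x ∈ M.core := by
  rcases a with a | h
  · exact ptOf_mem_core (arm_mem_pieceSet' (by simp)) (height_arm_of_re_eq_zero (by simp))
  · have := len_mul_mem_Icc h.2 hx
    exact edgePt_mem_core h.2 (by simpa using this.1) (by simpa using this.2)

theorem cell₂_mem_core (σ : W × Fin 3 → Bool) (a : W × Bool ⊕ {h // M.IsEdge h}) {x : ℝ × ℝ}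
    (hx : x ∈ Icc (0 : ℝ) 1 ×ˢ Icc (0 : ℝ) 1) : M.cell₂ σ a x ∈ M.core := by
  rcases a with a | h
  · exact ptOf_mem_core (triangle_mem_pieceSet (boolSign_mul_mem_Icc _ hx.1) hx.2)
      fun i => height_triangle i _ _
  · have := len_mul_mem_Icc h.2 hx.1
    exact edgePt_mem_core h.2 (by simpa using this.1) (by simpa using this.2)

theorem continuousOn_cell₁ (a : (W × Fin 3) × Bool ⊕ {h // M.IsEdge h}) :
    ContinuousOn (M.cell₁ a) (Icc 0 1) := by
  rcases a with a | h
  · refine (continuousOn_ptOf _).comp (Continuous.continuousOn ?_)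
      fun x _ => arm_mem_pieceSet' (by simp)
    exact (continuous_arm _).comp (by fun_prop)
  · refine (continuousOn_edgePt h.2).comp (Continuous.continuousOn (by fun_prop)) fun x hx => ?_
    have := len_mul_mem_Icc h.2 hx
    exact ⟨by simpa using this.1, by simpa using this.2⟩

theorem continuousOn_cell₂ (σ : W × Fin 3 → Bool) (a : W × Bool ⊕ {h // M.IsEdge h}) :
    ContinuousOn (M.cell₂ σ a) (Icc 0 1 ×ˢ Icc 0 1) := by
  rcases a with a | h
  · refine (continuousOn_ptOf _).comp (Continuous.continuousOn ?_)
      fun x hx => triangle_mem_pieceSet (boolSign_mul_mem_Icc _ hx.1) hx.2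
    exact continuous_triangle.comp (f := fun x : ℝ × ℝ => (boolSign a.2 * Real.pi * x.1, x.2))
      (by fun_prop)
  · refine (continuousOn_edgePt h.2).comp (Continuous.continuousOn (by fun_prop)) fun x hx => ?_
    have := len_mul_mem_Icc h.2 hx.1
    exact ⟨by simpa using this.1, by simpa using this.2⟩

theorem cell₁_inj (a b : (W × Fin 3) × Bool ⊕ {h // M.IsEdge h}) {x y : ℝ}
    (hx : x ∈ Ioo (0 : ℝ) 1) (hy : y ∈ Ioo (0 : ℝ) 1) (e : M.cell₁ a x = M.cell₁ b y) :
    a = b ∧ x = y := by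
  rcases a with ⟨⟨v, i⟩, s⟩ | ⟨h, hE⟩ <;> rcases b with ⟨⟨v', i'⟩, s'⟩ | ⟨h', hE'⟩
  · obtain ⟨rfl, e'⟩ := eq_of_ptOf_eq (arm_mem_pieceSet' (by simp)) (arm_mem_pieceSet' (by simp))
      (height_arm_of_re_eq_zero (by simp)) e
    have hii : i = i' := by
      by_contra hne
      exact imDiff_arm_mul_I (sin_boolSign_mul_ne_zero s hx)
        ((onSide_arm _ _).imDiff_eq_zero (e' ▸ onSide_arm _ _) hne)
    subst hii
    have e'' := eq_of_exp_eq (by simpa using boolSign_mul_mem_Ioc s hx)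
      (by simpa using boolSign_mul_mem_Ioc s' hy) (arm_eq_iff.mp e')
    have e3 := congrArg Complex.im e''
    simp only [Complex.im_ofReal_mul, Complex.I_im, mul_one] at e3
    obtain ⟨rfl, h⟩ := boolSign_mul_inj hx.1 hy.1 e3
    exact ⟨rfl, h⟩
  · exact absurd e (ptOf_ne_edgePt (arm_mem_pieceSet' (by simp))
      (height_arm_of_re_eq_zero (by simp)) (by simpa using len_mul_mem_Ioo hE' hy))
  · exact absurd e.symm (ptOf_ne_edgePt (arm_mem_pieceSet' (by simp))
      (height_arm_of_re_eq_zero (by simp)) (by simpa using len_mul_mem_Ioo hE hx))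
  · rcases eq_of_edgePt_eq (by simpa using len_mul_mem_Ioo hE hx)
      (by simpa using len_mul_mem_Ioo hE' hy) e with ⟨rfl, e'⟩ | ⟨rfl, e'⟩
    · have e3 := (sin_im_eq_of_exp_eq e').1
      simp only [Complex.ofReal_re] at e3
      exact ⟨rfl, mul_left_cancel₀ (M.len_pos h hE).ne' e3⟩
    · have e'' := eq_of_exp_eq (by simp [Real.pi_pos, Real.pi_pos.le])
        (by simp; linarith [Real.pi_pos]) e'
      have e3 := congrArg Complex.im e''
      simp at e3
      exact absurd e3.symm Real.pi_ne_zero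

theorem cell₂_inj {σ : W × Fin 3 → Bool} (hσ : ∀ h, M.IsEdge h → σ (M.opp h) = !σ h)
    (a b : W × Bool ⊕ {h // M.IsEdge h}) {x y : ℝ × ℝ}
    (hx : x ∈ Ioo (0 : ℝ) 1 ×ˢ Ioo (0 : ℝ) 1) (hy : y ∈ Ioo (0 : ℝ) 1 ×ˢ Ioo (0 : ℝ) 1)
    (e : M.cell₂ σ a x = M.cell₂ σ b y) : a = b ∧ x = y := by
  have hIcc : ∀ {z : ℝ × ℝ}, z ∈ Ioo (0 : ℝ) 1 ×ˢ Ioo (0 : ℝ) 1 →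
      z.1 ∈ Icc (0 : ℝ) 1 ∧ z.2 ∈ Icc (0 : ℝ) 1 :=
    fun h => ⟨Ioo_subset_Icc_self h.1, Ioo_subset_Icc_self h.2⟩
  rcases a with ⟨v, s⟩ | ⟨h, hE⟩ <;> rcases b with ⟨v', s'⟩ | ⟨h', hE'⟩
  · obtain ⟨rfl, e'⟩ := eq_of_ptOf_eq
      (triangle_mem_pieceSet (boolSign_mul_mem_Icc _ (hIcc hx).1) (hIcc hx).2)
      (triangle_mem_pieceSet (boolSign_mul_mem_Icc _ (hIcc hy).1) (hIcc hy).2)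
      (fun i => height_triangle i _ _) e
    obtain ⟨rfl, h⟩ := triangle_inj hx hy e'
    exact ⟨rfl, h⟩
  · exact absurd e (ptOf_ne_edgePt
      (triangle_mem_pieceSet (boolSign_mul_mem_Icc _ (hIcc hx).1) (hIcc hx).2)
      (fun i => height_triangle i _ _) (by simpa using len_mul_mem_Ioo hE' hy.1))
  · exact absurd e.symm (ptOf_ne_edgePt
      (triangle_mem_pieceSet (boolSign_mul_mem_Icc _ (hIcc hy).1) (hIcc hy).2)
      (fun i => height_triangle i _ _) (by simpa using len_mul_mem_Ioo hE hx.1))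
  · rcases eq_of_edgePt_eq (by simpa using len_mul_mem_Ioo hE hx.1)
      (by simpa using len_mul_mem_Ioo hE' hy.1) e with ⟨rfl, e'⟩ | ⟨rfl, e'⟩
    · have e3 := (sin_im_eq_of_exp_eq e').1
      simp at e3
      have e4 := congrArg Complex.im (eq_of_exp_eq
        (by simpa using boolSign_mul_mem_Ioc (σ h) hx.2)
        (by simpa using boolSign_mul_mem_Ioc (σ h) hy.2) e')
      simp only [Complex.add_im, Complex.ofReal_im, Complex.im_ofReal_mul, Complex.I_im, mul_one,
        zero_add] at e4
      exact ⟨rfl, Prod.ext (e3.resolve_right (M.len_pos h hE).ne')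
        (boolSign_mul_inj hx.2.1 hy.2.1 e4).2⟩
    · exfalso
      have e3 := (sin_im_eq_of_exp_eq e').2
      have h1 := boolSign_mul_sin_pos (σ h) hx.2
      have h2 := boolSign_mul_sin_pos (σ (M.opp h)) hy.2
      rw [flip_im, Real.sin_pi_sub] at e3
      simp only [Complex.add_im, Complex.ofReal_im, Complex.im_ofReal_mul, Complex.I_im, mul_one,
        zero_add] at e3
      rw [e3, hσ h hE, boolSign_not] at h2
      linarith

theorem cell₁_ne_cell₂ (σ : W × Fin 3 → Bool) (a : (W × Fin 3) × Bool ⊕ {h // M.IsEdge h})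
    (b : W × Bool ⊕ {h // M.IsEdge h}) {x : ℝ} {y : ℝ × ℝ}
    (hx : x ∈ Ioo (0 : ℝ) 1) (hy : y ∈ Ioo (0 : ℝ) 1 ×ˢ Ioo (0 : ℝ) 1) :
    M.cell₁ a x ≠ M.cell₂ σ b y := by
  intro e
  have hy1 := Ioo_subset_Icc_self hy.1
  have hy2 := Ioo_subset_Icc_self hy.2
  rcases a with ⟨⟨v, i⟩, s⟩ | ⟨h, hE⟩ <;> rcases b with ⟨v', s'⟩ | ⟨h', hE'⟩
  · obtain ⟨rfl, e'⟩ := eq_of_ptOf_eq (arm_mem_pieceSet' (by simp))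
      (triangle_mem_pieceSet (boolSign_mul_mem_Icc _ hy1) hy2)
      (height_arm_of_re_eq_zero (by simp)) e
    exact not_onSide_triangle hy i (e' ▸ onSide_arm i _)
  · exact absurd e (ptOf_ne_edgePt (arm_mem_pieceSet' (by simp))
      (height_arm_of_re_eq_zero (by simp)) (by simpa using len_mul_mem_Ioo hE' hy.1))
  · exact absurd e.symm (ptOf_ne_edgePt
      (triangle_mem_pieceSet (boolSign_mul_mem_Icc _ hy1) hy2)
      (fun i => height_triangle i _ _) (by simpa using len_mul_mem_Ioo hE hx))
  · have h1 := sin_boolSign_mul_ne_zero (σ h') hy.2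
    rcases eq_of_edgePt_eq (by simpa using len_mul_mem_Ioo hE hx)
      (by simpa using len_mul_mem_Ioo hE' hy.1) e with ⟨rfl, e'⟩ | ⟨rfl, e'⟩
    · have e3 := (sin_im_eq_of_exp_eq e').2
      simp at e3
      exact h1 e3.symm
    · have e3 := (sin_im_eq_of_exp_eq e').2
      simp at e3
      exact h1 e3

/-- The ends of the arcs and of the real segments are the corners. -/
theorem cell₁_boundary (a : (W × Fin 3) × Bool ⊕ {h // M.IsEdge h}) {x : ℝ} (hx : x = 0 ∨ x = 1) :
    ∃ h : W × Fin 3, M.cell₁ a x = M.ptOf h.1 (arm h.2 (Real.pi * Complex.I)) := by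
  have hc : ∀ i : Fin 3, arm i 0 = arm (i + 2) (Real.pi * Complex.I) := by
    intro i
    rw [arm_corner]
    congr 1
    fin_cases i <;> rfl
  rcases a with ⟨⟨v, i⟩, s⟩ | ⟨h, hE⟩
  · rcases hx with rfl | rfl
    · refine ⟨(v, i + 2), ?_⟩
      simp [cell₁, hc]
    · refine ⟨(v, i), ?_⟩
      simp only [cell₁]
      congr 1
      rw [arm_eq_iff]
      cases s <;> simp [boolSign, Complex.exp_neg]
  · rcases hx with rfl | rfl
    · refine ⟨(h.1, h.2 + 2), ?_⟩
      simp only [cell₁]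
      rw [edgePt_of_lt (by simpa using M.len_pos h hE)]
      simp [hc]
    · refine ⟨M.opp h, ?_⟩
      simp only [cell₁]
      rw [edgePt_of_pos hE (by simpa using M.len_pos h hE) (by simp)]
      simp [flip]

/-- The sides of the triangles are arcs, and the sides of the strips are arcs and real segments. -/
theorem cell₂_boundary (σ : W × Fin 3 → Bool) (a : W × Bool ⊕ {h // M.IsEdge h}) {x y : ℝ}
    (hx : x ∈ Icc (0 : ℝ) 1) (hy : y ∈ Icc (0 : ℝ) 1)
    (hxy : x = 0 ∨ x = 1 ∨ y = 0 ∨ y = 1) :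
    ∃ b, ∃ z ∈ Icc (0 : ℝ) 1, M.cell₂ σ a (x, y) = M.cell₁ b z := by
  have h1x : 1 - x ∈ Icc (0 : ℝ) 1 := ⟨by linarith [hx.2], by linarith [hx.1]⟩
  have h1y : 1 - y ∈ Icc (0 : ℝ) 1 := ⟨by linarith [hy.2], by linarith [hy.1]⟩
  rcases a with ⟨v, s⟩ | ⟨h, hE⟩
  · rcases hxy with rfl | rfl | rfl | rfl
    · refine ⟨.inl ((v, 2), true), 1, by simp, ?_⟩
      simp only [cell₂, cell₁]
      congr 1
      ext <;> simp [triangle, arm, annulus, boolSign]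
    · refine ⟨.inl ((v, 1), !s), y, hy, ?_⟩
      simp only [cell₂, cell₁]
      congr 1
      refine Prod.ext (Units.ext ?_) (Units.ext ?_)
      · cases s <;> simp [triangle, arm, annulus, boolSign, Complex.exp_neg]
      · simp [triangle, arm, annulus, Complex.exp_neg]
    · refine ⟨.inl ((v, 0), !s), x, hx, ?_⟩
      simp only [cell₂, cell₁]
      congr 1
      ext <;> simp [triangle, arm, annulus, Complex.exp_neg]
    · refine ⟨.inl ((v, 2), !s), 1 - x, h1x, ?_⟩
      have e : Complex.exp ((boolSign (!s) * Real.pi * (1 - x) : ℝ) * Complex.I) =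
          -Complex.exp ((boolSign s * Real.pi * x : ℝ) * Complex.I) := by
        rw [show ((boolSign (!s) * Real.pi * (1 - x) : ℝ) * Complex.I : ℂ) =
          (boolSign s * Real.pi * x : ℝ) * Complex.I - boolSign s * (Real.pi * Complex.I) by
            rw [boolSign_not]; push_cast; ring, Complex.exp_sub]
        cases s <;> simp [boolSign, Complex.exp_neg, div_neg]
      simp only [cell₂, cell₁]
      congr 1
      refine Prod.ext (Units.ext ?_) (Units.ext ?_)
      · simp only [triangle, arm, annulus]
        simp [-boolSign_not, -Complex.ofReal_mul, e]
      · simp only [triangle, arm, annulus]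
        simp [-boolSign_not, -Complex.ofReal_mul, e]
  · have hl := len_mul_mem_Icc hE hx
    rcases hxy with rfl | rfl | rfl | rfl
    · refine ⟨.inl (h, σ h), y, hy, ?_⟩
      simp only [cell₂, cell₁]
      rw [edgePt_of_lt (by simpa using M.len_pos h hE)]
      simp
    · refine ⟨.inl (M.opp h, σ h), 1 - y, h1y, ?_⟩
      simp only [cell₂, cell₁]
      rw [edgePt_of_pos hE (by simpa using M.len_pos h hE) (by simp)]
      congr 1
      rw [arm_eq_iff]
      cases σ h
      · rw [show ((boolSign false * Real.pi * (1 - y) : ℝ) * Complex.I : ℂ) =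
          M.flip h ((M.len h * 1 : ℝ) + (boolSign false * Real.pi * y : ℝ) * Complex.I)
            - 2 * Real.pi * Complex.I by simp [flip, boolSign]; ring, Complex.exp_sub,
          Complex.exp_two_pi_mul_I, div_one]
      · congr 1
        simp [flip, boolSign]; ring
    · refine ⟨.inr ⟨h, hE⟩, x, hx, ?_⟩
      simp [cell₂, cell₁]
    · refine ⟨.inr ⟨M.opp h, M.isEdge_opp h hE⟩, 1 - x, h1x, ?_⟩
      simp only [cell₂, cell₁]
      rw [← edgePt_opp hE (by simpa using hl.1) (by simpa using hl.2)]
      refine edgePt_congr ?_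
      rw [M.len_opp h hE]
      cases σ h
      · rw [show M.flip h ((M.len h * x : ℝ) + (boolSign false * Real.pi * 1 : ℝ) * Complex.I) =
          (M.len h * (1 - x) : ℝ) + 2 * Real.pi * Complex.I by simp [flip, boolSign]; ring,
          Complex.exp_add, Complex.exp_two_pi_mul_I, mul_one]
      · congr 1
        simp [flip, boolSign]; ring

theorem exists_boolSign_mul_eq {φ : ℝ} (hφ : φ ∈ Icc (-Real.pi) Real.pi) {s : Bool}
    (hs : 0 ≤ boolSign s * φ) : ∃ x ∈ Icc (0 : ℝ) 1, φ = boolSign s * Real.pi * x := by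
  refine ⟨boolSign s * φ / Real.pi, ⟨div_nonneg hs Real.pi_pos.le, ?_⟩, ?_⟩
  · rw [div_le_one Real.pi_pos]
    cases s <;> simp [boolSign] <;> linarith [hφ.1, hφ.2]
  · have := Real.pi_ne_zero
    field_simp
    rw [pow_two, boolSign_sq, mul_one]

/-- Every point of the core is in a closed triangle or in a closed strip. -/
theorem core_cover {σ : W × Fin 3 → Bool} (hσ : ∀ h, M.IsEdge h → σ (M.opp h) = !σ h)
    {x : M.Surface} (hx : x ∈ M.core) :
    ∃ a, ∃ z ∈ Icc (0 : ℝ) 1 ×ˢ Icc (0 : ℝ) 1, x = M.cell₂ σ a z := by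
  have hsign : ∀ φ : ℝ, ∃ s, 0 ≤ boolSign s * φ := by
    intro φ
    rcases le_total 0 φ with h | h
    · exact ⟨true, by simpa [boolSign] using h⟩
    · exact ⟨false, by simpa [boolSign] using h⟩
  obtain ⟨v, p, rfl, hp⟩ := hx
  rw [← ptOf_eq p.2]
  by_cases h : ∃ i, 0 < height i p.1
  · obtain ⟨i, hi⟩ := h
    have hE : M.IsEdge (v, i) := by
      by_contra hE
      exact hi.ne' (hp i hE)
    obtain ⟨u₀, hu₀, hr₀⟩ := eq_arm_of_height_pos p.2.1 hi
    obtain ⟨u, hu, hr, him⟩ := exists_im_mem_Ioc u₀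
    have hlt : u.re < M.len (v, i) := by rw [hr, hr₀]; exact p.2.2 i hE
    have hpos : 0 < u.re := by rw [hr, hr₀]; exact hi
    rw [hu₀, ← arm_eq_iff.mpr hu, ← edgePt_of_lt (h := (v, i)) hlt]
    -- the strip is associated with this half-edge or with the other half, according to the sign of
    -- the imaginary part
    have key : ∀ h (hE : M.IsEdge h) (u : ℂ), 0 < u.re → u.re < M.len h →
        u.im ∈ Icc (-Real.pi) Real.pi → 0 ≤ boolSign (σ h) * u.im →
        ∃ a, ∃ z ∈ Icc (0 : ℝ) 1 ×ˢ Icc (0 : ℝ) 1, M.edgePt h u = M.cell₂ σ a z := by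
      intro h hE u h0 h1 him hs
      obtain ⟨y, hy, e⟩ := exists_boolSign_mul_eq him hs
      have hl := M.len_pos h hE
      refine ⟨.inr ⟨h, hE⟩, (u.re / M.len h, y), ⟨⟨by positivity, ?_⟩, hy⟩, ?_⟩
      · rw [div_le_one hl]; exact h1.le
      · simp only [cell₂]
        congr 1
        rw [mul_div_cancel₀ _ hl.ne', ← e, Complex.re_add_im]
    by_cases hs : 0 ≤ boolSign (σ (v, i)) * u.im
    · exact key _ hE u hpos hlt (Ioc_subset_Icc_self him) hs
    · rw [← edgePt_opp hE hpos.le hlt.le]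
      have hE' := M.isEdge_opp _ hE
      have hl' := M.len_opp _ hE
      have hσ' := hσ _ hE
      cases hσv : σ (v, i)
      · refine key _ hE' _ ?_ ?_ ?_ ?_
        · rw [flip_re]; linarith
        · rw [flip_re, hl']; linarith
        · simp only [hσv, boolSign] at hs
          simp at hs
          rw [flip_im]
          exact ⟨by linarith [him.2, Real.pi_pos], by linarith⟩
        · rw [hσ', hσv, flip_im]
          simp [boolSign, him.2]
      · rw [edgePt_congr (u' := M.flip (v, i) u - 2 * Real.pi * Complex.I)
          (by rw [Complex.exp_sub, Complex.exp_two_pi_mul_I, div_one])]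
        simp only [hσv, boolSign] at hs
        simp at hs
        refine key _ hE' _ ?_ ?_ ?_ ?_
        · simp; linarith
        · simp [hl']; linarith
        · simp
          exact ⟨by linarith, by linarith [him.1, Real.pi_pos]⟩
        · rw [hσ', hσv]
          simp [boolSign]
          linarith [him.1]
  · push Not at h
    obtain ⟨φ, hφ, y, hy, e⟩ := exists_triangle_eq p.2.1 fun i =>
      le_antisymm (h i) (height_nonneg i _)
    obtain ⟨s, hs⟩ := hsign φ
    obtain ⟨x, hx, rfl⟩ := exists_boolSign_mul_eq hφ hs
    exact ⟨.inl (v, s), (x, y), ⟨hx, hy⟩, by simp only [cell₂]; rw [e]⟩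

/-- The cell decomposition of the core: there are three corners, six arcs and two triangles over
each vertex, and two real segments and two strips over each edge. -/
def coreCells {σ : W × Fin 3 → Bool} (hσ : ∀ h, M.IsEdge h → σ (M.opp h) = !σ h) :
    CellDecomposition M.core (W × Fin 3) ((W × Fin 3) × Bool ⊕ {h // M.IsEdge h})
      (W × Bool ⊕ {h // M.IsEdge h}) where
  p₀ h := ⟨M.ptOf h.1 (arm h.2 (Real.pi * Complex.I)),
    ptOf_mem_core (arm_mem_pieceSet' (by simp)) (height_arm_of_re_eq_zero (by simp))⟩
  p₁ a x := ⟨M.cell₁ a (projIcc 0 1 zero_le_one x), cell₁_mem_core a (projIcc 0 1 _ x).2⟩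
  p₂ a x := ⟨M.cell₂ σ a (projIcc 0 1 zero_le_one x.1, projIcc 0 1 zero_le_one x.2),
    cell₂_mem_core σ a ⟨(projIcc 0 1 zero_le_one x.1).2, (projIcc 0 1 zero_le_one x.2).2⟩⟩
  continuousOn₁ a := by
    refine Continuous.continuousOn (Continuous.subtype_mk ?_ _)
    exact (continuousOn_cell₁ a).comp_continuous
      (continuous_subtype_val.comp continuous_projIcc) fun x => (projIcc 0 1 _ x).2
  continuousOn₂ a := by
    refine Continuous.continuousOn (Continuous.subtype_mk ?_ _)
    refine (continuousOn_cell₂ σ a).comp_continuous (f := fun x : ℝ × ℝ =>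
      (((projIcc 0 1 zero_le_one x.1 : Icc (0 : ℝ) 1) : ℝ),
        ((projIcc 0 1 zero_le_one x.2 : Icc (0 : ℝ) 1) : ℝ))) ?_
      fun x => ⟨(projIcc 0 1 zero_le_one x.1).2, (projIcc 0 1 zero_le_one x.2).2⟩
    exact (continuous_subtype_val.comp (continuous_projIcc.comp continuous_fst)).prodMk
      (continuous_subtype_val.comp (continuous_projIcc.comp continuous_snd))
  inj₀₀ a b e := by
    obtain ⟨h, e'⟩ := eq_of_ptOf_eq (arm_mem_pieceSet' (by simp)) (arm_mem_pieceSet' (by simp))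
      (height_arm_of_re_eq_zero (by simp)) (congrArg Subtype.val e)
    exact Prod.ext h (corner_injective e')
  inj₁₁ a b x hx y hy e := by
    have e' := congrArg Subtype.val e
    simp only [projIcc_of_mem _ (Ioo_subset_Icc_self hx),
      projIcc_of_mem _ (Ioo_subset_Icc_self hy)] at e'
    exact cell₁_inj a b hx hy e'
  inj₂₂ a b x hx y hy e := by
    have e' := congrArg Subtype.val e
    simp only [projIcc_of_mem _ (Ioo_subset_Icc_self hx.1),
      projIcc_of_mem _ (Ioo_subset_Icc_self hy.1), projIcc_of_mem _ (Ioo_subset_Icc_self hx.2),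
      projIcc_of_mem _ (Ioo_subset_Icc_self hy.2)] at e'
    exact cell₂_inj hσ a b hx hy e'
  ne₀₁ a b x hx e := by
    have e' := congrArg Subtype.val e
    simp only [projIcc_of_mem _ (Ioo_subset_Icc_self hx)] at e'
    rcases b with ⟨⟨v, i⟩, s⟩ | ⟨h, hE⟩
    · obtain ⟨-, e''⟩ := eq_of_ptOf_eq (arm_mem_pieceSet' (by simp))
        (arm_mem_pieceSet' (by simp)) (height_arm_of_re_eq_zero (by simp)) e'
      exact imDiff_arm_mul_I (sin_boolSign_mul_ne_zero s hx) (e'' ▸ imDiff_corner a.2)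
    · exact ptOf_ne_edgePt (arm_mem_pieceSet' (by simp))
        (height_arm_of_re_eq_zero (by simp)) (by simpa using len_mul_mem_Ioo hE hx) e'
  ne₀₂ a b x hx e := by
    have e' := congrArg Subtype.val e
    simp only [projIcc_of_mem _ (Ioo_subset_Icc_self hx.1),
      projIcc_of_mem _ (Ioo_subset_Icc_self hx.2)] at e'
    rcases b with ⟨v, s⟩ | ⟨h, hE⟩
    · obtain ⟨-, e''⟩ := eq_of_ptOf_eq (arm_mem_pieceSet' (by simp))
        (triangle_mem_pieceSet (boolSign_mul_mem_Icc _ (Ioo_subset_Icc_self hx.1))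
          (Ioo_subset_Icc_self hx.2)) (height_arm_of_re_eq_zero (by simp)) e'
      exact imDiff_triangle_ne_zero hx (e'' ▸ imDiff_corner a.2)
    · exact ptOf_ne_edgePt (arm_mem_pieceSet' (by simp))
        (height_arm_of_re_eq_zero (by simp)) (by simpa using len_mul_mem_Ioo hE hx.1) e'
  ne₁₂ a b x hx y hy e := by
    have e' := congrArg Subtype.val e
    simp only [projIcc_of_mem _ (Ioo_subset_Icc_self hx),
      projIcc_of_mem _ (Ioo_subset_Icc_self hy.1),
      projIcc_of_mem _ (Ioo_subset_Icc_self hy.2)] at e'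
    exact cell₁_ne_cell₂ σ a b hx hy e'
  boundary₁ a x hx hx' := by
    have hx0 : x = 0 ∨ x = 1 := by
      by_contra! h
      exact hx' ⟨lt_of_le_of_ne hx.1 h.1.symm, lt_of_le_of_ne hx.2 h.2⟩
    obtain ⟨h, e⟩ := cell₁_boundary a hx0
    refine ⟨h, Subtype.ext ?_⟩
    simp only [projIcc_of_mem _ hx]
    exact e
  boundary₂ a x hx hx' := by
    have hx0 : x.1 = 0 ∨ x.1 = 1 ∨ x.2 = 0 ∨ x.2 = 1 := by
      by_contra! h
      exact hx' ⟨⟨lt_of_le_of_ne hx.1.1 h.1.symm, lt_of_le_of_ne hx.1.2 h.2.1⟩,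
        ⟨lt_of_le_of_ne hx.2.1 h.2.2.1.symm, lt_of_le_of_ne hx.2.2 h.2.2.2⟩⟩
    obtain ⟨b, z, hz, e⟩ := cell₂_boundary σ a hx.1 hx.2 hx0
    refine ⟨b, z, hz, Subtype.ext ?_⟩
    simp only [projIcc_of_mem _ hx.1, projIcc_of_mem _ hx.2, projIcc_of_mem _ hz]
    exact e
  cover x := by
    obtain ⟨a, z, hz, e⟩ := core_cover hσ x.2
    refine Or.inr (Or.inr ⟨a, z, hz, Subtype.ext ?_⟩)
    simp only [projIcc_of_mem _ hz.1, projIcc_of_mem _ hz.2]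
    exact e

/-- The surface retracts to a complex with `3 n` vertices, `6 n + m` edges and `2 n + m` faces,
where `n` is the number of vertices of the graph and `m` that of the half-edges that are not leaves. -/
theorem hasEulerCharacteristic [Finite W] :
    HasEulerCharacteristic M.Surface (-(Nat.card W : ℤ)) := by
  obtain ⟨σ, hσ⟩ := M.exists_sign
  have := (coreCells hσ).hasEulerCharacteristic M.coreHomotopyEquiv
  convert this using 1
  simp only [Nat.card_sum, Nat.card_prod]
  simp
  ring

end Ribbon

/-! ### Curves with compatible arcs -/

/-- A local homomorphism from the real line to a group extends to a homomorphism. -/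
theorem exists_hom_of_local {G : Type*} [Group G] {φ : ℝ → G} {δ : ℝ} (hδ : 0 < δ)
    (hφ : ∀ a b, |a| ≤ δ → |b| ≤ δ → |a + b| ≤ δ → φ (a + b) = φ a * φ b) :
    ∃ f : ℝ → G, (∀ a b, f (a + b) = f a * f b) ∧ ∀ a, |a| ≤ δ → f a = φ a := by
  have φ0 : φ 0 = 1 := by
    have h := hφ 0 0 (by simpa using hδ.le) (by simpa using hδ.le) (by simpa using hδ.le)
    rw [add_zero] at h
    exact left_eq_mul.mp h
  have hpow : ∀ (m : ℕ) (a : ℝ), |(m : ℝ) * a| ≤ δ → φ (m * a) = φ a ^ m := by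
    intro m a
    induction m with
    | zero => simp [φ0]
    | succ k ih =>
      intro h
      have hk : |(k : ℝ) * a| ≤ δ := by
        refine le_trans ?_ h
        rw [abs_mul, abs_mul]
        gcongr
        omega
      have h1 : |a| ≤ δ := by
        refine le_trans ?_ h
        rw [abs_mul, Nat.abs_cast]
        push_cast
        nlinarith [abs_nonneg a, (Nat.cast_nonneg k : (0 : ℝ) ≤ k)]
      have e : ((k + 1 : ℕ) : ℝ) * a = k * a + a := by push_cast; ring
      rw [e] at h ⊢
      rw [hφ _ _ hk h1 h, ih hk, pow_succ]
  -- divide the time into `N s` steps of length at most `δ`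
  set N : ℝ → ℕ := fun s => ⌈|s| / δ⌉₊ + 1
  have hN : ∀ s, |s| ≤ δ * N s := by
    intro s
    have h1 : |s| / δ ≤ N s := (Nat.le_ceil _).trans (by simp [N])
    rwa [div_le_iff₀' hδ] at h1
  -- the number of steps does not matter: compare with the common refinement
  have key : ∀ (s : ℝ) (n : ℕ), 0 < n → |s| ≤ δ * n → φ (s / N s) ^ N s = φ (s / n) ^ n := by
    intro s n hn hs
    have hNpos : (0 : ℝ) < N s := by simp only [N]; positivity
    have hnpos : (0 : ℝ) < n := by exact_mod_cast hn
    have e1 : s / N s = n * (s / (n * N s)) := by field_simp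
    have e2 : s / n = N s * (s / (n * N s)) := by field_simp
    have b1 : |s / N s| ≤ δ := by
      rw [abs_div, abs_of_pos hNpos, div_le_iff₀ hNpos]; exact hN s
    have b2 : |s / n| ≤ δ := by
      rw [abs_div, abs_of_pos hnpos, div_le_iff₀ hnpos]; exact hs
    rw [e1] at b1 ⊢
    rw [e2] at b2 ⊢
    rw [hpow _ _ b1, hpow _ _ b2, ← pow_mul, ← pow_mul, Nat.mul_comm]
  refine ⟨fun s => φ (s / N s) ^ N s, fun a b => ?_, fun a ha => ?_⟩
  · obtain ⟨n, hn⟩ := exists_nat_gt ((|a| + |b|) / δ)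
    rw [div_lt_iff₀' hδ] at hn
    have hn0 : 0 < n := by
      rcases Nat.eq_zero_or_pos n with rfl | h
      · have := abs_nonneg a
        have := abs_nonneg b
        simp at hn; linarith
      · exact h
    have hnpos : (0 : ℝ) < n := by exact_mod_cast hn0
    have ba : |a| ≤ δ * n := by linarith [abs_nonneg b]
    have bb : |b| ≤ δ * n := by linarith [abs_nonneg a]
    have bab : |a + b| ≤ δ * n := by linarith [abs_add_le a b]
    have small : ∀ x : ℝ, |x| ≤ δ * n → |x / n| ≤ δ := fun x hx => by
      rwa [abs_div, abs_of_pos hnpos, div_le_iff₀ hnpos]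
    simp only
    rw [key _ n hn0 ba, key _ n hn0 bb, key _ n hn0 bab]
    have h1 := hφ _ _ (small a ba) (small b bb) (by rw [← add_div]; exact small _ bab)
    have h2 := hφ _ _ (small b bb) (small a ba) (by rw [← add_div, add_comm]; exact small _ bab)
    have hc : Commute (φ (a / n)) (φ (b / n)) := by
      rw [Commute, SemiconjBy, ← h1, ← h2, add_comm]
    rw [← hc.mul_pow, ← h1, add_div]
  · simp only
    rw [key a 1 one_pos (by simpa using ha)]
    simp

/-- A curve in `Y` that is covered by arcs `arc c`, defined on intervals `dom c` around `0`, whose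
parameters agree up to translation where arcs overlap. The points `arc c 0` are the corners. Every
point lies well inside of one of the arcs, and an arc that does not go on forever leads to another
corner. -/
structure ArcAtlas (K Y : Type*) where
  /-- The interval on which an arc is defined. -/
  dom : K → Set ℝ
  /-- The arcs; the values outside of `dom` are irrelevant. -/
  arc : K → ℝ → Y
  /-- Every point has the time `2 * δ` on both sides before the end of some arc through it. -/
  δ : ℝ
  δ_pos : 0 < δ
  ordConnected : ∀ c, (dom c).OrdConnected
  zero_mem : ∀ c, (0 : ℝ) ∈ dom c
  compat : ∀ {c c' τ τ'}, τ ∈ dom c → τ' ∈ dom c' → arc c τ = arc c' τ' →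
    ∀ h, τ + h ∈ dom c → τ' + h ∈ dom c' → arc c (τ + h) = arc c' (τ' + h)
  injOn : ∀ c, InjOn (arc c) (dom c)
  eq_of_corner : ∀ {c c' τ}, τ ∈ dom c → arc c τ = arc c' 0 → c = c'
  exists_arc : ∀ {c τ}, τ ∈ dom c →
    ∃ c' τ', Icc (τ' - 2 * δ) (τ' + 2 * δ) ⊆ dom c' ∧ arc c τ = arc c' τ'
  /-- Going in the direction of the sign `e`. -/
  ends : ∀ (c) (e : ℝ), e = 1 ∨ e = -1 → (∀ t, 0 ≤ t → e * t ∈ dom c) ∨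
    ∀ t, 0 < t → e * t ∈ dom c → ∃ c' t', 0 < t' ∧ -(e * t') ∈ dom c' ∧
      arc c (e * t) = arc c' (-(e * t'))

namespace ArcAtlas

variable {K Y : Type*} (D : ArcAtlas K Y)

/-- The points of the curve. -/
def carrier : Set Y := {x | ∃ c, ∃ τ ∈ D.dom c, x = D.arc c τ}

variable {D}

theorem mem_carrier {c : K} {τ : ℝ} (h : τ ∈ D.dom c) : D.arc c τ ∈ D.carrier := ⟨c, τ, h, rfl⟩

theorem exists_window (x : D.carrier) :
    ∃ c τ, Icc (τ - 2 * D.δ) (τ + 2 * D.δ) ⊆ D.dom c ∧ x.1 = D.arc c τ := by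
  obtain ⟨c, τ, h, e⟩ := x.2
  obtain ⟨c', τ', h', e'⟩ := D.exists_arc h
  exact ⟨c', τ', h', e.trans e'⟩

theorem add_mem_of_window {c : K} {τ h : ℝ} (hw : Icc (τ - 2 * D.δ) (τ + 2 * D.δ) ⊆ D.dom c)
    (hh : |h| ≤ 2 * D.δ) : τ + h ∈ D.dom c := by
  rw [abs_le] at hh
  exact hw ⟨by linarith, by linarith⟩

theorem mem_of_window {c : K} {τ : ℝ} (hw : Icc (τ - 2 * D.δ) (τ + 2 * D.δ) ⊆ D.dom c) :
    τ ∈ D.dom c := by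
  have := D.δ_pos
  exact hw ⟨by linarith, by linarith⟩

variable (D) in
open Classical in
/-- The motion along the curve for a short time `h`. -/
def step (h : ℝ) (x : D.carrier) : D.carrier :=
  if hx : ∃ y : D.carrier, ∃ c, ∃ τ ∈ D.dom c, x.1 = D.arc c τ ∧ τ + h ∈ D.dom c ∧
    y.1 = D.arc c (τ + h) then hx.choose else x

theorem step_eq {h : ℝ} {x : D.carrier} {c : K} {τ : ℝ} (hτ : τ ∈ D.dom c)
    (hx : x.1 = D.arc c τ) (hh : τ + h ∈ D.dom c) : (D.step h x).1 = D.arc c (τ + h) := by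
  have h1 : ∃ y : D.carrier, ∃ c, ∃ τ ∈ D.dom c, x.1 = D.arc c τ ∧ τ + h ∈ D.dom c ∧
    y.1 = D.arc c (τ + h) := ⟨⟨_, mem_carrier hh⟩, c, τ, hτ, hx, hh, rfl⟩
  rw [step, dif_pos h1]
  obtain ⟨c', τ', hτ', hx', hh', e⟩ := h1.choose_spec
  rw [e]
  exact D.compat hτ' hτ (hx'.symm.trans hx) _ hh' hh

theorem step_step {h h' : ℝ} (hh : |h| ≤ D.δ) (hh' : |h'| ≤ D.δ) (x : D.carrier) :
    D.step h (D.step h' x) = D.step (h + h') x := by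
  obtain ⟨c, τ, hw, e⟩ := exists_window x
  have := D.δ_pos
  have m0 := mem_of_window hw
  have m1 := add_mem_of_window hw (h := h') (by linarith)
  have m2 := add_mem_of_window hw (h := h' + h) ((abs_add_le _ _).trans (by linarith))
  apply Subtype.ext
  rw [step_eq m1 (step_eq m0 e m1) (by rwa [add_assoc]), add_comm h h', step_eq m0 e m2, add_assoc]

theorem step_zero (x : D.carrier) : D.step 0 x = x := by
  obtain ⟨c, τ, hw, e⟩ := exists_window x
  apply Subtype.ext
  rw [step_eq (mem_of_window hw) e (by simpa using mem_of_window hw), e, add_zero]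

variable (D) in
/-- The short motions compose like translations, so they extend to an action of the real line. -/
theorem exists_flow : ∃ f : ℝ → Equiv.Perm D.carrier, (∀ a b, f (a + b) = f a * f b) ∧
    ∀ (h : ℝ) (x : D.carrier) (c : K) (τ : ℝ), τ ∈ D.dom c → x.1 = D.arc c τ → τ + h ∈ D.dom c →
      (f h x).1 = D.arc c (τ + h) := by
  classical
  have hδ := D.δ_pos
  set φ : ℝ → Equiv.Perm D.carrier := fun h => if hh : |h| ≤ D.δ then
    { toFun := D.step h
      invFun := D.step (-h)
      left_inv := fun x => by rw [step_step (by rwa [abs_neg]) hh, neg_add_cancel, step_zero]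
      right_inv := fun x => by rw [step_step hh (by rwa [abs_neg]), add_neg_cancel, step_zero] }
    else 1 with hφdef
  have hφ : ∀ h x, |h| ≤ D.δ → φ h x = D.step h x := by
    intro h x hh
    simp [φ, hh]
  obtain ⟨f, hf, hfφ⟩ := exists_hom_of_local (φ := φ) hδ (by
    intro a b ha hb hab
    ext1 x
    rw [Equiv.Perm.mul_apply, hφ _ _ hab, hφ _ _ ha, hφ _ _ hb, step_step ha hb])
  refine ⟨f, hf, fun h x c τ hτ hx hh => ?_⟩
  obtain ⟨n, hn⟩ := exists_nat_gt (|h| / D.δ)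
  rw [div_lt_iff₀' hδ] at hn
  have hn0 : 0 < (n : ℝ) := by
    have := abs_nonneg h
    by_contra hc
    nlinarith
  have hsmall : |h / n| ≤ D.δ := by
    rw [abs_div, abs_of_pos hn0, div_le_iff₀ hn0]; exact hn.le
  have key : ∀ k : ℕ, k ≤ n → (f (k * (h / n)) x).1 = D.arc c (τ + k * (h / n)) := by
    have hmem : ∀ k : ℕ, k ≤ n → τ + k * (h / n) ∈ D.dom c := by
      intro k hk
      have hk1 : (k : ℝ) / n ≤ 1 := by rw [div_le_one hn0]; exact_mod_cast hk
      have hk0 : (0 : ℝ) ≤ k / n := by positivity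
      have e : τ + k * (h / n) = τ + (k / n) * h := by ring
      have hconv := (D.ordConnected c).convex (𝕜 := ℝ)
      have := hconv.add_smul_sub_mem hτ hh ⟨hk0, hk1⟩
      simpa [e] using this
    intro k
    induction k with
    | zero =>
      intro _
      have : f 0 = 1 := by
        have h := hf 0 0
        rw [add_zero] at h
        exact left_eq_mul.mp h
      simp [this, hx]
    | succ k ih =>
      intro hk
      have e : ((k + 1 : ℕ) : ℝ) * (h / n) = h / n + k * (h / n) := by push_cast; ring
      have hk' := hmem _ hk
      have e2 : τ + (h / n + k * (h / n)) = τ + k * (h / n) + h / n := by ring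
      rw [e, e2] at hk'
      rw [e, hf, Equiv.Perm.mul_apply, hfφ _ hsmall, hφ _ _ hsmall,
        step_eq (hmem k (by omega)) (ih (by omega)) hk', e2]
  have := key n le_rfl
  rwa [mul_div_cancel₀ _ hn0.ne'] at this

variable (D) in
/-- The motion along the curve. -/
def flow : ℝ → Equiv.Perm D.carrier := D.exists_flow.choose

theorem flow_add (a b : ℝ) (x : D.carrier) : D.flow (a + b) x = D.flow a (D.flow b x) := by
  rw [flow, D.exists_flow.choose_spec.1, Equiv.Perm.mul_apply]

/-- As long as the motion stays on an arc, it is the translation of the parameter, no matter how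
long it takes. -/
theorem flow_eq {h : ℝ} {x : D.carrier} {c : K} {τ : ℝ} (hτ : τ ∈ D.dom c)
    (hx : x.1 = D.arc c τ) (hh : τ + h ∈ D.dom c) : (D.flow h x).1 = D.arc c (τ + h) :=
  D.exists_flow.choose_spec.2 h x c τ hτ hx hh

theorem flow_zero (x : D.carrier) : D.flow 0 x = x := by
  have h := D.exists_flow.choose_spec.1 0 0
  rw [add_zero] at h
  rw [flow, left_eq_mul.mp h, Equiv.Perm.one_apply]

theorem flow_neg_flow (a : ℝ) (x : D.carrier) : D.flow (-a) (D.flow a x) = x := by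
  rw [← flow_add, neg_add_cancel, flow_zero]

theorem eq_flow_iff {a : ℝ} {x y : D.carrier} : y = D.flow a x ↔ D.flow (-a) y = x := by
  constructor
  · rintro rfl; exact flow_neg_flow a x
  · rintro rfl; rw [← flow_add, add_neg_cancel, flow_zero]

variable (D) in
/-- The corner of an arc. -/
def corner (c : K) : D.carrier := ⟨D.arc c 0, mem_carrier (D.zero_mem c)⟩

theorem flow_corner {c : K} {τ : ℝ} (h : τ ∈ D.dom c) : (D.flow τ (D.corner c)).1 = D.arc c τ := by
  rw [flow_eq (D.zero_mem c) rfl (by simpa using h), zero_add]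

/-- A point at which a corner lies at time `h` on an arc that extends to this time. -/
theorem corner_unique {c c' : K} {τ h : ℝ} {x : D.carrier} (hτ : τ ∈ D.dom c)
    (hx : x.1 = D.arc c τ) (hh : τ + h ∈ D.dom c) (e : D.flow h x = D.corner c') :
    c = c' ∧ h = -τ := by
  have h1 : D.arc c (τ + h) = D.arc c' 0 := by
    rw [← flow_eq hτ hx hh, e]; rfl
  obtain rfl := D.eq_of_corner hh h1
  have := D.injOn c hh (D.zero_mem c) h1
  exact ⟨rfl, by linarith⟩

variable (D) in
/-- The set of times at which the motion returns to `x`. -/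
def stabilizer (x : D.carrier) : AddSubgroup ℝ where
  carrier := {a | D.flow a x = x}
  zero_mem' := flow_zero x
  add_mem' := fun {a b} (ha : D.flow a x = x) (hb : D.flow b x = x) => by
    change D.flow (a + b) x = x
    rw [flow_add, hb, ha]
  neg_mem' := fun {a} (ha : D.flow a x = x) => by
    change D.flow (-a) x = x
    nth_rw 1 [← ha]
    exact flow_neg_flow a x

/-- The stabilizer of a point is a cyclic group, since the motion is injective for short times. The
value `p = 0` stands for a component that is not closed. -/
theorem exists_period (x : D.carrier) :
    ∃ p : ℝ, 0 ≤ p ∧ ∀ a, D.flow a x = x ↔ ∃ m : ℤ, a = m * p := by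
  obtain ⟨c, τ, hw, e⟩ := exists_window x
  have hδ := D.δ_pos
  obtain ⟨b, hb⟩ := AddSubgroup.cyclic_of_isolated_zero (H := D.stabilizer x) hδ (by
    rw [Set.disjoint_left]
    rintro a ha ⟨h0, h1⟩
    have m := add_mem_of_window hw (h := a) (by rw [abs_of_pos h0]; linarith)
    have h2 := flow_eq (mem_of_window hw) e m
    rw [show D.flow a x = x from ha, e] at h2
    have := D.injOn c (mem_of_window hw) m h2
    linarith)
  refine ⟨|b|, abs_nonneg b, fun a => ?_⟩
  have : D.flow a x = x ↔ a ∈ D.stabilizer x := Iff.rfl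
  rw [this, hb, AddSubgroup.mem_closure_singleton]
  simp only [zsmul_eq_mul]
  rcases abs_choice b with h | h
  · rw [h]; exact ⟨fun ⟨m, h⟩ => ⟨m, h.symm⟩, fun ⟨m, h⟩ => ⟨m, h.symm⟩⟩
  · rw [h]
    exact ⟨fun ⟨m, h⟩ => ⟨-m, by rw [← h]; push_cast; ring⟩,
      fun ⟨m, h⟩ => ⟨-m, by rw [h]; push_cast; ring⟩⟩

variable (D) in
/-- One corner on each component of the curve. -/
theorem exists_representatives [Finite K] : ∃ (n : ℕ) (x : Fin n → K),
    (∀ y, ∃ k a, y = D.flow a (D.corner (x k))) ∧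
    ∀ k l a, D.corner (x l) = D.flow a (D.corner (x k)) → k = l := by
  let S : Setoid D.carrier :=
    { r := fun y z => ∃ a, z = D.flow a y
      iseqv := ⟨fun y => ⟨0, (flow_zero y).symm⟩,
        fun {y z} ⟨a, h⟩ => ⟨-a, (eq_flow_iff.mp h).symm⟩,
        fun {y z w} ⟨a, h⟩ ⟨b, h'⟩ => ⟨b + a, by rw [h', h, flow_add]⟩⟩ }
  have hsurj : Function.Surjective fun c : K => (Quotient.mk S (D.corner c)) := by
    intro q
    obtain ⟨y, rfl⟩ := Quotient.exists_rep q
    obtain ⟨c, τ, hτ, e⟩ := y.2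
    exact ⟨c, Quotient.sound ⟨τ, Subtype.ext (e.trans (flow_corner hτ).symm)⟩⟩
  have : Finite (Quotient S) := Finite.of_surjective _ hsurj
  obtain ⟨n, ⟨eq⟩⟩ := Finite.exists_equiv_fin (Quotient S)
  choose g hg using hsurj
  refine ⟨n, fun k => g (eq.symm k), fun y => ?_, fun k l a h => ?_⟩
  · refine ⟨eq (Quotient.mk S y), ?_⟩
    obtain ⟨a, ha⟩ := Quotient.exact (hg (Quotient.mk S y))
    exact ⟨a, by simpa using ha⟩
  · have h1 := Quotient.sound (s := S) ⟨a, h⟩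
    have h2 := hg (eq.symm k)
    have h3 := hg (eq.symm l)
    simp only at h2 h3
    exact eq.symm.injective (h2.symm.trans (h1.trans h3))

/-- A component that is not closed passes each of the finitely many corners at most once, so it
stays on a single arc from some time on, in both directions. -/
theorem exists_leaf [Finite K] {x : D.carrier} (hx : ∀ a, D.flow a x = x → a = 0) {e : ℝ}
    (he : e = 1 ∨ e = -1) :
    ∃ c T, (∀ t, 0 ≤ t → e * t ∈ D.dom c) ∧ D.flow T x = D.corner c := by
  have hfin : {a | ∃ c, D.flow a x = D.corner c}.Finite := by
    refine Set.Finite.of_finite_image (f := fun a => D.flow a x) ?_ ?_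
    · refine (Set.finite_range D.corner).subset ?_
      rintro _ ⟨a, ⟨c, h⟩, rfl⟩
      exact ⟨c, h.symm⟩
    · intro a _ b _ h
      have h1 := hx (-b + a) (by rw [flow_add, show D.flow a x = D.flow b x from h, flow_neg_flow])
      linarith
  obtain ⟨B, hB⟩ := hfin.isBounded.exists_norm_le
  replace hB : ∀ a c, D.flow a x = D.corner c → e * a ≤ |B| := by
    intro a c h
    have h1 := (hB a ⟨c, h⟩).trans (le_abs_self B)
    rw [Real.norm_eq_abs, abs_le] at h1
    rcases he with rfl | rfl <;> linarith
  have hee : e * e = 1 := by rcases he with rfl | rfl <;> norm_num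
  set s := e * (|B| + 1)
  obtain ⟨c, τ, hw, hy⟩ := exists_window (D.flow s x)
  have hτ := mem_of_window hw
  -- the time at which the motion would meet the corner of the arc
  have hc : D.flow (s - τ) x = D.corner c := by
    rw [sub_eq_neg_add, flow_add]
    apply Subtype.ext
    rw [flow_eq hτ hy (by simpa using D.zero_mem c), add_neg_cancel]
    rfl
  have h1 := hB _ _ hc
  have hs : e * s = |B| + 1 := by simp only [s]; rw [← mul_assoc, hee, one_mul]
  have hpos : 0 < e * τ := by rw [mul_sub, hs] at h1; linarith
  have hτe : e * (e * τ) = τ := by rw [← mul_assoc, hee, one_mul]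
  rcases D.ends c e he with h | h
  · exact ⟨c, _, h, hc⟩
  · obtain ⟨c', t', ht', hm, h2⟩ := h _ hpos (by rwa [hτe])
    rw [hτe] at h2
    have h3 : D.flow (e * t' + s) x = D.corner c' := by
      rw [flow_add]
      apply Subtype.ext
      rw [flow_eq hm (hy.trans h2) (by simpa using D.zero_mem c'), neg_add_cancel]
      rfl
    have h4 := hB _ _ h3
    rw [mul_add, hs, ← mul_assoc, hee] at h4
    linarith

theorem continuous_flow [TopologicalSpace Y] (hD : ∀ c, ContinuousOn (D.arc c) (D.dom c))
    (x : D.carrier) : Continuous fun s => (D.flow s x).1 := by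
  rw [continuous_iff_continuousAt]
  intro s
  obtain ⟨c, τ, hw, e⟩ := exists_window (D.flow s x)
  have hδ := D.δ_pos
  have h1 : ContinuousAt (fun t => D.arc c (τ + (t - s))) s := by
    have h2 : ContinuousAt (D.arc c) (τ + (s - s)) := by
      rw [sub_self, add_zero]
      exact (hD c).continuousAt (mem_of_superset (Icc_mem_nhds (by linarith) (by linarith)) hw)
    exact h2.comp (f := fun t => τ + (t - s)) (by fun_prop)
  refine h1.congr ?_
  filter_upwards [Metric.ball_mem_nhds s hδ] with t ht
  rw [Metric.mem_ball, Real.dist_eq] at ht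
  rw [← flow_eq (mem_of_window hw) e (add_mem_of_window hw (by linarith)), ← flow_add,
    sub_add_cancel]

end ArcAtlas

/-! ### Smooth ramps and angles -/

/-- A smooth function that grows from `0` to `1` on the interval `[-η, η]`. -/
def ramp (η t : ℝ) : ℝ := Real.smoothTransition ((t + η) / (2 * η))

theorem ramp_nonneg (η t : ℝ) : 0 ≤ ramp η t := Real.smoothTransition.nonneg _

theorem ramp_le_one (η t : ℝ) : ramp η t ≤ 1 := Real.smoothTransition.le_one _

theorem ramp_eq_zero {η t : ℝ} (hη : 0 < η) (h : t ≤ -η) : ramp η t = 0 :=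
  Real.smoothTransition.zero_of_nonpos (div_nonpos_of_nonpos_of_nonneg (by linarith) (by linarith))

theorem ramp_eq_one {η t : ℝ} (hη : 0 < η) (h : η ≤ t) : ramp η t = 1 :=
  Real.smoothTransition.one_of_one_le (by rw [one_le_div (by linarith)]; linarith)

theorem contDiff_ramp (η : ℝ) : ContDiff ℝ ∞ (ramp η) :=
  Real.smoothTransition.contDiff.comp ((contDiff_id.add contDiff_const).div_const _)

/-- The symmetry of the ramp makes its primitive `smoothMax` equal to the identity beyond `η`. -/
theorem ramp_add_ramp_neg {η : ℝ} (hη : 0 < η) (t : ℝ) : ramp η t + ramp η (-t) = 1 := by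
  have e : (-t + η) / (2 * η) = 1 - (t + η) / (2 * η) := by field_simp; ring
  rw [ramp, ramp, e]
  set x := (t + η) / (2 * η)
  have h := (Real.smoothTransition.pos_denom x).ne'
  simp only [Real.smoothTransition, sub_sub_cancel]
  rw [add_comm (expNegInvGlue (1 - x)), ← add_div, div_self h]

/-- A smoothing of the function `t ↦ max t 0` on the interval `[-η, η]`. -/
def smoothMax (η t : ℝ) : ℝ := ∫ r in (-η)..t, ramp η r

theorem hasDerivAt_smoothMax (η t : ℝ) : HasDerivAt (smoothMax η) (ramp η t) t :=
  ((contDiff_ramp η).continuous.integral_hasStrictDerivAt _ t).hasDerivAt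

theorem contDiff_smoothMax (η : ℝ) : ContDiff ℝ ∞ (smoothMax η) := by
  refine contDiff_infty_iff_deriv.mpr ⟨fun t => (hasDerivAt_smoothMax η t).differentiableAt, ?_⟩
  rw [show deriv (smoothMax η) = ramp η from funext fun t => (hasDerivAt_smoothMax η t).deriv]
  exact contDiff_ramp η

theorem smoothMax_eq_zero {η t : ℝ} (hη : 0 < η) (h : t ≤ -η) : smoothMax η t = 0 := by
  rw [smoothMax, intervalIntegral.integral_congr (g := fun _ => (0 : ℝ))]
  · simp
  · intro r hr
    rw [uIcc_of_ge h] at hr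
    exact ramp_eq_zero hη hr.2

theorem smoothMax_sub_smoothMax_neg {η : ℝ} (hη : 0 < η) (t : ℝ) :
    smoothMax η t - smoothMax η (-t) = t := by
  have hd : ∀ t, HasDerivAt (fun t => smoothMax η t - smoothMax η (-t) - t) 0 t := by
    intro t
    have h1 := hasDerivAt_smoothMax η t
    have h2 := (hasDerivAt_smoothMax η (-t)).comp t (hasDerivAt_neg t)
    have h3 := (h1.sub h2).sub (hasDerivAt_id t)
    have e : ramp η t - ramp η (-t) * -1 - 1 = 0 := by linarith [ramp_add_ramp_neg hη t]
    rw [e] at h3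
    exact h3
  have := is_const_of_deriv_eq_zero (fun t => (hd t).differentiableAt) (fun t => (hd t).deriv) t 0
  simp at this
  linarith

theorem smoothMax_eq_self {η t : ℝ} (hη : 0 < η) (h : η ≤ t) : smoothMax η t = t := by
  have := smoothMax_sub_smoothMax_neg hη t
  rw [smoothMax_eq_zero hη (neg_le_neg h)] at this
  linarith

theorem abs_smoothMax_sub_max {η : ℝ} (hη : 0 < η) (t : ℝ) :
    |smoothMax η t - max t 0| ≤ η := by
  have hmono : Monotone (smoothMax η) := monotone_of_deriv_nonneg
    (fun t => (hasDerivAt_smoothMax η t).differentiableAt)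
    fun t => by rw [(hasDerivAt_smoothMax η t).deriv]; exact ramp_nonneg η t
  rcases le_total t (-η) with h | h
  · rw [smoothMax_eq_zero hη h, max_eq_right (by linarith)]; simpa using hη.le
  rcases le_total η t with h' | h'
  · rw [smoothMax_eq_self hη h', max_eq_left (by linarith)]; simpa using hη.le
  have h1 := hmono h
  have h2 := hmono h'
  rw [smoothMax_eq_zero hη le_rfl] at h1
  rw [smoothMax_eq_self hη le_rfl] at h2
  have h3 : max t 0 ≤ η := max_le h' hη.le
  have h4 : 0 ≤ max t 0 := le_max_right _ _
  rw [abs_le]; constructor <;> linarith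

theorem smoothMax_sub_max_eq_zero {η t : ℝ} (hη : 0 < η) (h : η ≤ |t|) :
    smoothMax η t - max t 0 = 0 := by
  rcases le_abs'.mp h with h | h
  · rw [smoothMax_eq_zero hη h, max_eq_right (by linarith), sub_self]
  · rw [smoothMax_eq_self hη h, max_eq_left (by linarith), sub_self]

theorem deriv_ramp_eq_zero {η t : ℝ} (hη : 0 < η) (h : η ≤ |t|) : deriv (ramp η) t = 0 := by
  rcases le_abs'.mp h with h | h
  · refine IsLocalMin.deriv_eq_zero (Eventually.of_forall fun s => ?_)
    rw [ramp_eq_zero hη h]; exact ramp_nonneg η s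
  · refine IsLocalMax.deriv_eq_zero (Eventually.of_forall fun s => ?_)
    rw [ramp_eq_one hη h]; exact ramp_le_one η s

theorem hasDerivAt_ramp (η t : ℝ) : HasDerivAt (ramp η) (deriv (ramp η) t) t :=
  ((contDiff_ramp η).differentiable (by simp) t).hasDerivAt

theorem continuous_deriv_ramp (η : ℝ) : Continuous (deriv (ramp η)) :=
  (contDiff_ramp η).continuous_deriv (by simp)

/-- The plane of logarithmic coordinates as the complex plane. -/
def toC : (ℝ × ℝ) ≃L[ℝ] ℂ := Complex.equivRealProdCLM.symm

@[simp] theorem toC_apply (p : ℝ × ℝ) : toC p = p.1 + p.2 * Complex.I := by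
  apply Complex.ext <;> simp [toC]

theorem norm_toC_le (p : ℝ × ℝ) : ‖toC p‖ ≤ 2 * ‖p‖ := by
  rw [toC_apply]
  refine (norm_add_le _ _).trans ?_
  have h1 := norm_fst_le p
  have h2 := norm_snd_le p
  simp only [norm_mul, Complex.norm_real, Complex.norm_I, mul_one]
  linarith

/-- If a velocity is close to a convex combination of two unit vectors with angle `θ < π`, then it
is not opposite to any unit vector between the two. -/
theorem mul_exp_mem_slitPlane {d y z : ℂ} {θ μ : ℝ} (hd : ‖d‖ = 1) (hθ : θ < Real.pi) (hμ0 : 0 ≤ μ)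
    (hμ : μ ≤ θ) (hy : y ∈ segment ℝ d (d * Complex.exp (θ * Complex.I)))
    (hz : ‖z - y‖ < Real.cos (θ / 2)) :
    z * (d * Complex.exp (μ * Complex.I))⁻¹ ∈ Complex.slitPlane := by
  have hd0 : d ≠ 0 := by rintro rfl; simp at hd
  by_contra hc
  rw [Complex.mem_slitPlane_iff_not_le_zero, not_not] at hc
  set w := z * (d * Complex.exp (μ * Complex.I))⁻¹
  obtain ⟨r, hr⟩ : ∃ r : ℝ, w = r := ⟨w.re, Complex.ext rfl (by simpa using hc.2)⟩
  have hr0 : r ≤ 0 := by rw [hr] at hc; exact_mod_cast hc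
  have hz' : z = r * (d * Complex.exp (μ * Complex.I)) := by
    rw [← hr]; simp only [w]
    rw [inv_mul_cancel_right₀ (mul_ne_zero hd0 (Complex.exp_ne_zero _))]
  obtain ⟨a, b, ha, hb, hab, rfl⟩ := hy
  set e := Complex.exp (-(θ / 2 : ℝ) * Complex.I) * d⁻¹
  have he : ‖e‖ = 1 := by
    simp only [e, norm_mul, norm_inv, hd]
    rw [← Complex.ofReal_neg, Complex.norm_exp_ofReal_mul_I]; simp
  have h1 : (z - (a • d + b • (d * Complex.exp (θ * Complex.I)))) * e =
      r * Complex.exp ((μ - θ / 2 : ℝ) * Complex.I) -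
        (a * Complex.exp ((-(θ / 2) : ℝ) * Complex.I) +
          b * Complex.exp ((θ / 2 : ℝ) * Complex.I)) := by
    have e1 : Complex.exp ((μ - θ / 2 : ℝ) * Complex.I) =
        Complex.exp (μ * Complex.I) * Complex.exp (-(θ / 2 : ℝ) * Complex.I) := by
      rw [← Complex.exp_add]; congr 1; push_cast; ring
    have e2 : Complex.exp ((θ / 2 : ℝ) * Complex.I) =
        Complex.exp (θ * Complex.I) * Complex.exp (-(θ / 2 : ℝ) * Complex.I) := by
      rw [← Complex.exp_add]; congr 1; push_cast; ring
    rw [hz', e1, e2]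
    simp only [e, Complex.real_smul, Complex.ofReal_neg]
    field_simp
  have h2 := congrArg Complex.re h1
  have h3 : ((z - (a • d + b • (d * Complex.exp (θ * Complex.I)))) * e).re ≥
      -‖z - (a • d + b • (d * Complex.exp (θ * Complex.I)))‖ := by
    have := (abs_le.mp (Complex.abs_re_le_norm
      ((z - (a • d + b • (d * Complex.exp (θ * Complex.I)))) * e))).1
    rwa [norm_mul, he, mul_one] at this
  rw [h2] at h3
  simp only [Complex.sub_re, Complex.add_re, Complex.re_ofReal_mul, Complex.exp_ofReal_mul_I_re,
    Real.cos_neg] at h3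
  have h4 : 0 ≤ Real.cos (μ - θ / 2) :=
    Real.cos_nonneg_of_mem_Icc ⟨by linarith, by linarith⟩
  have h5 : r * Real.cos (μ - θ / 2) ≤ 0 := mul_nonpos_of_nonpos_of_nonneg hr0 h4
  have h6 : a * Real.cos (θ / 2) + b * Real.cos (θ / 2) = Real.cos (θ / 2) := by
    rw [← add_mul, hab, one_mul]
  linarith

/-! ### Locally convex piecewise linear curves in the plane -/

/-- A curve covered by arcs, with a piecewise linear map of unit speed to the plane that turns left
at each corner, by the angle `angle c` between the velocities `dIn c` and `dOut c`. -/
structure PlaneAtlas (K Y : Type*) extends ArcAtlas K Y where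
  pos : Y → ℝ × ℝ
  dIn : K → ℝ × ℝ
  dOut : K → ℝ × ℝ
  angle : K → ℝ
  angle_pos : ∀ c, 0 < angle c
  angle_lt : ∀ c, angle c < Real.pi
  norm_dIn : ∀ c, ‖toC (dIn c)‖ = 1
  toC_dOut : ∀ c, toC (dOut c) = toC (dIn c) * Complex.exp (angle c * Complex.I)
  pos_arc : ∀ c τ, τ ∈ dom c → pos (arc c τ) = pos (arc c 0) + min τ 0 • dIn c + max τ 0 • dOut c

namespace ArcAtlas

variable {K Y : Type*} (D : ArcAtlas K Y)

/-- A point that lies, with a neighborhood, on the arc `c` at the time `τ`. -/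
def Window (x : D.carrier) (c : K) (τ : ℝ) : Prop :=
  Icc (τ - D.δ) (τ + D.δ) ⊆ D.dom c ∧ x.1 = D.arc c τ

variable {D}

theorem exists_window_flow (x : D.carrier) :
    ∃ c τ, ∀ h, |h| ≤ D.δ → D.Window (D.flow h x) c (τ + h) := by
  obtain ⟨c, τ, hw, e⟩ := exists_window x
  have := D.δ_pos
  refine ⟨c, τ, fun h hh => ⟨fun t ht => hw ?_, ?_⟩⟩
  · rw [abs_le] at hh
    exact ⟨by linarith [ht.1], by linarith [ht.2]⟩
  · exact flow_eq (mem_of_window hw) e (add_mem_of_window hw (by linarith))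

theorem Window.add_mem {x : D.carrier} {c : K} {τ h : ℝ} (hx : D.Window x c τ) (hh : |h| ≤ D.δ) :
    τ + h ∈ D.dom c := by
  rw [abs_le] at hh
  exact hx.1 ⟨by linarith, by linarith⟩

theorem Window.mem {x : D.carrier} {c : K} {τ : ℝ} (hx : D.Window x c τ) : τ ∈ D.dom c := by
  simpa using hx.add_mem (h := 0) (by simpa using D.δ_pos.le)

theorem Window.flow_eq {x : D.carrier} {c : K} {τ h : ℝ} (hx : D.Window x c τ) (hh : |h| ≤ D.δ) :
    (D.flow h x).1 = D.arc c (τ + h) :=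
  ArcAtlas.flow_eq hx.mem hx.2 (hx.add_mem hh)

theorem Window.eq_flow_corner {x : D.carrier} {c : K} {τ : ℝ} (hx : D.Window x c τ) :
    x = D.flow τ (D.corner c) :=
  Subtype.ext (hx.2.trans (flow_corner hx.mem).symm)

/-- A corner near a point is the corner of each arc that passes through this point. -/
theorem Window.corner_eq {x : D.carrier} {c c' : K} {τ t : ℝ} (hx : D.Window x c τ) (ht : |t| ≤ D.δ)
    (e : x = D.flow t (D.corner c')) : c = c' ∧ t = τ := by
  have h1 := corner_unique hx.mem hx.2 (hx.add_mem (h := -t) (by rwa [abs_neg])) (eq_flow_iff.mp e)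
  exact ⟨h1.1, by linarith [h1.2]⟩

theorem window_corner (c : K) {t : ℝ} (ht : |t| ≤ D.δ) :
    D.Window (D.flow t (D.corner c)) c t := by
  obtain ⟨c', τ, h⟩ := exists_window_flow (D.corner c)
  have h0 := h 0 (by simpa using D.δ_pos.le)
  obtain ⟨rfl, h2⟩ := h0.corner_eq (c' := c) (t := 0) (by simpa using D.δ_pos.le) rfl
  have h3 := h t ht
  rwa [show τ = 0 by linarith, zero_add] at h3

open Classical in
variable (D) in
/-- The function on the curve that is `φ`, in terms of the time, near the corner `c`, and zero
elsewhere. -/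
def near {E : Type*} [Zero E] (c : K) (φ : ℝ → E) (x : D.carrier) : E :=
  if h : ∃ t, |t| ≤ D.δ ∧ x = D.flow t (D.corner c) then φ h.choose else 0

theorem near_flow_corner {E : Type*} [Zero E] {c : K} (φ : ℝ → E) {t : ℝ} (ht : |t| ≤ D.δ) :
    D.near c φ (D.flow t (D.corner c)) = φ t := by
  have h : ∃ t', |t'| ≤ D.δ ∧ D.flow t (D.corner c) = D.flow t' (D.corner c) := ⟨t, ht, rfl⟩
  rw [near, dif_pos h, ((window_corner c ht).corner_eq h.choose_spec.1 h.choose_spec.2).2]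

theorem near_eq_zero {E : Type*} [Zero E] {c : K} (φ : ℝ → E) {x : D.carrier}
    (h : ∀ t, |t| ≤ D.δ → x ≠ D.flow t (D.corner c)) : D.near c φ x = 0 := by
  rw [near, dif_neg]
  rintro ⟨t, ht, e⟩
  exact h t ht e

theorem Window.near_eq {E : Type*} [Zero E] {x : D.carrier} {c : K} {τ : ℝ} (hx : D.Window x c τ)
    {φ : ℝ → E} (hφ : ∀ t, D.δ ≤ |t| → φ t = 0) : D.near c φ x = φ τ := by
  by_cases h : |τ| ≤ D.δ
  · rw [hx.eq_flow_corner, near_flow_corner φ h]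
  · rw [hφ _ (not_le.mp h).le]
    refine near_eq_zero φ fun t ht e => h ?_
    rw [← (hx.corner_eq ht e).2]; exact ht

theorem Window.near_ne {E : Type*} [Zero E] {x : D.carrier} {c c' : K} {τ : ℝ}
    (hx : D.Window x c τ) (φ : ℝ → E) (hc : c ≠ c') : D.near c' φ x = 0 :=
  near_eq_zero φ fun _ ht e => hc (hx.corner_eq ht e).1

open Classical in
theorem Window.sum_near {E : Type*} [AddCommMonoid E] [Fintype K] {x : D.carrier} {c : K} {τ : ℝ}
    (hx : D.Window x c τ) {φ : K → ℝ → E} (hφ : ∀ t, D.δ ≤ |t| → φ c t = 0) :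
    ∑ c', D.near c' (φ c') x = φ c τ := by
  rw [Finset.sum_eq_single c (fun c' _ h => hx.near_ne _ h.symm) (by simp), hx.near_eq hφ]

theorem continuous_near (c : K) {φ : ℝ → ℝ} (hφ : Continuous φ) (h0 : ∀ t, D.δ ≤ |t| → φ t = 0)
    (x : D.carrier) : Continuous fun s => D.near c φ (D.flow s x) := by
  rw [continuous_iff_continuousAt]
  intro s
  obtain ⟨c', τ, hw⟩ := exists_window_flow (D.flow s x)
  have hev : ∀ᶠ t in 𝓝 s, D.Window (D.flow t x) c' (τ + (t - s)) := by
    filter_upwards [Metric.ball_mem_nhds s D.δ_pos] with t ht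
    rw [Metric.mem_ball, Real.dist_eq] at ht
    have := hw (t - s) ht.le
    rwa [← flow_add, sub_add_cancel] at this
  by_cases hc : c' = c
  · subst hc
    have h1 : Continuous fun t => φ (τ + (t - s)) := by fun_prop
    refine h1.continuousAt.congr ?_
    filter_upwards [hev] with t ht
    rw [ht.near_eq h0]
  · refine (continuousAt_const (y := (0 : ℝ))).congr ?_
    filter_upwards [hev] with t ht
    rw [ht.near_ne φ hc]

/-- The number of times, weighted by a smooth density, that the motion has passed the corner `c`
since it started at `x`. -/
def passages (x : D.carrier) (c : K) (s : ℝ) : ℝ :=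
  ∫ t in (0 : ℝ)..s, D.near c (deriv (ramp D.δ)) (D.flow t x)

theorem hasDerivAt_passages (x : D.carrier) (c : K) (s : ℝ) :
    HasDerivAt (passages x c) (D.near c (deriv (ramp D.δ)) (D.flow s x)) s :=
  ((continuous_near c (continuous_deriv_ramp _) (fun _ => deriv_ramp_eq_zero D.δ_pos)
    x).integral_hasStrictDerivAt _ s).hasDerivAt

theorem passages_eq_zero {x : D.carrier} {c : K} (h : ∀ T, D.flow T x ≠ D.corner c) (s : ℝ) :
    passages x c s = 0 := by
  rw [passages, intervalIntegral.integral_congr (g := fun _ => (0 : ℝ))]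
  · simp
  · intro t _
    refine near_eq_zero _ fun t' _ e => h (-t' + t) ?_
    rw [flow_add]; exact eq_flow_iff.mp e

/-- The motion is injective on the window of a point. -/
theorem two_mul_δ_le_period {x : D.carrier} {p : ℝ} (hp : 0 < p) (h : D.flow p x = x) :
    2 * D.δ < p := by
  by_contra! hc
  obtain ⟨c, τ, hw, e⟩ := exists_window x
  have hm := add_mem_of_window hw (h := p) (by rwa [abs_of_pos hp])
  have h1 := ArcAtlas.flow_eq (mem_of_window hw) e hm
  rw [h, e] at h1
  have := D.injOn c (mem_of_window hw) hm h1
  linarith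

/-- A closed component passes each of its corners once in a period. -/
theorem passages_period {x : D.carrier} {p : ℝ} (hp : 0 < p)
    (h : ∀ a, D.flow a x = x ↔ ∃ m : ℤ, a = m * p) {c : K} {T : ℝ} (hT : D.flow T x = D.corner c) :
    passages x c p = 1 := by
  have hpx : D.flow p x = x := (h p).mpr ⟨1, by simp⟩
  have hδ := two_mul_δ_le_period hp hpx
  have hδ0 := D.δ_pos
  have hper : Function.Periodic (fun t => D.near c (deriv (ramp D.δ)) (D.flow t x)) p := by
    intro t
    simp only [flow_add, hpx]
  -- move the period so that the passage, at the time `T`, is in its middle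
  have e1 : passages x c p = ∫ t in (T - p / 2)..(T - p / 2 + p),
      D.near c (deriv (ramp D.δ)) (D.flow t x) := by
    have := hper.intervalIntegral_add_eq 0 (T - p / 2)
    rwa [zero_add] at this
  have e2 : EqOn (fun t => D.near c (deriv (ramp D.δ)) (D.flow t x))
      (fun t => deriv (ramp D.δ) (t - T)) (uIcc (T - p / 2) (T - p / 2 + p)) := by
    intro t ht
    rw [uIcc_of_le (by linarith)] at ht
    have ht' : |t - T| ≤ p / 2 := abs_le.mpr ⟨by linarith [ht.1], by linarith [ht.2]⟩
    have ex : D.flow t x = D.flow (t - T) (D.corner c) := by rw [← hT, ← flow_add, sub_add_cancel]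
    by_cases hc : |t - T| ≤ D.δ
    · simp only; rw [ex, near_flow_corner _ hc]
    · push Not at hc
      simp only
      rw [deriv_ramp_eq_zero hδ0 hc.le]
      refine near_eq_zero _ fun t' ht' e => ?_
      have h1 : D.flow (-(t' + T) + t) x = x := by
        rw [flow_add, e, ← hT, ← flow_add, ← flow_add,
          show -(t' + T) + t' + T = 0 by ring, flow_zero]
      obtain ⟨m, hm⟩ := (h _).mp h1
      have hm' : t - T = t' + m * p := by linarith
      rcases lt_trichotomy m 0 with h0 | h0 | h0
      · have h2 : (m : ℝ) ≤ -1 := by exact_mod_cast Int.le_sub_one_of_lt h0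
        rw [abs_le] at *
        nlinarith
      · rw [h0] at hm'; simp at hm'; rw [hm'] at hc; linarith
      · have h2 : (1 : ℝ) ≤ m := by exact_mod_cast h0
        rw [abs_le] at *
        nlinarith
  rw [e1, intervalIntegral.integral_congr e2, intervalIntegral.integral_comp_sub_right,
    intervalIntegral.integral_deriv_eq_sub (fun t _ => (hasDerivAt_ramp _ t).differentiableAt)
      ((continuous_deriv_ramp _).intervalIntegrable _ _),
    ramp_eq_one hδ0 (by linarith), ramp_eq_zero hδ0 (by linarith), sub_zero]

/-- A component that is not closed passes each of its corners only once. -/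
theorem passages_line {x : D.carrier} (h : ∀ a, D.flow a x = x → a = 0) {c : K} {T : ℝ}
    (hT : D.flow T x = D.corner c) (s : ℝ) :
    passages x c s = ramp D.δ (s - T) - ramp D.δ (-T) := by
  have hδ0 := D.δ_pos
  have e2 : (fun t => D.near c (deriv (ramp D.δ)) (D.flow t x)) =
      fun t => deriv (ramp D.δ) (t - T) := by
    funext t
    have ex : D.flow t x = D.flow (t - T) (D.corner c) := by rw [← hT, ← flow_add, sub_add_cancel]
    by_cases hc : |t - T| ≤ D.δ
    · rw [ex, near_flow_corner _ hc]
    · push Not at hc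
      rw [deriv_ramp_eq_zero hδ0 hc.le]
      refine near_eq_zero _ fun t' ht' e => ?_
      have h1 : D.flow (-(t' + T) + t) x = x := by
        rw [flow_add, e, ← hT, ← flow_add, ← flow_add,
          show -(t' + T) + t' + T = 0 by ring, flow_zero]
      have := h _ h1
      rw [show t' = t - T by linarith] at ht'
      linarith
  rw [passages, e2, intervalIntegral.integral_comp_sub_right,
    intervalIntegral.integral_deriv_eq_sub (fun t _ => (hasDerivAt_ramp _ t).differentiableAt)
      ((continuous_deriv_ramp _).intervalIntegrable _ _), zero_sub]

open Classical in
theorem exists_tendsto_passages {x : D.carrier} (h : ∀ a, D.flow a x = x → a = 0) (c : K) :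
    ∃ a b, Tendsto (passages x c) atBot (𝓝 a) ∧ Tendsto (passages x c) atTop (𝓝 b) ∧
      b - a = if ∃ T, D.flow T x = D.corner c then 1 else 0 := by
  have hδ0 := D.δ_pos
  by_cases hc : ∃ T, D.flow T x = D.corner c
  · obtain ⟨T, hT⟩ := hc
    refine ⟨0 - ramp D.δ (-T), 1 - ramp D.δ (-T), ?_, ?_, by rw [if_pos ⟨T, hT⟩]; ring⟩
    · refine tendsto_const_nhds.congr' ?_
      filter_upwards [eventually_le_atBot (T - D.δ)] with s hs
      rw [passages_line h hT, ramp_eq_zero (t := s - T) hδ0 (by linarith)]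
    · refine tendsto_const_nhds.congr' ?_
      filter_upwards [eventually_ge_atTop (T + D.δ)] with s hs
      rw [passages_line h hT, ramp_eq_one (t := s - T) hδ0 (by linarith)]
  · have h0 : passages x c = fun _ => 0 := funext fun s =>
      passages_eq_zero (fun T hT => hc ⟨T, hT⟩) s
    exact ⟨0, 0, by rw [h0]; exact tendsto_const_nhds, by rw [h0]; exact tendsto_const_nhds,
      by rw [if_neg hc, sub_zero]⟩

end ArcAtlas

namespace PlaneAtlas

open ArcAtlas

variable {K Y : Type*} {D : PlaneAtlas K Y}

variable (D) in
/-- The path in the plane of the motion that starts at `x`. -/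
def planePath (x : D.carrier) (s : ℝ) : ℝ × ℝ := D.pos (D.flow s x).1

/-- Near any time, the path in the plane consists of at most two segments. -/
theorem planePath_add {x : D.carrier} {s h : ℝ} {c : K} {τ : ℝ} (hx : D.Window (D.flow s x) c τ)
    (hh : |h| ≤ D.δ) : D.planePath x (s + h) =
      D.pos (D.arc c 0) + min (τ + h) 0 • D.dIn c + max (τ + h) 0 • D.dOut c := by
  rw [planePath, add_comm s h, flow_add, hx.flow_eq hh, D.pos_arc _ _ (hx.add_mem hh)]

variable (D) in
/-- The velocity on the arc `c` at the time `τ ≠ 0`. -/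
def velocity (c : K) (τ : ℝ) : ℝ × ℝ := if 0 < τ then D.dOut c else D.dIn c

theorem hasDerivWithinAt_Ici {x : D.carrier} {s : ℝ} {c : K} {τ : ℝ}
    (hx : D.Window (D.flow s x) c τ) (hτ : 0 ≤ τ) :
    HasDerivWithinAt (D.planePath x) (D.dOut c) (Ici s) s := by
  have h1 : HasDerivWithinAt (fun t => D.pos (D.arc c 0) + (τ + (t - s)) • D.dOut c)
      (D.dOut c) (Ici s) s := by
    have := ((((hasDerivAt_id s).sub_const s).const_add τ).smul_const (D.dOut c)).const_add
      (D.pos (D.arc c 0))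
    simpa using this.hasDerivWithinAt
  have key : ∀ t, s ≤ t → |t - s| ≤ D.δ →
      D.planePath x t = D.pos (D.arc c 0) + (τ + (t - s)) • D.dOut c := by
    intro t h2 h3
    have := planePath_add hx h3
    rw [add_sub_cancel, min_eq_right (by linarith), max_eq_left (by linarith)] at this
    simpa using this
  refine h1.congr_of_eventuallyEq ?_ (key s le_rfl (by simpa using D.δ_pos.le))
  filter_upwards [self_mem_nhdsWithin, mem_nhdsWithin_of_mem_nhds (Metric.ball_mem_nhds s D.δ_pos)]
    with t ht ht'
  exact key t ht (by rw [Metric.mem_ball, Real.dist_eq] at ht'; exact ht'.le)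

theorem hasDerivWithinAt_Iic {x : D.carrier} {s : ℝ} {c : K} {τ : ℝ}
    (hx : D.Window (D.flow s x) c τ) (hτ : τ ≤ 0) :
    HasDerivWithinAt (D.planePath x) (D.dIn c) (Iic s) s := by
  have h1 : HasDerivWithinAt (fun t => D.pos (D.arc c 0) + (τ + (t - s)) • D.dIn c)
      (D.dIn c) (Iic s) s := by
    have := ((((hasDerivAt_id s).sub_const s).const_add τ).smul_const (D.dIn c)).const_add
      (D.pos (D.arc c 0))
    simpa using this.hasDerivWithinAt
  have key : ∀ t, t ≤ s → |t - s| ≤ D.δ →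
      D.planePath x t = D.pos (D.arc c 0) + (τ + (t - s)) • D.dIn c := by
    intro t h2 h3
    have := planePath_add hx h3
    rw [add_sub_cancel, min_eq_left (by linarith), max_eq_right (by linarith)] at this
    simpa using this
  refine h1.congr_of_eventuallyEq ?_ (key s le_rfl (by simpa using D.δ_pos.le))
  filter_upwards [self_mem_nhdsWithin, mem_nhdsWithin_of_mem_nhds (Metric.ball_mem_nhds s D.δ_pos)]
    with t ht ht'
  exact key t ht (by rw [Metric.mem_ball, Real.dist_eq] at ht'; exact ht'.le)

theorem hasDerivAt_planePath {x : D.carrier} {s : ℝ} {c : K} {τ : ℝ}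
    (hx : D.Window (D.flow s x) c τ) (hτ : τ ≠ 0) :
    HasDerivAt (D.planePath x) (D.velocity c τ) s := by
  have hδ := D.δ_pos
  rcases lt_or_gt_of_ne hτ with h | h
  · have h1 : HasDerivAt (fun t => D.pos (D.arc c 0) + (τ + (t - s)) • D.dIn c) (D.dIn c) s := by
      have := ((((hasDerivAt_id s).sub_const s).const_add τ).smul_const (D.dIn c)).const_add
        (D.pos (D.arc c 0))
      simpa using this
    rw [velocity, if_neg h.not_gt]
    refine h1.congr_of_eventuallyEq ?_
    filter_upwards [Metric.ball_mem_nhds s hδ, Metric.ball_mem_nhds s (neg_pos.mpr h)] with t ht ht'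
    rw [Metric.mem_ball, Real.dist_eq] at ht ht'
    have := planePath_add hx ht.le
    rw [abs_lt] at ht'
    rw [add_sub_cancel, min_eq_left (by linarith), max_eq_right (by linarith)] at this
    simpa using this
  · have h1 : HasDerivAt (fun t => D.pos (D.arc c 0) + (τ + (t - s)) • D.dOut c) (D.dOut c) s := by
      have := ((((hasDerivAt_id s).sub_const s).const_add τ).smul_const (D.dOut c)).const_add
        (D.pos (D.arc c 0))
      simpa using this
    rw [velocity, if_pos h]
    refine h1.congr_of_eventuallyEq ?_
    filter_upwards [Metric.ball_mem_nhds s hδ, Metric.ball_mem_nhds s h] with t ht ht'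
    rw [Metric.mem_ball, Real.dist_eq] at ht ht'
    have := planePath_add hx ht.le
    rw [abs_lt] at ht'
    rw [add_sub_cancel, min_eq_right (by linarith), max_eq_left (by linarith)] at this
    simpa using this

theorem dIn_ne_zero (c : K) : toC (D.dIn c) ≠ 0 := by
  intro h
  have := D.norm_dIn c
  rw [h] at this
  simp at this

theorem dIn_ne_dOut (c : K) : D.dIn c ≠ D.dOut c := by
  intro h
  have h1 := D.toC_dOut c
  rw [← h, left_eq_mul₀ (dIn_ne_zero c)] at h1
  have h2 := congrArg Complex.im h1
  rw [Complex.exp_ofReal_mul_I_im, Complex.one_im] at h2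
  exact (Real.sin_pos_of_pos_of_lt_pi (D.angle_pos c) (D.angle_lt c)).ne' h2

theorem not_differentiableAt {x : D.carrier} {s : ℝ} {c : K}
    (hx : D.Window (D.flow s x) c 0) : ¬ DifferentiableAt ℝ (D.planePath x) s := by
  intro h
  have h1 := h.hasDerivAt.hasDerivWithinAt (s := Ici s)
  have h2 := h.hasDerivAt.hasDerivWithinAt (s := Iic s)
  have e1 := (uniqueDiffWithinAt_Ici s).eq_deriv _ h1 (hasDerivWithinAt_Ici hx le_rfl)
  have e2 := (uniqueDiffWithinAt_Iic s).eq_deriv _ h2 (hasDerivWithinAt_Iic hx le_rfl)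
  exact dIn_ne_dOut c (e2.symm.trans e1)

variable (D) in
/-- A smoothing of the direction of the motion. -/
def heading (c : K) (τ : ℝ) : ℂ :=
  toC (D.dIn c) * Complex.exp ((D.angle c * ramp D.δ τ : ℝ) * Complex.I)

theorem norm_heading (c : K) (τ : ℝ) : ‖D.heading c τ‖ = 1 := by
  rw [heading, norm_mul, D.norm_dIn, Complex.norm_exp_ofReal_mul_I, one_mul]

theorem heading_eq_velocity {c : K} {τ : ℝ} (hτ : D.δ ≤ |τ|) :
    D.heading c τ = toC (D.velocity c τ) := by
  have hδ := D.δ_pos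
  rw [heading, velocity]
  rcases le_abs'.mp hτ with h | h
  · rw [ramp_eq_zero hδ h, if_neg (by linarith)]; simp
  · rw [ramp_eq_one hδ h, if_pos (by linarith), D.toC_dOut, mul_one]

/-- The smoothed direction does not depend on the arc: two arcs overlap only away from their
corners, where it is the velocity of the path. -/
theorem heading_eq_heading {x : D.carrier} {c c' : K} {τ τ' : ℝ} (hx : D.Window x c τ)
    (hx' : D.Window x c' τ') : D.heading c τ = D.heading c' τ' := by
  have hδ := D.δ_pos
  by_cases h : |τ| ≤ D.δ
  · obtain ⟨rfl, rfl⟩ := hx'.corner_eq h hx.eq_flow_corner; rfl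
  by_cases h' : |τ'| ≤ D.δ
  · obtain ⟨rfl, rfl⟩ := hx.corner_eq h' hx'.eq_flow_corner; rfl
  push Not at h h'
  rw [heading_eq_velocity h.le, heading_eq_velocity h'.le]
  rw [← flow_zero x] at hx hx'
  have h1 := hasDerivAt_planePath (x := x) (s := 0) hx (by rintro rfl; simp at h; linarith)
  have h2 := hasDerivAt_planePath (x := x) (s := 0) hx' (by rintro rfl; simp at h'; linarith)
  rw [h1.unique h2]

variable [Fintype K]

/-- A continuous choice of the argument of the smoothed direction of the motion. -/
theorem exists_lift (x : D.carrier) : ∃ Θ₀ : ℝ, ∀ s c τ, D.Window (D.flow s x) c τ →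
    Complex.exp ((Θ₀ + ∑ c, D.angle c * passages x c s : ℝ) * Complex.I) = D.heading c τ := by
  have hwin : ∀ y : D.carrier, ∃ q : K × ℝ, D.Window y q.1 q.2 := fun y => by
    obtain ⟨c, τ, h⟩ := exists_window_flow y
    have := h 0 (by simpa using D.δ_pos.le)
    rw [flow_zero] at this
    exact ⟨(c, _), this⟩
  choose q hq using hwin
  set A : ℝ → ℝ := fun s => ∑ c, D.angle c * passages x c s with hA
  set U : ℝ → ℂ := fun s => D.heading (q (D.flow s x)).1 (q (D.flow s x)).2 with hU
  have hUw : ∀ s c τ, D.Window (D.flow s x) c τ → U s = D.heading c τ := fun s c τ h =>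
    heading_eq_heading (hq _) h
  -- the direction `U`, turned back by the angle `A`, is locally constant
  set F : ℝ → ℂ := fun s => Complex.exp (((-A s : ℝ) : ℂ) * Complex.I) * U s with hF
  have hd : ∀ s, HasDerivAt F 0 s := by
    intro s
    obtain ⟨c, τ, hw⟩ := exists_window_flow (D.flow s x)
    have hw0 := hw 0 (by simpa using D.δ_pos.le)
    rw [flow_zero, add_zero] at hw0
    have h1 : HasDerivAt (fun t => -A t + D.angle c * ramp D.δ (τ + (t - s))) 0 s := by
      have hA' : HasDerivAt A (D.angle c * deriv (ramp D.δ) τ) s := by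
        have := HasDerivAt.fun_sum (u := Finset.univ) (A := fun c s => D.angle c * passages x c s)
          fun c _ => (hasDerivAt_passages x c s).const_mul (D.angle c)
        rw [Finset.sum_eq_single c (fun c' _ h => by rw [hw0.near_ne _ h.symm, mul_zero])
          (by simp), hw0.near_eq fun t => deriv_ramp_eq_zero D.δ_pos] at this
        exact this
      have hr : HasDerivAt (fun t => ramp D.δ (τ + (t - s))) (deriv (ramp D.δ) τ) s := by
        have h2 : HasDerivAt (fun t => τ + (t - s)) 1 s :=
          ((hasDerivAt_id s).sub_const s).const_add τ
        have h3 : HasDerivAt (ramp D.δ) (deriv (ramp D.δ) τ) (τ + (s - s)) := by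
          rw [sub_self, add_zero]; exact hasDerivAt_ramp _ _
        have h4 := h3.comp s h2
        rw [mul_one] at h4
        exact h4
      have h5 := hA'.neg.add (hr.const_mul (D.angle c))
      rw [neg_add_cancel] at h5
      exact h5
    have h2 := ((h1.ofReal_comp.mul_const Complex.I).cexp).const_mul (toC (D.dIn c))
    simp only [Complex.ofReal_zero, zero_mul, mul_zero] at h2
    refine h2.congr_of_eventuallyEq ?_
    filter_upwards [Metric.ball_mem_nhds s D.δ_pos] with t ht
    rw [Metric.mem_ball, Real.dist_eq] at ht
    have hwt := hw (t - s) ht.le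
    rw [← flow_add, sub_add_cancel] at hwt
    simp only [hF]
    rw [hUw t _ _ hwt, heading, Complex.ofReal_add, add_mul, Complex.exp_add]
    ring
  have hconst := fun s => is_const_of_deriv_eq_zero (fun t => (hd t).differentiableAt)
    (fun t => (hd t).deriv) s 0
  have hnorm : ‖F 0‖ = 1 := by
    simp only [hF, norm_mul, Complex.norm_exp_ofReal_mul_I, hU, norm_heading, mul_one]
  refine ⟨(F 0).arg, fun s c τ h => ?_⟩
  have h0 : Complex.exp ((F 0).arg * Complex.I) = F 0 := by
    have := Complex.norm_mul_exp_arg_mul_I (F 0)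
    rwa [hnorm, Complex.ofReal_one, one_mul] at this
  rw [Complex.ofReal_add, add_mul, Complex.exp_add, h0, ← hconst s]
  simp only [hF]
  rw [mul_comm, ← mul_assoc, ← Complex.exp_add, ← hUw s c τ h]
  simp [hA]

omit [Fintype K] in
/-- The velocities of the path at times near `s` are the incoming and the outgoing velocity of one
corner, so their convex combinations are on a segment. -/
theorem exists_segment {x : D.carrier} {ε : ℝ} (hε : ε ≤ D.δ) {s : ℝ} {c : K} {τ : ℝ}
    (hw : ∀ h, |h| ≤ D.δ → D.Window (D.flow h (D.flow s x)) c (τ + h)) {y : ℝ × ℝ}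
    (hy : y ∈ convexHull ℝ (deriv (D.planePath x) ''
      {t | |t - s| < ε ∧ DifferentiableAt ℝ (D.planePath x) t})) :
    y ∈ segment ℝ (D.dIn c) (D.dOut c) := by
  refine convexHull_min ?_ (convex_segment _ _) hy
  rintro _ ⟨t, ⟨ht, hd⟩, rfl⟩
  have hwt := hw (t - s) (by linarith)
  rw [← flow_add, sub_add_cancel] at hwt
  have h0 : τ + (t - s) ≠ 0 := by
    intro h0
    rw [h0] at hwt
    exact not_differentiableAt hwt hd
  rw [(hasDerivAt_planePath hwt h0).deriv, velocity]
  split_ifs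
  · exact right_mem_segment _ _ _
  · exact left_mem_segment _ _ _

end PlaneAtlas

namespace PlaneAtlas

open ArcAtlas

variable {K Y : Type*} {D : PlaneAtlas K Y} [Fintype K]

/-- A component that is not closed stays away from the corners from some time on, in both
directions. -/
theorem eventually_velocity {x : D.carrier} (hx : ∀ a, D.flow a x = x → a = 0) :
    (∀ᶠ s in atTop, ∃ c τ, D.δ < |τ| ∧ ∀ h, |h| ≤ D.δ → D.Window (D.flow (s + h) x) c (τ + h)) ∧
    ∀ᶠ s in atBot, ∃ c τ, D.δ < |τ| ∧ ∀ h, |h| ≤ D.δ → D.Window (D.flow (s + h) x) c (τ + h) := by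
  have hδ := D.δ_pos
  have key : ∀ {c T}, D.flow T x = D.corner c → ∀ s,
      Icc (s - T - 2 * D.δ) (s - T + 2 * D.δ) ⊆ D.dom c →
      ∀ h, |h| ≤ D.δ → D.Window (D.flow (s + h) x) c (s - T + h) := by
    intro c T hT s hs h hh
    rw [abs_le] at hh
    refine ⟨fun t ht => hs ⟨by linarith [ht.1], by linarith [ht.2]⟩, ?_⟩
    have e : D.flow (s + h) x = D.flow (s - T + h) (D.corner c) := by
      rw [← hT, ← flow_add]; congr 2; ring
    rw [e, flow_corner (hs ⟨by linarith, by linarith⟩)]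
  constructor
  · obtain ⟨c, T, hc, hT⟩ := exists_leaf hx (Or.inl rfl)
    filter_upwards [eventually_gt_atTop (T + 2 * D.δ)] with s hs
    refine ⟨c, s - T, by rw [abs_of_pos] <;> linarith, key hT s fun t ht => ?_⟩
    have := hc t (by linarith [ht.1])
    rwa [one_mul] at this
  · obtain ⟨c, T, hc, hT⟩ := exists_leaf hx (Or.inr rfl)
    filter_upwards [eventually_lt_atBot (T - 2 * D.δ)] with s hs
    refine ⟨c, s - T, by rw [abs_of_neg] <;> linarith, key hT s fun t ht => ?_⟩
    have := hc (-t) (by linarith [ht.2])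
    rwa [neg_one_mul, neg_neg] at this

open Classical in
/-- The Gauss map of a small smooth deformation turns, along a component, by the sum of the angles
at the corners of this component: the velocity of the deformation is never opposite to the smoothed
direction `heading`, so its argument differs from that of `heading` by a principal value, which
takes the same value at both ends. -/
theorem gaussMapTurnsBy {x : D.carrier} {p : ℝ} (hp0 : 0 ≤ p)
    (hp : ∀ a, D.flow a x = x ↔ ∃ m : ℤ, a = m * p) {ε : ℝ} (hε : ε ≤ D.δ)
    (hεc : ∀ c, 2 * ε ≤ Real.cos (D.angle c / 2)) {g : ℝ → ℝ × ℝ} (hg : ContDiff ℝ ∞ g)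
    (hper : ∀ s, g (s + p) = g s)
    (hclose : ∀ s, ∃ y ∈ convexHull ℝ (deriv (D.planePath x) ''
      {t | |t - s| < ε ∧ DifferentiableAt ℝ (D.planePath x) t}), dist (deriv g s) y < ε)
    (htop : p = 0 → Tendsto (fun s => deriv g s - deriv (D.planePath x) s) atTop (𝓝 0))
    (hbot : p = 0 → Tendsto (fun s => deriv g s - deriv (D.planePath x) s) atBot (𝓝 0)) :
    SimpleRealTropicalCurve.GaussMapTurnsBy g p
      (∑ c, if ∃ T, D.flow T x = D.corner c then D.angle c else 0) := by
  obtain ⟨Θ₀, hΘ⟩ := exists_lift x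
  set Θ : ℝ → ℝ := fun s => Θ₀ + ∑ c, D.angle c * passages x c s with hΘdef
  have hΘc : Continuous Θ := by
    refine continuous_const.add (continuous_finsetSum _ fun c _ => continuous_const.mul ?_)
    exact continuous_iff_continuousAt.mpr fun s => (hasDerivAt_passages x c s).continuousAt
  -- the velocity of the deformation relative to the smoothed direction
  set z : ℝ → ℂ := fun s => toC (deriv g s) * (Complex.exp (Θ s * Complex.I))⁻¹ with hz
  have hzc : Continuous z := by
    have h1 : Continuous (deriv g) := hg.continuous_deriv (by simp)
    exact (toC.continuous.comp h1).mul
      (Continuous.inv₀ (by fun_prop) fun s => Complex.exp_ne_zero _)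
  have hslit : ∀ s, z s ∈ Complex.slitPlane := by
    intro s
    obtain ⟨c, τ, hw⟩ := exists_window_flow (D.flow s x)
    have hw0 := hw 0 (by simpa using D.δ_pos.le)
    rw [flow_zero, add_zero] at hw0
    obtain ⟨y, hy, hd⟩ := hclose s
    have hy' := exists_segment hε hw hy
    simp only [hz, hΘdef]
    rw [hΘ s c τ hw0, heading]
    have h1 : ‖toC (deriv g s) - toC y‖ < Real.cos (D.angle c / 2) := by
      rw [← map_sub]
      rw [dist_eq_norm] at hd
      linarith [norm_toC_le (deriv g s - y), hεc c]
    refine mul_exp_mem_slitPlane (D.norm_dIn c) (D.angle_lt c)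
      (mul_nonneg (D.angle_pos c).le (ramp_nonneg _ _))
      (mul_le_of_le_one_right (D.angle_pos c).le (ramp_le_one _ _)) ?_ h1
    rw [← D.toC_dOut]
    have h2 := mem_image_of_mem toC hy'
    have h3 := image_segment ℝ toC.toLinearEquiv.toLinearMap.toAffineMap (D.dIn c) (D.dOut c)
    exact h3 ▸ h2
  -- the Gauss map is the velocity turned by a right angle
  refine ⟨fun s => Θ s + (z s).arg + Real.pi / 2, ?_, fun s => ?_, ?_⟩
  · refine (hΘc.add ?_).add continuous_const
    exact continuous_iff_continuousAt.mpr fun s =>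
      (Complex.continuousAt_arg (hslit s)).comp hzc.continuousAt
  · refine ⟨‖z s‖, norm_ne_zero_iff.mpr (Complex.slitPlane_ne_zero (hslit s)), ?_⟩
    have h1 : toC (deriv g s) =
        ‖z s‖ * Complex.exp ((Θ s + (z s).arg : ℝ) * Complex.I) := by
      rw [Complex.ofReal_add, add_mul, Complex.exp_add, mul_left_comm,
        Complex.norm_mul_exp_arg_mul_I, hz]
      field_simp
    have hre := congrArg Complex.re h1
    have him := congrArg Complex.im h1
    rw [Complex.re_ofReal_mul, Complex.exp_ofReal_mul_I_re] at hre
    rw [Complex.im_ofReal_mul, Complex.exp_ofReal_mul_I_im] at him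
    simp at hre him
    rw [Real.cos_add_pi_div_two, Real.sin_add_pi_div_two, hre, him]
    simp
  · rcases hp0.eq_or_lt with rfl | hp1
    · right
      refine ⟨rfl, ?_⟩
      have hx : ∀ a, D.flow a x = x → a = 0 := fun a ha => by
        obtain ⟨m, hm⟩ := (hp a).mp ha; simpa using hm
      choose a b ha hb hab using exists_tendsto_passages hx
      have hlim : ∀ {l : Filter ℝ}, (∀ᶠ s in l, ∃ c τ, D.δ < |τ| ∧ ∀ h, |h| ≤ D.δ →
          D.Window (D.flow (s + h) x) c (τ + h)) →
          Tendsto (fun s => deriv g s - deriv (D.planePath x) s) l (𝓝 0) →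
          Tendsto (fun s => (z s).arg) l (𝓝 0) := by
        intro l hev ht
        have h1 : Tendsto z l (𝓝 1) := by
          rw [tendsto_iff_norm_sub_tendsto_zero]
          have h2 := ((toC.continuous.tendsto 0).comp ht).norm
          rw [map_zero, norm_zero] at h2
          refine h2.congr' ?_
          filter_upwards [hev] with s ⟨c, τ, hτ, hw⟩
          have hw0 := hw 0 (by simpa using D.δ_pos.le)
          rw [add_zero, add_zero] at hw0
          have hτ0 : τ ≠ 0 := by
            rintro rfl
            simp at hτ
            linarith [D.δ_pos]
          have e1 := hΘ s c τ hw0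
          rw [heading_eq_velocity hτ.le, ← (hasDerivAt_planePath hw0 hτ0).deriv] at e1
          have e2 : z s - 1 = toC (deriv g s - deriv (D.planePath x) s) *
              (Complex.exp (Θ s * Complex.I))⁻¹ := by
            simp only [hz]
            rw [map_sub, ← e1, sub_mul, mul_inv_cancel₀ (Complex.exp_ne_zero _)]
          rw [e2, norm_mul, norm_inv, Complex.norm_exp_ofReal_mul_I, inv_one, mul_one]
          rfl
        have h3 := (Complex.continuousAt_arg Complex.one_mem_slitPlane).tendsto.comp h1
        rwa [Complex.arg_one] at h3
      obtain ⟨hev1, hev2⟩ := eventually_velocity hx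
      refine ⟨Θ₀ + ∑ c, D.angle c * a c + 0 + Real.pi / 2,
        Θ₀ + ∑ c, D.angle c * b c + 0 + Real.pi / 2, ?_, ?_, ?_⟩
      · refine Tendsto.add_const _ (Tendsto.add ?_ (hlim hev2 (hbot rfl)))
        exact tendsto_const_nhds.add (tendsto_finsetSum _ fun c _ => (ha c).const_mul _)
      · refine Tendsto.add_const _ (Tendsto.add ?_ (hlim hev1 (htop rfl)))
        exact tendsto_const_nhds.add (tendsto_finsetSum _ fun c _ => (hb c).const_mul _)
      · rw [show Θ₀ + ∑ c, D.angle c * b c + 0 + Real.pi / 2 -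
          (Θ₀ + ∑ c, D.angle c * a c + 0 + Real.pi / 2) =
          ∑ c, D.angle c * b c - ∑ c, D.angle c * a c by ring, ← Finset.sum_sub_distrib]
        refine Finset.sum_congr rfl fun c _ => ?_
        rw [← mul_sub, hab c]
        split_ifs <;> simp
    · left
      refine ⟨hp1, ?_⟩
      have hpx : D.flow p x = x := (hp p).mpr ⟨1, by simp⟩
      have hzp : z p = z 0 := by
        obtain ⟨c, τ, hw⟩ := exists_window_flow x
        have hw0 := hw 0 (by simpa using D.δ_pos.le)
        have hwp : D.Window (D.flow p x) c (τ + 0) := by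
          rw [hpx]; rwa [flow_zero] at hw0
        have hd : deriv g p = deriv g 0 := by
          have : (fun s => g (s + p)) = g := funext hper
          have h1 := congrFun (congrArg deriv this) 0
          rwa [deriv_comp_add_const, zero_add] at h1
        simp only [hz, hd, hΘdef]
        rw [hΘ _ _ _ hw0, hΘ _ _ _ hwp]
      have h0 : ∀ c, passages x c 0 = 0 := fun c => by simp [passages]
      simp only [hzp, hΘdef, h0]
      rw [show ∀ u v w y : ℝ, u + v + w + y - (u + ∑ c : K, D.angle c * 0 + w + y) = v by
        intros; simp]
      refine Finset.sum_congr rfl fun c _ => ?_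
      split_ifs with hc
      · obtain ⟨T, hT⟩ := hc
        rw [passages_period hp1 hp hT, mul_one]
      · rw [passages_eq_zero (fun T hT => hc ⟨T, hT⟩), mul_zero]

variable (D) in
/-- The map to the plane with its corners smoothed, by the parameter `η`. -/
def smoothPos (η : ℝ) (y : D.carrier) : ℝ × ℝ := D.pos y.1 +
  ∑ c, D.near c (fun t => (smoothMax η t - max t 0) • (D.dOut c - D.dIn c)) y

theorem smoothPos_eq {η : ℝ} (hη : 0 < η) (hηδ : η ≤ D.δ) {y : D.carrier} {c : K} {τ : ℝ}
    (hy : D.Window y c τ) : D.smoothPos η y =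
      D.pos y.1 + (smoothMax η τ - max τ 0) • (D.dOut c - D.dIn c) := by
  rw [smoothPos, hy.sum_near (φ := fun c t => (smoothMax η t - max t 0) • (D.dOut c - D.dIn c))]
  intro t ht
  rw [smoothMax_sub_max_eq_zero hη (hηδ.trans ht), zero_smul]

/-- In a window, `max τ 0` is replaced by `smoothMax η τ` in the formula for the position. -/
theorem smoothPos_flow {η : ℝ} (hη : 0 < η) (hηδ : η ≤ D.δ) {x : D.carrier} {s : ℝ} {c : K} {τ : ℝ}
    (hw : ∀ h, |h| ≤ D.δ → D.Window (D.flow h (D.flow s x)) c (τ + h)) {t : ℝ}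
    (ht : |t - s| ≤ D.δ) : D.smoothPos η (D.flow t x) = D.pos (D.arc c 0) +
      (τ + (t - s)) • D.dIn c + smoothMax η (τ + (t - s)) • (D.dOut c - D.dIn c) := by
  have hwt := hw (t - s) ht
  rw [← flow_add, sub_add_cancel] at hwt
  rw [smoothPos_eq hη hηδ hwt, hwt.2, D.pos_arc _ _ hwt.mem]
  generalize τ + (t - s) = r
  have e : min r 0 = r - max r 0 := by linarith [min_add_max r 0]
  rw [e]
  ext <;> simp <;> ring

omit [Fintype K] in
theorem norm_dOut_sub_dIn_le (c : K) : ‖D.dOut c - D.dIn c‖ ≤ 2 := by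
  have h1 : ∀ p : ℝ × ℝ, ‖p‖ ≤ ‖toC p‖ := fun p => by
    have e1 := Complex.abs_re_le_norm (toC p)
    have e2 := Complex.abs_im_le_norm (toC p)
    simp only [toC_apply] at *
    simp at e1 e2
    rw [Prod.norm_def]
    exact max_le e1 e2
  have h2 : ‖toC (D.dOut c)‖ = 1 := by
    rw [D.toC_dOut, norm_mul, D.norm_dIn, Complex.norm_exp_ofReal_mul_I, one_mul]
  calc ‖D.dOut c - D.dIn c‖ ≤ ‖toC (D.dOut c - D.dIn c)‖ := h1 _
    _ ≤ ‖toC (D.dOut c)‖ + ‖toC (D.dIn c)‖ := by rw [map_sub]; exact norm_sub_le _ _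
    _ = 2 := by rw [h2, D.norm_dIn]; norm_num

theorem hasDerivAt_smoothPos {η : ℝ} (hη : 0 < η) (hηδ : η ≤ D.δ) {x : D.carrier} {s : ℝ} {c : K}
    {τ : ℝ} (hw : ∀ h, |h| ≤ D.δ → D.Window (D.flow h (D.flow s x)) c (τ + h)) :
    HasDerivAt (fun s => D.smoothPos η (D.flow s x))
      (D.dIn c + ramp η τ • (D.dOut c - D.dIn c)) s := by
  have h2 : HasDerivAt (fun t => τ + (t - s)) 1 s := ((hasDerivAt_id s).sub_const s).const_add τ
  have h3 : HasDerivAt (smoothMax η) (ramp η τ) (τ + (s - s)) := by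
    rw [sub_self, add_zero]; exact hasDerivAt_smoothMax _ _
  have h4 := h3.comp s h2
  rw [mul_one] at h4
  have h5 := ((h2.smul_const (D.dIn c)).const_add (D.pos (D.arc c 0))).add
    (h4.smul_const (D.dOut c - D.dIn c))
  rw [one_smul] at h5
  refine h5.congr_of_eventuallyEq ?_
  filter_upwards [Metric.ball_mem_nhds s D.δ_pos] with t ht
  rw [Metric.mem_ball, Real.dist_eq] at ht
  exact smoothPos_flow hη hηδ hw ht.le

omit [Fintype K] in
theorem dIn_add_ramp_eq_velocity {η : ℝ} (hη : 0 < η) {c : K} {τ : ℝ} (hτ : η ≤ |τ|) :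
    D.dIn c + ramp η τ • (D.dOut c - D.dIn c) = D.velocity c τ := by
  rw [velocity]
  rcases le_abs'.mp hτ with h | h
  · rw [ramp_eq_zero hη h, if_neg (by linarith)]; simp
  · rw [ramp_eq_one hη h, if_pos (by linarith)]; simp

theorem contDiff_smoothPos {η : ℝ} (hη : 0 < η) (hηδ : η ≤ D.δ) (x : D.carrier) :
    ContDiff ℝ ∞ fun s => D.smoothPos η (D.flow s x) := by
  rw [contDiff_iff_contDiffAt]
  intro s
  obtain ⟨c, τ, hw⟩ := exists_window_flow (D.flow s x)
  have h1 : ContDiff ℝ ∞ fun t => D.pos (D.arc c 0) +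
      (τ + (t - s)) • D.dIn c + smoothMax η (τ + (t - s)) • (D.dOut c - D.dIn c) := by
    have h2 : ContDiff ℝ ∞ fun t : ℝ => τ + (t - s) :=
      contDiff_const.add (contDiff_id.sub contDiff_const)
    exact (contDiff_const.add (h2.smul contDiff_const)).add
      (((contDiff_smoothMax η).comp h2).smul contDiff_const)
  refine h1.contDiffAt.congr_of_eventuallyEq ?_
  filter_upwards [Metric.ball_mem_nhds s D.δ_pos] with t ht
  rw [Metric.mem_ball, Real.dist_eq] at ht
  exact smoothPos_flow hη hηδ hw ht.le

theorem dist_smoothPos_lt {ε η : ℝ} (hη : 0 < η) (hηδ : η ≤ D.δ) (hηε : 2 * η < ε)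
    (x : D.carrier) (s : ℝ) : dist (D.smoothPos η (D.flow s x)) (D.planePath x s) < ε := by
  obtain ⟨c, τ, hw⟩ := exists_window_flow (D.flow s x)
  have hw0 := hw 0 (by simpa using D.δ_pos.le)
  rw [flow_zero] at hw0
  rw [smoothPos_eq hη hηδ hw0, planePath, dist_eq_norm, add_sub_cancel_left, norm_smul,
    Real.norm_eq_abs]
  have h1 := abs_smoothMax_sub_max hη (τ + 0)
  have h2 := norm_dOut_sub_dIn_le (D := D) c
  nlinarith [abs_nonneg (smoothMax η (τ + 0) - max (τ + 0) 0), norm_nonneg (D.dOut c - D.dIn c)]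

/-- The velocity of the smoothing is a convex combination of velocities of the path at nearby times.
-/
theorem deriv_smoothPos_mem {ε η : ℝ} (hη : 0 < η) (hηδ : 2 * η ≤ D.δ) (hηε : 2 * η < ε)
    (x : D.carrier) (s : ℝ) : deriv (fun s => D.smoothPos η (D.flow s x)) s ∈ convexHull ℝ
      (deriv (D.planePath x) '' {t | |t - s| < ε ∧ DifferentiableAt ℝ (D.planePath x) t}) := by
  obtain ⟨c, τ, hw⟩ := exists_window_flow (D.flow s x)
  rw [(hasDerivAt_smoothPos hη (by linarith) hw).deriv]
  have key : ∀ t, |t - s| < ε → |t - s| ≤ D.δ → τ + (t - s) ≠ 0 → D.velocity c (τ + (t - s)) ∈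
      deriv (D.planePath x) '' {t | |t - s| < ε ∧ DifferentiableAt ℝ (D.planePath x) t} := by
    intro t h1 h2 h3
    have hwt := hw (t - s) h2
    rw [← flow_add, sub_add_cancel] at hwt
    have h4 := hasDerivAt_planePath hwt h3
    exact ⟨t, ⟨h1, h4.differentiableAt⟩, h4.deriv⟩
  by_cases hτ : η ≤ |τ|
  · rw [dIn_add_ramp_eq_velocity hη hτ]
    have h0 : τ ≠ 0 := by rintro rfl; simp at hτ; linarith
    have := key s (by simp; linarith) (by simpa using D.δ_pos.le) (by simpa using h0)
    rw [sub_self, add_zero] at this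
    exact subset_convexHull ℝ _ this
  -- both velocities of the corner occur within the time `2 * η`, at the times `η` and `-η`
  · push Not at hτ
    have hτ' := abs_lt.mp hτ
    have h1 : |s + (η - τ) - s| < 2 * η := by rw [abs_lt]; constructor <;> linarith
    have h2 : |s + (-η - τ) - s| < 2 * η := by rw [abs_lt]; constructor <;> linarith
    have k1 := key (s + (η - τ)) (by linarith) (by linarith) (by ring_nf; exact hη.ne')
    have k2 := key (s + (-η - τ)) (by linarith) (by linarith)
      (by ring_nf; exact neg_ne_zero.mpr hη.ne')
    rw [show τ + (s + (η - τ) - s) = η by ring, velocity, if_pos hη] at k1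
    rw [show τ + (s + (-η - τ) - s) = -η by ring, velocity, if_neg (by linarith)] at k2
    have hconv := convex_convexHull ℝ (deriv (D.planePath x) ''
      {t | |t - s| < ε ∧ DifferentiableAt ℝ (D.planePath x) t})
    exact hconv.add_smul_sub_mem (subset_convexHull ℝ _ k2) (subset_convexHull ℝ _ k1)
      ⟨ramp_nonneg _ _, ramp_le_one _ _⟩

theorem eventually_deriv_smoothPos {η : ℝ} (hη : 0 < η) (hηδ : η ≤ D.δ) {x : D.carrier}
    (hx : ∀ a, D.flow a x = x → a = 0) :
    (∀ᶠ s in atTop, deriv (fun s => D.smoothPos η (D.flow s x)) s = deriv (D.planePath x) s) ∧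
    ∀ᶠ s in atBot, deriv (fun s => D.smoothPos η (D.flow s x)) s = deriv (D.planePath x) s := by
  have key : ∀ s, (∃ c τ, D.δ < |τ| ∧ ∀ h, |h| ≤ D.δ → D.Window (D.flow (s + h) x) c (τ + h)) →
      deriv (fun s => D.smoothPos η (D.flow s x)) s = deriv (D.planePath x) s := by
    rintro s ⟨c, τ, hτ, hw⟩
    have hw' : ∀ h, |h| ≤ D.δ → D.Window (D.flow h (D.flow s x)) c (τ + h) := fun h hh => by
      rw [← flow_add, add_comm h s]; exact hw h hh
    have hw0 := hw 0 (by simpa using D.δ_pos.le)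
    rw [add_zero, add_zero] at hw0
    have h0 : τ ≠ 0 := by
      rintro rfl
      simp at hτ
      linarith [D.δ_pos]
    rw [(hasDerivAt_smoothPos hη hηδ hw').deriv, (hasDerivAt_planePath hw0 h0).deriv,
      dIn_add_ramp_eq_velocity hη (hηδ.trans hτ.le)]
  exact ⟨(eventually_velocity hx).1.mono key, (eventually_velocity hx).2.mono key⟩

end PlaneAtlas

/-! ### The real part of a surface glued from phase-tropical lines -/

/-- A ribbon graph with a map to the plane that is affine on the edges and leaves, such that the
three directions at each vertex are in positive cyclic order. -/
structure PlaneRibbon (W : Type) extends Ribbon W where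
  vertexPos : W → ℝ × ℝ
  dir : W × Fin 3 → ℝ × ℝ
  cross_dir : ∀ v i, 0 < cross (dir (v, i)) (dir (v, i + 1))
  dir_opp : ∀ h, IsEdge h → dir (opp h) = -dir h
  vertexPos_opp : ∀ h, IsEdge h → vertexPos (opp h).1 = vertexPos h.1 + len h • dir h

namespace PlaneRibbon

open Ribbon

variable {W : Type} (M : PlaneRibbon W)

/-- The Euclidean norm of the direction of a half-edge. -/
def speed (h : W × Fin 3) : ℝ := ‖toC (M.dir h)‖

/-- The Euclidean length of an edge. -/
def edgeLength (h : W × Fin 3) : ℝ := M.len h * M.speed h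

/-- The real line of a phase-tropical line that passes the corner between the rays `c.2 + 1`
and `c.2`. It comes in over the ray `c.2 + 1`, and goes out over the ray `c.2`. -/
def cornerPoint (c : W × Fin 3) (τ : ℝ) : Torus :=
  if τ ≤ 0 then arm (c.2 + 1) ((-τ / M.speed (c.1, c.2 + 1) : ℝ) : ℂ)
  else arm c.2 ((τ / M.speed c : ℝ) + Real.pi * Complex.I)

/-- The interval of the times for which the real line at a corner stays in its piece. -/
def cornerDom (c : W × Fin 3) : Set ℝ :=
  {τ | (M.IsEdge c → τ < M.edgeLength c) ∧
    (M.IsEdge (c.1, c.2 + 1) → -M.edgeLength (c.1, c.2 + 1) < τ)}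

/-- The real line at a corner, in the surface. -/
def cornerArc (c : W × Fin 3) (τ : ℝ) : M.Surface := M.ptOf c.1 (M.cornerPoint c τ)

variable {M}

theorem dir_ne_zero (h : W × Fin 3) : M.dir h ≠ 0 := by
  intro h0
  have := M.cross_dir h.1 h.2
  rw [show (h.1, h.2) = h from rfl, h0] at this
  simp [cross] at this

theorem speed_pos (h : W × Fin 3) : 0 < M.speed h :=
  norm_pos_iff.mpr fun h0 => dir_ne_zero h (toC.map_eq_zero_iff.mp h0)

theorem speed_opp {h : W × Fin 3} (hE : M.IsEdge h) : M.speed (M.opp h) = M.speed h := by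
  rw [speed, M.dir_opp h hE, map_neg, norm_neg, speed]

theorem edgeLength_pos {h : W × Fin 3} (hE : M.IsEdge h) : 0 < M.edgeLength h :=
  mul_pos (M.len_pos h hE) (speed_pos h)

theorem edgeLength_opp {h : W × Fin 3} (hE : M.IsEdge h) :
    M.edgeLength (M.opp h) = M.edgeLength h := by
  rw [edgeLength, speed_opp hE, M.len_opp h hE, edgeLength]

theorem cornerPoint_of_nonpos {c : W × Fin 3} {τ : ℝ} (h : τ ≤ 0) :
    M.cornerPoint c τ = arm (c.2 + 1) ((-τ / M.speed (c.1, c.2 + 1) : ℝ) : ℂ) := if_pos h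

theorem cornerPoint_of_nonneg {c : W × Fin 3} {τ : ℝ} (h : 0 ≤ τ) :
    M.cornerPoint c τ = arm c.2 ((τ / M.speed c : ℝ) + Real.pi * Complex.I) := by
  rcases h.eq_or_lt with rfl | h
  · rw [cornerPoint_of_nonpos le_rfl]
    simpa using (arm_corner c.2).symm
  · exact if_neg h.not_ge

theorem cornerPoint_mem {c : W × Fin 3} {τ : ℝ} (h : τ ∈ M.cornerDom c) :
    M.cornerPoint c τ ∈ M.pieceSet c.1 := by
  rcases le_total τ 0 with h0 | h0
  · rw [cornerPoint_of_nonpos h0]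
    have hs := speed_pos (M := M) (c.1, c.2 + 1)
    refine arm_mem_pieceSet (by simpa using div_nonneg (by linarith) hs.le) fun hE => ?_
    have := h.2 hE
    rw [edgeLength] at this
    rw [Complex.ofReal_re, div_lt_iff₀ hs]; linarith
  · rw [cornerPoint_of_nonneg h0]
    have hs := speed_pos (M := M) c
    refine arm_mem_pieceSet (by simpa using div_nonneg h0 hs.le) fun hE => ?_
    have := h.1 hE
    rw [edgeLength] at this
    have : τ / M.speed c < M.len c := by rwa [div_lt_iff₀ hs]
    simpa using this

theorem cornerArc_eq {c : W × Fin 3} {τ : ℝ} (h : τ ∈ M.cornerDom c) :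
    M.cornerArc c τ = M.pt c.1 ⟨M.cornerPoint c τ, cornerPoint_mem h⟩ := ptOf_eq _

theorem zero_mem_cornerDom (c : W × Fin 3) : (0 : ℝ) ∈ M.cornerDom c :=
  ⟨fun h => edgeLength_pos h, fun h => neg_lt_zero.mpr (edgeLength_pos h)⟩

/-- The exponentials of logarithmic coordinates on the two real lines of an annulus differ. -/
theorem exp_ofReal_ne (x y : ℝ) : Complex.exp (x : ℂ) ≠ Complex.exp (y + Real.pi * Complex.I) := by
  intro h
  have h1 := congrArg Complex.re h
  rw [Complex.exp_add, Complex.exp_pi_mul_I, ← Complex.ofReal_exp, ← Complex.ofReal_exp] at h1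
  rw [Complex.ofReal_re, mul_neg_one, Complex.neg_re, Complex.ofReal_re] at h1
  linarith [Real.exp_pos x, Real.exp_pos y]

theorem ofReal_eq_of_exp_eq {x y : ℝ} {a : ℂ} (h : Complex.exp (x + a) = Complex.exp (y + a)) :
    x = y := by
  rw [Complex.exp_add, Complex.exp_add] at h
  have h1 := mul_right_cancel₀ (Complex.exp_ne_zero a) h
  have := congrArg norm h1
  simpa [Complex.norm_exp] using this

theorem ofReal_injOn_exp {x y : ℝ} (h : Complex.exp (x : ℂ) = Complex.exp (y : ℂ)) : x = y :=
  ofReal_eq_of_exp_eq (a := 0) (by rwa [add_zero, add_zero])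

/-- Over an edge, the arc of a corner continues as the arc of the next corner. -/
theorem cornerArc_next {c c' : W × Fin 3} (hE : M.IsEdge c)
    (ho : M.opp c = (c'.1, c'.2 + 1)) {τ : ℝ} (h0 : 0 < τ) (h1 : τ < M.edgeLength c) :
    M.cornerArc c τ = M.cornerArc c' (τ - M.edgeLength c) := by
  have hs := speed_pos (M := M) c
  have hl := div_lt_iff₀ hs |>.mpr h1
  have e := pt_arm (M := M.toRibbon) (v := c.1) (i := c.2) hE ho
    (u := (τ / M.speed c : ℝ) + Real.pi * Complex.I)
    (by simpa using div_pos h0 hs) (by simpa using hl)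
  have hs' : M.speed (c'.1, c'.2 + 1) = M.speed c := by rw [← ho, speed_opp hE]
  have e1 : M.flip c ((τ / M.speed c : ℝ) + Real.pi * Complex.I) =
      ((-(τ - M.edgeLength c) / M.speed (c'.1, c'.2 + 1) : ℝ) : ℂ) := by
    rw [hs', Ribbon.flip, edgeLength]
    have : (M.speed c : ℂ) ≠ 0 := by exact_mod_cast hs.ne'
    push_cast
    field_simp
    ring
  have m : τ ∈ M.cornerDom c := ⟨fun _ => h1, fun h => by linarith [edgeLength_pos h]⟩
  have m' : τ - M.edgeLength c ∈ M.cornerDom c' := ⟨fun h => by linarith [edgeLength_pos h],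
    fun _ => by rw [← ho, edgeLength_opp hE]; linarith⟩
  rw [cornerArc_eq m, cornerArc_eq m']
  refine (congrArg (M.pt c.1) (Subtype.ext (cornerPoint_of_nonneg h0.le))).trans
    (e.trans (congrArg (M.pt c'.1) (Subtype.ext ?_)))
  exact (congrArg (arm (c'.2 + 1)) e1).trans (cornerPoint_of_nonpos (by linarith)).symm

/-- The points that lie on the arcs of two different corners. -/
theorem cornerArc_eq_iff {c c' : W × Fin 3} {τ τ' : ℝ} (h : τ ∈ M.cornerDom c)
    (h' : τ' ∈ M.cornerDom c') (e : M.cornerArc c τ = M.cornerArc c' τ') :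
    (c = c' ∧ τ = τ') ∨
    (0 < τ ∧ τ' < 0 ∧ M.IsEdge c ∧ M.opp c = (c'.1, c'.2 + 1) ∧ τ' = τ - M.edgeLength c) ∨
    (0 < τ' ∧ τ < 0 ∧ M.IsEdge c' ∧ M.opp c' = (c.1, c.2 + 1) ∧ τ = τ' - M.edgeLength c') := by
  rw [cornerArc_eq h, cornerArc_eq h', pt_eq_iff_rel] at e
  obtain ⟨v, i⟩ := c
  obtain ⟨v', i'⟩ := c'
  have hs := speed_pos (M := M)
  rcases e with e | ⟨k, j, u, hE, ho, hu0, hu1, hx, hy⟩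
  · left
    rw [Sigma.mk.injEq] at e
    obtain ⟨rfl, e⟩ := e
    have e := congrArg Subtype.val (eq_of_heq e)
    simp only at e
    -- the two points have the same height over each ray
    rcases lt_trichotomy τ 0 with h0 | rfl | h0
    · rw [cornerPoint_of_nonpos h0.le] at e
      have hre : 0 < (((-τ / M.speed (v, i + 1) : ℝ) : ℂ)).re := by
        simpa using div_pos (neg_pos.mpr h0) (hs _)
      rcases le_or_gt τ' 0 with h0' | h0'
      · rw [cornerPoint_of_nonpos h0'] at e
        obtain ⟨hi, he⟩ := eq_of_arm_eq hre
          (by simpa using div_nonneg (neg_nonneg.mpr h0') (hs _).le) e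
        obtain rfl := add_right_cancel hi
        have := ofReal_injOn_exp he
        rw [div_left_inj' (hs _).ne'] at this
        exact ⟨rfl, by linarith⟩
      · rw [cornerPoint_of_nonneg h0'.le] at e
        obtain ⟨hi, he⟩ := eq_of_arm_eq hre (by simpa using div_nonneg h0'.le (hs _).le) e
        exact absurd he (exp_ofReal_ne _ _)
    · have hτ' : τ' = 0 := by
        by_contra hne
        rw [cornerPoint_of_nonneg le_rfl] at e
        rcases lt_or_gt_of_ne hne with h0' | h0'
        · rw [cornerPoint_of_nonpos h0'.le] at e
          have := (eq_of_arm_eq (by simpa using div_pos (neg_pos.mpr h0') (hs _)) (by simp) e.symm).2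
          have := congrArg norm this
          simp [Complex.norm_exp] at this
          exact this.elim hne (hs _).ne'
        · rw [cornerPoint_of_nonneg h0'.le] at e
          have := (eq_of_arm_eq (by simpa using div_pos h0' (hs _)) (by simp) e.symm).2
          have := congrArg norm this
          simp [Complex.norm_exp] at this
          exact this.elim hne (hs _).ne'
      subst hτ'
      rw [cornerPoint_of_nonneg le_rfl, cornerPoint_of_nonneg le_rfl] at e
      simp only [zero_div, Complex.ofReal_zero, zero_add] at e
      rw [corner_injective e]
      exact ⟨rfl, rfl⟩
    · rw [cornerPoint_of_nonneg h0.le] at e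
      have hre : 0 < (((τ / M.speed (v, i) : ℝ) : ℂ) + Real.pi * Complex.I).re := by
        simpa using div_pos h0 (hs _)
      rcases le_or_gt τ' 0 with h0' | h0'
      · rw [cornerPoint_of_nonpos h0'] at e
        obtain ⟨hi, he⟩ := eq_of_arm_eq hre
          (by simpa using div_nonneg (neg_nonneg.mpr h0') (hs _).le) e
        exact absurd he.symm (exp_ofReal_ne _ _)
      · rw [cornerPoint_of_nonneg h0'.le] at e
        obtain ⟨hi, he⟩ := eq_of_arm_eq hre (by simpa using div_nonneg h0'.le (hs _).le) e
        obtain rfl : i = i' := hi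
        have := ofReal_eq_of_exp_eq he
        rw [div_left_inj' (hs _).ne'] at this
        exact ⟨rfl, this⟩
  · right
    simp only at hE ho hu1 hx hy
    have hl := M.len_opp _ hE
    have hso := speed_opp hE
    rw [ho] at hl hso
    have hfre : 0 < (M.flip (v, k) u).re := by rw [flip_re]; linarith
    rcases le_or_gt τ 0 with h0 | h0
    · right
      rw [cornerPoint_of_nonpos h0] at hx
      obtain ⟨hk, he⟩ := eq_of_arm_eq hu0 (by simpa using div_nonneg (neg_nonneg.mpr h0) (hs _).le)
        hx.symm
      obtain rfl : k = i + 1 := hk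
      rw [arm_flip_eq _ _ he] at hy
      have hf : M.flip (v, i + 1) ((-τ / M.speed (v, i + 1) : ℝ) : ℂ) =
          ((M.len (v, i + 1) + τ / M.speed (v, i + 1) : ℝ) : ℂ) + Real.pi * Complex.I := by
        rw [Ribbon.flip]; push_cast; ring
      have hfre' : 0 < (M.flip (v, i + 1) ((-τ / M.speed (v, i + 1) : ℝ) : ℂ)).re := by
        rw [flip_re] at hfre ⊢
        rw [(sin_im_eq_of_exp_eq he).1] at hfre; exact hfre
      have hτ0 : τ ≠ 0 := by
        rintro rfl
        have h1 := (sin_im_eq_of_exp_eq he).1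
        simp at h1
        linarith
      rcases le_or_gt τ' 0 with h0' | h0'
      · rw [cornerPoint_of_nonpos h0'] at hy
        obtain ⟨-, he'⟩ := eq_of_arm_eq hfre'
          (by simpa using div_nonneg (neg_nonneg.mpr h0') (hs _).le) hy.symm
        rw [hf] at he'
        exact absurd he'.symm (exp_ofReal_ne _ _)
      · rw [cornerPoint_of_nonneg h0'.le] at hy
        obtain ⟨hj, he'⟩ := eq_of_arm_eq hfre' (by simpa using div_nonneg h0'.le (hs _).le) hy.symm
        obtain rfl : j = i' := hj
        rw [hf] at he'
        have := ofReal_eq_of_exp_eq he'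
        refine ⟨h0', lt_of_le_of_ne h0 hτ0, ?_, ?_, ?_⟩
        · rw [← ho]; exact M.isEdge_opp _ hE
        · rw [← ho, M.opp_opp _ hE]
        · rw [edgeLength, hl, hso]
          rw [hso] at this
          have hs1 := (hs (v, i + 1)).ne'
          field_simp at this
          linarith
    · left
      rw [cornerPoint_of_nonneg h0.le] at hx
      obtain ⟨hk, he⟩ := eq_of_arm_eq hu0 (by simpa using div_nonneg h0.le (hs _).le) hx.symm
      obtain rfl : k = i := hk
      rw [arm_flip_eq _ _ he] at hy
      have hf : M.flip (v, k) (((τ / M.speed (v, k) : ℝ) : ℂ) + Real.pi * Complex.I) =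
          ((M.len (v, k) - τ / M.speed (v, k) : ℝ) : ℂ) := by
        rw [Ribbon.flip]; push_cast; ring
      have hfre' : 0 < (M.flip (v, k) (((τ / M.speed (v, k) : ℝ) : ℂ) + Real.pi * Complex.I)).re := by
        rw [flip_re] at hfre ⊢
        rw [(sin_im_eq_of_exp_eq he).1] at hfre; exact hfre
      rcases le_or_gt τ' 0 with h0' | h0'
      · rw [cornerPoint_of_nonpos h0'] at hy
        obtain ⟨hj, he'⟩ := eq_of_arm_eq hfre'
          (by simpa using div_nonneg (neg_nonneg.mpr h0') (hs _).le) hy.symm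
        simp only at hj
        rw [hf] at he'
        have := ofReal_injOn_exp he'
        rw [← hj, hso] at this
        have hs1 := (hs (v, k)).ne'
        have e1 : τ' = τ - M.edgeLength (v, k) := by
          rw [edgeLength]
          field_simp at this
          linarith
        refine ⟨h0, ?_, hE, by rw [ho, hj], e1⟩
        rw [e1]
        linarith [h.1 hE]
      · rw [cornerPoint_of_nonneg h0'.le] at hy
        obtain ⟨-, he'⟩ := eq_of_arm_eq hfre' (by simpa using div_nonneg h0'.le (hs _).le) hy.symm
        rw [hf] at he'
        exact absurd he' (exp_ofReal_ne _ _)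

end PlaneRibbon

namespace PlaneRibbon

open Ribbon

variable {W : Type} (M : PlaneRibbon W)

/-- The corner at the other end of the edge over which the arc of a corner goes out. -/
def next (c : W × Fin 3) : W × Fin 3 := ((M.opp c).1, (M.opp c).2 - 1)

/-- The corner at the other end of the edge over which the arc of a corner comes in. -/
def prev (c : W × Fin 3) : W × Fin 3 := M.opp (c.1, c.2 + 1)

variable {M}

theorem opp_eq_next (c : W × Fin 3) : M.opp c = ((M.next c).1, (M.next c).2 + 1) := by
  simp [next]

theorem opp_prev {c : W × Fin 3} (h : M.IsEdge (c.1, c.2 + 1)) :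
    M.opp (M.prev c) = (c.1, c.2 + 1) := M.opp_opp _ h

/-- The lengths of the finitely many edges are bounded below. -/
theorem exists_small_of_finite [Finite W] : ∃ δ > 0, ∀ h, M.IsEdge h → 8 * δ ≤ M.edgeLength h := by
  obtain ⟨B, hB⟩ := (Set.finite_range fun h : {h // M.IsEdge h} => (M.edgeLength h.1)⁻¹).bddAbove
  refine ⟨1 / (8 * (|B| + 1)), by positivity, fun h hE => ?_⟩
  have h1 := hB ⟨⟨h, hE⟩, rfl⟩
  simp only at h1
  have h2 := edgeLength_pos hE
  have h3 : 1 ≤ (|B| + 1) * M.edgeLength h := by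
    rw [inv_le_iff_one_le_mul₀ h2] at h1
    nlinarith [le_abs_self B]
  have h4 : 0 < |B| + 1 := by positivity
  rw [mul_one_div, div_le_iff₀ (by positivity)]
  nlinarith

theorem cornerArc_compat {c c' : W × Fin 3} {τ τ' : ℝ} (h : τ ∈ M.cornerDom c)
    (h' : τ' ∈ M.cornerDom c') (e : M.cornerArc c τ = M.cornerArc c' τ') (t : ℝ)
    (ht : τ + t ∈ M.cornerDom c) (ht' : τ' + t ∈ M.cornerDom c') :
    M.cornerArc c (τ + t) = M.cornerArc c' (τ' + t) := by
  rcases cornerArc_eq_iff h h' e with ⟨rfl, rfl⟩ | ⟨h0, h0', hE, ho, rfl⟩ | ⟨h0, h0', hE, ho, rfl⟩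
  · rfl
  · have h1 := ht'.2 (by rw [← ho]; exact M.isEdge_opp _ hE)
    rw [← ho, edgeLength_opp hE] at h1
    rw [cornerArc_next hE ho (by linarith) (ht.1 hE)]
    congr 1; ring
  · have h1 := ht.2 (by rw [← ho]; exact M.isEdge_opp _ hE)
    rw [← ho, edgeLength_opp hE] at h1
    rw [cornerArc_next hE ho (by linarith) (ht'.1 hE)]
    congr 1; ring

theorem Icc_subset_cornerDom {c : W × Fin 3} {a b : ℝ} (ha : M.IsEdge (c.1, c.2 + 1) →
    -M.edgeLength (c.1, c.2 + 1) < a) (hb : M.IsEdge c → b < M.edgeLength c) :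
    Icc a b ⊆ M.cornerDom c :=
  fun _ ht => ⟨fun h => ht.2.trans_lt (hb h), fun h => (ha h).trans_le ht.1⟩

/-- A point over the farther half of an edge is well inside of the arc at the other end. -/
theorem cornerArc_exists {δ : ℝ} (hδ : 0 < δ) (hδE : ∀ h, M.IsEdge h → 8 * δ ≤ M.edgeLength h)
    {c : W × Fin 3} {τ : ℝ} (h : τ ∈ M.cornerDom c) :
    ∃ c' τ', Icc (τ' - 2 * δ) (τ' + 2 * δ) ⊆ M.cornerDom c' ∧
      M.cornerArc c τ = M.cornerArc c' τ' := by
  rcases le_total 0 τ with h0 | h0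
  · by_cases hc : M.IsEdge c ∧ M.edgeLength c / 2 < τ
    · have h1 := hδE _ hc.1
      have h2 := h.1 hc.1
      have ho := opp_eq_next (M := M) c
      refine ⟨M.next c, τ - M.edgeLength c, Icc_subset_cornerDom (fun _ => ?_) (fun hE => ?_),
        cornerArc_next hc.1 ho (by linarith) h2⟩
      · rw [← ho, edgeLength_opp hc.1]; linarith [hc.2]
      · linarith [hδE _ hE]
    · refine ⟨c, τ, Icc_subset_cornerDom (fun hE => ?_) (fun hE => ?_), rfl⟩
      · linarith [hδE _ hE]
      · have : τ ≤ M.edgeLength c / 2 := by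
          by_contra! hlt
          exact hc ⟨hE, hlt⟩
        linarith [hδE _ hE]
  · by_cases hc : M.IsEdge (c.1, c.2 + 1) ∧ τ < -(M.edgeLength (c.1, c.2 + 1) / 2)
    · have h1 := hδE _ hc.1
      have h2 := h.2 hc.1
      have ho := opp_prev hc.1
      have hE' : M.IsEdge (M.prev c) := M.isEdge_opp _ hc.1
      have hl : M.edgeLength (M.prev c) = M.edgeLength (c.1, c.2 + 1) := edgeLength_opp hc.1
      refine ⟨M.prev c, τ + M.edgeLength (M.prev c),
        Icc_subset_cornerDom (fun hE => ?_) (fun _ => ?_), ?_⟩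
      · linarith [hδE _ hE]
      · linarith [hc.2]
      · rw [cornerArc_next hE' ho (by linarith) (by linarith [hc.2])]
        congr 1; ring
    · refine ⟨c, τ, Icc_subset_cornerDom (fun hE => ?_) (fun hE => ?_), rfl⟩
      · have : -(M.edgeLength (c.1, c.2 + 1) / 2) ≤ τ := by
          by_contra! hlt
          exact hc ⟨hE, hlt⟩
        linarith [hδE _ hE]
      · linarith [hδE _ hE]

/-- An arc that ends does so at the end of an edge, and over the whole edge it overlaps with the arc
of the corner there. -/
theorem cornerArc_ends (c : W × Fin 3) (e : ℝ) (he : e = 1 ∨ e = -1) :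
    (∀ t, 0 ≤ t → e * t ∈ M.cornerDom c) ∨
    ∀ t, 0 < t → e * t ∈ M.cornerDom c → ∃ c' t', 0 < t' ∧ -(e * t') ∈ M.cornerDom c' ∧
      M.cornerArc c (e * t) = M.cornerArc c' (-(e * t')) := by
  rcases he with rfl | rfl
  · by_cases hE : M.IsEdge c
    · right
      intro t ht htc
      rw [one_mul] at htc ⊢
      have ho := opp_eq_next (M := M) c
      have h1 := htc.1 hE
      refine ⟨M.next c, M.edgeLength c - t, by linarith,
        ⟨fun h => by linarith [edgeLength_pos h], fun h => ?_⟩, ?_⟩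
      · rw [← ho, edgeLength_opp hE]; linarith
      · rw [cornerArc_next hE ho ht h1]; congr 1; ring
    · left
      intro t ht
      exact ⟨fun h => absurd h hE, fun h => by linarith [edgeLength_pos h]⟩
  · by_cases hE : M.IsEdge (c.1, c.2 + 1)
    · right
      intro t ht htc
      rw [neg_one_mul] at htc ⊢
      have ho := opp_prev hE
      have hE' : M.IsEdge (M.prev c) := M.isEdge_opp _ hE
      have hl : M.edgeLength (M.prev c) = M.edgeLength (c.1, c.2 + 1) := edgeLength_opp hE
      have h1 := htc.2 hE
      refine ⟨M.prev c, M.edgeLength (M.prev c) - t, by linarith,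
        ⟨fun h => by linarith, fun h => by linarith [edgeLength_pos h]⟩, ?_⟩
      rw [cornerArc_next (τ := -(-1 * (M.edgeLength (M.prev c) - t))) hE' ho (by linarith)
        (by linarith)]
      congr 1; ring
    · left
      intro t ht
      exact ⟨fun h => by linarith [edgeLength_pos h], fun h => absurd h hE⟩

theorem convex_cornerDom (c : W × Fin 3) : (M.cornerDom c).OrdConnected := by
  refine ⟨fun a ha b hb t ht => ⟨fun h => ht.2.trans_lt (hb.1 h), fun h => (ha.2 h).trans_le ht.1⟩⟩

theorem continuousOn_cornerArc (c : W × Fin 3) :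
    ContinuousOn (M.cornerArc c) (M.cornerDom c) := by
  refine (continuousOn_ptOf c.1).comp (Continuous.continuousOn ?_) fun τ h => cornerPoint_mem h
  have e : M.cornerPoint c = fun τ =>
      if τ ≤ 0 then arm (c.2 + 1) ((-τ / M.speed (c.1, c.2 + 1) : ℝ) : ℂ)
      else arm c.2 ((τ / M.speed c : ℝ) + Real.pi * Complex.I) := rfl
  rw [e]
  refine Continuous.if_le ((continuous_arm _).comp (by fun_prop))
    ((continuous_arm _).comp (by fun_prop)) continuous_id continuous_const ?_
  rintro τ rfl
  simpa using (arm_corner c.2).symm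

variable (M) in
/-- The map to the plane. -/
def pos : M.Surface → ℝ × ℝ :=
  Quot.lift (fun x => M.vertexPos x.1 + ∑ i, height i x.2.1 • M.dir (x.1, i)) (by
    rintro ⟨v, p⟩ ⟨v', q⟩ ⟨i, j, u, hE, ho, h0, h1, hx, hy⟩
    dsimp only at hE ho h1 hx hy ⊢
    have h2 := M.vertexPos_opp _ hE
    have h3 := M.dir_opp _ hE
    have hfre : 0 ≤ (M.flip (v, i) u).re := by rw [flip_re]; linarith
    rw [ho] at h2 h3
    rw [hx, hy, Finset.sum_eq_single i (fun j _ hj => by rw [height_arm _ _ h0.le, if_neg hj.symm,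
      zero_smul]) (by simp), Finset.sum_eq_single j (fun k _ hk => by
        rw [height_arm _ _ hfre, if_neg hk.symm, zero_smul]) (by simp), height_arm_self _ h0.le,
      height_arm_self _ hfre, h2, h3, flip_re, smul_neg, sub_smul]
    abel)

theorem pos_pt (v : W) (p : M.Piece v) :
    M.pos (M.pt v p) = M.vertexPos v + ∑ i, height i p.1 • M.dir (v, i) := rfl

theorem sum_height_arm (v : W) (i : Fin 3) {u : ℂ} (h : 0 ≤ u.re) :
    ∑ j, height j (arm i u) • M.dir (v, j) = u.re • M.dir (v, i) := by
  rw [Finset.sum_eq_single i (fun j _ hj => by rw [height_arm _ _ h, if_neg hj.symm,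
    zero_smul]) (by simp), height_arm_self _ h]

variable (M) in
/-- The unit vector in the direction of a half-edge. -/
def unitDir (h : W × Fin 3) : ℝ × ℝ := (M.speed h)⁻¹ • M.dir h

theorem pos_cornerArc {c : W × Fin 3} {τ : ℝ} (h : τ ∈ M.cornerDom c) :
    M.pos (M.cornerArc c τ) =
      M.vertexPos c.1 + min τ 0 • -M.unitDir (c.1, c.2 + 1) + max τ 0 • M.unitDir c := by
  have hs := speed_pos (M := M)
  rw [cornerArc_eq h, pos_pt]
  rcases le_total τ 0 with h0 | h0
  · simp only [cornerPoint_of_nonpos h0]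
    rw [sum_height_arm _ _ (by simpa using div_nonneg (neg_nonneg.mpr h0) (hs _).le),
      min_eq_left h0, max_eq_right h0, zero_smul, add_zero, unitDir, smul_neg, ← neg_smul, smul_smul,
      Complex.ofReal_re, div_eq_mul_inv]
  · simp only [cornerPoint_of_nonneg h0]
    rw [sum_height_arm _ _ (by simpa using div_nonneg h0 (hs _).le),
      min_eq_right h0, max_eq_left h0, zero_smul, add_zero, unitDir, smul_smul,
      Complex.add_re, Complex.ofReal_re, Complex.re_ofReal_mul, Complex.I_re, mul_zero, add_zero,
      div_eq_mul_inv]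

variable (M) in
/-- The angle by which the real line turns at a corner. -/
def cornerAngle (c : W × Fin 3) : ℝ := (-(toC (M.dir c) / toC (M.dir (c.1, c.2 + 1)))).arg

theorem cornerAngle_mem (c : W × Fin 3) : M.cornerAngle c ∈ Ioo 0 Real.pi := by
  have h := M.cross_dir c.1 c.2
  have hne : toC (M.dir (c.1, c.2 + 1)) ≠ 0 := fun h0 =>
    dir_ne_zero (c.1, c.2 + 1) (toC.map_eq_zero_iff.mp h0)
  have him : 0 < (-(toC (M.dir c) / toC (M.dir (c.1, c.2 + 1)))).im := by
    have h1 : 0 < Complex.normSq (toC (M.dir (c.1, c.2 + 1))) := Complex.normSq_pos.mpr hne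
    rw [Complex.neg_im, Complex.div_im, ← sub_div, ← neg_div]
    refine div_pos ?_ h1
    rw [show (c.1, c.2) = c from rfl, cross] at h
    simp
    linarith
  refine ⟨(Complex.arg_nonneg_iff.mpr him.le).lt_of_ne fun h0 => ?_,
    lt_of_le_of_ne (Complex.arg_le_pi _) fun h0 => ?_⟩
  · have := Complex.arg_eq_zero_iff.mp h0.symm
    linarith [this.2]
  · have := Complex.arg_eq_pi_iff.mp h0
    linarith [this.2]

theorem toC_unitDir (h : W × Fin 3) : toC (M.unitDir h) = toC (M.dir h) / M.speed h := by
  rw [unitDir, map_smul, Complex.real_smul, Complex.ofReal_inv, inv_mul_eq_div]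

theorem exp_cornerAngle (c : W × Fin 3) : Complex.exp (M.cornerAngle c * Complex.I) =
    -(toC (M.unitDir c) / toC (M.unitDir (c.1, c.2 + 1))) := by
  have h := Complex.norm_mul_exp_arg_mul_I (-(toC (M.dir c) / toC (M.dir (c.1, c.2 + 1))))
  have hs := speed_pos (M := M)
  have h1 : (M.speed c : ℂ) ≠ 0 := by exact_mod_cast (hs c).ne'
  have h2 : (M.speed (c.1, c.2 + 1) : ℂ) ≠ 0 := by exact_mod_cast (hs _).ne'
  have hne : toC (M.dir (c.1, c.2 + 1)) ≠ 0 := fun h0 =>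
    dir_ne_zero (c.1, c.2 + 1) (toC.map_eq_zero_iff.mp h0)
  rw [norm_neg, norm_div, ← speed, ← speed, ← cornerAngle] at h
  rw [toC_unitDir, toC_unitDir]
  push_cast at h
  field_simp at h ⊢
  linear_combination h

/-- The three angles at a vertex add up to a half turn. -/
theorem sum_cornerAngle (v : W) : ∑ i, M.cornerAngle (v, i) = Real.pi := by
  have hm := fun i => cornerAngle_mem (M := M) (v, i)
  have hne : ∀ i, toC (M.unitDir (v, i)) ≠ 0 := fun i h0 => by
    have h1 := toC_unitDir (M := M) (v, i)
    rw [h0, eq_comm, div_eq_zero_iff] at h1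
    rcases h1 with h1 | h1
    · exact dir_ne_zero _ (toC.map_eq_zero_iff.mp h1)
    · exact (speed_pos (M := M) (v, i)).ne' (by exact_mod_cast h1)
  have hexp : Complex.exp ((∑ i, M.cornerAngle (v, i) : ℝ) * Complex.I) = -1 := by
    rw [Fin.sum_univ_three]
    push_cast
    rw [add_mul, add_mul, Complex.exp_add, Complex.exp_add, exp_cornerAngle, exp_cornerAngle,
      exp_cornerAngle]
    have h0 := hne 0
    have h1 := hne 1
    have h2 := hne 2
    simp only [zero_add, show (1 + 1 : Fin 3) = 2 from rfl, show (2 + 1 : Fin 3) = 0 from rfl]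
    field_simp
  have hcos : Real.cos (∑ i, M.cornerAngle (v, i)) = -1 := by
    have := congrArg Complex.re hexp
    rwa [Complex.exp_ofReal_mul_I_re] at this
  rw [Real.cos_eq_neg_one_iff] at hcos
  obtain ⟨k, hk⟩ := hcos
  have hpi := Real.pi_pos
  have h0 := hm 0
  have h1 := hm 1
  have h2 := hm 2
  have hsum : ∑ i, M.cornerAngle (v, i) ∈ Ioo 0 (3 * Real.pi) := by
    rw [Fin.sum_univ_three]
    exact ⟨by linarith [h0.1, h1.1, h2.1], by linarith [h0.2, h1.2, h2.2]⟩
  have hk0 : k = 0 := by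
    rw [← hk] at hsum
    have l1 : (-1 : ℝ) < k := by nlinarith [hsum.1]
    have l2 : (k : ℝ) < 1 := by nlinarith [hsum.2]
    have : (-1 : ℤ) < k := by exact_mod_cast l1
    have : k < (1 : ℤ) := by exact_mod_cast l2
    omega
  rw [← hk, hk0]; simp

variable (M) in
/-- The real part of the surface, as a curve that is covered by the arcs at the corners. -/
def atlas [Finite W] : PlaneAtlas (W × Fin 3) M.Surface where
  dom := M.cornerDom
  arc := M.cornerArc
  δ := M.exists_small_of_finite.choose
  δ_pos := M.exists_small_of_finite.choose_spec.1
  ordConnected := convex_cornerDom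
  zero_mem := zero_mem_cornerDom
  compat := cornerArc_compat
  injOn c τ h τ' h' e := by
    rcases cornerArc_eq_iff h h' e with h1 | ⟨-, -, hE, ho, -⟩ | ⟨-, -, hE, ho, -⟩
    · exact h1.2
    · exact absurd (congrArg Prod.fst ho) (M.opp_fst_ne _ hE)
    · exact absurd (congrArg Prod.fst ho) (M.opp_fst_ne _ hE)
  eq_of_corner {c c' τ} h e := by
    rcases cornerArc_eq_iff h (zero_mem_cornerDom c') e with h1 | ⟨-, h2, -⟩ | ⟨h2, -⟩
    · exact h1.1
    · exact absurd h2 (lt_irrefl _)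
    · exact absurd h2 (lt_irrefl _)
  exists_arc := cornerArc_exists M.exists_small_of_finite.choose_spec.1
    M.exists_small_of_finite.choose_spec.2
  ends := cornerArc_ends
  pos := M.pos
  dIn c := -M.unitDir (c.1, c.2 + 1)
  dOut c := M.unitDir c
  angle := M.cornerAngle
  angle_pos c := (cornerAngle_mem c).1
  angle_lt c := (cornerAngle_mem c).2
  norm_dIn c := by
    rw [map_neg, norm_neg, toC_unitDir, norm_div, ← speed, Complex.norm_real, Real.norm_eq_abs,
      abs_of_pos (speed_pos _), div_self (speed_pos _).ne']
  toC_dOut c := by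
    have h0 : toC (M.unitDir (c.1, c.2 + 1)) ≠ 0 := by
      rw [toC_unitDir]
      exact div_ne_zero (fun h0 => dir_ne_zero _ (toC.map_eq_zero_iff.mp h0))
        (by exact_mod_cast (speed_pos (M := M) _).ne')
    rw [exp_cornerAngle, map_neg]
    field_simp
  pos_arc c τ h := by
    rw [pos_cornerArc h, pos_cornerArc (zero_mem_cornerDom c)]
    simp

end PlaneRibbon

namespace Ribbon

variable {W : Type} (M : Ribbon W)

/-- One of the two halves of the surface. -/
def half : Set M.Surface := {x | ∃ v, ∃ p : M.Piece v, x = M.pt v p ∧ 0 < imDiff p.1}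

variable {M}

/-- The gluing `ζ ↦ -e^T / ζ` preserves the sign of the imaginary part. -/
theorem Rel.imDiff_pos {x y : Σ v, M.Piece v} (h : M.Rel x y) (hx : 0 < imDiff x.2.1) :
    0 < imDiff y.2.1 := by
  obtain ⟨i, j, u, -, -, -, -, e, e'⟩ := h
  obtain ⟨r, hr, h1⟩ := imDiff_arm i u
  obtain ⟨r', hr', h2⟩ := imDiff_arm j (M.flip (x.1, i) u)
  rw [e, h1] at hx
  rw [e', h2, flip_im, Real.sin_pi_sub]
  have : 0 < -Real.sin u.im := by
    by_contra! hc
    nlinarith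
  nlinarith

theorem pt_mem_half_iff {v : W} {p : M.Piece v} : M.pt v p ∈ M.half ↔ 0 < imDiff p.1 := by
  refine ⟨?_, fun h => ⟨v, p, rfl, h⟩⟩
  rintro ⟨v', q, e, hq⟩
  rcases pt_eq_iff_rel.mp e.symm with h | h
  · have h1 : imDiff q.1 = imDiff p.1 :=
      congrArg (fun x : Σ v, M.Piece v => imDiff x.2.1) h
    rwa [← h1]
  · exact h.imDiff_pos hq

theorem isOpen_half : IsOpen M.half := by
  have e : M.half = ⋃ v, M.pt v '' {p | 0 < imDiff p.1} := by
    ext x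
    simp only [half, mem_ofPred_eq, mem_iUnion, mem_image]
    exact ⟨fun ⟨v, p, h, h'⟩ => ⟨v, p, h', h.symm⟩, fun ⟨v, p, h', h⟩ => ⟨v, p, h.symm, h'⟩⟩
  rw [e]
  exact isOpen_iUnion fun v => isOpenMap_pt v _
    (isOpen_lt continuous_const (continuous_imDiff.comp continuous_subtype_val))

end Ribbon

namespace PlaneRibbon

open Ribbon

variable {W : Type} {M : PlaneRibbon W}

theorem star_cornerPoint (c : W × Fin 3) (τ : ℝ) :
    star (M.cornerPoint c τ) = M.cornerPoint c τ := by
  rcases le_total τ 0 with h | h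
  · rw [cornerPoint_of_nonpos h, star_arm]
    congr 1
    simp
  · rw [cornerPoint_of_nonneg h, star_arm, arm_eq_iff]
    have e : star (((τ / M.speed c : ℝ) : ℂ) + Real.pi * Complex.I) =
        ((τ / M.speed c : ℝ) : ℂ) - Real.pi * Complex.I := by
      simp [sub_eq_add_neg]
    rw [e, Complex.exp_sub, Complex.exp_add, Complex.exp_pi_mul_I]
    simp [div_neg]

/-- The real points over the vertex are the three corners. -/
theorem exists_corner_of_star_eq {p : Torus} (hp : p ∈ phaseTropicalLine) (h : star p = p)
    (h0 : ∀ i, height i p = 0) : ∃ i, p = arm i (Real.pi * Complex.I) := by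
  have ha : amoeba p = 0 := by
    rw [amoeba_eq_sum]; simp [h0]
  obtain ⟨h1, h2⟩ := star_eq_self_iff_im.mp h
  have key : ∀ z : ℂˣ, (z : ℂ).im = 0 → Real.log ‖(z : ℂ)‖ = 0 → z = 1 ∨ z = -1 := by
    intro z hz hl
    have hn : ‖(z : ℂ)‖ = 1 := by
      have := Real.exp_log (norm_pos_iff.mpr z.ne_zero)
      rw [hl, Real.exp_zero] at this; exact this.symm
    have hz' : (z : ℂ) = ((z : ℂ).re : ℂ) := Complex.ext rfl (by simpa using hz)
    rw [hz', Complex.norm_real, Real.norm_eq_abs] at hn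
    rcases eq_or_eq_neg_of_abs_eq hn with h3 | h3
    · left; ext; rw [hz', h3]; simp
    · right; ext; rw [hz', h3]; simp
  have k1 := key p.1 h1 (congrArg Prod.fst ha)
  have k2 := key p.2 h2 (congrArg Prod.snd ha)
  have c0 : arm 0 (Real.pi * Complex.I) = (-1, -1) := by
    ext <;> simp [arm, annulus]
  have c1 : arm 1 (Real.pi * Complex.I) = (-1, 1) := by
    ext <;> simp [arm, annulus]
  have c2 : arm 2 (Real.pi * Complex.I) = (1, -1) := by
    ext <;> simp [arm, annulus]
  obtain ⟨z, w⟩ := p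
  simp only at k1 k2
  rcases k1 with rfl | rfl <;> rcases k2 with rfl | rfl
  · obtain ⟨a, b, c, -, -, -, hs, he, -⟩ := exists_coeff_of_mem_phaseTropicalLine hp
    exfalso
    simp at he
    have : (a + b + c : ℂ) = ((a + b + c : ℝ) : ℂ) := by push_cast; ring
    rw [this, hs] at he
    simp at he
  · exact ⟨2, c2.symm⟩
  · exact ⟨1, c1.symm⟩
  · exact ⟨0, c0.symm⟩

theorem exists_cornerPoint {v : W} {p : Torus} (hp : p ∈ M.pieceSet v) (h : star p = p) :
    ∃ i τ, τ ∈ M.cornerDom (v, i) ∧ p = M.cornerPoint (v, i) τ := by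
  have hs := speed_pos (M := M)
  by_cases h0 : ∀ i, height i p = 0
  · obtain ⟨i, hi⟩ := exists_corner_of_star_eq hp.1 h h0
    refine ⟨i, 0, zero_mem_cornerDom _, ?_⟩
    rw [hi, cornerPoint_of_nonneg le_rfl]; simp
  · push Not at h0
    obtain ⟨i, hi⟩ := h0
    have hi' := lt_of_le_of_ne (height_nonneg i p) hi.symm
    obtain ⟨u, rfl, hu⟩ := eq_arm_of_height_pos hp.1 hi'
    have hu0 : 0 < u.re := hu ▸ hi'
    have hlen : M.IsEdge (v, i) → u.re < M.len (v, i) := fun hE => hu ▸ hp.2 i hE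
    have hsin : Real.sin u.im = 0 := by
      obtain ⟨r, hr, e⟩ := imDiff_arm i u
      rw [(imDiff_eq_zero_iff hp.1).mpr h] at e
      by_contra hc
      exact mul_ne_zero (neg_ne_zero.mpr hr.ne') hc e.symm
    rcases cexp_eq_of_sin_eq_zero hsin with he | he
    · refine ⟨i - 1, -(u.re * M.speed (v, i)), ⟨fun hE => ?_, fun hE => ?_⟩, ?_⟩
      · have := edgeLength_pos hE
        nlinarith [hs (v, i)]
      · simp only [sub_add_cancel] at hE ⊢
        rw [edgeLength]
        have := hlen hE
        nlinarith [hs (v, i)]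
      · rw [cornerPoint_of_nonpos (by nlinarith [hs (v, i)])]
        simp only [sub_add_cancel]
        rw [arm_eq_iff, he, neg_neg, mul_div_cancel_right₀ _ (hs _).ne']
    · refine ⟨i, u.re * M.speed (v, i), ⟨fun hE => ?_, fun hE => ?_⟩, ?_⟩
      · rw [edgeLength]
        have := hlen hE
        nlinarith [hs (v, i)]
      · have := edgeLength_pos hE
        nlinarith [hs (v, i)]
      · rw [cornerPoint_of_nonneg (by nlinarith [hs (v, i)])]
        rw [arm_eq_iff, he, mul_div_cancel_right₀ _ (hs _).ne']

variable [Finite W]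

theorem pt_mem_carrier_iff {v : W} {p : M.Piece v} :
    M.pt v p ∈ M.atlas.carrier ↔ star p.1 = p.1 := by
  constructor
  · rintro ⟨c, τ, hτ, e⟩
    replace hτ : τ ∈ M.cornerDom c := hτ
    replace e : M.pt v p = M.cornerArc c τ := e
    rw [cornerArc_eq hτ] at e
    rcases pt_eq_iff_rel.mp e with h | ⟨i, j, u, hE, ho, h0, h1, hx, hy⟩
    · have h1 : p.1 = M.cornerPoint c τ := congrArg (fun x : Σ v, M.Piece v => x.2.1) h
      rw [h1, star_cornerPoint]
    · simp only at hx hy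
      have h2 := star_cornerPoint (M := M) c τ
      rw [hy, star_arm, arm_eq_iff] at h2
      rw [hx, star_arm, arm_eq_iff]
      have e1 : star u = M.len (v, i) + Real.pi * Complex.I - star (M.flip (v, i) u) -
          2 * Real.pi * Complex.I := by
        simp [Ribbon.flip]; ring
      have e2 : u = M.len (v, i) + Real.pi * Complex.I - M.flip (v, i) u := by
        simp [Ribbon.flip]
      rw [e1, Complex.exp_sub, Complex.exp_two_pi_mul_I, div_one, Complex.exp_sub, h2,
        ← Complex.exp_sub, ← e2]
  · intro h
    obtain ⟨i, τ, hτ, e⟩ := exists_cornerPoint p.2 h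
    refine ⟨(v, i), τ, hτ, ?_⟩
    change _ = M.cornerArc (v, i) τ
    rw [cornerArc_eq hτ]
    exact congrArg _ (Subtype.ext e)

/-- The velocity of the motion along the real part: the motion goes out along the real
line of an annulus that is on the negative side of the logarithmic coordinate, and comes in along
the other one. -/
theorem exists_velocity {x : M.atlas.carrier} {s : ℝ} {v : W} {p : M.Piece v}
    (hx : (M.atlas.flow s x).1 = M.pt v p)
    (hd : DifferentiableAt ℝ (M.atlas.planePath x) s) :
    ∃ i, ∃ r : ℝ, 0 < r ∧ ((p.1 = arm i (r : ℂ) ∧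
        deriv (M.atlas.planePath x) s = -M.unitDir (v, i)) ∨
      (p.1 = arm i (r + Real.pi * Complex.I) ∧
        deriv (M.atlas.planePath x) s = M.unitDir (v, i))) := by
  have hs := speed_pos (M := M)
  have hstar : star p.1 = p.1 := by
    rw [← pt_mem_carrier_iff, ← hx]; exact (M.atlas.flow s x).2
  obtain ⟨i, τ, hτ, e⟩ := exists_cornerPoint p.2 hstar
  obtain ⟨c, τ', hw⟩ := ArcAtlas.exists_window_flow (M.atlas.flow s x)
  have hw0 := hw 0 (by simpa using M.atlas.δ_pos.le)
  rw [ArcAtlas.flow_zero, add_zero] at hw0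
  have hτ'0 : τ' ≠ 0 := by
    rintro rfl
    exact PlaneAtlas.not_differentiableAt hw0 hd
  have hder := (PlaneAtlas.hasDerivAt_planePath hw0 hτ'0).deriv
  have harc : M.cornerArc (v, i) τ = M.cornerArc c τ' := by
    have h1 : (M.atlas.flow s x).1 = M.cornerArc c τ' := hw0.2
    rw [← h1, hx, cornerArc_eq hτ]
    exact congrArg _ (Subtype.ext e.symm)
  have hvel : (0 < τ ∧ deriv (M.atlas.planePath x) s = M.unitDir (v, i)) ∨
      (τ < 0 ∧ deriv (M.atlas.planePath x) s = -M.unitDir (v, i + 1)) := by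
    have hopp : ∀ h, M.IsEdge h → M.unitDir (M.opp h) = -M.unitDir h := fun h hE => by
      rw [unitDir, unitDir, M.dir_opp h hE, speed_opp hE, smul_neg]
    have hvn : τ' < 0 → M.atlas.velocity c τ' = -M.unitDir (c.1, c.2 + 1) := fun h => by
      rw [PlaneAtlas.velocity, if_neg h.not_gt]; rfl
    have hvp : 0 < τ' → M.atlas.velocity c τ' = M.unitDir c := fun h => by
      rw [PlaneAtlas.velocity, if_pos h]; rfl
    rw [hder]
    rcases cornerArc_eq_iff hτ hw0.mem harc with ⟨rfl, rfl⟩ | ⟨h0, h0', hE, ho, -⟩ |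
      ⟨h0, h0', hE, ho, -⟩
    · rcases lt_or_gt_of_ne hτ'0 with h | h
      · exact Or.inr ⟨h, hvn h⟩
      · exact Or.inl ⟨h, hvp h⟩
    · left
      rw [hvn h0', ← ho, hopp _ hE, neg_neg]
      exact ⟨h0, rfl⟩
    · right
      have h1 := hopp _ hE
      rw [ho] at h1
      rw [hvp h0, h1, neg_neg]
      exact ⟨h0', rfl⟩
  rcases hvel with ⟨h0, h1⟩ | ⟨h0, h1⟩
  · refine ⟨i, τ / M.speed (v, i), div_pos h0 (hs _), Or.inr ⟨?_, h1⟩⟩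
    rw [e, cornerPoint_of_nonneg h0.le]
  · refine ⟨i + 1, -τ / M.speed (v, i + 1), div_pos (neg_pos.mpr h0) (hs _), Or.inl ⟨?_, h1⟩⟩
    rw [e, cornerPoint_of_nonpos h0.le]

end PlaneRibbon

/-! ### Positively oriented charts of phase-tropical lines -/

/-- The symmetry of the phase-tropical line that exchanges the coordinates, if `b` is true. -/
def turn (b : Bool) (p : Torus) : Torus := bif b then p.swap else p

/-- The permutation of the rays that corresponds to `turn b`. -/
def turnIdx (b : Bool) (i : Fin 3) : Fin 3 := bif b then ![1, 0, 2] i else i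

@[simp] theorem turn_turn (b : Bool) (p : Torus) : turn b (turn b p) = p := by
  cases b <;> simp [turn]

theorem continuous_turn (b : Bool) : Continuous (turn b) := by
  cases b
  · exact continuous_id
  · exact continuous_swap

theorem star_turn (b : Bool) (p : Torus) : star (turn b p) = turn b (star p) := by
  cases b <;> rfl

theorem turn_mem_phaseTropicalLine {b : Bool} {p : Torus} :
    turn b p ∈ phaseTropicalLine ↔ p ∈ phaseTropicalLine := by
  cases b
  · rfl
  · have e : dominantTerms p.swap = dominantTerms p := by
      simp only [dominantTerms, Prod.fst_swap, Prod.snd_swap, pair_comm (p.2 : ℂ)]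
    change (0 : ℂ) ∈ convexHull ℝ (dominantTerms p.swap) ↔ _
    rw [e]; rfl

theorem amoeba_turn (b : Bool) (p : Torus) :
    amoeba (turn b p) = ∑ i, height i p • toReal (ray (turnIdx b i)) := by
  cases b
  · exact amoeba_eq_sum p
  · have h := amoeba_eq_sum p
    have e : amoeba (turn true p) = (amoeba p).swap := rfl
    rw [e, h, Fin.sum_univ_three, Fin.sum_univ_three]
    ext <;> simp [turnIdx, ray, toReal]

namespace ToricMorphism

variable (A : ToricMorphism)

theorem amoeba_toFun (p : Torus) : amoeba (A.toFun p) = amoeba A.b + A.linReal (amoeba p) := by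
  have h : ∀ (b z w : ℂˣ) (m n : ℤ), Real.log ‖((b * (z ^ m * w ^ n) : ℂˣ) : ℂ)‖ =
      Real.log ‖(b : ℂ)‖ + (m * Real.log ‖(z : ℂ)‖ + n * Real.log ‖(w : ℂ)‖) := by
    intro b z w m n
    have hz : ∀ x : ℂˣ, ‖(x : ℂ)‖ ≠ 0 := fun x => norm_ne_zero_iff.mpr x.ne_zero
    simp only [Units.val_mul, Units.val_zpow_eq_zpow_val, norm_mul, norm_zpow]
    rw [Real.log_mul (hz _) (mul_ne_zero (zpow_ne_zero _ (hz _)) (zpow_ne_zero _ (hz _))),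
      Real.log_mul (zpow_ne_zero _ (hz _)) (zpow_ne_zero _ (hz _)), Real.log_zpow, Real.log_zpow]
  exact Prod.ext (h _ _ _ _ _) (h _ _ _ _ _)

theorem linReal_toReal (u : ℤ × ℤ) : A.linReal (toReal u) = toReal (A.linInt u) := by
  ext <;> simp [linReal, toReal, linInt]

theorem linReal_add (x y : ℝ × ℝ) : A.linReal (x + y) = A.linReal x + A.linReal y := by
  ext <;> simp [linReal] <;> ring

theorem linReal_smul (t : ℝ) (x : ℝ × ℝ) : A.linReal (t • x) = t • A.linReal x := by
  ext <;> simp [linReal] <;> ring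

theorem amoeba_toFun_turn (b : Bool) (p : Torus) : amoeba (A.toFun (turn b p)) =
    amoeba A.b + ∑ i, height i p • toReal (A.linInt (ray (turnIdx b i))) := by
  rw [amoeba_toFun, amoeba_turn]
  simp only [Fin.sum_univ_three, linReal_add, linReal_smul, linReal_toReal]

theorem exists_toFun_turn_arm (b : Bool) (i : Fin 3) : ∃ k : Torus, ∀ u,
    A.toFun (turn b (arm i u)) = (k.1 * cexpUnit u ^ (A.linInt (ray (turnIdx b i))).1,
      k.2 * cexpUnit u ^ (A.linInt (ray (turnIdx b i))).2) := by
  obtain ⟨s, hs⟩ : ∃ s : Torus, ∀ u, turn b (arm i u) =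
      (s.1 * cexpUnit u ^ (ray (turnIdx b i)).1, s.2 * cexpUnit u ^ (ray (turnIdx b i)).2) := by
    cases b <;> fin_cases i
    · exact ⟨(1, -1), fun u => by simp [turn, turnIdx, arm, annulus, ray]⟩
    · exact ⟨(-1, -1), fun u => by simp [turn, turnIdx, arm, annulus, ray]⟩
    · exact ⟨(-1, 1), fun u => by simp [turn, turnIdx, arm, annulus, ray]⟩
    · exact ⟨(-1, 1), fun u => by simp [turn, turnIdx, arm, annulus, ray]⟩
    · exact ⟨(-1, -1), fun u => by simp [turn, turnIdx, arm, annulus, ray]⟩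
    · exact ⟨(1, -1), fun u => by simp [turn, turnIdx, arm, annulus, ray]⟩
  refine ⟨(A.b.1 * (s.1 ^ A.a₁₁ * s.2 ^ A.a₁₂), A.b.2 * (s.1 ^ A.a₂₁ * s.2 ^ A.a₂₂)), fun u => ?_⟩
  rw [hs, toFun, linInt]
  simp only [mul_zpow, ← zpow_mul, zpow_add, mul_comm (ray _).1, mul_comm (ray _).2]
  ext1
  · simp only [mul_left_comm, mul_assoc]
  · simp only [mul_left_comm, mul_assoc]

end ToricMorphism

namespace SimplePhaseTropicalCurve

open TropicalPolynomial

variable {C : TropicalPolynomial} (V : SimplePhaseTropicalCurve C)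

/-- The chart at `v` reverses the orientation of the plane. -/
def flipped (v : C.Vertex) : Bool :=
  decide (cross ((V.chart v).linInt (ray 0)) ((V.chart v).linInt (ray 1)) < 0)

/-- The integer direction vector of the ray `h.2` at the vertex `h.1`. -/
def dirInt (h : C.Vertex × Fin 3) : ℤ × ℤ :=
  (V.chart h.1).linInt (ray (turnIdx (V.flipped h.1) h.2))

/-- The direction vector of the ray `h.2` at the vertex `h.1`. -/
def dir (h : C.Vertex × Fin 3) : ℝ × ℝ := toReal (V.dirInt h)

theorem amoeba_chart_turn (v : C.Vertex) (p : Torus) :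
    amoeba ((V.chart v).toFun (turn (V.flipped v) p)) = v.1 + ∑ i, height i p • V.dir (v, i) := by
  rw [ToricMorphism.amoeba_toFun_turn, V.chart_origin]; rfl

theorem amoeba_chart_arm (v : C.Vertex) (i : Fin 3) {u : ℂ} (hu : 0 ≤ u.re) :
    amoeba ((V.chart v).toFun (turn (V.flipped v) (arm i u))) = v.1 + u.re • V.dir (v, i) := by
  rw [amoeba_chart_turn, Finset.sum_eq_single i (fun j _ hj => by
    rw [height_arm _ _ hu, if_neg hj.symm, zero_smul]) (by simp), height_arm_self _ hu]

/-- Cells contain finitely many lattice points, so a weight is positive on the curve. -/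
theorem _root_.PhaseTropical.TropicalPolynomial.weight_pos {p : ℝ × ℝ} (hp : p ∈ C.curve) :
    0 < C.weight p := by
  obtain ⟨a, ha, b, hb, hab⟩ := hp
  have hmem : ∀ a ∈ C.active p, toReal a ∈ C.cell p := fun a ha =>
    subset_convexHull ℝ _ (mem_image_of_mem _ ha)
  have hfin : {a : ℤ × ℤ | toReal a ∈ C.cell p}.Finite := by
    have hact : (toReal '' C.active p).Finite :=
      (C.supp.finite_toSet.subset fun a ha => ha.1).image _
    obtain ⟨B, hB⟩ := (isBounded_convexHull.mpr hact.isBounded).exists_norm_le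
    refine ((Set.finite_Icc (-⌈B⌉) ⌈B⌉).prod (Set.finite_Icc (-⌈B⌉) ⌈B⌉)).subset fun a ha => ?_
    have h1 := hB _ ha
    have h2 := (norm_fst_le (toReal a)).trans h1
    have h3 := (norm_snd_le (toReal a)).trans h1
    have key : ∀ n : ℤ, ‖(n : ℝ)‖ ≤ B → n ∈ Icc (-⌈B⌉) ⌈B⌉ := by
      intro n hn
      rw [Real.norm_eq_abs, abs_le] at hn
      have h5 := Int.le_ceil B
      constructor
      · have : (-(⌈B⌉ : ℝ)) ≤ n := by linarith
        exact_mod_cast this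
      · have : (n : ℝ) ≤ ⌈B⌉ := by linarith
        exact_mod_cast this
    exact ⟨key _ h2, key _ h3⟩
  have h2 : 1 < {a : ℤ × ℤ | toReal a ∈ C.cell p}.ncard :=
    (Set.one_lt_ncard hfin).mpr ⟨a, hmem a ha, b, hmem b hb, hab⟩
  rw [weight]; omega

/-- The direction of a ray is a primitive vector times the weight of the edge. -/
theorem exists_dirInt_eq (h : C.Vertex × Fin 3) : ∃ (m : ℕ) (u : ℤ × ℤ), 0 < m ∧
    IsCoprime u.1 u.2 ∧ V.dirInt h = (m : ℤ) • u ∧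
    (face (C.active h.1.1) (toReal u)).Nontrivial := by
  obtain ⟨m, u, hu, he, hev⟩ := V.chart_ray h.1 (turnIdx (V.flipped h.1) h.2)
  refine ⟨m, u, ?_, hu, he, (C.eventually_mem_curve_iff _ _).mp (hev.mono fun t ht => ht.1)⟩
  obtain ⟨t, ht⟩ := hev.exists
  rw [← ht.2]
  exact weight_pos ht.1

/-- The rays of the chart are in the tropical curve near the vertex. -/
theorem dir_spec (h : C.Vertex × Fin 3) :
    V.dir h ≠ 0 ∧ (face (C.active h.1.1) (V.dir h)).Nontrivial := by
  obtain ⟨m, u, hm, hu, he, hf⟩ := V.exists_dirInt_eq h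
  have e : V.dir h = (m : ℝ) • toReal u := by
    rw [dir, he]; ext <;> simp [toReal]
  have hm' : (0 : ℝ) < m := by exact_mod_cast hm
  rw [e]
  refine ⟨smul_ne_zero hm'.ne' fun h0 => ?_, by rwa [face_smul _ _ hm']⟩
  have hu0 : u = 0 := toReal_injective (by rw [h0]; ext <;> simp [toReal])
  obtain ⟨x, y, hxy⟩ := hu
  simp [hu0] at hxy

theorem sum_dir (v : C.Vertex) : ∑ i, V.dir (v, i) = 0 := by
  simp only [dir, dirInt, Fin.sum_univ_three]
  cases V.flipped v <;> ext <;>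
    simp [turnIdx, ray, toReal, ToricMorphism.linInt] <;> ring

/-- The edges at a vertex are the three rays of the chart. -/
theorem directions (v : C.Vertex) : ∀ y ≠ 0, (face (C.active v.1) y).Nontrivial →
      ∃ i, ∃ r : ℝ, 0 < r ∧ y = r • V.dir (v, i) :=
  (v.2.directions (w := fun i => V.dir (v, i)) (fun i => (V.dir_spec (v, i)).1) (V.sum_dir v)
    fun i => (V.dir_spec (v, i)).2).2

/-- The coordinates are exchanged exactly if the chart reverses the orientation, so the three rays
always have the positive cyclic order. -/
theorem cross_dir (v : C.Vertex) (i : Fin 3) : 0 < cross (V.dir (v, i)) (V.dir (v, i + 1)) := by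
  have hne := (v.2.directions (w := fun i => V.dir (v, i)) (fun i => (V.dir_spec (v, i)).1)
    (V.sum_dir v) fun i => (V.dir_spec (v, i)).2).1
  have h01 : 0 < cross (V.dir (v, 0)) (V.dir (v, 1)) := by
    refine lt_of_le_of_ne ?_ hne.symm
    have hc : ∀ a b : ℤ × ℤ, cross (toReal a) (toReal b) = ((cross a b : ℤ) : ℝ) := by
      intro a b; simp [cross, toReal]
    simp only [dir, dirInt, hc]
    rcases hb : V.flipped v with _ | _
    · rw [flipped, decide_eq_false_iff_not, not_lt] at hb
      simpa [turnIdx] using hb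
    · rw [flipped, decide_eq_true_iff] at hb
      have : cross ((V.chart v).linInt (ray 1)) ((V.chart v).linInt (ray 0)) =
          -cross ((V.chart v).linInt (ray 0)) ((V.chart v).linInt (ray 1)) := by
        simp [cross]; ring
      simp only [turnIdx, cond_true, Matrix.cons_val_zero, Matrix.cons_val_one, this]
      exact_mod_cast (neg_pos.mpr hb).le
  have hsum := V.sum_dir v
  rw [Fin.sum_univ_three] at hsum
  have h2 : V.dir (v, 2) = -(V.dir (v, 0) + V.dir (v, 1)) := by
    rw [eq_neg_iff_add_eq_zero, ← hsum]; abel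
  have e12 : cross (V.dir (v, 1)) (V.dir (v, 2)) = cross (V.dir (v, 0)) (V.dir (v, 1)) := by
    rw [h2]; simp [cross]; ring
  have e20 : cross (V.dir (v, 2)) (V.dir (v, 0)) = cross (V.dir (v, 0)) (V.dir (v, 1)) := by
    rw [h2]; simp [cross]; ring
  fin_cases i
  · exact h01
  · change 0 < cross (V.dir (v, 1)) (V.dir (v, 2)); rwa [e12]
  · change 0 < cross (V.dir (v, 2)) (V.dir (v, 0)); rwa [e20]

/-- Different rays at a vertex have different directions. -/
theorem eq_of_smul_dir_eq {v : C.Vertex} {i j : Fin 3} {a b : ℝ} (ha : 0 ≤ a) (hb : 0 < b)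
    (h : a • V.dir (v, i) = b • V.dir (v, j)) : i = j ∧ a = b := by
  have key : ∀ {i j : Fin 3}, j = i + 1 → a • V.dir (v, i) = b • V.dir (v, j) → False := by
    rintro i j rfl h
    have hx : a * (V.dir (v, i)).1 = b * (V.dir (v, i + 1)).1 := congrArg Prod.fst h
    have hy : a * (V.dir (v, i)).2 = b * (V.dir (v, i + 1)).2 := congrArg Prod.snd h
    have h2 := V.cross_dir v i
    have h3 : b * cross (V.dir (v, i)) (V.dir (v, i + 1)) = 0 := by
      rw [cross]
      linear_combination -(V.dir (v, i)).1 * hy + (V.dir (v, i)).2 * hx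
    exact (mul_pos hb h2).ne' h3
  have key' : ∀ {i j : Fin 3}, i = j + 1 → a • V.dir (v, i) = b • V.dir (v, j) → False := by
    rintro i j rfl h
    rcases ha.eq_or_lt with rfl | ha
    · rw [zero_smul, eq_comm, smul_eq_zero] at h
      exact h.elim hb.ne' (V.dir_spec (v, j)).1
    have hx : a * (V.dir (v, j + 1)).1 = b * (V.dir (v, j)).1 := congrArg Prod.fst h
    have hy : a * (V.dir (v, j + 1)).2 = b * (V.dir (v, j)).2 := congrArg Prod.snd h
    have h2 := V.cross_dir v j
    have h3 : a * cross (V.dir (v, j)) (V.dir (v, j + 1)) = 0 := by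
      rw [cross]
      linear_combination (V.dir (v, j)).1 * hy - (V.dir (v, j)).2 * hx
    exact (mul_pos ha h2).ne' h3
  have hij : i = j := by
    by_contra hne
    have : j = i + 1 ∨ i = j + 1 := by
      revert hne; fin_cases i <;> fin_cases j <;> simp
    rcases this with h' | h'
    · exact key h' h
    · exact key' h' h
  subst hij
  refine ⟨rfl, ?_⟩
  have h0 : (a - b) • V.dir (v, i) = 0 := by rw [sub_smul, h, sub_self]
  rcases smul_eq_zero.mp h0 with h1 | h1
  · linarith
  · exact absurd h1 (V.dir_spec (v, i)).1

end SimplePhaseTropicalCurve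

/-! ### Edges of simple phase-tropical curves -/

namespace SimplePhaseTropicalCurve

open TropicalPolynomial

variable {C : TropicalPolynomial} (V : SimplePhaseTropicalCurve C)

theorem mem_segment_add_iff {v d y : ℝ × ℝ} {T : ℝ} (hT : 0 < T) :
    y ∈ segment ℝ v (v + T • d) ↔ ∃ t ∈ Icc 0 T, y = v + t • d := by
  rw [segment_eq_image']
  constructor
  · rintro ⟨θ, hθ, rfl⟩
    exact ⟨θ * T, ⟨by nlinarith [hθ.1], by nlinarith [hθ.2]⟩, by simp [smul_smul]⟩
  · rintro ⟨t, ht, rfl⟩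
    refine ⟨t / T, ⟨div_nonneg ht.1 hT.le, (div_le_one hT).mpr ht.2⟩, ?_⟩
    simp only [add_sub_cancel_left, smul_smul]
    rw [div_mul_cancel₀ _ hT.ne']

theorem mem_openSegment_add_iff {v d y : ℝ × ℝ} {T : ℝ} (hT : 0 < T) :
    y ∈ openSegment ℝ v (v + T • d) ↔ ∃ t ∈ Ioo 0 T, y = v + t • d := by
  rw [openSegment_eq_image']
  constructor
  · rintro ⟨θ, hθ, rfl⟩
    exact ⟨θ * T, ⟨by nlinarith [hθ.1], by nlinarith [hθ.2]⟩, by simp [smul_smul]⟩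
  · rintro ⟨t, ht, rfl⟩
    refine ⟨t / T, ⟨div_pos ht.1 hT, (div_lt_one hT).mpr ht.2⟩, ?_⟩
    simp only [add_sub_cancel_left, smul_smul]
    rw [div_mul_cancel₀ _ hT.ne']

/-- The rays `h` and `h'` are the two halves of an edge, which has the lengths `T` and `T'` with
respect to the two direction vectors. -/
structure Opposite (h h' : C.Vertex × Fin 3) (T T' : ℝ) : Prop where
  pos : 0 < T
  pos' : 0 < T'
  eq : h'.1.1 = h.1.1 + T • V.dir h
  opp : T • V.dir h = -(T' • V.dir h')
  not_isVertex : ∀ y ∈ openSegment ℝ h.1.1 h'.1.1, ¬ C.IsVertex y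

variable {V}

namespace Opposite

variable {h h' : C.Vertex × Fin 3} {T T' : ℝ}

theorem symm (H : V.Opposite h h' T T') : V.Opposite h' h T' T where
  pos := H.pos'
  pos' := H.pos
  eq := by rw [H.eq, H.opp]; abel
  opp := by rw [H.opp, neg_neg]
  not_isVertex := by rw [openSegment_symm]; exact H.not_isVertex

theorem not_isVertex_add (H : V.Opposite h h' T T') {t : ℝ} (ht : t ∈ Ioo 0 T) :
    ¬ C.IsVertex (h.1.1 + t • V.dir h) :=
  H.not_isVertex _ (by rw [H.eq]; exact (mem_openSegment_add_iff H.pos).mpr ⟨t, ht, rfl⟩)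

theorem fst_ne (H : V.Opposite h h' T T') : h.1 ≠ h'.1 := by
  intro e
  have h1 := H.eq
  rw [← e, left_eq_add, smul_eq_zero] at h1
  exact h1.elim H.pos.ne' (V.dir_spec h).1

theorem adj (H : V.Opposite h h' T T') (hC : C.IsSimple) :
    C.normalizationGraph.Adj h.1 h'.1 := by
  refine ⟨H.fst_ne, fun y hy => ?_, H.not_isVertex⟩
  rw [H.eq, mem_segment_add_iff H.pos] at hy
  obtain ⟨t, ht, rfl⟩ := hy
  exact hC.segment_subset_curve (V.dir_spec h).2 (fun t ht => H.not_isVertex_add ht) t ht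

theorem unique {h₁ h₂ : C.Vertex × Fin 3} {T₁ T₁' T₂ T₂' : ℝ} (H₁ : V.Opposite h h₁ T₁ T₁')
    (H₂ : V.Opposite h h₂ T₂ T₂') : h₁ = h₂ ∧ T₁ = T₂ := by
  have hT : T₁ = T₂ := by
    rcases lt_trichotomy T₁ T₂ with hlt | heq | hlt
    · exact absurd (H₁.eq ▸ h₁.1.2) (H₂.not_isVertex_add ⟨H₁.pos, hlt⟩)
    · exact heq
    · exact absurd (H₂.eq ▸ h₂.1.2) (H₁.not_isVertex_add ⟨H₂.pos, hlt⟩)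
  subst hT
  refine ⟨?_, rfl⟩
  obtain ⟨v₁, j₁⟩ := h₁
  obtain ⟨v₂, j₂⟩ := h₂
  obtain rfl : v₁ = v₂ := Subtype.ext (H₁.eq.trans H₂.eq.symm)
  have e := neg_injective (H₁.opp.symm.trans H₂.opp)
  rw [(V.eq_of_smul_dir_eq H₁.pos'.le H₂.pos' e).1]

end Opposite

/-- A segment of the curve between two vertices follows a ray at each of its ends. -/
theorem exists_opposite_of_adj {v v' : C.Vertex} (h : C.normalizationGraph.Adj v v') :
    ∃ i j T T', V.Opposite (v, i) (v', j) T T' := by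
  obtain ⟨hne, hseg, hno⟩ := h
  have key : ∀ {v v' : C.Vertex}, v ≠ v' → segment ℝ v.1 v'.1 ⊆ C.curve →
      ∃ i, ∃ T : ℝ, 0 < T ∧ v'.1 - v.1 = T • V.dir (v, i) := by
    intro v v' hne hseg
    refine V.directions v _ (sub_ne_zero.mpr fun e => hne (Subtype.ext e.symm)) ?_
    rw [← C.eventually_mem_curve_iff]
    filter_upwards [Ioo_mem_nhdsGT one_pos] with t ht
    refine hseg ?_
    rw [segment_eq_image']
    exact ⟨t, ⟨ht.1.le, ht.2.le⟩, rfl⟩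
  obtain ⟨i, T, hT, e⟩ := key hne hseg
  obtain ⟨j, T', hT', e'⟩ := key hne.symm (by rwa [segment_symm])
  exact ⟨i, j, T, T', hT, hT', by simp [← e], by simp [← e, ← e'], hno⟩

/-- If there is a vertex beyond the start of a ray, then the ray is half of the edge to the first
such vertex: it continues straight through the points dual to parallelograms. -/
theorem exists_opposite (hC : C.IsSimple) {h : C.Vertex × Fin 3} {t : ℝ} (ht : 0 < t)
    (hv : C.IsVertex (h.1.1 + t • V.dir h)) : ∃ h' T T', V.Opposite h h' T T' ∧ T ≤ t := by
  rcases C.first_vertex h.1.1 (V.dir_spec h).1 with hno | ⟨T, hT, hvT, hno⟩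
  · exact absurd hv (hno t ht)
  · have hcurve := hC.segment_subset_curve (V.dir_spec h).2 hno
    have hneg : (face (C.active (h.1.1 + T • V.dir h)) (-V.dir h)).Nontrivial := by
      rw [← C.eventually_mem_curve_iff]
      filter_upwards [Ioo_mem_nhdsGT hT] with s hs
      have := hcurve (T - s) ⟨by linarith [hs.2], by linarith [hs.1]⟩
      rwa [show h.1.1 + T • V.dir h + s • -V.dir h = h.1.1 + (T - s) • V.dir h by
        rw [sub_smul, smul_neg]; abel]
    obtain ⟨j, r, hr, e⟩ := V.directions ⟨_, hvT⟩ _ (neg_ne_zero.mpr (V.dir_spec h).1) hneg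
    refine ⟨(⟨_, hvT⟩, j), T, T * r, ⟨hT, mul_pos hT hr, rfl, ?_, ?_⟩, ?_⟩
    · rw [mul_smul, ← e, smul_neg, neg_neg]
    · intro y hy
      obtain ⟨s, hs, rfl⟩ := (mem_openSegment_add_iff hT).mp hy
      exact hno s hs
    · by_contra! hlt
      exact hno t ⟨ht, hlt⟩ hv

theorem sum_height_arm' (v : C.Vertex) (i : Fin 3) {u : ℂ} (hu : 0 ≤ u.re) :
    ∑ j, height j (arm i u) • V.dir (v, j) = u.re • V.dir (v, i) := by
  rw [Finset.sum_eq_single i (fun j _ hj => by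
    rw [height_arm _ _ hu, if_neg hj.symm, zero_smul]) (by simp), height_arm_self _ hu]

/-- A point of the phase-tropical line is over the vertex or over one of the rays. -/
theorem height_cases {q : Torus} (hq : q ∈ phaseTropicalLine) :
    (∀ i, height i q = 0) ∨ ∃ i u, q = arm i u ∧ 0 < u.re := by
  by_cases h : ∃ i, 0 < height i q
  · obtain ⟨i, hi⟩ := h
    obtain ⟨u, e, hu⟩ := eq_arm_of_height_pos hq hi
    exact Or.inr ⟨i, u, e, hu ▸ hi⟩
  · push Not at h
    exact Or.inl fun i => le_antisymm (h i) (height_nonneg i q)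

/-- The part of a phase-tropical line over an edge. -/
theorem turn_mem_partOver_openSegment {h h' : C.Vertex × Fin 3} {T T' : ℝ}
    (H : V.Opposite h h' T T') {q : Torus} : turn (V.flipped h.1) q ∈
      (V.chart h.1).partOver (openSegment ℝ h.1.1 h'.1.1) ↔
      ∃ u : ℂ, q = arm h.2 u ∧ 0 < u.re ∧ u.re < T := by
  rw [ToricMorphism.partOver, mem_ofPred_eq, turn_mem_phaseTropicalLine, amoeba_chart_turn, H.eq,
    mem_openSegment_add_iff H.pos]
  constructor
  · rintro ⟨hq, t, ht, e⟩
    have e := add_left_cancel e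
    rcases height_cases hq with h0 | ⟨i, u, rfl, hu⟩
    · simp only [h0, zero_smul, Finset.sum_const_zero] at e
      exact absurd e.symm (smul_ne_zero ht.1.ne' (V.dir_spec h).1)
    · rw [sum_height_arm' _ _ hu.le] at e
      obtain ⟨rfl, rfl⟩ := V.eq_of_smul_dir_eq (v := h.1) (j := h.2) hu.le ht.1 e
      exact ⟨u, rfl, ht.1, ht.2⟩
  · rintro ⟨u, rfl, h0, h1⟩
    exact ⟨arm_mem_phaseTropicalLine _ h0.le, u.re, ⟨h0, h1⟩, by rw [sum_height_arm' _ _ h0.le]⟩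

/-- The part of a phase-tropical line over a tripod. -/
theorem turn_mem_partOver_tripod (hC : C.IsSimple) {v : C.Vertex} {q : Torus} :
    turn (V.flipped v) q ∈ (V.chart v).partOver (C.tripod v) ↔ q ∈ phaseTropicalLine ∧
      ∀ i h' T T', V.Opposite (v, i) h' T T' → height i q < T := by
  rw [ToricMorphism.partOver, mem_ofPred_eq, turn_mem_phaseTropicalLine, amoeba_chart_turn]
  refine and_congr_right fun hq => ?_
  rcases height_cases hq with h0 | ⟨i, u, rfl, hu⟩
  · simp only [h0, zero_smul, Finset.sum_const_zero, add_zero]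
    refine iff_of_true ⟨?_, ?_⟩ fun i h' T T' H => H.pos
    · intro y hy
      rw [segment_same, mem_singleton_iff] at hy
      have := hC.segment_subset_curve (V.dir_spec (v, 0)).2 (T := 0) (by simp) 0 (by simp)
      simpa [hy] using this
    · intro y hy _
      rwa [segment_same, mem_singleton_iff] at hy
  · rw [sum_height_arm' _ _ hu.le]
    constructor
    · rintro ⟨-, h2⟩ j h' T T' H
      rw [height_arm _ _ hu.le]
      split_ifs with hij
      · subst hij
        by_contra! hle
        have hmem : h'.1.1 ∈ segment ℝ v.1 (v.1 + u.re • V.dir (v, i)) :=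
          (mem_segment_add_iff hu).mpr ⟨T, ⟨H.pos.le, hle⟩, H.eq⟩
        exact H.fst_ne (Subtype.ext (h2 _ hmem h'.1.2).symm)
      · exact H.pos
    · intro hall
      have hno : ∀ t, 0 < t → t ≤ u.re → ¬ C.IsVertex (v.1 + t • V.dir (v, i)) := by
        intro t ht htu hv
        obtain ⟨h', T, T', H, hTt⟩ := exists_opposite hC (h := (v, i)) ht hv
        have := hall i h' T T' H
        rw [height_arm_self _ hu.le] at this
        linarith
      constructor
      · intro y hy
        obtain ⟨t, ht, rfl⟩ := (mem_segment_add_iff hu).mp hy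
        exact hC.segment_subset_curve (V.dir_spec (v, i)).2
          (fun t ht => hno t ht.1 ht.2.le) t ht
      · intro y hy hv
        obtain ⟨t, ht, rfl⟩ := (mem_segment_add_iff hu).mp hy
        rcases ht.1.eq_or_lt with rfl | h0
        · simp
        · exact absurd hv (hno t h0 ht.2)

end SimplePhaseTropicalCurve

/-! ### The gluing over an edge -/

theorem exists_int_of_cexpUnit_eq_one {x : ℝ}
    (h : cexpUnit (x * (2 * Real.pi * Complex.I)) = 1) : ∃ n : ℤ, x = n := by
  have h1 : Complex.exp (x * (2 * Real.pi * Complex.I)) = 1 := congrArg Units.val h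
  obtain ⟨n, hn⟩ := Complex.exp_eq_one_iff.mp h1
  refine ⟨n, ?_⟩
  have h2 : ((x : ℂ)) = n := mul_right_cancel₀ Complex.two_pi_I_ne_zero hn
  exact_mod_cast h2

theorem finite_setOf_pow_eq {m : ℕ} (hm : 0 < m) (c : ℂˣ) : {ζ : ℂˣ | ζ ^ m = c}.Finite := by
  refine ((Polynomial.nthRoots m (c : ℂ)).toFinset.finite_toSet.preimage (f := Units.val)
    Units.val_injective.injOn).subset fun ζ hζ => ?_
  simpa [Polynomial.mem_nthRoots hm] using congrArg Units.val hζ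

theorem star_arm_of_im_eq_zero (i : Fin 3) {u : ℂ} (hu : u.im = 0) : star (arm i u) = arm i u := by
  rw [star_arm]
  congr 1
  exact Complex.conj_eq_iff_im.mpr hu

theorem star_arm_add_pi (i : Fin 3) (r : ℝ) :
    star (arm i (r + Real.pi * Complex.I)) = arm i (r + Real.pi * Complex.I) := by
  rw [star_arm, arm_eq_iff, Complex.exp_eq_exp_iff_exists_int]
  exact ⟨-1, by simp; ring⟩

/-- The real rays that meet at a corner are in the same quadrant. -/
theorem sameQuadrant_turn_arm (b : Bool) (i : Fin 3) (r x : ℝ) :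
    SimpleRealTropicalCurve.SameQuadrant (turn b (arm i (r + Real.pi * Complex.I)))
      (turn b (arm (i + 1) x)) := by
  have e : Complex.exp (r + Real.pi * Complex.I) = -(Real.exp r : ℝ) := by
    rw [Complex.exp_add, Complex.exp_pi_mul_I]; push_cast; ring
  have e' : Complex.exp (x : ℂ) = (Real.exp x : ℝ) := by push_cast; rfl
  have h1 := Real.exp_pos r
  have h2 := Real.exp_pos x
  have h3 : ∀ y : ℝ, ((Real.exp y : ℝ) : ℂ)⁻¹ = ((Real.exp y)⁻¹ : ℝ) := by intro y; push_cast; rfl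
  have main : SimpleRealTropicalCurve.SameQuadrant (arm i (r + Real.pi * Complex.I))
      (arm (i + 1) x) := by
    unfold SimpleRealTropicalCurve.SameQuadrant
    fin_cases i
    · simp only [arm, annulus, Fin.zero_eta, Fin.isValue, zero_add, Matrix.cons_val_zero,
        Matrix.cons_val_one, Units.val_neg, Units.val_one, Units.val_inv_eq_inv_val, coe_cexpUnit,
        e, e', inv_neg, h3, Complex.neg_re, Complex.ofReal_re, Complex.one_re]
      constructor <;> nlinarith [inv_pos.mpr h1, inv_pos.mpr h2]
    · change 0 < ((annulus 1 _).1 : ℂ).re * ((annulus 2 _).1 : ℂ).re ∧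
        0 < ((annulus 1 _).2 : ℂ).re * ((annulus 2 _).2 : ℂ).re
      simp only [annulus, Fin.isValue, Matrix.cons_val, Matrix.cons_val_one, Units.val_neg,
        Units.val_one, Units.val_inv_eq_inv_val, coe_cexpUnit,
        e, e', inv_neg, h3, Complex.neg_re, Complex.ofReal_re, Complex.one_re]
      constructor <;> nlinarith [inv_pos.mpr h1, inv_pos.mpr h2, mul_pos (inv_pos.mpr h1) h2]
    · change 0 < ((annulus 2 _).1 : ℂ).re * ((annulus 0 _).1 : ℂ).re ∧
        0 < ((annulus 2 _).2 : ℂ).re * ((annulus 0 _).2 : ℂ).re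
      simp only [annulus, Fin.isValue, Matrix.cons_val, Matrix.cons_val_zero, Units.val_neg,
        Units.val_one, Units.val_inv_eq_inv_val, coe_cexpUnit,
        e, e', h3, Complex.neg_re, Complex.ofReal_re, Complex.one_re]
      constructor <;> nlinarith [inv_pos.mpr h1, inv_pos.mpr h2, mul_pos (inv_pos.mpr h2) h1]
  cases b
  · exact main
  · exact main.symm

namespace SimplePhaseTropicalCurve

open TropicalPolynomial

variable {C : TropicalPolynomial} {V : SimplePhaseTropicalCurve C}

/-- The two rays of an edge have opposite primitive directions. -/
theorem Opposite.exists_coprime {h h' : C.Vertex × Fin 3} {T T' : ℝ} (H : V.Opposite h h' T T') :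
    ∃ (m m' : ℕ) (u : ℤ × ℤ), 0 < m ∧ 0 < m' ∧ IsCoprime u.1 u.2 ∧
      V.dirInt h = (m : ℤ) • u ∧ V.dirInt h' = -((m' : ℤ) • u) := by
  obtain ⟨m, u, hm, hu, e, -⟩ := V.exists_dirInt_eq h
  obtain ⟨m', u', hm', hu', e', -⟩ := V.exists_dirInt_eq h'
  have hopp := H.opp
  rw [dir, dir, e, e'] at hopp
  have a1 : T * (m * u.1) = -(T' * (m' * u'.1)) := by
    simpa [toReal] using congrArg Prod.fst hopp
  have a2 : T * (m * u.2) = -(T' * (m' * u'.2)) := by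
    simpa [toReal] using congrArg Prod.snd hopp
  have hmr : (0 : ℝ) < m := by exact_mod_cast hm
  have hmr' : (0 : ℝ) < m' := by exact_mod_cast hm'
  have hp : 0 < T * m := mul_pos H.pos hmr
  have hp' : 0 < T' * m' := mul_pos H.pos' hmr'
  have hcr : u.1 * u'.2 = u.2 * u'.1 := by
    have : (T * m) * ((u.1 : ℝ) * u'.2 - u.2 * u'.1) = 0 := by
      linear_combination u'.2 * a1 - u'.1 * a2
    rcases mul_eq_zero.mp this with h0 | h0
    · exact absurd h0 hp.ne'
    · have := sub_eq_zero.mp h0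
      exact_mod_cast this
  obtain ⟨x, y, hxy⟩ := hu
  obtain ⟨x', y', hxy'⟩ := hu'
  have s1 : u'.1 = (x * u'.1 + y * u'.2) * u.1 := by
    linear_combination -u'.1 * hxy - y * hcr
  have s2 : u'.2 = (x * u'.1 + y * u'.2) * u.2 := by
    linear_combination -u'.2 * hxy + x * hcr
  set s := x * u'.1 + y * u'.2 with hs
  have hunit : (x' * u.1 + y' * u.2) * s = 1 := by
    linear_combination hxy' - x' * s1 - y' * s2
  rcases Int.isUnit_iff.mp (IsUnit.of_mul_eq_one_right _ hunit) with h1 | h1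
  · exfalso
    rw [h1, one_mul] at s1 s2
    rw [s1] at a1
    rw [s2] at a2
    have b1 : (T * m + T' * m') * (u.1 : ℝ) = 0 := by linear_combination a1
    have b2 : (T * m + T' * m') * (u.2 : ℝ) = 0 := by linear_combination a2
    have hne : T * m + T' * m' ≠ 0 := by positivity
    have c1 : u.1 = 0 := by exact_mod_cast (mul_eq_zero.mp b1).resolve_left hne
    have c2 : u.2 = 0 := by exact_mod_cast (mul_eq_zero.mp b2).resolve_left hne
    simp [c1, c2] at hxy
  · refine ⟨m, m', u, hm, hm', ⟨x, y, hxy⟩, e, ?_⟩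
    rw [e']
    rw [h1] at s1 s2
    have : u' = -u := Prod.ext (by simpa using s1) (by simpa using s2)
    rw [this, smul_neg]

/-- The gluing, in the positively oriented coordinates of the two charts. -/
def turnedGlue (V : SimplePhaseTropicalCurve C) (v v' : C.Vertex) (q : Torus) : Torus :=
  turn (V.flipped v') (V.glue v v' (turn (V.flipped v) q))

theorem Opposite.exists_turnedGlue_arm {h h' : C.Vertex × Fin 3} {T T' : ℝ}
    (H : V.Opposite h h' T T') (hC : C.IsSimple) {u : ℂ} (h0 : 0 < u.re) (h1 : u.re < T) :
    ∃ w : ℂ, V.turnedGlue h.1 h'.1 (arm h.2 u) = arm h'.2 w ∧ 0 < w.re ∧ w.re < T' := by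
  have hm := V.glue_mapsTo _ _ (H.adj hC) ((turn_mem_partOver_openSegment H).mpr ⟨u, rfl, h0, h1⟩)
  rw [← turn_turn (V.flipped h'.1) (V.glue _ _ _)] at hm
  exact (turn_mem_partOver_openSegment H.symm).mp hm

/-- The strip that parametrizes the annulus over an edge. -/
theorem isPreconnected_strip (T : ℝ) : IsPreconnected {u : ℂ | 0 < u.re ∧ u.re < T} :=
  ((convex_halfSpace_re_gt 0).inter (convex_halfSpace_re_lt T)).isPreconnected

/-- In the coordinates of the annuli, the gluing is a monomial map: it intertwines two coverings
`ζ ↦ ζ ^ m` and `ζ ↦ ζ ^ (-m')`, so it is constant up to a branch of `ζ ^ (m / m')`. Such a branch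
exists only if `m'` divides `m`. -/
theorem Opposite.exists_coord_turnedGlue {h h' : C.Vertex × Fin 3} {T T' : ℝ}
    (H : V.Opposite h h' T T') (hC : C.IsSimple) {m m' : ℕ} {u₀ : ℤ × ℤ} (hm' : 0 < m')
    (hu : IsCoprime u₀.1 u₀.2) (e : V.dirInt h = (m : ℤ) • u₀)
    (e' : V.dirInt h' = -((m' : ℤ) • u₀)) :
    m' ∣ m ∧ ∃ c : ℂˣ, ∀ u : ℂ, 0 < u.re → u.re < T →
      coord h'.2 (V.turnedGlue h.1 h'.1 (arm h.2 u)) * cexpUnit (((m : ℝ) / m' : ℝ) * u) = c := by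
  obtain ⟨k, hk⟩ := (V.chart h.1).exists_toFun_turn_arm (V.flipped h.1) h.2
  obtain ⟨k', hk'⟩ := (V.chart h'.1).exists_toFun_turn_arm (V.flipped h'.1) h'.2
  have hkd : (V.chart h.1).linInt (ray (turnIdx (V.flipped h.1) h.2)) = (m : ℤ) • u₀ := e
  have hkd' : (V.chart h'.1).linInt (ray (turnIdx (V.flipped h'.1) h'.2)) = -((m' : ℤ) • u₀) := e'
  rw [hkd] at hk
  rw [hkd'] at hk'
  have hm0 : (m' : ℝ) ≠ 0 := by exact_mod_cast hm'.ne'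
  set Z : ℂ → ℂˣ := fun u => coord h'.2 (V.turnedGlue h.1 h'.1 (arm h.2 u)) with hZ
  set f : ℂ → ℂˣ := fun u => Z u * cexpUnit (((m : ℝ) / m' : ℝ) * u) with hf
  have hpow : ∀ (n : ℕ) (u : ℂ), cexpUnit u ^ n = cexpUnit (n * u) := by
    intro n u
    exact Units.ext (by simp [Complex.exp_nat_mul])
  obtain ⟨x, y, hxy⟩ := hu
  have hpowf : ∀ u : ℂ, 0 < u.re → u.re < T →
      f u ^ m' = (k'.1 / k.1) ^ x * (k'.2 / k.2) ^ y := by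
    intro u h0 h1
    obtain ⟨w, hw, -, -⟩ := H.exists_turnedGlue_arm hC h0 h1
    have hg := V.chart_glue _ _ (H.adj hC) _
      ((turn_mem_partOver_openSegment H).mpr ⟨u, rfl, h0, h1⟩)
    have hw' : V.glue h.1 h'.1 (turn (V.flipped h.1) (arm h.2 u)) =
        turn (V.flipped h'.1) (arm h'.2 w) := by rw [← hw, turnedGlue, turn_turn]
    rw [hw', hk, hk'] at hg
    have hZw : Z u = cexpUnit w := by
      change coord h'.2 (V.turnedGlue h.1 h'.1 (arm h.2 u)) = _
      rw [hw, arm, coord_annulus]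
    have key : ∀ (a b : ℂˣ) (n : ℤ), a * cexpUnit w ^ (-((m' : ℤ) * n)) =
        b * cexpUnit u ^ ((m : ℤ) * n) →
        (cexpUnit u ^ (m : ℤ) * cexpUnit w ^ (m' : ℤ)) ^ n = a / b := by
      intro a b n hab
      rw [mul_zpow, ← zpow_mul, ← zpow_mul, eq_div_iff_mul_eq', mul_right_comm,
        mul_comm _ b, ← hab, mul_assoc, ← zpow_add, neg_add_cancel, zpow_zero, mul_one]
    have g1 := key _ _ _ (congrArg Prod.fst hg)
    have g2 := key _ _ _ (congrArg Prod.snd hg)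
    have hfm : f u ^ m' = cexpUnit u ^ (m : ℤ) * cexpUnit w ^ (m' : ℤ) := by
      rw [hf]
      simp only [mul_pow, hZw, hpow, zpow_natCast]
      rw [mul_comm]
      congr 2
      push_cast
      have : (m' : ℂ) ≠ 0 := by exact_mod_cast hm'.ne'
      field_simp
    rw [hfm, ← g1, ← g2, ← zpow_mul, ← zpow_mul, ← zpow_add, mul_comm u₀.1, mul_comm u₀.2, hxy,
      zpow_one]
  have hZc : ContinuousOn Z {u : ℂ | 0 < u.re ∧ u.re < T} := by
    refine (continuous_coord _).comp_continuousOn ((continuous_turn _).comp_continuousOn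
      ((V.glue_continuousOn _ _ (H.adj hC)).comp
        ((continuous_turn _).comp (continuous_arm _)).continuousOn fun u hu => ?_))
    exact (turn_mem_partOver_openSegment H).mpr ⟨u, rfl, hu.1, hu.2⟩
  have hfc : ContinuousOn f {u : ℂ | 0 < u.re ∧ u.re < T} :=
    hZc.mul (continuous_cexpUnit.comp (continuous_const.mul continuous_id)).continuousOn
  have hconst : ∀ u : ℂ, 0 < u.re → u.re < T → f u = f (T / 2 : ℝ) := by
    intro u h0 h1
    refine (isPreconnected_strip T).constant_of_mapsTo (finite_setOf_pow_eq hm' _).isDiscrete hfc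
      (fun u hu => hpowf u hu.1 hu.2) ⟨h0, h1⟩ ?_
    rw [mem_ofPred_eq, Complex.ofReal_re]
    exact ⟨half_pos H.pos, half_lt_self H.pos⟩
  refine ⟨?_, f (T / 2 : ℝ), hconst⟩
  -- the function `Z` has period `2πi`
  have hper := hconst ((T / 2 : ℝ) + 2 * Real.pi * Complex.I)
    (by simpa using H.pos) (by simpa using H.pos)
  have hZper : Z ((T / 2 : ℝ) + 2 * Real.pi * Complex.I) = Z (T / 2 : ℝ) := by
    have : arm h.2 ((T / 2 : ℝ) + 2 * Real.pi * Complex.I) = arm h.2 (T / 2 : ℝ) := by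
      rw [arm_eq_iff, Complex.exp_periodic]
    rw [hZ]
    simp only [this]
  rw [hf] at hper
  simp only [hZper, mul_add, cexpUnit_add] at hper
  obtain ⟨n, hn⟩ := exists_int_of_cexpUnit_eq_one (mul_left_cancel
    ((mul_left_cancel hper).trans (mul_one _).symm))
  rw [div_eq_iff hm0] at hn
  have : (m : ℤ) = n * m' := by exact_mod_cast hn
  exact_mod_cast Dvd.intro_left n this.symm

/-- The gluing over an edge inverts the coordinates of the annuli, up to a factor. -/
theorem Opposite.exists_turnedGlue_eq {h h' : C.Vertex × Fin 3} {T T' : ℝ}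
    (H : V.Opposite h h' T T') (hC : C.IsSimple) :
    T = T' ∧ V.dir h' = -V.dir h ∧ ∃ w : ℂ, w.re = T ∧ ∀ u : ℂ, 0 < u.re → u.re < T →
      V.turnedGlue h.1 h'.1 (arm h.2 u) = arm h'.2 (w - u) := by
  obtain ⟨m, m', u₀, hm, hm', hu, e, e'⟩ := H.exists_coprime
  obtain ⟨hd, c, hc⟩ := H.exists_coord_turnedGlue hC hm' hu e e'
  obtain ⟨hd', -⟩ := H.symm.exists_coord_turnedGlue hC (u₀ := -u₀) hm hu.neg_neg
    (by rw [e', smul_neg]) (by rw [e, smul_neg, neg_neg])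
  -- the gluing in the opposite direction gives the other divisibility
  obtain rfl : m = m' := Nat.dvd_antisymm hd' hd
  have hdir : V.dir h' = -V.dir h := by
    rw [dir, dir, e, e']; ext <;> simp [toReal]
  have hT : T = T' := by
    have := H.opp
    rw [hdir, smul_neg, neg_neg] at this
    exact (V.eq_of_smul_dir_eq (v := h.1) (i := h.2) (j := h.2) H.pos.le H.pos' this).2
  refine ⟨hT, hdir, ?_⟩
  obtain ⟨w, rfl⟩ := exists_cexpUnit c
  have hglue : ∀ u : ℂ, 0 < u.re → u.re < T →
      V.turnedGlue h.1 h'.1 (arm h.2 u) = arm h'.2 (w - u) := by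
    intro u h0 h1
    obtain ⟨w', hw', -, -⟩ := H.exists_turnedGlue_arm hC h0 h1
    have := hc u h0 h1
    have hm0 : (m : ℝ) ≠ 0 := by exact_mod_cast hm.ne'
    rw [hw', div_self hm0, arm, coord_annulus, Complex.ofReal_one, one_mul] at this
    rw [hw', arm, arm, sub_eq_add_neg, cexpUnit_add, cexpUnit_neg, ← this, mul_inv_cancel_right]
  refine ⟨w, ?_, hglue⟩
  have h0 : (0 : ℝ) < ((T / 2 : ℝ) : ℂ).re := by simpa using H.pos
  have h1 : ((T / 2 : ℝ) : ℂ).re < T := by simpa using H.pos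
  obtain ⟨w', hw', hp, -⟩ := H.exists_turnedGlue_arm hC h0 h1
  have hre : (w - (T / 2 : ℝ)).re = w'.re := by
    have := arm_eq_iff.mp ((hglue _ h0 h1).symm.trans hw')
    simpa [Complex.norm_exp] using congrArg norm this
  have ham := congrArg amoeba (V.chart_glue _ _ (H.adj hC) _
    ((turn_mem_partOver_openSegment H).mpr ⟨_, rfl, h0, h1⟩))
  rw [← turn_turn (V.flipped h'.1) (V.glue _ _ _)] at ham
  change amoeba ((V.chart h'.1).toFun (turn _ (V.turnedGlue h.1 h'.1 _))) = _ at ham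
  rw [hw', amoeba_chart_arm _ _ _ hp.le, amoeba_chart_arm _ _ _ h0.le, H.eq, ← hre] at ham
  have hd : V.dir (h'.1, h'.2) = -V.dir h := hdir
  rw [hd, smul_neg, add_assoc] at ham
  have ham := add_left_cancel ham
  rw [← sub_eq_add_neg, ← sub_smul] at ham
  have h2 := smul_left_injective ℝ (V.dir_spec h).1 ham
  simp at h2
  linarith

/-- There are points on every ray that are not beyond the end of the edge. -/
theorem exists_lt_of_opposite (h : C.Vertex × Fin 3) :
    ∃ r : ℝ, 0 < r ∧ ∀ h' T T', V.Opposite h h' T T' → r < T := by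
  by_cases hex : ∃ h' T T', V.Opposite h h' T T'
  · obtain ⟨h', T, T', H⟩ := hex
    refine ⟨T / 2, half_pos H.pos, fun h'' S S' H' => ?_⟩
    rw [← (H.unique H').2]
    exact half_lt_self H.pos
  · refine ⟨1, one_pos, fun h' T T' H => (hex ⟨h', T, T', H⟩).elim⟩

theorem turn_arm_mem_partOver_tripod (hC : C.IsSimple) {v : C.Vertex} {i : Fin 3} {u : ℂ}
    (hu : 0 ≤ u.re) (h1 : ∀ h' T T', V.Opposite (v, i) h' T T' → u.re < T) :
    turn (V.flipped v) (arm i u) ∈ (V.chart v).partOver (C.tripod v) := by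
  refine (turn_mem_partOver_tripod hC).mpr ⟨arm_mem_phaseTropicalLine i hu, fun j h' T T' H => ?_⟩
  rw [height_arm _ _ hu]
  split_ifs with hij
  · subst hij; exact h1 _ _ _ H
  · exact H.pos

end SimplePhaseTropicalCurve

namespace SimpleRealTropicalCurve

open SimplePhaseTropicalCurve

variable {C : TropicalPolynomial} {V : SimpleRealTropicalCurve C}

/-- Without inflection patterns, the gluing is `ζ ↦ -e^T / ζ` in the coordinates of the annuli: the
real lines on the same side of the edge are glued to each other. -/
theorem IsHarnack.turnedGlue_arm (hV : V.IsHarnack) {h h' : C.Vertex × Fin 3} {T T' : ℝ}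
    (H : V.Opposite h h' T T') {u : ℂ} (h0 : 0 < u.re) (h1 : u.re < T) :
    V.turnedGlue h.1 h'.1 (arm h.2 u) = arm h'.2 (T + Real.pi * Complex.I - u) := by
  have hC := hV.simple
  obtain ⟨rfl, hdir, w, hw, hglue⟩ := H.exists_turnedGlue_eq hC
  have p0 : (0 : ℝ) < ((T / 2 : ℝ) : ℂ).re := by simpa using H.pos
  have p1 : ((T / 2 : ℝ) : ℂ).re < T := by simpa using H.pos
  have hmem := (turn_mem_partOver_openSegment H).mpr ⟨_, rfl, p0, p1⟩
  have hreal := hglue _ p0 p1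
  -- the gluing is compatible with complex conjugation, so the factor is real
  have hsin : Real.sin w.im = 0 := by
    have hs := V.glue_star _ _ (H.adj hC) _ hmem
    rw [star_turn, star_arm_of_im_eq_zero _ (by simp)] at hs
    have hs' := congrArg (turn (V.flipped h'.1)) hs
    rw [← star_turn] at hs'
    change V.turnedGlue h.1 h'.1 (arm h.2 (T / 2 : ℝ)) =
      star (V.turnedGlue h.1 h'.1 (arm h.2 (T / 2 : ℝ))) at hs'
    rw [hreal, star_arm, arm_eq_iff] at hs'
    have h2 := congrArg (fun z => z * Complex.exp (T / 2 : ℝ)) hs'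
    simp only [← Complex.exp_add, star_sub, Complex.star_def, Complex.conj_ofReal,
      sub_add_cancel] at h2
    have h3 := congrArg Complex.im h2
    rw [Complex.exp_im, Complex.exp_im, Complex.conj_re, Complex.conj_im, Real.sin_neg] at h3
    have h4 := Real.exp_pos w.re
    nlinarith
  rcases cexp_eq_of_sin_eq_zero hsin with hexp | hexp
  -- for a positive factor, the real line of the edge on the side of the ray `i - 1` at `v` is glued
  -- to the one on the side of the ray `j - 1` at `v'`; these rays are on different sides of the edge
  · exfalso
    rw [hw] at hexp
    obtain ⟨v, i⟩ := h
    obtain ⟨v', j⟩ := h'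
    obtain ⟨r, hr, hr'⟩ := V.exists_lt_of_opposite (v, i - 1)
    obtain ⟨s, hs, hs'⟩ := V.exists_lt_of_opposite (v', j - 1)
    have hp3 : V.glue v v' (turn (V.flipped v) (arm i (T / 2 : ℝ))) =
        turn (V.flipped v') (arm j (T / 2 : ℝ)) := by
      rw [← turn_turn (V.flipped v') (V.glue _ _ _)]
      change turn _ (V.turnedGlue v v' _) = _
      rw [hreal]
      congr 1
      rw [arm_eq_iff, Complex.exp_sub, hexp, ← Complex.exp_sub]
      congr 1
      push_cast
      ring
    have q1 : turn (V.flipped v) (arm (i - 1) (r + Real.pi * Complex.I)) ∈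
        (V.chart v).partOver (C.tripod v) :=
      turn_arm_mem_partOver_tripod hC (by simpa using hr.le) (by simpa using hr')
    have q2 : turn (V.flipped v) (arm i (T / 2 : ℝ)) ∈ (V.chart v).partOver (C.tripod v) :=
      turn_arm_mem_partOver_tripod hC p0.le fun h' S S' H' => by rwa [← (H.unique H').2]
    have q3 : turn (V.flipped v') (arm j (T / 2 : ℝ)) ∈ (V.chart v').partOver (C.tripod v') :=
      turn_arm_mem_partOver_tripod hC p0.le fun h' S S' H' => by rwa [← (H.symm.unique H').2]
    have q4 : turn (V.flipped v') (arm (j - 1) (s + Real.pi * Complex.I)) ∈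
        (V.chart v').partOver (C.tripod v') :=
      turn_arm_mem_partOver_tripod hC (by simpa using hs.le) (by simpa using hs')
    refine hV.no_inflection v v' ⟨H.adj hC, ⟨_, q1⟩, ⟨_, q2⟩, ⟨_, q3⟩, ⟨_, q4⟩, ?_, ?_, ?_, ?_,
      ?_, ?_, ?_, ?_, ?_⟩
    · rw [star_turn, star_arm_add_pi]
    · rw [star_turn, star_arm_of_im_eq_zero _ (by simp)]
    · rw [star_turn, star_arm_of_im_eq_zero _ (by simp)]
    · rw [star_turn, star_arm_add_pi]
    · exact hmem.2
    · exact Quot.sound ⟨H.adj hC, hmem, hp3.symm⟩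
    · have := sameQuadrant_turn_arm (V.flipped v) (i - 1) r (T / 2)
      rwa [sub_add_cancel] at this
    · have := sameQuadrant_turn_arm (V.flipped v') (j - 1) s (T / 2)
      rw [sub_add_cancel] at this
      exact ⟨by rw [mul_comm]; exact this.1, by rw [mul_comm]; exact this.2⟩
    · have a1 : V.amoebaMap (V.point v ⟨_, q1⟩) = v.1 + r • V.dir (v, i - 1) := by
        refine (V.amoeba_chart_arm v (i - 1) (by simpa using hr.le)).trans ?_
        simp
      have a4 : V.amoebaMap (V.point v' ⟨_, q4⟩) = v'.1 + s • V.dir (v', j - 1) := by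
        refine (V.amoeba_chart_arm v' (j - 1) (by simpa using hs.le)).trans ?_
        simp
      have c1 := V.cross_dir v (i - 1)
      have c2 := V.cross_dir v' (j - 1)
      rw [sub_add_cancel] at c1 c2
      rw [hdir] at c2
      have hv' : v'.1 = v.1 + T • V.dir (v, i) := H.eq
      rw [a1, a4, hv', add_sub_cancel_left, add_sub_cancel_left, add_assoc, add_sub_cancel_left]
      have d1 : cross (T • V.dir (v, i)) (r • V.dir (v, i - 1)) =
          -(T * r * cross (V.dir (v, i - 1)) (V.dir (v, i))) := by
        simp [cross]; ring
      have d2 : cross (T • V.dir (v, i)) (T • V.dir (v, i) + s • V.dir (v', j - 1)) =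
          T * s * cross (V.dir (v', j - 1)) (-V.dir (v, i)) := by
        simp [cross]; ring
      rw [d1, d2]
      have := mul_pos (mul_pos (mul_pos H.pos hr) c1) (mul_pos (mul_pos H.pos hs) c2)
      linarith
  · rw [hglue u h0 h1, arm_eq_iff, Complex.exp_sub, hexp, hw, ← Complex.exp_sub]

end SimpleRealTropicalCurve

/-! ### The normalization as a surface glued from phase-tropical lines -/

namespace SimplePhaseTropicalCurve

open TropicalPolynomial

variable {C : TropicalPolynomial} (V : SimplePhaseTropicalCurve C)

open Classical in
/-- The other half of the edge that starts along a ray; the ray itself if it is a leaf. -/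
def oppositeRay (h : C.Vertex × Fin 3) : C.Vertex × Fin 3 :=
  if H : ∃ h' T T', V.Opposite h h' T T' then H.choose else h

open Classical in
/-- The length of the edge that starts along a ray, measured with respect to the direction vector;
the value `1` for leaves is irrelevant. -/
def rayLength (h : C.Vertex × Fin 3) : ℝ :=
  if H : ∃ h' T T', V.Opposite h h' T T' then H.choose_spec.choose else 1

variable {V}

theorem Opposite.oppositeRay_eq {h h' : C.Vertex × Fin 3} {T T' : ℝ} (H : V.Opposite h h' T T') :
    V.oppositeRay h = h' := by
  have hex : ∃ h' T T', V.Opposite h h' T T' := ⟨h', T, T', H⟩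
  rw [oppositeRay, dif_pos hex]
  obtain ⟨T₂', H₂⟩ := hex.choose_spec.choose_spec
  exact (H₂.unique H).1

theorem Opposite.rayLength_eq {h h' : C.Vertex × Fin 3} {T T' : ℝ} (H : V.Opposite h h' T T') :
    V.rayLength h = T := by
  have hex : ∃ h' T T', V.Opposite h h' T T' := ⟨h', T, T', H⟩
  rw [rayLength, dif_pos hex]
  obtain ⟨T₂', H₂⟩ := hex.choose_spec.choose_spec
  exact (H₂.unique H).2

variable (V) in
/-- The tropical curve as a 3-valent graph in the plane. -/
def planeRibbon (hC : C.IsSimple) : PlaneRibbon C.Vertex where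
  IsEdge h := ∃ h' T T', V.Opposite h h' T T'
  opp := V.oppositeRay
  len := V.rayLength
  len_pos := by
    rintro h ⟨h', T, T', H⟩
    rw [H.rayLength_eq]; exact H.pos
  isEdge_opp := by
    rintro h ⟨h', T, T', H⟩
    rw [H.oppositeRay_eq]; exact ⟨_, _, _, H.symm⟩
  opp_opp := by
    rintro h ⟨h', T, T', H⟩
    rw [H.oppositeRay_eq, H.symm.oppositeRay_eq]
  len_opp := by
    rintro h ⟨h', T, T', H⟩
    rw [H.oppositeRay_eq, H.symm.rayLength_eq, H.rayLength_eq, (H.exists_turnedGlue_eq hC).1]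
  opp_fst_ne := by
    rintro h ⟨h', T, T', H⟩
    rw [H.oppositeRay_eq]; exact H.fst_ne.symm
  vertexPos v := v.1
  dir := V.dir
  cross_dir := V.cross_dir
  dir_opp := by
    rintro h ⟨h', T, T', H⟩
    rw [H.oppositeRay_eq, (H.exists_turnedGlue_eq hC).2.1]
  vertexPos_opp := by
    rintro h ⟨h', T, T', H⟩
    rw [H.oppositeRay_eq, H.rayLength_eq, H.eq]

theorem mem_pieceSet_iff (hC : C.IsSimple) {v : C.Vertex} {q : Torus} :
    q ∈ (V.planeRibbon hC).pieceSet v ↔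
      turn (V.flipped v) q ∈ (V.chart v).partOver (C.tripod v) := by
  rw [turn_mem_partOver_tripod hC]
  refine and_congr_right fun _ => ⟨fun hq i h' T T' H => ?_, ?_⟩
  · rw [← H.rayLength_eq]; exact hq i ⟨h', T, T', H⟩
  · rintro hq i ⟨h', T, T', H⟩
    change _ < V.rayLength (v, i)
    rw [H.rayLength_eq]; exact hq i h' T T' H

end SimplePhaseTropicalCurve

namespace SimpleRealTropicalCurve

open SimplePhaseTropicalCurve

variable {C : TropicalPolynomial} {V : SimpleRealTropicalCurve C}

namespace IsHarnack

/-- The 3-valent plane graph of a phase-tropical Harnack curve. -/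
abbrev ribbon (hV : V.IsHarnack) : PlaneRibbon C.Vertex := V.planeRibbon hV.simple

variable (hV : V.IsHarnack)

/-- The point of the piece of the curve that corresponds to a point of the piece of the model. -/
def toPiece (v : C.Vertex) (p : hV.ribbon.Piece v) : V.Piece v :=
  ⟨turn (V.flipped v) p.1, (mem_pieceSet_iff hV.simple).mp p.2⟩

/-- The inverse of `toPiece`. -/
def ofPiece (v : C.Vertex) (p : V.Piece v) : hV.ribbon.Piece v :=
  ⟨turn (V.flipped v) p.1, (mem_pieceSet_iff hV.simple).mpr (by rw [turn_turn]; exact p.2)⟩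

theorem continuous_toPiece (v : C.Vertex) : Continuous (hV.toPiece v) :=
  ((continuous_turn _).comp continuous_subtype_val).subtype_mk _

theorem continuous_ofPiece (v : C.Vertex) : Continuous (hV.ofPiece v) :=
  ((continuous_turn _).comp continuous_subtype_val).subtype_mk _

theorem toPiece_ofPiece (v : C.Vertex) (p : V.Piece v) : hV.toPiece v (hV.ofPiece v p) = p :=
  Subtype.ext (turn_turn _ _)

theorem ofPiece_toPiece (v : C.Vertex) (p : hV.ribbon.Piece v) :
    hV.ofPiece v (hV.toPiece v p) = p :=
  Subtype.ext (turn_turn _ _)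

/-- Both gluings are the map `ζ ↦ -e^T / ζ` over an edge of length `T`. -/
def homeomorph : hV.ribbon.Surface ≃ₜ V.Normalization where
  toFun := Quot.map (fun x => ⟨x.1, hV.toPiece x.1 x.2⟩) (by
    rintro ⟨v, p⟩ ⟨v', q⟩ ⟨i, j, u, ⟨h', T, T', H⟩, ho, h0, h1, hp, hq⟩
    dsimp only at *
    have e1 : h' = (v', j) := H.oppositeRay_eq.symm.trans ho
    have e2 : hV.ribbon.len (v, i) = T := H.rayLength_eq
    subst e1
    rw [e2] at h1
    refine ⟨H.adj hV.simple, (turn_mem_partOver_openSegment H).mpr ⟨u, hp, h0, h1⟩, ?_⟩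
    simp only [toPiece]
    rw [hq, Ribbon.flip, e2, ← hV.turnedGlue_arm H h0 h1, turnedGlue, turn_turn, ← hp])
  invFun := Quot.map (fun x => ⟨x.1, hV.ofPiece x.1 x.2⟩) (by
    rintro ⟨v, p⟩ ⟨v', q⟩ ⟨hadj, hp, hq⟩
    dsimp only at *
    obtain ⟨i, j, T, T', H⟩ := exists_opposite_of_adj (V := V.toSimplePhaseTropicalCurve) hadj
    have e2 : hV.ribbon.len (v, i) = T := H.rayLength_eq
    rw [← turn_turn (V.flipped v) p.1, turn_mem_partOver_openSegment H] at hp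
    obtain ⟨u, hu, h0, h1⟩ := hp
    refine ⟨i, j, u, ⟨_, _, _, H⟩, H.oppositeRay_eq, h0, e2 ▸ h1, hu, ?_⟩
    simp only [ofPiece]
    rw [hq, Ribbon.flip, e2, ← hV.turnedGlue_arm H h0 h1, turnedGlue, ← hu, turn_turn])
  left_inv := by
    rintro ⟨v, p⟩
    exact congrArg (hV.ribbon.pt v) (hV.ofPiece_toPiece v p)
  right_inv := by
    rintro ⟨v, p⟩
    exact congrArg (V.point v) (hV.toPiece_ofPiece v p)
  continuous_toFun := continuous_quot_lift _ (continuous_quot_mk.comp (continuous_sigma fun _ =>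
    continuous_sigmaMk.comp (hV.continuous_toPiece _)))
  continuous_invFun := continuous_quot_lift _ (continuous_quot_mk.comp (continuous_sigma fun _ =>
    continuous_sigmaMk.comp (hV.continuous_ofPiece _)))

theorem homeomorph_pt (v : C.Vertex) (p : hV.ribbon.Piece v) :
    hV.homeomorph (hV.ribbon.pt v p) = V.point v (hV.toPiece v p) := rfl

theorem homeomorph_symm_point (v : C.Vertex) (p : V.Piece v) :
    hV.homeomorph.symm (V.point v p) = hV.ribbon.pt v (hV.ofPiece v p) := rfl

theorem amoebaMap_homeomorph (x : hV.ribbon.Surface) :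
    V.amoebaMap (hV.homeomorph x) = hV.ribbon.pos x := by
  obtain ⟨v, p, rfl⟩ := Ribbon.exists_pt x
  exact V.amoeba_chart_turn v p.1

theorem star_mem_pieceSet {v : C.Vertex} {q : Torus} (hq : q ∈ hV.ribbon.pieceSet v) :
    star q ∈ hV.ribbon.pieceSet v :=
  ⟨star_mem_phaseTropicalLine hq.1, fun i hi => by rw [height_star]; exact hq.2 i hi⟩

theorem conj_homeomorph_pt (v : C.Vertex) (p : hV.ribbon.Piece v) :
    V.conj (hV.homeomorph (hV.ribbon.pt v p)) =
      hV.homeomorph (hV.ribbon.pt v ⟨star p.1, hV.star_mem_pieceSet p.2⟩) :=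
  congrArg (V.point v) (Subtype.ext (star_turn _ _))

theorem homeomorph_pt_mem_realPart_iff {v : C.Vertex} {p : hV.ribbon.Piece v} :
    hV.homeomorph (hV.ribbon.pt v p) ∈ V.realPart ↔ star p.1 = p.1 := by
  change V.conj _ = _ ↔ _
  rw [conj_homeomorph_pt, hV.homeomorph.injective.eq_iff, (Ribbon.pt_injective v).eq_iff]
  exact Subtype.ext_iff

theorem isHalf : V.IsHalf (hV.homeomorph '' hV.ribbon.half) := by
  have hmem : ∀ v (p : hV.ribbon.Piece v), hV.homeomorph (hV.ribbon.pt v p) ∈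
      hV.homeomorph '' hV.ribbon.half ↔ 0 < imDiff p.1 := fun v p => by
    rw [hV.homeomorph.injective.mem_set_image, Ribbon.pt_mem_half_iff]
  have hconj : ∀ v (p : hV.ribbon.Piece v), hV.homeomorph (hV.ribbon.pt v p) ∈
      V.conj ⁻¹' (hV.homeomorph '' hV.ribbon.half) ↔ imDiff p.1 < 0 := fun v p => by
    rw [mem_preimage, conj_homeomorph_pt, hmem, imDiff_star, neg_pos]
  have hsurj : ∀ y : V.Normalization, ∃ v, ∃ p : hV.ribbon.Piece v,
      y = hV.homeomorph (hV.ribbon.pt v p) := fun y => by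
    obtain ⟨v, p, hp⟩ := Ribbon.exists_pt (hV.homeomorph.symm y)
    exact ⟨v, p, by rw [← hp, Homeomorph.apply_symm_apply]⟩
  refine ⟨hV.homeomorph.isOpenMap _ Ribbon.isOpen_half, ?_, ?_⟩
  · rw [Set.disjoint_left]
    intro y h1 h2
    obtain ⟨v, p, rfl⟩ := hsurj y
    exact lt_asymm ((hmem v p).mp h1) ((hconj v p).mp h2)
  · ext y
    obtain ⟨v, p, rfl⟩ := hsurj y
    rw [mem_union, hmem, hconj, mem_compl_iff, homeomorph_pt_mem_realPart_iff,
      ← imDiff_eq_zero_iff p.2.1, or_comm, ← ne_iff_lt_or_gt]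

end IsHarnack

end SimpleRealTropicalCurve

/-! ### The logarithmic curvature of a phase-tropical Harnack curve -/

theorem HasEulerCharacteristic.of_homeomorph {X X' : Type} [TopologicalSpace X]
    [TopologicalSpace X'] {χ : ℤ} (h : HasEulerCharacteristic X χ) (e : X ≃ₜ X') :
    HasEulerCharacteristic X' χ := by
  obtain ⟨Y, i1, i2, i3, hfin, ⟨f⟩, hχ⟩ := h
  exact ⟨Y, i1, i2, i3, hfin, ⟨e.symm.toHomotopyEquiv.trans f⟩, hχ⟩

theorem sq_add_sq_eq_one {d : ℝ × ℝ} (h : ‖toC d‖ = 1) : d.1 ^ 2 + d.2 ^ 2 = 1 := by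
  have h1 := Complex.sq_norm (toC d)
  rw [h, Complex.normSq_apply, toC_apply] at h1
  simp at h1
  linarith

/-- Rotating the arguments along the direction vector of an annulus is a shift of its logarithmic
coordinate. -/
theorem rotate_turn_arm (b : Bool) (i : Fin 3) (a τ : ℝ) (u : ℂ) :
    SimpleRealTropicalCurve.rotate τ (a • toReal (ray (turnIdx b i))) (turn b (arm i u)) =
      turn b (arm i (u + (τ * a : ℝ) * Complex.I)) := by
  cases b <;> fin_cases i <;>
  · simp [SimpleRealTropicalCurve.rotate, turn, turnIdx, ray, toReal, arm, annulus]
    exact Units.ext (by simp [Complex.exp_add, mul_comm])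

theorem SimplePhaseTropicalCurve.linReal_injective {C : TropicalPolynomial}
    (V : SimplePhaseTropicalCurve C) (v : C.Vertex) :
    Function.Injective (V.chart v).linReal := by
  intro x y h
  have h1 := congrArg Prod.fst h
  have h2 := congrArg Prod.snd h
  simp only [ToricMorphism.linReal] at h1 h2
  have hdet : ((V.chart v).a₁₁ * (V.chart v).a₂₂ - (V.chart v).a₁₂ * (V.chart v).a₂₁ : ℝ) ≠ 0 := by
    intro h0
    have h3 := V.cross_dir v 0
    simp only [dir, dirInt, cross] at h3
    rcases hb : V.flipped v with _ | _ <;>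
    · simp [hb, turnIdx, ray, toReal, ToricMorphism.linInt] at h3
      linarith
  refine Prod.ext ?_ ?_
  · refine mul_left_cancel₀ hdet ?_
    linear_combination (V.chart v).a₂₂ * h1 - (V.chart v).a₁₂ * h2
  · refine mul_left_cancel₀ hdet ?_
    linear_combination (V.chart v).a₁₁ * h2 - (V.chart v).a₂₁ * h1

namespace PlaneAtlas

open ArcAtlas

variable {K Y : Type*} {D : PlaneAtlas K Y}

/-- On both sides of any time, the path is affine with a velocity of norm one. -/
theorem planePath_unit_speed (x : D.carrier) (s : ℝ) : ∃ δ > 0, ∃ d₁ d₂ : ℝ × ℝ,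
    d₁.1 ^ 2 + d₁.2 ^ 2 = 1 ∧ d₂.1 ^ 2 + d₂.2 ^ 2 = 1 ∧ ∀ h ∈ Icc (0 : ℝ) δ,
      D.planePath x (s - h) = D.planePath x s - h • d₁ ∧
      D.planePath x (s + h) = D.planePath x s + h • d₂ := by
  obtain ⟨c, τ, hw⟩ := exists_window_flow (D.flow s x)
  have hw0 := hw 0 (by simpa using D.δ_pos.le)
  rw [flow_zero, add_zero] at hw0
  have hp := fun h (hh : |h| ≤ D.δ) => planePath_add hw0 hh
  have hs := hp 0 (by simpa using D.δ_pos.le)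
  rw [add_zero, add_zero] at hs
  have hin := sq_add_sq_eq_one (D.norm_dIn c)
  have hout := sq_add_sq_eq_one (d := D.dOut c) (by
    rw [D.toC_dOut, norm_mul, D.norm_dIn, Complex.norm_exp_ofReal_mul_I, one_mul])
  rcases lt_trichotomy τ 0 with hτ | rfl | hτ
  · refine ⟨min D.δ (-τ), lt_min D.δ_pos (by linarith), _, _, hin, hin, fun h hh => ?_⟩
    have h1 := hh.2.trans (min_le_left _ _)
    have h2 := hh.2.trans (min_le_right _ _)
    have h3 := hh.1
    have e1 := hp (-h) (by rwa [abs_neg, abs_of_nonneg h3])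
    have e2 := hp h (by rwa [abs_of_nonneg h3])
    rw [min_eq_left (by linarith), max_eq_right (by linarith)] at e1 e2 hs
    rw [sub_eq_add_neg s, e1, e2, hs]
    constructor <;> module
  · refine ⟨D.δ, D.δ_pos, _, _, hin, hout, fun h hh => ?_⟩
    have h1 := hh.2
    have h3 := hh.1
    have e1 := hp (-h) (by rwa [abs_neg, abs_of_nonneg h3])
    have e2 := hp h (by rwa [abs_of_nonneg h3])
    rw [min_eq_left (by linarith), max_eq_right (by linarith)] at e1 hs
    rw [min_eq_right (by linarith), max_eq_left (by linarith)] at e2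
    rw [sub_eq_add_neg s, e1, e2, hs]
    constructor <;> module
  · refine ⟨min D.δ τ, lt_min D.δ_pos hτ, _, _, hout, hout, fun h hh => ?_⟩
    have h1 := hh.2.trans (min_le_left _ _)
    have h2 := hh.2.trans (min_le_right _ _)
    have h3 := hh.1
    have e1 := hp (-h) (by rwa [abs_neg, abs_of_nonneg h3])
    have e2 := hp h (by rwa [abs_of_nonneg h3])
    rw [min_eq_right (by linarith), max_eq_left (by linarith)] at e1 e2 hs
    rw [sub_eq_add_neg s, e1, e2, hs]
    constructor <;> module

open Classical in
/-- Every corner is on exactly one of the paths, so the angles of the corners on the paths add up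
to the sum of all angles. -/
theorem sum_angle_eq [Fintype K] {n : ℕ} {x : Fin n → K}
    (hx : ∀ y, ∃ k a, y = D.flow a (D.corner (x k)))
    (hx' : ∀ k l a, D.corner (x l) = D.flow a (D.corner (x k)) → k = l) :
    ∑ k, ∑ c, (if ∃ T, D.flow T (D.corner (x k)) = D.corner c then D.angle c else 0) =
      ∑ c, D.angle c := by
  rw [Finset.sum_comm]
  refine Finset.sum_congr rfl fun c _ => ?_
  obtain ⟨k, a, hk⟩ := hx (D.corner c)
  rw [Finset.sum_eq_single k, if_pos ⟨a, hk.symm⟩]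
  · rintro l - hlk
    refine if_neg ?_
    rintro ⟨T, hT⟩
    refine hlk (hx' l k (-a + T) ?_)
    rw [flow_add, hT, hk, flow_neg_flow]
  · simp

end PlaneAtlas

namespace SimpleRealTropicalCurve.IsHarnack

open SimplePhaseTropicalCurve ArcAtlas PlaneAtlas

variable {C : TropicalPolynomial} {V : SimpleRealTropicalCurve C} (hV : V.IsHarnack)

/-- The corners of the real part, as an atlas. -/
abbrev atlas : PlaneAtlas (C.Vertex × Fin 3) hV.ribbon.Surface := hV.ribbon.atlas

/-- The components of the real part, as orbits of the unit speed flow. -/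
def realParametrization {n : ℕ} {x : Fin n → C.Vertex × Fin 3}
    (hx : ∀ y, ∃ k a, y = hV.atlas.flow a (hV.atlas.corner (x k)))
    (hx' : ∀ k l a, hV.atlas.corner (x l) = hV.atlas.flow a (hV.atlas.corner (x k)) → k = l)
    {p : Fin n → ℝ} (hp0 : ∀ k, 0 ≤ p k)
    (hp : ∀ k a, hV.atlas.flow a (hV.atlas.corner (x k)) = hV.atlas.corner (x k) ↔
      ∃ m : ℤ, a = m * p k) : V.RealParametrization where
  n := n
  path k s := hV.homeomorph (hV.atlas.flow s (hV.atlas.corner (x k))).1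
  period := p
  period_nonneg := hp0
  continuous k := hV.homeomorph.continuous.comp
    (continuous_flow (fun c => PlaneRibbon.continuousOn_cornerArc c) _)
  range_eq := by
    ext y
    obtain ⟨y, rfl⟩ := hV.homeomorph.surjective y
    obtain ⟨v, q, rfl⟩ := Ribbon.exists_pt y
    rw [hV.homeomorph_pt_mem_realPart_iff, ← PlaneRibbon.pt_mem_carrier_iff, mem_iUnion]
    constructor
    · rintro ⟨k, s, e⟩
      rw [← hV.homeomorph.injective e]
      exact Subtype.property _
    · intro hq
      obtain ⟨k, s, e⟩ := hx ⟨_, hq⟩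
      exact ⟨k, s, by simp only [← e]⟩
  path_eq_iff k l s t := by
    rw [hV.homeomorph.injective.eq_iff, ← Subtype.ext_iff]
    constructor
    · intro h
      have e : hV.atlas.corner (x l) = hV.atlas.flow (-t + s) (hV.atlas.corner (x k)) := by
        rw [flow_add, h, flow_neg_flow]
      obtain rfl := hx' _ _ _ e
      obtain ⟨m, hm⟩ := (hp k _).mp e.symm
      exact ⟨rfl, -m, by push_cast; linarith⟩
    · rintro ⟨rfl, m, rfl⟩
      rw [flow_add, (hp k _).mpr ⟨m, rfl⟩]
  unit_speed k s := by
    simp only [amoebaMap_homeomorph]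
    exact planePath_unit_speed (D := hV.atlas) _ s

section

variable {n : ℕ} {x : Fin n → C.Vertex × Fin 3}
  (hx : ∀ y, ∃ k a, y = hV.atlas.flow a (hV.atlas.corner (x k)))
  (hx' : ∀ k l a, hV.atlas.corner (x l) = hV.atlas.flow a (hV.atlas.corner (x k)) → k = l)
  {p : Fin n → ℝ} (hp0 : ∀ k, 0 ≤ p k)
  (hp : ∀ k a, hV.atlas.flow a (hV.atlas.corner (x k)) = hV.atlas.corner (x k) ↔
    ∃ m : ℤ, a = m * p k)

theorem planePath_eq (k : Fin n) : (hV.realParametrization hx hx' hp0 hp).planePath k =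
    hV.atlas.planePath (hV.atlas.corner (x k)) :=
  funext fun _ => hV.amoebaMap_homeomorph _

/-- Rotating the arguments in the direction of the velocity leads into the half on which `Im z - Im
w` has the right sign: the motion goes out along the negative and comes in along the positive real
line of an annulus. -/
theorem isOrientedBy :
    (hV.realParametrization hx hx' hp0 hp).IsOrientedBy (hV.homeomorph '' hV.ribbon.half) := by
  intro (k : Fin n) s v q d hs hd
  rw [hV.planePath_eq hx hx' hp0 hp k] at hd
  have hs' : (hV.atlas.flow s (hV.atlas.corner (x k))).1 = hV.ribbon.pt v (hV.ofPiece v q) := by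
    rw [← homeomorph_symm_point, ← hs]
    exact (hV.homeomorph.symm_apply_apply _).symm
  obtain ⟨i, r, hr, hcase⟩ := PlaneRibbon.exists_velocity hs' hd.differentiableAt
  rw [hd.deriv] at hcase
  have hspeed := hV.ribbon.speed_pos (v, i)
  set σ := hV.ribbon.speed (v, i) with hσ
  have hunit : hV.ribbon.unitDir (v, i) =
      (V.chart v).linReal (σ⁻¹ • toReal (ray (turnIdx (V.flipped v) i))) := by
    rw [ToricMorphism.linReal_smul, ToricMorphism.linReal_toReal]; rfl
  have hq : q.1 = turn (V.flipped v) (hV.ofPiece v q).1 := (turn_turn _ _).symm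
  have main : ∀ (u : ℂ) (a : ℝ), u.re = r → (hV.ofPiece v q).1 = arm i u →
      d = a • toReal (ray (turnIdx (V.flipped v) i)) →
      (∀ τ ∈ Ioo 0 (σ * Real.pi), Real.sin (u.im + τ * a) < 0) →
      ∀ᶠ τ in 𝓝[>] (0 : ℝ), ∃ q' : V.Piece v, q'.1 = rotate τ d q.1 ∧
        V.point v q' ∈ hV.homeomorph '' hV.ribbon.half := by
    intro u a hu hqu hda hsin
    filter_upwards [Ioo_mem_nhdsGT (mul_pos hspeed Real.pi_pos)] with τ hτ
    have hre : (u + (τ * a : ℝ) * Complex.I).re = r := by simp [hu]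
    have him : (u + (τ * a : ℝ) * Complex.I).im = u.im + τ * a := by simp
    have hmem : arm i (u + (τ * a : ℝ) * Complex.I) ∈ hV.ribbon.pieceSet v := by
      refine Ribbon.arm_mem_pieceSet (by rw [hre]; exact hr.le) fun hE => ?_
      have := (hV.ofPiece v q).2.2 i hE
      rwa [hqu, height_arm_self _ (by rw [hu]; exact hr.le), hu, ← hre] at this
    refine ⟨hV.toPiece v ⟨_, hmem⟩, ?_, _, ?_, hV.homeomorph_pt _ _⟩
    · rw [hq, hqu, hda, rotate_turn_arm]; rfl
    · rw [Ribbon.pt_mem_half_iff]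
      obtain ⟨ρ, hρ, e⟩ := imDiff_arm i (u + (τ * a : ℝ) * Complex.I)
      rw [e, him]
      nlinarith [hsin τ hτ]
  have hsmall : ∀ τ ∈ Ioo 0 (σ * Real.pi), 0 < Real.sin (τ * σ⁻¹) := by
    intro τ hτ
    refine Real.sin_pos_of_pos_of_lt_pi (mul_pos hτ.1 (inv_pos.mpr hspeed)) ?_
    rw [← div_eq_mul_inv, div_lt_iff₀ hspeed, mul_comm]
    exact hτ.2
  rcases hcase with ⟨hqa, e⟩ | ⟨hqa, e⟩
  · refine main r (-σ⁻¹) (by simp) hqa ?_ fun τ hτ => ?_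
    · refine V.linReal_injective v ?_
      rw [e, hunit, neg_smul, ← neg_one_smul ℝ (σ⁻¹ • toReal _),
        ToricMorphism.linReal_smul _ (-1), neg_one_smul]
    · rw [Complex.ofReal_im, zero_add, mul_neg, Real.sin_neg]
      linarith [hsmall τ hτ]
  · refine main (r + Real.pi * Complex.I) σ⁻¹ (by simp) hqa
      (V.linReal_injective v (e.trans hunit)) fun τ hτ => ?_
    have : ((r : ℂ) + Real.pi * Complex.I).im = Real.pi := by simp
    rw [this, add_comm, Real.sin_add_pi]
    linarith [hsmall τ hτ]

include hp in
theorem eq_zero_of_flow_eq {k : Fin n} (hk : p k = 0) (a : ℝ)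
    (ha : hV.atlas.flow a (hV.atlas.corner (x k)) = hV.atlas.corner (x k)) : a = 0 := by
  obtain ⟨m, hm⟩ := (hp k a).mp ha
  rw [hm, hk, mul_zero]

theorem exists_isSmoothing {ε : ℝ} (hε : 0 < ε) :
    ∃ g, (hV.realParametrization hx hx' hp0 hp).IsSmoothing ε g := by
  have := Fintype.ofFinite (C.Vertex × Fin 3)
  have hδ := hV.atlas.δ_pos
  obtain ⟨η, hη, hηδ, hηε⟩ : ∃ η : ℝ, 0 < η ∧ 2 * η ≤ hV.atlas.δ ∧ 2 * η < ε := by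
    refine ⟨min (hV.atlas.δ / 2) (ε / 3), lt_min (by linarith) (by linarith), ?_, ?_⟩
    · linarith [min_le_left (hV.atlas.δ / 2) (ε / 3)]
    · linarith [min_le_right (hV.atlas.δ / 2) (ε / 3)]
  refine ⟨fun k s => hV.atlas.smoothPos η (hV.atlas.flow s (hV.atlas.corner (x k))), ?_, ?_, ?_, ?_,
    ?_, ?_⟩
  · exact fun k => contDiff_smoothPos hη (by linarith) _
  · intro (k : Fin n) s
    change hV.atlas.smoothPos η (hV.atlas.flow (s + p k) _) = _
    rw [flow_add, (hp k _).mpr ⟨1, by simp⟩]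
  · intro (k : Fin n) s
    rw [hV.planePath_eq hx hx' hp0 hp k]
    exact dist_smoothPos_lt hη (by linarith) hηε _ _
  · intro (k : Fin n) s
    rw [hV.planePath_eq hx hx' hp0 hp k]
    exact ⟨_, deriv_smoothPos_mem hη hηδ hηε _ s, by rwa [dist_self]⟩
  · intro (k : Fin n) hk
    rw [hV.planePath_eq hx hx' hp0 hp k]
    refine tendsto_const_nhds.congr' ((eventually_deriv_smoothPos hη (by linarith)
      (hV.eq_zero_of_flow_eq hp hk)).1.mono fun s hs =>
        (sub_eq_zero.mpr hs).symm)
  · intro (k : Fin n) hk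
    rw [hV.planePath_eq hx hx' hp0 hp k]
    refine tendsto_const_nhds.congr' ((eventually_deriv_smoothPos hη (by linarith)
      (hV.eq_zero_of_flow_eq hp hk)).2.mono fun s hs =>
        (sub_eq_zero.mpr hs).symm)

/-- The degree is the sum of all angles, divided by a half turn. At each vertex the angles add up to
a half turn. -/
theorem exists_gaussMapHasDegree : ∃ ε > 0, ∀ g,
    (hV.realParametrization hx hx' hp0 hp).IsSmoothing ε g →
      (hV.realParametrization hx hx' hp0 hp).GaussMapHasDegree g (Nat.card C.Vertex) := by
  have := Fintype.ofFinite C.Vertex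
  obtain ⟨ε, hε, hεδ, hεc⟩ : ∃ ε : ℝ, 0 < ε ∧ ε ≤ hV.atlas.δ ∧
      ∀ c, 2 * ε ≤ Real.cos (hV.atlas.angle c / 2) := by
    have hc : ∀ c, 0 < Real.cos (hV.atlas.angle c / 2) := fun c =>
      Real.cos_pos_of_mem_Ioo ⟨by linarith [hV.atlas.angle_pos c, Real.pi_pos],
        by linarith [hV.atlas.angle_lt c]⟩
    have h1 : ∀ᶠ ε in 𝓝[>] (0 : ℝ), ∀ c, 2 * ε ≤ Real.cos (hV.atlas.angle c / 2) :=
      eventually_all.mpr fun c => by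
        filter_upwards [Ioo_mem_nhdsGT (half_pos (hc c))] with ε hε
        linarith [hε.2]
    obtain ⟨ε, h2, h3⟩ := (h1.and (Ioo_mem_nhdsGT hV.atlas.δ_pos)).exists
    exact ⟨ε, h3.1, h3.2.le, h2⟩
  refine ⟨ε, hε, fun g hg => ?_⟩
  classical
  refine ⟨fun k => ∑ c, if ∃ T, hV.atlas.flow T (hV.atlas.corner (x k)) = hV.atlas.corner c then
    hV.atlas.angle c else 0, fun k => ?_, ?_⟩
  · have hclose := hg.deriv_close k
    have htop := hg.tendsto_atTop k
    have hbot := hg.tendsto_atBot k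
    rw [hV.planePath_eq hx hx' hp0 hp k] at hclose htop hbot
    exact gaussMapTurnsBy (hp0 k) (hp k) hεδ hεc (hg.smooth k) (hg.periodic k) hclose htop hbot
  · refine (sum_angle_eq hx hx').trans ?_
    rw [Fintype.sum_prod_type]
    refine (Finset.sum_congr rfl fun v _ => hV.ribbon.sum_cornerAngle v).trans ?_
    simp

end

include hV in
theorem isLogCurvature : V.IsLogCurvature (Nat.card C.Vertex) := by
  obtain ⟨n, x, hx, hx'⟩ := hV.atlas.exists_representatives
  choose p hp0 hp using fun k => hV.atlas.exists_period (hV.atlas.corner (x k))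
  exact ⟨by positivity, _, hV.isHalf, hV.realParametrization hx hx' hp0 hp,
    hV.isOrientedBy hx hx' hp0 hp, fun ε hε => hV.exists_isSmoothing hx hx' hp0 hp hε,
    hV.exists_gaussMapHasDegree hx hx' hp0 hp⟩

include hV in
theorem hasEulerCharacteristic :
    HasEulerCharacteristic V.Normalization (-(Nat.card C.Vertex : ℤ)) :=
  (Ribbon.hasEulerCharacteristic (M := hV.ribbon.toRibbon)).of_homeomorph hV.homeomorph

end SimpleRealTropicalCurve.IsHarnack

end PhaseTropical

end

theorem mainTheorem11 (C : TropicalPolynomial) (V : SimpleRealTropicalCurve C)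
    (hV : V.IsHarnack) :
    ∃ κ χ : ℤ, V.IsLogCurvature κ ∧ HasEulerCharacteristic V.Normalization χ ∧
      κ = -χ ∧ -χ = (Nat.card C.Vertex : ℤ) :=
  ⟨Nat.card C.Vertex, -(Nat.card C.Vertex : ℤ), hV.isLogCurvature, hV.hasEulerCharacteristic,
    (neg_neg _).symm, neg_neg _⟩
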